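/- Let $F=\mathbf R$ or $F=\mathbf C$, with a Haar measure $\mu$ and its modulus $|\cdot|$ (the usual absolute value if $F=\mathbf R$, its square if $F=\mathbf C$). Let $X$ be a smooth projective variety over $F$, purely of dimension $n$. Let $D=\sum_{\alpha\in\mathscr A}d_\alpha D_\alpha$ (with $d_\alpha>0$ and $D_\alpha$ the irreducible components of $D$ over $F$) and $L$ be effective divisors on $X$ (rational coefficients are allowed) such that the support of $L$ contains that of $D$ and has strict normal crossings over an algebraic closure of $F$. Write $L=\Delta+\sum_{\alpha\in\mathscr A}\lambda_\alpha D_\alpha$, where $\lambda_\alpha>0$ is the multiplicity of $D_\alpha$ in $L$. Endow $\omega_X(D)$, $\mathscr O_X(L)$ and the $\mathscr O_X(D_\alpha)$ with smooth ($C^\infty$) metrics over $X(F)$; let $f_D,f_L,f_\alpha,f_\Delta$ be the canonical sections of $\mathscr O_X(D)$, $\mathscr O_X(L)$, $\mathscr O_X(D_\alpha)$, $\mathscr O_X(\Delta)$, and endow $\mathscr O_X(\Delta)$ and $\omega_X$ with the metrics such that $\|f_L\|=\|f_\Delta\|\prod_\alpha\|f_\alpha\|^{\lambda_\alpha}$ and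 $\omega_X(D)\simeq\omega_X\otimes\bigotimes_\alpha\mathscr O_X(D_\alpha)^{d_\alpha}$ is an isometry. Let $\tau_{(X,D)}$ be the measure on $(X\setminus D)(F)$ given locally by $|\omega|/\|f_D\,\omega\|$, for $\omega$ a local non-vanishing $n$-form, and for $B>0$ put $$V(B)=\tau_{(X,D)}\{x\in (X\setminus D)(F):\ \|f_L(x)\|\ge 1/B\}.$$ Let $\sigma=\max (d_\alpha-1)/\lambda_\alpha$, over all $\alpha\in\mathscr A$ such that $D_\alpha(F)\ne\emptyset$, and assume that there is such an $\alpha$ and that $\sigma\ge0$. For $A\subseteq\mathscr A$ let $D_A(F)=\bigcap_{\alpha\in A}D_\alpha(F)$. Let $\mathscr C$ be the set of all non-empty $A\subseteq\mathscr A$ such that $D_A(F)\neq\emptyset$ and $d_\alpha=\lambda_\alpha\sigma+1$ for all $\alpha\in A$, and let $b$ be the maximal cardinality $\#A$ of the elements $A$ of $\mathscr C$. For $A\in\mathscr C$ with $\#A=b$ let $$Z_A(\sigma)=\int_{D_A(F)}\|f_\Delta\|^{\sigma}\prod_{\alpha\in\mathscr A\setminus A}\|f_\alpha\|^{\sigma\lambda_\alpha-d_\alpha}\,d\tau_{D_A},$$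 where $\tau_{D_A}$ is the residue measure multiplied by $\prod_{\alpha\in A}c_{F_\alpha}$. Explicitly, near each point of $D_A(F)$ choose étale coordinates $((x_\alpha)_{\alpha\in A},y)$ with $x_\alpha$ valued in $F_\alpha$ such that $N_{F_\alpha/F}(x_\alpha)$ is a local equation of $D_\alpha$; here $F_\alpha=F$, except when $F=\mathbf R$ and $D_\alpha$ splits over $\mathbf C$ into two conjugate components, in which case $F_\alpha=\mathbf C=\mathbf R^2$. Then $$d\tau_{D_A}=\prod_{\alpha\in A}c_{F_\alpha}\cdot\Big(\Big\|\bigwedge_{\alpha\in A} dx_\alpha\wedge dy\Big\|\,\prod_{\alpha\in A}\lim\frac{\|f_\alpha\|}{|N_{F_\alpha/F}(x_\alpha)|}\Big)^{-1}|dy|,$$ where $dx_\alpha$ stands for $da\wedge db$ if $x_\alpha=a+ib$ with $F_\alpha=\mathbf C$ and $F=\mathbf R$, and $c_{F_\alpha}$ is the Haar measure of the unit ball of $F_\alpha=F^{[F_\alpha:F]}$. Then $b\ge1$, $V(B)$ is finite for every $B>0$, the integrals $Z_A(\sigma)$ converge, and there exist a real polynomial $P$ and a real number $\delta>0$ such that,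 as $B\to\infty$, $$V(B)=B^\sigma P(\log B)+O(B^{\sigma-\delta}).$$ If $\sigma>0$, then $P$ has degree $b-1$ and leading coefficient $$\frac1{\sigma\,(b-1)!}\sum_{A\in\mathscr C,\ \#A=b}Z_A(\sigma)\prod_{\alpha\in A}\frac1{\lambda_\alpha}.$$ If $\sigma=0$, then $P$ has degree $b$ and leading coefficient $$\frac1{b!}\sum_{A\in\mathscr C,\ \#A=b}Z_A(\sigma)\prod_{\alpha\in A}\frac1{\lambda_\alpha}.$$ -/

import Mathlib

open CategoryTheory AlgebraicGeometry MeasureTheory Filter Topology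
open scoped ContDiff NNRat

universe u

noncomputable section

namespace VolAsymp

/-! ### Varieties over a field -/

section Field

variable {K : Type u} [Field K] {X : Scheme.{u}}

attribute [local instance] MvPolynomial.gradedAlgebra

/-- The structure map `K → Γ(X, U)` of a `K`-scheme `p : X ⟶ Spec K`. -/
def scalar (p : X ⟶ Spec (CommRingCat.of K)) (U : X.Opens) : K →+* Γ(X, U) :=
  (p.appLE ⊤ U (le_top.trans p.preimage_top.ge)).hom.comp (Scheme.ΓSpecIso (CommRingCat.of K)).inv.hom

/-- The structure morphism of the projective space `ℙ^N` over `K`. -/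
def projectiveSpaceToSpec (K : Type u) [Field K] (N : ℕ) :
    Proj (MvPolynomial.homogeneousSubmodule (Fin (N + 1)) K) ⟶ Spec (CommRingCat.of K) :=
  Proj.toSpecZero (MvPolynomial.homogeneousSubmodule (Fin (N + 1)) K) ≫
    Spec.map (CommRingCat.ofHom
      (algebraMap K (MvPolynomial.homogeneousSubmodule (Fin (N + 1)) K 0)))

/-- `X` is projective over `K`: it is a closed subscheme of some projective space. -/
def IsProjectiveOver (p : X ⟶ Spec (CommRingCat.of K)) : Prop :=
  ∃ (N : ℕ) (i : X ⟶ Proj (MvPolynomial.homogeneousSubmodule (Fin (N + 1)) K)),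
    IsClosedImmersion i ∧ i ≫ projectiveSpaceToSpec K N = p

/-- `t₁, …, tₙ` are étale coordinates on the affine open `U`: the morphism `U ⟶ 𝔸ⁿ` which they
define is étale. -/
def IsEtaleCoord (p : X ⟶ Spec (CommRingCat.of K)) {n : ℕ} (U : X.Opens)
    (t : Fin n → Γ(X, U)) : Prop :=
  IsAffineOpen U ∧ (MvPolynomial.eval₂Hom (scalar p U) t).Etale

/-- A prime divisor, given by its generic point (a point of codimension one). The divisor itself
is the closure of this point, with its reduced structure. -/
structure PrimeDivisor (X : Scheme.{u}) where
  pt : X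
  codim_one : ringKrullDim (X.presheaf.stalk pt) = 1

/-- Effective `ℚ`-divisors; ordinary effective divisors are those with integral coefficients.
The irreducible components of `D` are the elements of `D.support`, and `D α` is the multiplicity
of the component `α`. -/
abbrev EffDivisor (X : Scheme.{u}) := PrimeDivisor X →₀ ℚ≥0

/-- The set of points of the support of a divisor. -/
def supportSet (E : EffDivisor X) : Set X := {x | ∃ P ∈ E.support, P.pt ⤳ x}

/-- `u` is a local equation on the affine open `U` of the prime divisor `P`: it generates the ideal of all regular
functions on `U` which vanish on `P`. (If `P` does not meet `U`, then this says that `u` is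
invertible.) -/
def IsLocalEq (P : PrimeDivisor X) (U : X.Opens) (u : Γ(X, U)) : Prop :=
  IsAffineOpen U ∧ ∀ f : Γ(X, U), u ∣ f ↔ P.pt ∉ X.basicOpen f

/-- A closed subset `S` of the smooth `K`-scheme `X` (of pure dimension `n`) is a divisor with
strict normal crossings: every point has a neighbourhood `U` with étale coordinates such that each
irreducible component of `S` which meets `U` is there the preimage of a coordinate hyperplane. -/
def IsStrictNormalCrossings (p : X ⟶ Spec (CommRingCat.of K)) (n : ℕ) (S : Set X) : Prop :=
  ∀ x : X, ∃ (U : X.Opens) (t : Fin n → Γ(X, U)), x ∈ U ∧ IsEtaleCoord p U t ∧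
    ∀ Z : Set X, Maximal (fun T : Set X => IsIrreducible T ∧ T ⊆ S) Z →
      (Z ∩ U).Nonempty → ∃ j, ∀ y ∈ U, (y ∈ Z ↔ y ∉ X.basicOpen (t j))

/-- The support of `E` has strict normal crossings over an algebraic closure of `K`. -/
def IsGeometricSNC (p : X ⟶ Spec (CommRingCat.of K)) (n : ℕ) (E : EffDivisor X) : Prop :=
  let q : Spec (CommRingCat.of (AlgebraicClosure K)) ⟶ Spec (CommRingCat.of K) :=
    Spec.map (CommRingCat.ofHom (algebraMap K (AlgebraicClosure K)))
  IsStrictNormalCrossings (Limits.pullback.snd p q) n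
    {z | Limits.pullback.fst p q z ∈ supportSet E}

/-! ### Rational points -/

/-- The set `X(K)` of rational points of the `K`-scheme `X`. -/
structure RatPoint (p : X ⟶ Spec (CommRingCat.of K)) where
  hom : Spec (CommRingCat.of K) ⟶ X
  comp_eq : hom ≫ p = 𝟙 (Spec (CommRingCat.of K))

variable {p : X ⟶ Spec (CommRingCat.of K)}

/-- The point of the scheme `X` underlying a rational point. -/
def RatPoint.pt (x : RatPoint p) : X := x.hom (IsLocalRing.closedPoint K)

theorem RatPoint.top_le (x : RatPoint p) {U : X.Opens} (h : x.pt ∈ U) : ⊤ ≤ x.hom ⁻¹ᵁ U := by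
  intro y _
  have hy : y = IsLocalRing.closedPoint K := Subsingleton.elim (α := PrimeSpectrum K) _ _
  subst hy
  exact h

/-- Evaluation at a rational point of `U`, as a ring morphism `Γ(X, U) → K`. -/
def RatPoint.evalHom (x : RatPoint p) (U : X.Opens) (h : x.pt ∈ U) : Γ(X, U) →+* K :=
  (Scheme.ΓSpecIso (CommRingCat.of K)).hom.hom.comp (x.hom.appLE U ⊤ (x.top_le h)).hom

open Classical in
/-- The value at a rational point of a regular function on `U` (and `0` outside of `U`). -/
def RatPoint.val (x : RatPoint p) {U : X.Opens} (f : Γ(X, U)) : K :=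
  if h : x.pt ∈ U then x.evalHom U h f else 0

/-- The set `E(K)` of rational points of the support of `E`. -/
def ratSupport (p : X ⟶ Spec (CommRingCat.of K)) (E : EffDivisor X) : Set (RatPoint p) :=
  {x | x.pt ∈ supportSet E}

/-- The set `D_A(K)` of rational points common to all prime divisors in `A`. -/
def stratum (p : X ⟶ Spec (CommRingCat.of K)) (A : Finset (PrimeDivisor X)) :
    Set (RatPoint p) :=
  {x | ∀ α ∈ A, α.pt ⤳ x.pt}

/-- `dt' = J dt` in the cotangent space of `X` at the rational point `x`, that is, modulo the
square of the ideal of functions vanishing at `x`. -/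
def IsJacobianAt (x : RatPoint p) {n : ℕ} {U U' : X.Opens} (t : Fin n → Γ(X, U))
    (t' : Fin n → Γ(X, U')) (J : Matrix (Fin n) (Fin n) K) : Prop :=
  ∃ (V : X.Opens) (hV : V ≤ U) (hV' : V ≤ U') (hx : x.pt ∈ V), ∀ i,
    (X.presheaf.map (homOfLE hV').op (t' i) - scalar p V (x.val (t' i))) -
      ∑ j, scalar p V (J i j) *
        (X.presheaf.map (homOfLE hV).op (t j) - scalar p V (x.val (t j))) ∈
    RingHom.ker (x.evalHom V hx) ^ 2

end Field

/-! ### Analytic notions over `F = ℝ` or `F = ℂ` -/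

section Archimedean

variable {F : Type u} [RCLike F] {X : Scheme.{u}} {p : X ⟶ Spec (CommRingCat.of F)}

/-- The modulus of `F`: the usual absolute value for `F = ℝ`, its square for `F = ℂ`. -/
def modulus (a : F) : ℝ := ‖a‖ ^ Module.finrank ℝ F

/-- The analytic topology of `X(F)`: the coarsest one for which the sets `U(F)` are open and the
regular functions are continuous on them. -/
instance : TopologicalSpace (RatPoint p) :=
  TopologicalSpace.generateFrom
    {S | ∃ (U : X.Opens) (f : Γ(X, U)) (W : Set F), IsOpen W ∧
      S = {x | x.pt ∈ U ∧ x.val f ∈ W}}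

instance : MeasurableSpace (RatPoint p) := borel _

instance : BorelSpace (RatPoint p) := ⟨rfl⟩

/-- A real function on `X(F)` is smooth (`C^∞`) on the subset `S`, if near each point of `S` it is
a smooth function of finitely many regular functions. -/
def IsSmoothOn (g : RatPoint p → ℝ) (S : Set (RatPoint p)) : Prop :=
  ∀ x ∈ S, ∃ (U : X.Opens) (m : ℕ) (f : Fin m → Γ(X, U)) (G : (Fin m → F) → ℝ),
    x.pt ∈ U ∧ ContDiff ℝ ∞ G ∧ ∀ᶠ y in 𝓝 x, g y = G (fun i => y.val (f i))

/-- A smooth metric on the line bundle `𝒪_X(E)` over `X(F)`, recorded by the function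
`x ↦ ‖f_E(x)‖`, where `f_E` is the canonical section. For local equations `u_P` of the components,
the local generator `∏ u_P ^ (-E P)` of `𝒪_X(E)` has as norm a smooth positive function `h`, and
`f_E` is `∏ u_P ^ (E P)` times this generator. Fractional coefficients are allowed:
`‖f_E‖ = ‖f_{mE}‖ ^ (1 / m)`. -/
structure DivisorMetric (p : X ⟶ Spec (CommRingCat.of F)) (E : EffDivisor X) where
  norm : RatPoint p → ℝ
  local_form : ∀ (U : X.Opens) (u : PrimeDivisor X → Γ(X, U)),
    (∀ P ∈ E.support, IsLocalEq P U (u P)) →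
    ∃ h : RatPoint p → ℝ, IsSmoothOn h {x | x.pt ∈ U} ∧
      ∀ x : RatPoint p, x.pt ∈ U → 0 < h x ∧
        norm x = (∏ P ∈ E.support, modulus (x.val (u P)) ^ (E P : ℝ)) * h x

/-- A smooth metric on the line bundle `ω_X(E)` over `X(F)`, recorded by the functions
`norm U t : x ↦ ‖f_E dt₁ ∧ ⋯ ∧ dtₙ‖(x)` on `U(F)`, for étale coordinates `t` on `U`. -/
structure CanonicalMetric (p : X ⟶ Spec (CommRingCat.of F)) (n : ℕ) (E : EffDivisor X) where
  norm : (U : X.Opens) → (Fin n → Γ(X, U)) → RatPoint p → ℝ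
  change : ∀ (U U' : X.Opens) (t : Fin n → Γ(X, U)) (t' : Fin n → Γ(X, U')),
    IsEtaleCoord p U t → IsEtaleCoord p U' t' →
    ∀ (x : RatPoint p) (J : Matrix (Fin n) (Fin n) F), IsJacobianAt x t t' J →
      norm U' t' x = modulus J.det * norm U t x
  local_form : ∀ (U : X.Opens) (t : Fin n → Γ(X, U)), IsEtaleCoord p U t →
    ∀ u : PrimeDivisor X → Γ(X, U), (∀ P ∈ E.support, IsLocalEq P U (u P)) →
    ∃ h : RatPoint p → ℝ, IsSmoothOn h {x | x.pt ∈ U} ∧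
      ∀ x : RatPoint p, x.pt ∈ U → 0 < h x ∧
        norm U t x = (∏ P ∈ E.support, modulus (x.val (u P)) ^ (E P : ℝ)) * h x

/-- The measure `|dt₁ ∧ ⋯ ∧ dtₙ| / ‖f_D dt₁ ∧ ⋯ ∧ dtₙ‖` on the set `W`, on which the coordinates
`t` are injective, extended by zero to `X(F)`. -/
def chartMeasure (μ : Measure F) {n : ℕ} {D : EffDivisor X} (M : CanonicalMetric p n D)
    (U : X.Opens) (t : Fin n → Γ(X, U)) (W : Set (RatPoint p)) : Measure (RatPoint p) :=
  ((((Measure.pi fun _ : Fin n => μ).comap fun (x : W) i => x.1.val (t i)).withDensity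
    fun x => ENNReal.ofReal (1 / M.norm U t x.1))).map Subtype.val

/-- The measure `τ_{(X,D)}` on `(X ∖ D)(F)` attached to a metric on `ω_X(D)` and to the Haar
measure `μ` on `F`, viewed as a measure on `X(F)`. The chart measures agree on overlaps, and
`τ_{(X,D)}` is the measure obtained by patching them, that is, their supremum. -/
def tauPair (μ : Measure F) {n : ℕ} {D : EffDivisor X} (M : CanonicalMetric p n D) :
    Measure (RatPoint p) :=
  sSup {ν | ∃ (U : X.Opens) (t : Fin n → Γ(X, U)) (W : Set (RatPoint p)),
    IsEtaleCoord p U t ∧ IsOpen W ∧ W ⊆ {x | x.pt ∈ U} ∧ Disjoint W (ratSupport p D) ∧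
    Set.InjOn (fun x i => x.val (t i)) W ∧ ν = chartMeasure μ M U t W}

/-- The volume `V(B)` of the set of all `x ∈ (X ∖ D)(F)` such that `‖f_L(x)‖ ≥ 1 / B`. -/
def volumeBall (μ : Measure F) {n : ℕ} {D L : EffDivisor X} (M : CanonicalMetric p n D)
    (ML : DivisorMetric p L) (B : ℝ) : ENNReal :=
  tauPair μ M {x | x ∉ ratSupport p D ∧ 1 / B ≤ ML.norm x}

/-- `‖dt₁ ∧ ⋯ ∧ dtₙ‖(x)` for the metric on `ω_X` such that `ω_X(D) ≃ ω_X ⊗ ⨂ 𝒪_X(D_α) ^ d_α` is an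
isometry; where the canonical sections vanish, it is the limit of the quotient of norms. -/
def canonicalNorm {n : ℕ} {D : EffDivisor X} (M : CanonicalMetric p n D)
    (Mc : ∀ α : PrimeDivisor X, DivisorMetric p (Finsupp.single α 1))
    (U : X.Opens) (t : Fin n → Γ(X, U)) (x : RatPoint p) : ℝ :=
  limUnder (𝓝[(ratSupport p D)ᶜ] x)
    fun y => M.norm U t y / ∏ α ∈ D.support, (Mc α).norm y ^ (D α : ℝ)

/-- `‖f_Δ(x)‖`, where `Δ = L - ∑ λ_α D_α` (the sum running over the components of `D`, and `λ_α`
being the multiplicity of `D_α` in `L`), for the metric on `𝒪_X(Δ)` such that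
`‖f_L‖ = ‖f_Δ‖ ∏ ‖f_α‖ ^ λ_α`. -/
def residualNorm (D : EffDivisor X) {L : EffDivisor X} (ML : DivisorMetric p L)
    (Mc : ∀ α : PrimeDivisor X, DivisorMetric p (Finsupp.single α 1)) (x : RatPoint p) : ℝ :=
  limUnder (𝓝[(ratSupport p D)ᶜ] x)
    fun y => ML.norm y / ∏ α ∈ D.support, (Mc α).norm y ^ (L α : ℝ)

/-- `u` is the norm `N(x_α)` of the local coordinate `x_α` with values in `F_α` whose components
are the coordinates `t_j`, for `j ∈ S`. Either `F_α = F`, `x_α = t_j` and `u = t_j`; or `F = ℝ`,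
`F_α = ℂ`, `x_α = t_j + i t_k` and `u = t_j² + t_k²` (this happens when `D_α` is irreducible over
`ℝ`, but is over `ℂ` the union of two conjugate divisors). -/
def IsNormForm (F : Type u) [RCLike F] {R : Type*} [CommRing R] {n : ℕ} (t : Fin n → R)
    (S : Finset (Fin n)) (u : R) : Prop :=
  (∃ j, S = {j} ∧ u = t j) ∨
    ((RCLike.I : F) = 0 ∧ ∃ j k, j ≠ k ∧ S = {j, k} ∧ u = t j ^ 2 + t k ^ 2)

/-- The constant `c_{F_α}`: the Haar measure of the unit ball in `F_α = F ^ S`. -/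
def unitBallConst (μ : Measure F) {n : ℕ} (S : Finset (Fin n)) : ℝ :=
  (Measure.pi (fun _ : S => μ)).real {v | ∑ i, ‖v i‖ ^ 2 ≤ 1}

/-- The étale coordinates `t` on `U` are adapted to the divisors in `A`: for each `α ∈ A` the norm
`u α` of the local coordinate with components `(t_j)`, `j ∈ e α`, is a local equation of `D_α`. The
other coordinates are then coordinates on `D_A(F)`. -/
def IsAdapted (p : X ⟶ Spec (CommRingCat.of F)) {n : ℕ} (A : Finset (PrimeDivisor X))
    (U : X.Opens) (t : Fin n → Γ(X, U)) (e : PrimeDivisor X → Finset (Fin n))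
    (u : PrimeDivisor X → Γ(X, U)) : Prop :=
  IsEtaleCoord p U t ∧ (A : Set (PrimeDivisor X)).PairwiseDisjoint e ∧
    ∀ α ∈ A, IsNormForm F t (e α) (u α) ∧ IsLocalEq α U (u α)

/-- The normalized residue measure on the part of `D_A(F)` contained in `W`, in adapted coordinates
(with `dy` the Haar measure in the coordinates `t_j` which do not belong to `A`):
`∏ c_{F_α} · dy / (‖dt₁ ∧ ⋯ ∧ dtₙ‖ ∏ lim (‖f_α‖ / |u_α|))`. -/
def residueChartMeasure (μ : Measure F) {n : ℕ} {D : EffDivisor X} (M : CanonicalMetric p n D)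
    (Mc : ∀ α : PrimeDivisor X, DivisorMetric p (Finsupp.single α 1))
    (A : Finset (PrimeDivisor X)) (U : X.Opens) (t : Fin n → Γ(X, U))
    (e : PrimeDivisor X → Finset (Fin n)) (u : PrimeDivisor X → Γ(X, U))
    (W : Set (RatPoint p)) : Measure (RatPoint p) :=
  ((((Measure.pi fun _ : {i : Fin n // i ∉ A.biUnion e} => μ).comap
    fun (x : (W ∩ stratum p A : Set (RatPoint p))) (i : {i : Fin n // i ∉ A.biUnion e}) =>
      x.1.val (t i)).withDensity
    fun x => ENNReal.ofReal ((∏ α ∈ A, unitBallConst μ (e α)) /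
      (canonicalNorm M Mc U t x.1 *
        ∏ α ∈ A, limUnder (𝓝[(ratSupport p D)ᶜ] x.1)
          fun y => (Mc α).norm y / modulus (y.val (u α)))))).map Subtype.val

/-- The measure `τ_{D_A}` on `D_A(F)` (viewed as a measure on `X(F)`): the residue measure
multiplied by the constants `c_{F_α}`, obtained by patching its expressions in adapted charts. -/
def residueMeasure (μ : Measure F) {n : ℕ} {D : EffDivisor X} (M : CanonicalMetric p n D)
    (Mc : ∀ α : PrimeDivisor X, DivisorMetric p (Finsupp.single α 1))
    (A : Finset (PrimeDivisor X)) : Measure (RatPoint p) :=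
  sSup {ν | ∃ (U : X.Opens) (t : Fin n → Γ(X, U)) (e : PrimeDivisor X → Finset (Fin n))
    (u : PrimeDivisor X → Γ(X, U)) (W : Set (RatPoint p)),
    IsAdapted p A U t e u ∧ IsOpen W ∧ W ⊆ {x | x.pt ∈ U} ∧
    Set.InjOn (fun x (i : {i : Fin n // i ∉ A.biUnion e}) => x.val (t i)) (W ∩ stratum p A) ∧
    ν = residueChartMeasure μ M Mc A U t e u W}

open Classical in
/-- The faces of the analytic Clemens complex of `D` all of whose vertices `α` satisfy
`d_α = λ_α σ + 1`: the non-empty sets `A` of components of `D` with `D_A(F) ≠ ∅`. -/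
def clemensFaces (p : X ⟶ Spec (CommRingCat.of F)) (D L : EffDivisor X) (σ : ℝ) :
    Finset (Finset (PrimeDivisor X)) :=
  D.support.powerset.filter fun A =>
    A.Nonempty ∧ (stratum p A).Nonempty ∧ ∀ α ∈ A, (D α : ℝ) = L α * σ + 1

/-- The integer `b`: the maximal number of elements of a face. -/
def clemensRank (p : X ⟶ Spec (CommRingCat.of F)) (D L : EffDivisor X) (σ : ℝ) : ℕ :=
  (clemensFaces p D L σ).sup Finset.card

/-- The faces with the maximal number `b` of elements. -/
def maximalFaces (p : X ⟶ Spec (CommRingCat.of F)) (D L : EffDivisor X) (σ : ℝ) :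
    Finset (Finset (PrimeDivisor X)) :=
  (clemensFaces p D L σ).filter fun A => A.card = clemensRank p D L σ

open Classical in
/-- The function `‖f_Δ‖ ^ s ∏_{α ∉ A} ‖f_α‖ ^ (s λ_α - d_α)` whose integral over `D_A(F)` is
`Z_A(s)`. -/
def faceIntegrand (D : EffDivisor X) {L : EffDivisor X} (ML : DivisorMetric p L)
    (Mc : ∀ α : PrimeDivisor X, DivisorMetric p (Finsupp.single α 1))
    (A : Finset (PrimeDivisor X)) (s : ℝ) (x : RatPoint p) : ℝ :=
  residualNorm D ML Mc x ^ s *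
    ∏ α ∈ D.support \ A, (Mc α).norm x ^ (s * (L α : ℝ) - (D α : ℝ))

/-- `Z_A(s) = ∫_{D_A(F)} ‖f_Δ‖ ^ s ∏_{α ∉ A} ‖f_α‖ ^ (s λ_α - d_α) dτ_{D_A}`. -/
def faceIntegral (μ : Measure F) {n : ℕ} {D L : EffDivisor X} (M : CanonicalMetric p n D)
    (ML : DivisorMetric p L)
    (Mc : ∀ α : PrimeDivisor X, DivisorMetric p (Finsupp.single α 1))
    (A : Finset (PrimeDivisor X)) (s : ℝ) : ℝ :=
  ∫ x, faceIntegrand D ML Mc A s x ∂(residueMeasure μ M Mc A)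

end Archimedean

end VolAsymp

end

/-!
The function `V(B)` is a volume on a compact space, so its growth is decided near each rational
point, where normal crossings turn it into an explicit integral.

*Geometry.* `RatPoint p` is a compact metrizable space: finitely many affine charts of projective
space, normalised by a largest coordinate, give compactness (`compactSpace_and_t2Space`). Around each
point there are étale coordinates in which every component through the point is given by one
coordinate, or by the norm form `a² + b²` of a pair of coordinates when it splits over `ℂ`
(`exists_adapted_coordinates`). For this, coordinates are found over the algebraic closure, where the
branches of the boundary are individually smooth, and are descended along complex conjugation
(`exists_adapted_of_conjugation`). The implicit function theorem turns étale coordinates into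
topological charts of `X(F)` (`exists_chart`, `exists_adaptedChart`), and by the Jacobian formula
the metrics and measures become smooth positive functions times powers of the block norms
`|N(x_α)|`.

*Local integrals.* Up to normalisation the `k`-fold primitives of `T ↦ exp (-σT) V(exp T)`, cut off
at `T ≥ 0`, have density `kernel σ k`. In a chart they are integrals of a Lipschitz function
against `∏ |N(x_α)| ^ (-a_α)`, `a_α = d_α - σ λ_α ≤ 1`. Only blocks with `a_α = 1` contribute
powers of `T`; each distributes like an exponential variable, and integrating them out one at a
time leaves a polynomial whose leading coefficient is the integral over the face on which all
of them vanish, with an exponentially small error (`LocalDatum.exists_expansion`).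

*Residue measures.* A face integral has to be one integral against the residue measure, defined as a
supremum over charts. On each chart that measure is the limit as `ε → 0⁺` of the measures
`∏_{α ∈ A} ε ‖f_α‖ ^ (ε - 1) ∏ ‖f_β‖ ^ d_β τ`, which do not depend on the chart
(`tendsto_lintegral_residueWeight`), so the chart measures glue (`setLIntegral_residueMeasure`).

*Conclusion.* A partition of unity adds up the local expansions (`exists_local_expansion`). Only the
faces of maximal cardinality reach the top degree, and their integrals are positive. The expansion
is then one for a primitive of a monotone function, and difference quotients with steps
`exp (-ηT)` recover that of `V` itself (`exists_tauberian`).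
-/

noncomputable section
namespace VolAsymp
open Real Finset MvPolynomial Limits Module
open CommRingCat (of ofHom)

/-! ### Regular functions at rational points -/

section FieldBasics

variable {K : Type u} [Field K] {X : Scheme.{u}} {p : X ⟶ Spec (of K)}

/-- Restriction of regular functions to a smaller open set. -/
abbrev res {U V : X.Opens} (h : V ≤ U) : Γ(X, U) →+* Γ(X, V) := (X.presheaf.map (homOfLE h).op).hom

theorem evalHom_res (x : RatPoint p) {U V : X.Opens} (h : V ≤ U) (hx : x.pt ∈ V) (f : Γ(X, U)) :
    x.evalHom V hx (res h f) = x.evalHom U (h hx) f := by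
  simp [RatPoint.evalHom, RingHom.comp_apply]
  congr 1
  exact congr($(Scheme.Hom.map_appLE x.hom (x.top_le hx) (homOfLE h).op) f)

theorem scalar_res (p : X ⟶ Spec (of K)) {U V : X.Opens} (h : V ≤ U) (a : K) :
    res h (scalar p U a) = scalar p V a := by
  simp [scalar, RingHom.comp_apply]
  exact congr($(Scheme.Hom.appLE_map p (le_top.trans p.preimage_top.ge) (homOfLE h).op) _)

theorem evalHom_scalar (x : RatPoint p) {U : X.Opens} (hx : x.pt ∈ U) (a : K) :
    x.evalHom U hx (scalar p U a) = a := by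
  have h := Scheme.Hom.appLE_comp_appLE x.hom p ⊤ U ⊤ (le_top.trans p.preimage_top.ge) (x.top_le hx)
  simp [scalar, RatPoint.evalHom, RingHom.comp_apply]
  have h2 := congr($h ((Scheme.ΓSpecIso (of K)).inv.hom a))
  simp [CommRingCat.hom_comp, RingHom.comp_apply] at h2
  erw [h2]
  have : ∀ (f : Spec (of K) ⟶ Spec (of K)) (hf : f = 𝟙 _) (e),
      (Scheme.ΓSpecIso (of K)).hom.hom ((f.appLE ⊤ ⊤ e).hom
        ((Scheme.ΓSpecIso (of K)).inv.hom a)) = a := by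
    rintro f rfl e
    have h3 : (𝟙 (Spec (of K)) : Spec (of K) ⟶ _).appLE ⊤ ⊤ e = 𝟙 _ := by
      rw [Scheme.Hom.appLE, Scheme.Hom.id_app]
      exact (Category.id_comp _).trans ((Spec (of K)).presheaf.map_id _)
    rw [h3]
    simp
  exact this _ x.comp_eq _

theorem RatPoint.hom_eq (x : RatPoint p) {U : X.Opens} (hU : IsAffineOpen U) (hx : x.pt ∈ U) :
    x.hom = Spec.map (ofHom (x.evalHom U hx)) ≫ hU.fromSpec := by
  have h := IsAffineOpen.SpecMap_appLE_fromSpec x.hom hU (isAffineOpen_top _) (x.top_le hx)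
  rw [IsAffineOpen.fromSpec_top, Scheme.isoSpec_Spec_inv] at h
  have h2 : ofHom (x.evalHom U hx) =
      x.hom.appLE U ⊤ (x.top_le hx) ≫ (Scheme.ΓSpecIso (of K)).hom := rfl
  rw [h2, Spec.map_comp, Category.assoc, h, ← Spec.map_comp_assoc]
  simp

theorem mem_basicOpen_iff_of_affine (x : RatPoint p) {U : X.Opens} (hU : IsAffineOpen U)
    (hx : x.pt ∈ U) (f : Γ(X, U)) : x.pt ∈ X.basicOpen f ↔ x.evalHom U hx f ≠ 0 := by
  have h1 : x.pt = hU.fromSpec (Spec.map (ofHom (x.evalHom U hx))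
      (IsLocalRing.closedPoint K)) := by
    rw [RatPoint.pt]
    conv_lhs => rw [x.hom_eq hU hx]
    rfl
  rw [h1]
  change (Spec.map (ofHom (x.evalHom U hx)) (IsLocalRing.closedPoint K)) ∈
    hU.fromSpec ⁻¹ᵁ X.basicOpen f ↔ _
  rw [hU.fromSpec_preimage_basicOpen]
  change f ∉ Ideal.comap (x.evalHom U hx) (IsLocalRing.maximalIdeal K) ↔ _
  simp [Ideal.mem_comap, IsLocalRing.mem_maximalIdeal]

theorem mem_basicOpen_iff (x : RatPoint p) {U : X.Opens} (hx : x.pt ∈ U) (f : Γ(X, U)) :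
    x.pt ∈ X.basicOpen f ↔ x.evalHom U hx f ≠ 0 := by
  obtain ⟨V, hV, hxV, hVU⟩ := exists_isAffineOpen_mem_and_subset hx
  rw [← evalHom_res x hVU hxV, ← mem_basicOpen_iff_of_affine x hV hxV, Scheme.basicOpen_res]
  exact ⟨fun h => ⟨hxV, h⟩, fun h => h.2⟩

theorem val_eq (x : RatPoint p) {U : X.Opens} (hx : x.pt ∈ U) (f : Γ(X, U)) :
    x.val f = x.evalHom U hx f := by
  simp [RatPoint.val, hx]

theorem RatPoint.ext_of_evalHom {x y : RatPoint p} {U : X.Opens} (hU : IsAffineOpen U)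
    (hx : x.pt ∈ U) (hy : y.pt ∈ U) (h : ∀ f, x.evalHom U hx f = y.evalHom U hy f) : x = y := by
  have h1 := x.hom_eq hU hx
  have h2 := y.hom_eq hU hy
  rw [RingHom.ext h, ← h2] at h1
  cases x; cases y; cases h1; rfl

theorem fromSpec_comp (p : X ⟶ Spec (of K)) {U : X.Opens} (hU : IsAffineOpen U) :
    hU.fromSpec ≫ p = Spec.map (ofHom (scalar p U)) := by
  have h := IsAffineOpen.SpecMap_appLE_fromSpec p (isAffineOpen_top _) hU
    (le_top.trans p.preimage_top.ge)
  rw [IsAffineOpen.fromSpec_top, Scheme.isoSpec_Spec_inv] at h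
  rw [← h, ← Spec.map_comp]
  rfl

theorem RatPoint.exists_of_ringHom {U : X.Opens} (hU : IsAffineOpen U) (φ : Γ(X, U) →+* K)
    (hφ : ∀ a, φ (scalar p U a) = a) : ∃ (x : RatPoint p) (hx : x.pt ∈ U), x.evalHom U hx = φ := by
  have hc : Spec.map (ofHom φ) ≫ hU.fromSpec ≫ p = 𝟙 _ := by
    rw [fromSpec_comp, ← Spec.map_comp, ← CommRingCat.ofHom_comp]
    have : φ.comp (scalar p U) = RingHom.id K := RingHom.ext hφ
    rw [this]
    exact Spec.map_id _
  let x : RatPoint p := ⟨Spec.map (ofHom φ) ≫ hU.fromSpec, by rw [Category.assoc, hc]⟩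
  have hx : x.pt ∈ U := by
    have : x.pt ∈ Set.range hU.fromSpec := ⟨_, rfl⟩
    rw [hU.range_fromSpec] at this
    exact this
  refine ⟨x, hx, ?_⟩
  have h := x.hom_eq hU hx
  have h2 :=
    (cancel_mono hU.fromSpec).1 h
  have h3 := Spec.map_injective h2
  exact (congrArg CommRingCat.Hom.hom h3).symm

/-- A prime divisor passes through a rational point if and only if its local equations vanish
there. -/
theorem IsLocalEq.specializes_iff {P : PrimeDivisor X} {U : X.Opens} {f : Γ(X, U)}
    (h : IsLocalEq P U f) (x : RatPoint p) (hx : x.pt ∈ U) :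
    P.pt ⤳ x.pt ↔ x.evalHom U hx f = 0 := by
  constructor
  · intro hs
    by_contra h0
    have h1 := (mem_basicOpen_iff x hx f).2 h0
    exact (h.2 f).1 dvd_rfl (hs.mem_open (X.basicOpen f).2 h1)
  · intro h0
    by_contra hs
    have hxc : x.pt ∈ (closure {P.pt})ᶜ := fun hc => hs (specializes_iff_mem_closure.2 hc)
    obtain ⟨g, hg, hxg⟩ := h.1.exists_basicOpen_le (V := ⟨(closure {P.pt})ᶜ, isClosed_closure.isOpen_compl⟩)
      ⟨x.pt, hxc⟩ hx
    have h1 : P.pt ∉ X.basicOpen g := fun hP => hg hP (subset_closure rfl)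
    obtain ⟨b, rfl⟩ := (h.2 g).2 h1
    have := (mem_basicOpen_iff x hx _).1 hxg
    simp [h0] at this

/-- Local equations remain local equations after localization. -/
theorem IsLocalEq.res_basicOpen {P : PrimeDivisor X} {U : X.Opens} {f : Γ(X, U)}
    (h : IsLocalEq P U f) (g : Γ(X, U)) :
    IsLocalEq P (X.basicOpen g) (res (X.basicOpen_le g) f) := by
  refine ⟨h.1.basicOpen g, fun a => ?_⟩
  have hloc := h.1.isLocalization_basicOpen g
  obtain ⟨k, b, hb⟩ : ∃ (k : ℕ) (b : Γ(X, U)), a * res (X.basicOpen_le g) g ^ k =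
      res (X.basicOpen_le g) b := by
    obtain ⟨⟨b, _, k, rfl⟩, hb⟩ := IsLocalization.surj (Submonoid.powers g) a
    refine ⟨k, b, ?_⟩
    rw [← map_pow]
    exact hb
  have hgu : IsUnit (res (X.basicOpen_le g) g) := RingedSpace.isUnit_res_basicOpen _ g
  have key : P.pt ∉ X.basicOpen a ↔ P.pt ∉ X.basicOpen (g * b) := by
    have : X.basicOpen a = X.basicOpen (res (X.basicOpen_le g) b) := by
      rw [← hb, Scheme.basicOpen_mul, Scheme.basicOpen_of_isUnit _ (hgu.pow k)]
      exact (inf_eq_left.2 (X.basicOpen_le a)).symm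
    rw [this, Scheme.basicOpen_mul]
    rw [Scheme.basicOpen_res]
  rw [key, ← h.2]
  constructor
  · rintro ⟨c, rfl⟩
    obtain ⟨⟨c', _, l, rfl⟩, hc⟩ := IsLocalization.surj (Submonoid.powers g) c
    have hc : c * res (X.basicOpen_le g) (g ^ l) = res (X.basicOpen_le g) c' := hc
    have h1 : res (X.basicOpen_le g) (b * g ^ l) = res (X.basicOpen_le g) (f * c' * g ^ k) := by
      simp only [map_mul, map_pow] at hc ⊢
      rw [← hb, ← hc]; ring
    obtain ⟨⟨_, m, rfl⟩, hm⟩ := (IsLocalization.eq_iff_exists (Submonoid.powers g) _).1 h1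
    have hm : g ^ m * (b * g ^ l) = g ^ m * (f * c' * g ^ k) := hm
    -- it suffices that `f` divides `g ^ N * b`, since then `g ^ N * b` and `g * b` vanish on `P` together
    have hd : f ∣ g ^ (m + l) * b := ⟨g ^ m * c' * g ^ k, by rw [pow_add]; linear_combination hm⟩
    rw [h.2, Scheme.basicOpen_mul] at hd ⊢
    intro hP
    refine hd ⟨?_, hP.2⟩
    rcases Nat.eq_zero_or_pos (m + l) with h0 | h0
    · rw [h0, pow_zero, Scheme.basicOpen_of_isUnit _ isUnit_one]
      exact X.basicOpen_le _ hP.1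
    · rw [Scheme.basicOpen_pow _ _ h0]; exact hP.1
  · rintro ⟨c, hc⟩
    have : res (X.basicOpen_le g) f ∣ a * res (X.basicOpen_le g) g ^ (k + 1) := by
      rw [pow_succ, ← mul_assoc, hb, mul_comm, ← map_mul, hc, map_mul]
      exact dvd_mul_right _ _
    exact (hgu.pow (k + 1)).dvd_mul_right.1 this

theorem isLocalEq_one {P : PrimeDivisor X} {U : X.Opens} (hU : IsAffineOpen U) (hP : P.pt ∉ U) :
    IsLocalEq P U 1 :=
  ⟨hU, fun f => ⟨fun _ h => hP (X.basicOpen_le f h), fun _ => one_dvd _⟩⟩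

/-- Étale coordinates restrict to smaller affine open sets. -/
theorem IsEtaleCoord.restrict {n : ℕ} {U V : X.Opens} {t : Fin n → Γ(X, U)} (h : IsEtaleCoord p U t)
    (hV : IsAffineOpen V) (hVU : V ≤ U) : IsEtaleCoord p V fun i => res hVU (t i) := by
  refine ⟨hV, ?_⟩
  have h1 := Scheme.Hom.etale_appLE (𝟙 X) h.1 hV hVU
  have h2 := RingHom.Etale.stableUnderComposition _ _ h.2 h1
  convert h2
  have h3 : (Scheme.Hom.appLE (𝟙 X) U V hVU).hom = VolAsymp.res hVU := by
    simp [Scheme.Hom.appLE]; rfl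
  rw [h3]
  refine ringHom_ext (fun a => ?_) fun i => ?_
  · simp [scalar_res p hVU a]
  · simp

end FieldBasics

/-! ### Charts of a projective scheme -/

section ProjectiveCharts
attribute [local instance] gradedAlgebra

variable {K : Type u} [Field K] {X : Scheme.{u}} {p : X ⟶ Spec (of K)}

theorem scalar_comp {Y : Scheme.{u}} (f : Y ⟶ X) (p : X ⟶ Spec (of K)) (q : Y ⟶ Spec (of K))
    (h : f ≫ p = q) (U : X.Opens) (V : Y.Opens) (e : V ≤ f ⁻¹ᵁ U) (a : K)
    : scalar q V a = f.appLE U V e (scalar p U a) := by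
  subst h
  have h := Scheme.Hom.appLE_comp_appLE f p ⊤ U V (le_top.trans p.preimage_top.ge) e
  exact congr($h.symm ((Scheme.ΓSpecIso (of K)).inv.hom a))

theorem eval₂Hom_mul_of_isHomogeneous {σ R S : Type*} [CommRing R] [CommRing S]
    {P : MvPolynomial σ R} {n : ℕ} (hP : P.IsHomogeneous n) (f : R →+* S) (g : σ → S) (c : S) :
    eval₂Hom f (fun j => g j * c) P = eval₂Hom f g P * c ^ n := by
  simp [coe_eval₂Hom, eval₂_eq, sum_mul]
  refine sum_congr rfl fun d hd => ?_
  have h := hP (MvPolynomial.mem_support_iff.1 hd)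
  have h2 : ∑ i ∈ d.support, d i = n := by
    rw [← h, Finsupp.weight_apply, Finsupp.sum]; simp
  simp [mul_pow, prod_mul_distrib, prod_pow_eq_pow_sum, h2, mul_assoc]

/-- The standard affine charts of a projective scheme: affine open sets `U i`, with the functions
`y i j = X_j / X_i`, which generate `Γ(X, U i)` and satisfy the cocycle relations. -/
theorem IsProjectiveOver.exists_charts (hp : IsProjectiveOver p) :
    ∃ (N : ℕ) (U : Fin (N + 1) → X.Opens) (y : ∀ i, Fin (N + 1) → Γ(X, U i)),
      (∀ i, IsAffineOpen (U i)) ∧ (∀ x : X, ∃ i, x ∈ U i) ∧ (∀ i, y i i = 1) ∧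
      (∀ i j, X.basicOpen (y i j) = U i ⊓ U j) ∧
      (∀ i j k, res inf_le_left (y i k) =
        (res inf_le_left (y i j) * res inf_le_right (y j k) : Γ(X, U i ⊓ U j))) ∧
      (∀ i (f : Γ(X, U i)), ∃ P : MvPolynomial (Fin (N + 1)) K,
        f = eval₂Hom (scalar p (U i)) (y i) P) := by
  obtain ⟨N, ι, hι, hιp⟩ := hp
  let 𝒜 := homogeneousSubmodule (Fin (N + 1)) K
  let T : Fin (N + 1) → MvPolynomial (Fin (N + 1)) K := MvPolynomial.X
  have hT : ∀ i, T i ∈ 𝒜 1 := fun i => isHomogeneous_X _ _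
  let q : ∀ i j, HomogeneousLocalization.Away 𝒜 (T i) := fun i j =>
    HomogeneousLocalization.Away.isLocalizationElem (hT i) (hT j)
  have hq : ∀ i j, (q i j).val = Localization.mk (T j) ⟨T i, Submonoid.mem_powers _⟩ := by
    intro i j
    simp only [q, HomogeneousLocalization.Away.isLocalizationElem, HomogeneousLocalization.Away.val_mk, pow_one]
  have haff : ∀ i, IsAffineOpen (Proj.basicOpen 𝒜 (T i)) :=
    fun i => Proj.isAffineOpen_basicOpen 𝒜 (T i) (hT i) one_pos
  let s : ∀ i j, Γ(Proj 𝒜, Proj.basicOpen 𝒜 (T i)) := fun i j => Proj.awayToSection 𝒜 (T i) (q i j)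
  have hcov : ∀ x : Proj 𝒜, ∃ i, x ∈ Proj.basicOpen 𝒜 (T i) := by
    intro x
    have h := Proj.iSup_basicOpen_eq_top' 𝒜 T (fun i => ⟨1, hT i⟩) (by
      refine top_le_iff.1 fun f _ => ?_
      induction f using induction_on with
      | C a =>
        have : MvPolynomial.C a = algebraMap (𝒜 0) (MvPolynomial (Fin (N + 1)) K)
          ⟨MvPolynomial.C a, isHomogeneous_C _ _⟩ := rfl
        rw [this]
        exact Subalgebra.algebraMap_mem _ _
      | add f g hf hg => exact add_mem (hf trivial) (hg trivial)
      | mul_X f i hf => exact mul_mem (hf trivial) (Algebra.subset_adjoin ⟨i, rfl⟩))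
    exact TopologicalSpace.Opens.mem_iSup.1 (h.ge (Set.mem_univ x))
  have hs1 : ∀ i, s i i = 1 := by
    intro i
    have : q i i = 1 := by
      apply HomogeneousLocalization.val_injective
      rw [hq, HomogeneousLocalization.val_one, Localization.mk_self ⟨T i, Submonoid.mem_powers _⟩]
    simp only [s, this, map_one]
  have hfs : ∀ i, Spec.map (Proj.awayToSection 𝒜 (T i)) ≫ Proj.awayι 𝒜 (T i) (hT i) one_pos =
        (haff i).fromSpec := by
    intro i
    have : IsIso (Proj.basicOpen 𝒜 (T i)).toSpecΓ := by
      rw [← (haff i).isoSpec_hom]; infer_instance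
    rw [← cancel_epi (Proj.basicOpen 𝒜 (T i)).toSpecΓ, (haff i).toSpecΓ_fromSpec, ← Category.assoc]
    change Proj.basicOpenToSpec 𝒜 (T i) ≫ _ = _
    rw [← Proj.basicOpenIsoSpec_hom 𝒜 (T i) (hT i) one_pos, Proj.awayι, Iso.hom_inv_id_assoc]
  have hsb : ∀ i j, (Proj 𝒜).basicOpen (s i j) = Proj.basicOpen 𝒜 (T i) ⊓ Proj.basicOpen 𝒜 (T j) := by
    intro i j
    have h2 : (haff i).fromSpec ⁻¹ᵁ Proj.basicOpen 𝒜 (T j) = (haff i).fromSpec ⁻¹ᵁ (Proj 𝒜).basicOpen (s i j) := by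
      rw [(haff i).fromSpec_preimage_basicOpen, ← hfs, Scheme.Hom.comp_preimage,
        Proj.awayι_preimage_basicOpen 𝒜 (hT i) one_pos (hT j) one_pos]
      rfl
    have h3 := congrArg (fun W => (haff i).fromSpec ''ᵁ W) h2
    simp only [Scheme.Hom.image_preimage_eq_opensRange_inf, (haff i).opensRange_fromSpec] at h3
    rw [h3]
    exact (inf_eq_right.2 (Scheme.basicOpen_le _ _)).symm
  have hsc : ∀ i j k, res inf_le_left (s i k) =
        (res inf_le_left (s i j) * res inf_le_right (s j k) :
          Γ(Proj 𝒜, Proj.basicOpen 𝒜 (T i) ⊓ Proj.basicOpen 𝒜 (T j))) := by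
    intro i j k
    apply Subtype.ext
    ext ⟨z, hz⟩
    have e : ∀ (i j) (hz : z ∈ Proj.basicOpen 𝒜 (T i)), ((s i j).1 ⟨z, hz⟩).val =
        Localization.mk (T j) ⟨T i, hz⟩ := by
      intro i j hz
      erw [ProjectiveSpectrum.Proj.awayToSection_apply, hq, Localization.mk_eq_mk',
        IsLocalization.map_mk', ← Localization.mk_eq_mk']
      rfl
    change ((s i k).1 ⟨z, hz.1⟩).val = ((s i j).1 ⟨z, hz.1⟩ * (s j k).1 ⟨z, hz.2⟩).val
    rw [HomogeneousLocalization.val_mul, e, e, e, Localization.mk_mul, Localization.mk_eq_mk_iff, Localization.r_iff_exists]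
    refine ⟨1, ?_⟩
    simp
    ring
  have hsg : ∀ i (f : Γ(Proj 𝒜, Proj.basicOpen 𝒜 (T i))), ∃ P : MvPolynomial (Fin (N + 1)) K,
        f = eval₂Hom (scalar (projectiveSpaceToSpec K N) _) (s i) P := by
    intro i f
    obtain ⟨g, rfl⟩ : ∃ g, Proj.awayToSection 𝒜 (T i) g = f := by
      refine ⟨(Proj.basicOpenIsoAway 𝒜 (T i) (hT i) one_pos).inv f, ?_⟩
      rw [← Proj.basicOpenIsoAway_hom 𝒜 (T i) (hT i) one_pos]
      simp
    obtain ⟨n, P, hP, rfl⟩ := HomogeneousLocalization.Away.mk_surjective 𝒜 (hT i) g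
    refine ⟨P, ?_⟩
    let c : K →+* HomogeneousLocalization.Away 𝒜 (T i) :=
      (HomogeneousLocalization.fromZeroRingHom 𝒜 _).comp (algebraMap K (𝒜 0))
    have hc : ∀ a, Proj.awayToSection 𝒜 (T i) (c a) = scalar (projectiveSpaceToSpec K N) _ a := by
      intro a
      have h1 := fromSpec_comp (projectiveSpaceToSpec K N) (haff i)
      rw [← hfs, projectiveSpaceToSpec, Category.assoc, Proj.awayι_toSpecZero_assoc,
        ← Spec.map_comp, ← Spec.map_comp] at h1
      exact congr($(Spec.map_injective h1) a)
    have h1 : HomogeneousLocalization.Away.mk 𝒜 (hT i) n P hP = eval₂Hom c (q i) P := by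
      apply HomogeneousLocalization.val_injective
      let L := Localization (Submonoid.powers (T i))
      let v : HomogeneousLocalization.Away 𝒜 (T i) →+* L := algebraMap _ _
      have h2 : v.comp (eval₂Hom c (q i)) = eval₂Hom
          ((algebraMap (MvPolynomial (Fin (N + 1)) K) L).comp MvPolynomial.C)
          (fun j => algebraMap (MvPolynomial (Fin (N + 1)) K) L (T j) *
            Localization.mk 1 ⟨T i, Submonoid.mem_powers _⟩) := by
        refine ringHom_ext (fun a => ?_) fun j => ?_
        · simp only [RingHom.comp_apply, eval₂Hom_C]
          exact Localization.mk_one_eq_algebraMap _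
        · simp only [RingHom.comp_apply, eval₂Hom_X']
          rw [← Localization.mk_one_eq_algebraMap, Localization.mk_mul]
          refine (hq i j).trans ?_
          simp
      have h3 := congr($h2 P)
      have hP' : P.IsHomogeneous n := by simpa [𝒜] using hP
      rw [eval₂Hom_mul_of_isHomogeneous hP'] at h3
      have h4 : eval₂Hom ((algebraMap (MvPolynomial (Fin (N + 1)) K) L).comp MvPolynomial.C)
          (fun j => algebraMap (MvPolynomial (Fin (N + 1)) K) L (T j)) =
          algebraMap (MvPolynomial (Fin (N + 1)) K) L := by
        refine ringHom_ext (fun a => ?_) fun j => ?_ <;> simp [T]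
      rw [h4] at h3
      refine Eq.trans ?_ h3.symm
      rw [HomogeneousLocalization.Away.val_mk, ← Localization.mk_one_eq_algebraMap,
        Localization.mk_pow, Localization.mk_mul]
      simp
    rw [h1]
    change ((Proj.awayToSection 𝒜 (T i)).hom.comp (eval₂Hom c (q i))) P = _
    congr 1
    refine ringHom_ext (fun a => ?_) fun j => ?_
    · simpa using hc a
    · simp [s]
  refine ⟨N, fun i => ι ⁻¹ᵁ Proj.basicOpen 𝒜 (T i), fun i j => ι.app _ (s i j),
    fun i => (haff i).preimage ι, fun x => hcov (ι x), fun i => ?_, fun i j => ?_, fun i j k => ?_, fun i f => ?_⟩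
  · simp [hs1]
  · rw [← Scheme.preimage_basicOpen, hsb]; rfl
  · have hn : ∀ (U V : (Proj 𝒜).Opens) (h : V ≤ U) (a : Γ(Proj 𝒜, U)),
        res (show ι ⁻¹ᵁ V ≤ ι ⁻¹ᵁ U from fun _ hx => h hx) (ι.app U a) = ι.app V (res h a) := by
      intro U V h a
      exact congr($((Scheme.Hom.naturality ι (homOfLE h).op).symm) a)
    have h := congrArg (ι.app _) (hsc i j k)
    rw [map_mul, ← hn, ← hn, ← hn] at h
    exact h
  · obtain ⟨g, rfl⟩ : ∃ g, ι.app _ g = f := by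
      exact Scheme.Hom.app_surjective ι _ (haff i) f
    obtain ⟨P, rfl⟩ := hsg i g
    refine ⟨P, ?_⟩
    change ((ι.app _).hom.comp (eval₂Hom (scalar (projectiveSpaceToSpec K N) _) (s i))) P = _
    congr 1
    refine ringHom_ext (fun a => ?_) fun i => ?_
    · have h := scalar_comp ι _ p hιp (Proj.basicOpen 𝒜 (T i)) _ le_rfl a
      simp only [Scheme.Hom.appLE_eq_app] at h
      simpa using h.symm
    · simp

end ProjectiveCharts

/-! ### The topology of the set of rational points -/

/-- Near a rational point of the affine open set `U`, every regular function is a quotient of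
regular functions on `U`. -/
theorem exists_val_eq_div {K : Type u} [Field K] {X : Scheme.{u}} {p : X ⟶ Spec (of K)}
    {U V : X.Opens} (hU : IsAffineOpen U) {y : RatPoint p} (hy : y.pt ∈ U) (hyV : y.pt ∈ V)
    (f : Γ(X, V)) :
    ∃ (b g : Γ(X, U)) (k : ℕ), y.val g ≠ 0 ∧ ∀ x : RatPoint p, x.pt ∈ U → x.val g ≠ 0 →
      x.pt ∈ V ∧ x.val f = x.val b / x.val g ^ k := by
  obtain ⟨g, hgV, hyg⟩ := hU.exists_basicOpen_le (V := V) ⟨y.pt, hyV⟩ hy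
  have hloc := hU.isLocalization_basicOpen g
  obtain ⟨⟨b, _, k, rfl⟩, hb⟩ := IsLocalization.surj (Submonoid.powers g) (res hgV f)
  have hb : res hgV f * res (X.basicOpen_le g) (g ^ k) = res (X.basicOpen_le g) b := hb
  refine ⟨b, g, k, ?_, fun x hxU hxg => ?_⟩
  · rw [val_eq y hy, ← mem_basicOpen_iff y hy]; exact hyg
  · have hx : x.pt ∈ X.basicOpen g := by rwa [mem_basicOpen_iff x hxU, ← val_eq]
    refine ⟨hgV hx, ?_⟩
    have h1 := congrArg (x.evalHom _ hx) hb
    rw [map_mul, evalHom_res, evalHom_res, evalHom_res, map_pow] at h1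
    rw [val_eq x hxU] at hxg
    rw [val_eq x (hgV hx), val_eq x hxU, val_eq x hxU, ← h1]
    field_simp

section RatTopology

variable {F : Type u} [RCLike F] {X : Scheme.{u}} {p : X ⟶ Spec (of F)}

theorem isOpen_setOf_pt_mem (U : X.Opens) : IsOpen {x : RatPoint p | x.pt ∈ U} := by
  refine TopologicalSpace.isOpen_generateFrom_of_mem ⟨U, 0, Set.univ, isOpen_univ, by simp⟩

theorem continuousAt_val {U : X.Opens} (f : Γ(X, U)) {x : RatPoint p} (hx : x.pt ∈ U) :
    ContinuousAt (fun y => y.val f) x := by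
  intro W hW
  obtain ⟨W', hW', hWo, hyW⟩ := mem_nhds_iff.1 hW
  have ho : IsOpen {x : RatPoint p | x.pt ∈ U ∧ x.val f ∈ W'} :=
    TopologicalSpace.isOpen_generateFrom_of_mem ⟨U, f, W', hWo, rfl⟩
  exact Filter.mem_map.2 (mem_of_superset (ho.mem_nhds ⟨hx, hyW⟩) fun a ha => hW' ha.2)

/-- Convergence of rational points can be tested with the regular functions on one affine
neighbourhood of the limit. -/
theorem RatPoint.tendsto_nhds_of_affine {T : Type*} {l : Filter T} {z : T → RatPoint p}
    {y : RatPoint p} {U : X.Opens} (hU : IsAffineOpen U) (hy : y.pt ∈ U)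
    (hz : ∀ᶠ a in l, (z a).pt ∈ U)
    (h : ∀ f : Γ(X, U), Tendsto (fun a => (z a).val f) l (𝓝 (y.val f))) : Tendsto z l (𝓝 y) := by
  rw [TopologicalSpace.nhds_generateFrom, tendsto_iInf]
  intro s
  rw [tendsto_iInf]
  rintro ⟨hys, V, f, W, hW, rfl⟩
  rw [tendsto_principal]
  obtain ⟨hyV, hyW⟩ := hys
  obtain ⟨b, g, k, hyg, key⟩ := exists_val_eq_div hU hy hyV f
  have hzg : ∀ᶠ a in l, (z a).val g ≠ 0 := (h g).eventually_ne hyg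
  have hlim : Tendsto (fun a => (z a).val b / (z a).val g ^ k) l (𝓝 (y.val f)) := by
    rw [(key y hy hyg).2]
    exact (h b).div ((h g).pow k) (pow_ne_zero _ hyg)
  filter_upwards [hz, hzg, hlim (hW.mem_nhds hyW)] with a ha hga hW'
  refine ⟨(key _ ha hga).1, ?_⟩
  rw [(key _ ha hga).2]
  exact hW'

theorem val_scalar (x : RatPoint p) {U : X.Opens} (hx : x.pt ∈ U) (a : F) :
    x.val (scalar p U a) = a := by rw [val_eq x hx, evalHom_scalar]

theorem val_eval₂Hom (x : RatPoint p) {U : X.Opens} (hx : x.pt ∈ U) {σ : Type*} (y : σ → Γ(X, U))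
    (P : MvPolynomial σ F) : x.val (eval₂Hom (scalar p U) y P) =
      MvPolynomial.eval (fun i => x.val (y i)) P := by
  rw [val_eq x hx]
  change ((x.evalHom U hx).comp (eval₂Hom (scalar p U) y)) P = _
  have : (x.evalHom U hx).comp (eval₂Hom (scalar p U) y) =
      MvPolynomial.eval (fun i => x.val (y i)) := by
    refine ringHom_ext (fun a => ?_) fun i => ?_
    · simp [evalHom_scalar]
    · simp [val_eq x hx]
  rw [this]

/-- Rational points are compact because every limit of rational points along an ultrafilter is again one:
the limits of the values of regular functions, in a chart where all coordinates stay bounded by `1`,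
define a ring homomorphism to `F`. -/
theorem compactSpace_and_t2Space (hp : IsProjectiveOver p) :
    CompactSpace (RatPoint p) ∧ T2Space (RatPoint p) := by
  obtain ⟨N, U, y, hU, hcov, hy1, hyb, hyc, hyg⟩ := hp.exists_charts
  have hmem : ∀ (x : RatPoint p) i j, x.pt ∈ U i → (x.pt ∈ U j ↔ x.val (y i j) ≠ 0) := by
    intro x i j hi
    rw [val_eq x hi, ← mem_basicOpen_iff x hi, hyb]
    exact ⟨fun h => ⟨hi, h⟩, fun h => h.2⟩
  have hmul : ∀ (x : RatPoint p) i j k, x.pt ∈ U i → x.pt ∈ U j →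
      x.val (y i k) = x.val (y i j) * x.val (y j k) := by
    intro x i j k hi hj
    have hij : x.pt ∈ U i ⊓ U j := ⟨hi, hj⟩
    have h := congrArg (x.evalHom (U i ⊓ U j) hij) (hyc i j k)
    rwa [map_mul, evalHom_res, evalHom_res, evalHom_res, ← val_eq, ← val_eq, ← val_eq] at h
  have hone : ∀ (x : RatPoint p) i, x.pt ∈ U i → x.val (y i i) = 1 := by
    intro x i hi
    rw [val_eq x hi, hy1, map_one]
  -- a rational point lies in the chart where the absolute value of the homogeneous coordinate is maximal
  have hbd : ∀ x : RatPoint p, ∃ i, x.pt ∈ U i ∧ ∀ j, ‖x.val (y i j)‖ ≤ 1 := by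
    intro x
    obtain ⟨i, hi⟩ := hcov x.pt
    obtain ⟨j, -, hj⟩ := exists_max_image univ (fun j => ‖x.val (y i j)‖) ⟨i, mem_univ _⟩
    have hij : x.val (y i j) ≠ 0 := by
      intro h0
      have := hj i (mem_univ _)
      rw [h0, hone x i hi] at this
      simp at this
      linarith
    have hxj := (hmem x i j hi).2 hij
    refine ⟨j, hxj, fun k => ?_⟩
    have h1 := hj k (mem_univ _)
    rw [hmul x i j k hi hxj, norm_mul] at h1
    have h2 : 0 < ‖x.val (y i j)‖ := norm_pos_iff.2 hij
    nlinarith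
  have hlim : ∀ {T : Type u} {l : Filter T} {z : T → RatPoint p} {i} {v : Fin (N + 1) → F},
      (∀ᶠ a in l, (z a).pt ∈ U i) → (∀ j, Tendsto (fun a => (z a).val (y i j)) l (𝓝 (v j))) →
      ∀ P, Tendsto (fun a => (z a).val (eval₂Hom (scalar p (U i)) (y i) P)) l
        (𝓝 (MvPolynomial.eval v P)) := by
    intro T l z i v hz hv P
    have h1 : Tendsto (fun a => MvPolynomial.eval (fun j => (z a).val (y i j)) P) l
        (𝓝 (MvPolynomial.eval v P)) :=
      ((continuous_eval P).tendsto v).comp (tendsto_pi_nhds.2 hv)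
    refine h1.congr' ?_
    filter_upwards [hz] with a ha
    rw [val_eval₂Hom _ ha]
  constructor
  · refine ⟨isCompact_iff_ultrafilter_le_nhds.2 fun l _ => ?_⟩
    obtain ⟨i, hi⟩ : ∃ i, ∀ᶠ x in (l : Filter (RatPoint p)), x.pt ∈ U i ∧ ∀ j, ‖x.val (y i j)‖ ≤ 1 := by
      by_contra hne
      rw [not_exists] at hne
      have h1 : ∀ᶠ x in (l : Filter (RatPoint p)), ∀ i, ¬ (x.pt ∈ U i ∧ ∀ j, ‖x.val (y i j)‖ ≤ 1) := by
        rw [eventually_all]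
        intro i
        exact Ultrafilter.eventually_not.2 (hne i)
      obtain ⟨x, hx⟩ := h1.exists
      obtain ⟨i, hi⟩ := hbd x
      exact hx i hi
    have hv : ∀ j, ∃ v, Tendsto (fun x : RatPoint p => x.val (y i j)) l (𝓝 v) := by
      intro j
      have h1 := isCompact_iff_ultrafilter_le_nhds.1 (isCompact_closedBall (0 : F) 1)
        (l.map fun x : RatPoint p => x.val (y i j)) (by
          rw [le_principal_iff]
          exact hi.mono fun x hx => by simpa using hx.2 j)
      obtain ⟨v, -, hv⟩ := h1
      exact ⟨v, hv⟩
    choose v hv using hv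
    have hφ : ∀ f : Γ(X, U i), ∃ c, Tendsto (fun x : RatPoint p => x.val f) l (𝓝 c) := by
      intro f
      obtain ⟨P, rfl⟩ := hyg i f
      exact ⟨_, hlim (hi.mono fun x hx => hx.1) hv P⟩
    choose φ hφ using hφ
    let Φ : Γ(X, U i) →+* F :=
      { toFun := φ
        map_one' := tendsto_nhds_unique ((hφ 1).congr' (by
          filter_upwards [hi] with x hx
          rw [val_eq x hx.1, map_one])) tendsto_const_nhds
        map_zero' := tendsto_nhds_unique ((hφ 0).congr' (by
          filter_upwards [hi] with x hx
          rw [val_eq x hx.1, map_zero])) tendsto_const_nhds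
        map_mul' := fun f g => tendsto_nhds_unique ((hφ (f * g)).congr' (by
          filter_upwards [hi] with x hx
          rw [val_eq x hx.1, map_mul, ← val_eq, ← val_eq])) ((hφ f).mul (hφ g))
        map_add' := fun f g => tendsto_nhds_unique ((hφ (f + g)).congr' (by
          filter_upwards [hi] with x hx
          rw [val_eq x hx.1, map_add, ← val_eq, ← val_eq])) ((hφ f).add (hφ g)) }
    obtain ⟨x, hx, hxΦ⟩ := RatPoint.exists_of_ringHom (p := p) (hU i) Φ (fun a =>
      tendsto_nhds_unique ((hφ (scalar p (U i) a)).congr' (by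
          filter_upwards [hi] with x hx
          rw [val_scalar x hx.1])) tendsto_const_nhds)
    refine ⟨x, trivial, ?_⟩
    refine RatPoint.tendsto_nhds_of_affine (z := id) (hU i) hx (hi.mono fun x hx => hx.1) fun f => ?_
    rw [val_eq x hx, hxΦ]
    exact hφ f
  · rw [t2_iff_ultrafilter]
    intro x x' l hx hx'
    obtain ⟨i, hi⟩ := hcov x.pt
    obtain ⟨j, hj⟩ := hcov x'.pt
    have hli : ∀ᶠ z : RatPoint p in l, z.pt ∈ U i := hx ((isOpen_setOf_pt_mem (U i)).mem_nhds hi)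
    have hlj : ∀ᶠ z : RatPoint p in l, z.pt ∈ U j := hx' ((isOpen_setOf_pt_mem (U j)).mem_nhds hj)
    have h1 := (continuousAt_val (y i j) hi).mono_left hx
    have h2 := (continuousAt_val (y j i) hj).mono_left hx'
    have h3 : x.val (y i j) * x'.val (y j i) = 1 := by
      refine tendsto_nhds_unique ((h1.mul h2).congr' ?_) tendsto_const_nhds
      filter_upwards [hli, hlj] with z hzi hzj
      rw [← hmul z i j i hzi hzj, hone z i hzi]
    have hxj : x.pt ∈ U j := (hmem x i j hi).2 (left_ne_zero_of_mul_eq_one h3)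
    refine RatPoint.ext_of_evalHom (hU j) hxj hj fun f => ?_
    rw [← val_eq, ← val_eq]
    exact tendsto_nhds_unique ((continuousAt_val f hxj).mono_left hx)
      ((continuousAt_val f hj).mono_left hx')

end RatTopology

/-! ### Étale coordinates are local coordinates on `X(F)` -/

section ImplicitFunction

variable {F : Type*} [RCLike F] {E : Type*} [NormedAddCommGroup E] [NormedSpace F E]
  [FiniteDimensional F E]

/-- The implicit function theorem for the zero set of one function `f` in the open set `g ≠ 0`,
on which the partial derivative of `f` in the last variable does not vanish. -/
theorem exists_implicit_function {f g : E × F → F} (hf : ContDiff F ∞ f) (hg : Continuous g)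
    (hs : ∀ a, f a = 0 → g a ≠ 0 → fderiv F f a (0, 1) ≠ 0) {a₀ : E × F} (h₀ : f a₀ = 0)
    (hg₀ : g a₀ ≠ 0) :
    ∃ (S : Set (E × F)) (T : Set E) (φ : E → F), IsOpen S ∧ IsOpen T ∧ a₀ ∈ S ∧
      (∀ a ∈ S, f a = 0 → a.1 ∈ T ∧ φ a.1 = a.2) ∧
      (∀ t ∈ T, (t, φ t) ∈ S ∧ f (t, φ t) = 0 ∧ g (t, φ t) ≠ 0) ∧
      ∀ t ∈ T, ContDiffAt F ∞ φ t := by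
  have : CompleteSpace E := FiniteDimensional.complete F E
  let G : E × F → E × F := fun a => (a.1, f a)
  have hG : ContDiff F ∞ G := contDiff_fst.prodMk hf
  have hder : ∀ a, f a = 0 → g a ≠ 0 → ∃ L : (E × F) ≃L[F] (E × F),
      HasFDerivAt G (L : (E × F) →L[F] (E × F)) a := by
    intro a ha hga
    let L₀ : (E × F) →L[F] (E × F) := (ContinuousLinearMap.fst F E F).prod (fderiv F f a)
    have hL₀ : HasFDerivAt G L₀ a :=
      hasFDerivAt_fst.prodMk (hf.differentiable (by simp) a).hasFDerivAt
    have hinj : Function.Injective L₀ := by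
      rw [injective_iff_map_eq_zero]
      rintro ⟨x, y⟩ hxy
      obtain ⟨h1, h2⟩ := Prod.mk.injEq _ _ _ _ |>.mp (show (x, fderiv F f a (x, y)) = ((0 : E), (0 : F)) from hxy)
      subst h1
      have h3 : fderiv F f a ((0 : E), y) = y * fderiv F f a (0, 1) := by
        rw [← smul_eq_mul, ← map_smul]; simp
      rw [h3] at h2
      rcases mul_eq_zero.1 h2 with h | h
      · simp [h]
      · exact absurd h (hs a ha hga)
    let e := (LinearEquiv.ofInjectiveEndo (L₀ : (E × F) →ₗ[F] (E × F)) hinj).toContinuousLinearEquiv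
    have : (e : (E × F) →L[F] (E × F)) = L₀ := by ext x <;> rfl
    exact ⟨e, this ▸ hL₀⟩
  obtain ⟨L, hL⟩ := hder a₀ h₀ hg₀
  let H := hG.contDiffAt.toOpenPartialHomeomorph G hL (by simp)
  have hHG : ∀ a, H a = G a := fun a => rfl
  have ha₀ : a₀ ∈ H.source := hG.contDiffAt.mem_toOpenPartialHomeomorph_source hL (by simp)
  have hcont : Continuous fun t : E => (t, (0 : F)) := by fun_prop
  have hHsymm : ∀ t, (t, (0 : F)) ∈ H.target → H.symm (t, 0) = (t, (H.symm (t, 0)).2) ∧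
      f (H.symm (t, 0)) = 0 := by
    intro t ht
    have h1 : G (H.symm (t, 0)) = (t, 0) := H.right_inv ht
    obtain ⟨h2, h3⟩ := Prod.mk.injEq _ _ _ _ |>.mp h1
    exact ⟨Prod.ext h2 rfl, h3⟩
  refine ⟨H.source ∩ {a | g a ≠ 0}, (fun t => (t, (0 : F))) ⁻¹' (H.target ∩ H.symm ⁻¹' {a | g a ≠ 0}),
    fun t => (H.symm (t, 0)).2, H.open_source.inter (isOpen_ne_fun hg continuous_const),
    (H.continuousOn_symm.isOpen_inter_preimage H.open_target
      (isOpen_ne_fun hg continuous_const)).preimage hcont, ⟨ha₀, hg₀⟩, ?_, ?_, ?_⟩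
  · rintro ⟨t, s⟩ ⟨ha, hga⟩ hfa
    have h1 : H (t, s) = (t, 0) := by rw [hHG]; exact Prod.ext rfl hfa
    have h2 : H.symm (t, 0) = (t, s) := by rw [← h1, H.left_inv ha]
    exact ⟨⟨by simpa only [← h1] using H.map_source ha, by simpa [h2] using hga⟩, by simp only [h2]⟩
  · rintro t ⟨ht, hgt⟩
    have hgt : g (H.symm (t, 0)) ≠ 0 := hgt
    obtain ⟨h1, h2⟩ := hHsymm t ht
    simpa only [← h1] using ⟨⟨H.map_target ht, hgt⟩, h2, hgt⟩
  · rintro t ⟨ht, hgt⟩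
    have hgt : g (H.symm (t, 0)) ≠ 0 := hgt
    obtain ⟨L', hL'⟩ := hder _ (hHsymm t ht).2 hgt
    have h1 : ContDiffAt F ∞ H.symm (t, 0) := H.contDiffAt_symm ht hL' hG.contDiffAt
    have h2 : ContDiffAt F ∞ (fun t : E => (t, (0 : F))) t := (contDiff_id.prodMk contDiff_const).contDiffAt
    exact (h1.comp t h2).snd

end ImplicitFunction

section EtaleChart

variable {F : Type u} [RCLike F] {X : Scheme.{u}} {p : X ⟶ Spec (of F)}

theorem contDiff_mvPolynomial_eval {σ : Type*} [Fintype σ] (P : MvPolynomial σ F) :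
    ContDiff F ∞ fun v : σ → F => MvPolynomial.eval v P := by
  induction P using induction_on with
  | C a => simpa using contDiff_const
  | add f g hf hg => simpa using hf.add hg
  | mul_X f i hf => simpa using hf.mul (contDiff_apply _ _ i)

theorem contDiff_polynomial_eval₂ {σ : Type*} [Fintype σ] (q : Polynomial (MvPolynomial σ F)) :
    ContDiff F ∞ fun a : (σ → F) × F => q.eval₂ (MvPolynomial.eval a.1) a.2 := by
  induction q using Polynomial.induction_on' with
  | add f g hf hg => simpa [Polynomial.eval₂_add] using hf.add hg
  | monomial k c =>
    simp only [Polynomial.eval₂_monomial]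
    exact ((contDiff_mvPolynomial_eval c).comp contDiff_fst).mul (contDiff_snd.pow k)

/-- Local coordinates on `X(F)`. -/
abbrev CoordChart (p : X ⟶ Spec (of F)) (n : ℕ) :=
  OpenPartialHomeomorph (RatPoint p) (Fin n → F)

/-- Étale coordinates are local coordinates on the analytic space `X(F)`, in which regular functions
are smooth. -/
theorem IsEtaleCoord.exists_chart {n : ℕ} {U : X.Opens} {t : Fin n → Γ(X, U)}
    (h : IsEtaleCoord p U t) {x₀ : RatPoint p} (hx₀ : x₀.pt ∈ U) :
    ∃ χ : CoordChart p n, x₀ ∈ χ.source ∧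
      (∀ x ∈ χ.source, x.pt ∈ U) ∧ (∀ x, χ x = fun i => x.val (t i)) ∧
      ∀ x ∈ χ.source, ∀ (V : X.Opens) (f : Γ(X, V)), x.pt ∈ V →
        ContDiffAt F ∞ (fun e => (χ.symm e).val f) (χ x) := by
  -- shrink `U` so that it becomes standard étale
  let _ : Algebra (MvPolynomial (Fin n) F) Γ(X, U) := (eval₂Hom (scalar p U) t).toAlgebra
  have het : Algebra.Etale (MvPolynomial (Fin n) F) Γ(X, U) := h.2
  have hprime : (RingHom.ker (x₀.evalHom U hx₀)).IsPrime := RingHom.ker_isPrime _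
  obtain ⟨g₀, hg₀, hst⟩ := Algebra.IsEtaleAt.exists_isStandardEtale (R := MvPolynomial (Fin n) F)
    (RingHom.ker (x₀.evalHom U hx₀))
  let V := X.basicOpen g₀
  have hV : IsAffineOpen V := h.1.basicOpen g₀
  have hVU : V ≤ U := X.basicOpen_le g₀
  have hxV : x₀.pt ∈ V := (mem_basicOpen_iff x₀ hx₀ g₀).2 (by simpa using hg₀)
  have hloc := h.1.isLocalization_basicOpen g₀
  let _ : Algebra (MvPolynomial (Fin n) F) Γ(X, V) :=
    (eval₂Hom (scalar p V) fun i => res hVU (t i)).toAlgebra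
  have halg : ∀ P : MvPolynomial (Fin n) F, algebraMap _ Γ(X, V) P =
      eval₂Hom (scalar p V) (fun i => res hVU (t i)) P := fun P => rfl
  have hst' : Algebra.IsStandardEtale (MvPolynomial (Fin n) F) Γ(X, V) := by
    let e₀ := IsLocalization.algEquiv (Submonoid.powers g₀) (Localization.Away g₀) Γ(X, V)
    let e : Localization.Away g₀ ≃ₐ[MvPolynomial (Fin n) F] Γ(X, V) :=
      AlgEquiv.ofRingEquiv (f := e₀.toRingEquiv) (fun P => by
        have h1 : algebraMap (MvPolynomial (Fin n) F) (Localization.Away g₀) P =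
          algebraMap Γ(X, U) _ (eval₂Hom (scalar p U) t P) := rfl
        rw [h1]
        refine (e₀.commutes _).trans ?_
        rw [halg]
        change ((res hVU).comp (eval₂Hom (scalar p U) t)) P = _
        congr 1
        refine ringHom_ext (fun a => ?_) fun i => ?_
        · simp [scalar_res p hVU a]
        · simp)
    exact Algebra.IsStandardEtale.of_equiv e
  obtain ⟨⟨P⟩⟩ := hst'
  -- rational points of `V` are pairs `(t, s)` with `f (t, s) = 0` and `g (t, s) ≠ 0`
  let ev : Polynomial (MvPolynomial (Fin n) F) → (Fin n → F) × F → F :=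
    fun q a => q.eval₂ (MvPolynomial.eval a.1) a.2
  have hev : ∀ (q) (z : RatPoint p), z.pt ∈ V →
      z.val (Polynomial.aeval P.x q) = ev q (fun i => z.val (t i), z.val P.x) := by
    intro q z hz
    rw [val_eq z hz, Polynomial.aeval_def, Polynomial.hom_eval₂, val_eq z hz]
    have h1 : (z.evalHom V hz).comp (algebraMap (MvPolynomial (Fin n) F) Γ(X, V)) =
        MvPolynomial.eval fun i => z.val (t i) := by
      refine ringHom_ext (fun a => ?_) fun i => ?_
      · simp [halg, evalHom_scalar]
      · simp [halg, evalHom_res, val_eq z (hVU hz)]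
    rw [h1]
  have hpt : ∀ (a : (Fin n → F) × F), ev P.f a = 0 → ev P.g a ≠ 0 → ∃ z : RatPoint p, z.pt ∈ V ∧
      (fun i => z.val (t i)) = a.1 ∧ z.val P.x = a.2 := by
    intro a hfa hga
    let _ : Algebra (MvPolynomial (Fin n) F) F := (MvPolynomial.eval a.1).toAlgebra
    have hm : P.HasMap a.2 := ⟨hfa, IsUnit.mk0 _ hga⟩
    let Ψ : Γ(X, V) →ₐ[MvPolynomial (Fin n) F] F := (P.lift a.2 hm).comp P.equivRing.toAlgHom
    obtain ⟨z, hz, hzΨ⟩ := RatPoint.exists_of_ringHom (p := p) hV Ψ.toRingHom (fun c => by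
      have h1 := Ψ.commutes (MvPolynomial.C c)
      rw [halg, eval₂Hom_C] at h1
      exact h1.trans (eval_C c))
    refine ⟨z, hz, ?_, ?_⟩
    · funext i
      have h1 := Ψ.commutes (MvPolynomial.X i)
      rw [halg, eval₂Hom_X'] at h1
      rw [val_eq z (hVU hz), ← evalHom_res z hVU hz, hzΨ]
      exact h1.trans (eval_X i)
    · rw [val_eq z hz, hzΨ]
      exact (congrArg (P.lift a.2 hm) P.equivRing_x).trans (P.lift_X ..)
  have hzero : ∀ z : RatPoint p, z.pt ∈ V → ev P.f (fun i => z.val (t i), z.val P.x) = 0 ∧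
      ev P.g (fun i => z.val (t i), z.val P.x) ≠ 0 := by
    intro z hz
    rw [← hev _ _ hz, ← hev _ _ hz, P.hasMap.1, val_eq z hz, val_eq z hz, map_zero]
    exact ⟨rfl, (P.hasMap.2.map (z.evalHom V hz)).ne_zero⟩
  have hinj : ∀ z z' : RatPoint p, z.pt ∈ V → z'.pt ∈ V → (∀ i, z.val (t i) = z'.val (t i)) →
      z.val P.x = z'.val P.x → z = z' := by
    intro z z' hz hz' hzt hzs
    refine RatPoint.ext_of_evalHom hV hz hz' fun a => ?_
    obtain ⟨q, k, hq⟩ := P.exists_mul_aeval_x_g_pow_eq_aeval_x a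
    have e1 : ∀ (w : RatPoint p) (hw : w.pt ∈ V), w.evalHom V hw a *
        (ev P.g (fun i => w.val (t i), w.val P.x)) ^ k = ev q (fun i => w.val (t i), w.val P.x) := by
      intro w hw
      rw [← hev _ _ hw, ← hev _ _ hw, ← hq, val_eq w hw, val_eq w hw, map_mul, map_pow]
    have e2 := e1 z hz
    have e3 := e1 z' hz'
    simp only [hzt, hzs] at e2
    rw [← e3] at e2
    exact mul_right_cancel₀ (pow_ne_zero _ (hzero z' hz').2) e2
  have hcd : ∀ q, ContDiff F ∞ (ev q) := contDiff_polynomial_eval₂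
  have hderiv : ∀ a, ev P.f a = 0 → ev P.g a ≠ 0 → fderiv F (ev P.f) a (0, 1) ≠ 0 := by
    rintro ⟨e, s⟩ hfa hga
    have h1 : HasFDerivAt (ev P.f) (fderiv F (ev P.f) (e, s)) (e, s) :=
      ((hcd P.f).differentiable (by simp) _).hasFDerivAt
    have h2 : HasDerivAt (fun r : F => ((e, r) : (Fin n → F) × F)) (0, 1) s :=
      (hasDerivAt_const s e).prodMk (hasDerivAt_id s)
    have h3 := h1.comp_hasDerivAt s h2
    have h4 : HasDerivAt (fun r : F => ev P.f (e, r)) (ev (Polynomial.derivative P.f) (e, s)) s := by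
      have := (P.f.map (MvPolynomial.eval e)).hasDerivAt s
      rw [Polynomial.derivative_map, Polynomial.eval_map] at this
      refine this.congr_of_eventuallyEq (.of_forall fun r => ?_)
      simp [ev, Polynomial.eval_map]
    rw [h3.unique h4]
    obtain ⟨p₁, p₂, k, hk⟩ := P.cond
    have h5 := congrArg (fun q => ev q (e, s)) hk
    intro h0
    simp only [ev] at h5 h0 hfa hga
    rw [Polynomial.eval₂_add, Polynomial.eval₂_mul, Polynomial.eval₂_mul, Polynomial.eval₂_pow, h0, hfa] at h5
    simp only [zero_mul, add_zero] at h5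
    exact pow_ne_zero k hga h5.symm
  obtain ⟨S, T, φ, hS, hT, hx₀S, hST, hTS, hφ⟩ := exists_implicit_function (hcd P.f) (hcd P.g).continuous
    hderiv (hzero x₀ hxV).1 (hzero x₀ hxV).2
  classical
  have hpt' : ∀ e : Fin n → F, ∃ z : RatPoint p, e ∈ T → z.pt ∈ V ∧
      (fun i => z.val (t i)) = e ∧ z.val P.x = φ e := by
    intro e
    by_cases he : e ∈ T
    · obtain ⟨z, hz⟩ := hpt (e, φ e) (hTS e he).2.1 (hTS e he).2.2
      exact ⟨z, fun _ => hz⟩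
    · exact ⟨x₀, fun h => absurd h he⟩
  choose ζ hζ using hpt'
  have hsm : ∀ e ∈ T, ∀ a : Γ(X, V), ContDiffAt F ∞ (fun e => (ζ e).val a) e := by
    intro e he a
    obtain ⟨q, k, hq⟩ := P.exists_mul_aeval_x_g_pow_eq_aeval_x a
    have e1 : ∀ e' ∈ T, (ζ e').val a = ev q (e', φ e') / (ev P.g (e', φ e')) ^ k := by
      intro e' he'
      obtain ⟨h1, h2, h3⟩ := hζ e' he'
      have h4 := congrArg ((ζ e').evalHom V h1) hq
      rw [map_mul, map_pow, ← val_eq, ← val_eq, ← val_eq, hev _ _ h1, hev _ _ h1, h2, h3] at h4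
      rw [← h4, mul_div_cancel_right₀]
      exact pow_ne_zero _ (hTS e' he').2.2
    have hpair : ContDiffAt F ∞ (fun e => (e, φ e)) e := contDiffAt_id.prodMk (hφ e he)
    have h5 : ContDiffAt F ∞ (fun e' => ev q (e', φ e') / (ev P.g (e', φ e')) ^ k) e :=
      ((hcd q).contDiffAt.comp e hpair).div (((hcd P.g).contDiffAt.comp e hpair).pow k)
        (pow_ne_zero _ (hTS e he).2.2)
    exact h5.congr_of_eventuallyEq ((hT.eventually_mem he).mono fun e' he' => e1 e' he')
  have hζc : ∀ e ∈ T, ContinuousAt ζ e := fun e he =>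
    RatPoint.tendsto_nhds_of_affine hV (hζ e he).1 ((hT.eventually_mem he).mono fun e' he' => (hζ e' he').1)
      fun f => (hsm e he f).continuousAt
  refine ⟨
    { toFun := fun x i => x.val (t i)
      invFun := ζ
      source := {x | x.pt ∈ V ∧ ((fun i => x.val (t i), x.val P.x) : (Fin n → F) × F) ∈ S}
      target := T
      map_source' := fun x hx => (hST _ hx.2 (hzero x hx.1).1).1
      map_target' := ?mt
      left_inv' := ?li
      right_inv' := fun e he => (hζ e he).2.1
      open_source := ?os
      open_target := hT
      continuousOn_toFun := ?ct
      continuousOn_invFun := fun e he => (hζc e he).continuousWithinAt }, ?_, ?_, ?_, ?_⟩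
  case mt =>
    intro e he
    obtain ⟨h1, h2, h3⟩ := hζ e he
    refine ⟨h1, ?_⟩
    rw [h2, h3]
    exact (hTS e he).1
  case li =>
    intro x hx
    have h0 := hST _ hx.2 (hzero x hx.1).1
    obtain ⟨h1, h2, h3⟩ := hζ _ h0.1
    exact hinj _ _ h1 hx.1 (fun i => congrFun h2 i) (h3.trans h0.2)
  case os =>
    rw [isOpen_iff_mem_nhds]
    rintro x ⟨hxV, hxS⟩
    exact inter_mem ((isOpen_setOf_pt_mem V).mem_nhds hxV) (((continuousAt_pi.2 fun i =>
      continuousAt_val (t i) (hVU hxV)).prodMk (continuousAt_val P.x hxV)) (hS.mem_nhds hxS))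
  case ct =>
    exact fun x hx => (continuousAt_pi.2 fun i =>
      continuousAt_val (t i) (hVU hx.1)).continuousWithinAt
  · exact ⟨hxV, hx₀S⟩
  · exact fun x hx => hVU hx.1
  · exact fun x => rfl
  · rintro x ⟨hxV, hxS⟩ W f hxW
    change ContDiffAt F ∞ (fun e => (ζ e).val f) (fun i => x.val (t i))
    have h0 := hST _ hxS (hzero x hxV).1
    have heT : (fun i => x.val (t i)) ∈ T := h0.1
    have hζx : ζ (fun i => x.val (t i)) = x := by
      obtain ⟨h1, h2, h3⟩ := hζ _ heT
      exact hinj _ _ h1 hxV (fun i => congrFun h2 i) (h3.trans h0.2)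
    obtain ⟨b, g, k, hyg, key⟩ := exists_val_eq_div hV hxV hxW f
    have h5 : ContDiffAt F ∞ (fun e' => (ζ e').val b / ((ζ e').val g) ^ k) (fun i => x.val (t i)) :=
      (hsm _ heT b).div ((hsm _ heT g).pow k) (pow_ne_zero _ (by rw [hζx]; exact hyg))
    refine h5.congr_of_eventuallyEq ?_
    have h6 : ∀ᶠ e' in 𝓝 (fun i => x.val (t i)), (ζ e').val g ≠ 0 :=
      (hsm _ heT g).continuousAt.eventually_ne (by rw [hζx]; exact hyg)
    filter_upwards [hT.eventually_mem heT, h6] with e' he' hge'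
    exact (key _ (hζ e' he').1 hge').2

end EtaleChart

/-! ### Étale algebras over polynomial rings -/

section EtaleAlgebra

open TensorProduct KaehlerDifferential

variable {R A : Type*} [CommRing R] [CommRing A] [Algebra R A]

/-- By the Jacobi–Zariski sequence, elements of a standard smooth algebra whose differentials form a
basis are étale coordinates. -/
theorem etale_eval₂Hom_of_basis [Algebra.IsStandardSmooth R A] {n : ℕ} (b : Basis (Fin n) A Ω[A⁄R])
    (t : Fin n → A) (hb : ∀ i, b i = D R A (t i)) :
    (eval₂Hom (algebraMap R A) t).Etale := by
  let S := MvPolynomial (Fin n) R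
  let _ : Algebra S A := (eval₂Hom (algebraMap R A) t).toAlgebra
  have halg : ∀ P : S, algebraMap S A P = eval₂Hom (algebraMap R A) t P := fun P => rfl
  have : IsScalarTower R S A := IsScalarTower.of_algebraMap_eq fun r => by
    rw [halg, algebraMap_eq, coe_eval₂Hom, eval₂_C]
  have hbij : Function.Bijective (mapBaseChange R S A) := by
    let b₁ : Basis (Fin n) A (A ⊗[S] Ω[S⁄R]) := (mvPolynomialBasis R (Fin n)).baseChange A
    have hX : ∀ i, mvPolynomialBasis R (Fin n) i = D R S (MvPolynomial.X i) := fun i => by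
      apply (mvPolynomialBasis R (Fin n)).repr.injective
      rw [mvPolynomialBasis_repr_D_X, Basis.repr_self]
    have h : mapBaseChange R S A = (b₁.equiv b (Equiv.refl _)).toLinearMap := by
      refine b₁.ext fun i => ?_
      simp only [LinearEquiv.coe_coe, Basis.equiv_apply, Equiv.refl_apply, hb]
      rw [Basis.baseChange_apply, hX, mapBaseChange_tmul, map_D, one_smul, halg]
      simp
    rw [h]
    exact (b₁.equiv b (Equiv.refl _)).bijective
  have hΩ : Subsingleton Ω[A⁄S] := by
    refine subsingleton_of_forall_eq 0 fun y => ?_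
    obtain ⟨z, rfl⟩ := KaehlerDifferential.map_surjective R S A y
    obtain ⟨w, rfl⟩ := hbij.2 z
    exact (exact_mapBaseChange_map R S A _).2 ⟨w, rfl⟩
  have hH : Subsingleton (Algebra.H1Cotangent S A) := by
    refine subsingleton_of_forall_eq 0 fun y => ?_
    have hy : Algebra.H1Cotangent.δ R S A y = 0 := hbij.1 <| by
      rw [map_zero]
      exact (Algebra.H1Cotangent.exact_δ_mapBaseChange R S A _).2 ⟨y, rfl⟩
    obtain ⟨z, rfl⟩ := (Algebra.H1Cotangent.exact_map_δ R S A y).1 hy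
    rw [Subsingleton.elim z 0, map_zero]
  have hfe : Algebra.FormallyEtale S A := ⟨hΩ, hH⟩
  have hfp : Algebra.FinitePresentation S A :=
    Algebra.FinitePresentation.of_restrict_scalars_finitePresentation R S A
  exact (⟨hfe, hfp⟩ : Algebra.Etale S A)

/-- Étale coordinates near a point are detected by a Jacobian determinant. -/
theorem etale_eval₂Hom_of_isUnit_det [Algebra.IsStandardSmooth R A] {n : ℕ}
    (b : Basis (Fin n) A Ω[A⁄R]) (t : Fin n → A) {A' : Type*} [CommRing A'] [Algebra A A']
    [Algebra R A'] [IsScalarTower R A A'] (g : A) [IsLocalization.Away g A']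
    (hg : b.det (fun i => D R A (t i)) ∣ g) :
    (eval₂Hom (algebraMap R A') fun i => algebraMap A A' (t i)).Etale := by
  have h1 : Algebra.IsStandardSmooth A A' := (Algebra.IsStandardSmoothOfRelativeDimension.localization_away g).isStandardSmooth 0
  have h2 : Algebra.IsStandardSmooth R A' := Algebra.IsStandardSmooth.trans R A A'
  have h3 : Algebra.FormallyEtale A A' := Algebra.FormallyEtale.of_isLocalization (.powers g)
  let b' : Basis (Fin n) A' Ω[A'⁄R] :=
    (b.baseChange A').map (tensorKaehlerEquivOfFormallyEtale R A A')
  have hrepr : ∀ a i, b'.repr (D R A' (algebraMap A A' a)) i = algebraMap A A' (b.repr (D R A a) i) := by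
    intro a i
    simp only [b', Basis.map_repr, LinearEquiv.trans_apply,
      tensorKaehlerEquivOfFormallyEtale_symm_D_algebraMap, Basis.baseChange_repr_tmul]
    rw [Algebra.smul_def, mul_one]
  have hdet : b'.det (fun i => D R A' (algebraMap A A' (t i))) = algebraMap A A' (b.det fun i => D R A (t i)) := by
    rw [Basis.det_apply, Basis.det_apply, RingHom.map_det]
    congr 1
    ext i j
    simp [Basis.toMatrix_apply, hrepr]
  have hu : IsUnit (b'.det (fun i => D R A' (algebraMap A A' (t i)))) := by
    rw [hdet]
    exact isUnit_of_dvd_unit (map_dvd _ hg) (IsLocalization.Away.algebraMap_isUnit g)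
  obtain ⟨hli, hsp⟩ := (Basis.is_basis_iff_det b').2 hu
  exact etale_eval₂Hom_of_basis (Basis.mk hli hsp.ge) _ fun i => by simp

theorem isReduced_of_etale_of_isDomain (S T : Type*) [CommRing S] [IsDomain S] [CommRing T] [Algebra S T]
    [Algebra.Etale S T] : _root_.IsReduced T := by
  let k := FractionRing S
  have e3 : _root_.IsReduced (k ⊗[S] T) := Algebra.FormallyUnramified.isReduced_of_field k _
  have e5 : Function.Injective (Algebra.TensorProduct.includeRight : T →ₐ[S] k ⊗[S] T) :=
    Algebra.TensorProduct.includeRight_injective (IsFractionRing.injective _ _)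
  exact isReduced_of_injective _ e5

/-- A coordinate of a system of étale coordinates over a field generates a radical ideal: an algebra
étale over a polynomial ring is reduced, since it embeds in an étale algebra over a field. -/
theorem isRadical_span_of_etale {K B : Type*} [Field K] [CommRing B] [Algebra K B] {n : ℕ}
    (t : Fin n → B) (h : (eval₂Hom (algebraMap K B) t).Etale) (j : Fin n) :
    (Ideal.span {t j}).IsRadical := by
  let S := MvPolynomial (Fin n) K
  let _ : Algebra S B := (eval₂Hom (algebraMap K B) t).toAlgebra
  have halg : ∀ P : S, algebraMap S B P = eval₂Hom (algebraMap K B) t P := fun P => rfl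
  have het : Algebra.Etale S B := h
  let P : Ideal S := Ideal.span {MvPolynomial.X j}
  have hP : P.IsPrime := by
    rw [Ideal.span_singleton_prime (X_ne_zero j)]
    exact X_prime
  have hmap : P.map (algebraMap S B) = Ideal.span {t j} := by
    rw [Ideal.map_span, Set.image_singleton, halg]
    simp
  let T := (S ⧸ P) ⊗[S] B
  have e6 : _root_.IsReduced T := isReduced_of_etale_of_isDomain (S ⧸ P) T
  have e7 : _root_.IsReduced (B ⧸ P.map (algebraMap S B)) :=
    isReduced_of_injective (Algebra.TensorProduct.quotIdealMapEquivQuotTensor B P)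
      (AlgEquiv.injective _)
  rw [← hmap]
  exact (Ideal.isRadical_iff_quotient_reduced _).2 e7

/-- Étale coordinates generate the cotangent space at a rational point: two ring morphisms out of an
unramified algebra, which agree modulo an ideal of square zero, are equal. -/
theorem exists_sub_sum_mem_ker_sq {K B : Type*} [Field K] [CommRing B] (s : K →+* B) {n : ℕ}
    (t : Fin n → B) (h : (eval₂Hom s t).Etale) (x : B →+* K) (hx : ∀ a, x (s a) = a) (f : B) :
    ∃ c : Fin n → K, (f - s (x f)) - ∑ j, s (c j) * (t j - s (x (t j))) ∈ RingHom.ker x ^ 2 := by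
  let _ : Algebra (MvPolynomial (Fin n) K) B := (eval₂Hom s t).toAlgebra
  have halg : ∀ P : MvPolynomial (Fin n) K, algebraMap _ B P = eval₂Hom s t P :=
    fun P => rfl
  have het : Algebra.Etale (MvPolynomial (Fin n) K) B := h
  let m := RingHom.ker x
  have hm : ∀ a, a - s (x a) ∈ m := fun a => by simp [m, RingHom.mem_ker, hx]
  let J : Ideal B := Ideal.span (Set.range fun j => t j - s (x (t j))) ⊔ m ^ 2
  let g₁ : B →ₐ[MvPolynomial (Fin n) K] B ⧸ J := Ideal.Quotient.mkₐ _ J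
  let g₂ : B →ₐ[MvPolynomial (Fin n) K] B ⧸ J :=
    { (Ideal.Quotient.mk J).comp (s.comp x) with
      commutes' := fun P => by
        change ((Ideal.Quotient.mk J).comp (s.comp x)) (algebraMap _ B P) =
          Ideal.Quotient.mk J (algebraMap _ B P)
        rw [halg, ← RingHom.comp_apply, ← RingHom.comp_apply]
        congr 1
        refine ringHom_ext (fun a => ?_) fun i => ?_
        · simp [hx]
        · simp only [RingHom.comp_apply, eval₂Hom_X']
          rw [eq_comm, Ideal.Quotient.eq]
          exact Ideal.mem_sup_left (Ideal.subset_span ⟨i, rfl⟩) }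
  have hg : g₁ = g₂ := by
    refine Algebra.FormallyUnramified.lift_unique (m.map (Ideal.Quotient.mk J)) ⟨2, ?_⟩ _ _ ?_
    · rw [← Ideal.map_pow, Ideal.zero_eq_bot, Ideal.map_eq_bot_iff_le_ker, Ideal.mk_ker]
      exact le_sup_right
    · ext a
      refine Ideal.Quotient.eq.2 ?_
      change Ideal.Quotient.mk J a - Ideal.Quotient.mk J (s (x a)) ∈ _
      rw [← map_sub]
      exact Ideal.mem_map_of_mem _ (hm a)
  have hf : f - s (x f) ∈ J := by
    rw [← Ideal.Quotient.eq]
    exact congr($hg f)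
  obtain ⟨a, ha, b, hb, hab⟩ := Submodule.mem_sup.1 hf
  obtain ⟨c, rfl⟩ := (Ideal.mem_span_range_iff_exists_fun).1 ha
  refine ⟨fun j => x (c j), ?_⟩
  rw [← hab, add_sub_right_comm, ← sum_sub_distrib]
  refine Ideal.add_mem _ (Ideal.sum_mem _ fun j _ => ?_) hb
  rw [← sub_mul, pow_two]
  exact Ideal.mul_mem_mul (hm _) (hm _)

/-- If a determinant with rows `R i + ι S i` does not vanish, then one row of each pair can be
chosen such that the resulting determinant does not vanish. -/
theorem exists_det_piecewise_ne_zero {K : Type*} [Field K] {n : ℕ} (R S : Fin n → Fin n → K) (ι : K)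
    (h : (Matrix.of fun i => R i + ι • S i).det ≠ 0) :
    ∃ s : Finset (Fin n), (Matrix.of (s.piecewise R S)).det ≠ 0 := by
  by_contra! hs
  apply h
  change Matrix.detRowAlternating.toMultilinearMap (R + fun i => ι • S i) = 0
  rw [MultilinearMap.map_add_univ]
  refine sum_eq_zero fun s _ => ?_
  have h1 : s.piecewise R (fun i => ι • S i) = sᶜ.piecewise (fun i => ι • s.piecewise R S i) (s.piecewise R S) := by
    ext i
    by_cases hi : i ∈ s <;> simp [hi]
  rw [h1, MultilinearMap.map_piecewise_smul _ (fun _ => ι)]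
  have := hs s
  change Matrix.detRowAlternating.toMultilinearMap (s.piecewise R S) = 0 at this
  rw [this, smul_zero]

end EtaleAlgebra

/-! ### Jacobian matrices and derivatives -/

section Jacobian

variable {K : Type u} [Field K] {X : Scheme.{u}} {p : X ⟶ Spec (of K)}

theorem val_res (x : RatPoint p) {U V : X.Opens} (h : V ≤ U) (hx : x.pt ∈ V) (f : Γ(X, U)) :
    x.val (res h f) = x.val f := by
  rw [val_eq x hx, val_eq x (h hx), evalHom_res]

theorem IsEtaleCoord.exists_sub_sum_mem {n : ℕ} {U : X.Opens} {t : Fin n → Γ(X, U)}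
    (h : IsEtaleCoord p U t) (x : RatPoint p) (hx : x.pt ∈ U) (f : Γ(X, U)) :
    ∃ c : Fin n → K, (f - scalar p U (x.val f)) -
      ∑ j, scalar p U (c j) * (t j - scalar p U (x.val (t j))) ∈
      RingHom.ker (x.evalHom U hx) ^ 2 := by
  simpa only [val_eq x hx] using
    exists_sub_sum_mem_ker_sq (scalar p U) t h.2 (x.evalHom U hx) (evalHom_scalar x hx) f

theorem IsEtaleCoord.exists_isJacobianAt {n : ℕ} {U U' : X.Opens} {t : Fin n → Γ(X, U)}
    {t' : Fin n → Γ(X, U')} (h : IsEtaleCoord p U t) (x : RatPoint p) (hx : x.pt ∈ U)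
    (hx' : x.pt ∈ U') : ∃ J : Matrix (Fin n) (Fin n) K, IsJacobianAt x t t' J := by
  obtain ⟨V, hV, hxV, hVU⟩ : ∃ V : X.Opens, IsAffineOpen V ∧ x.pt ∈ V ∧ V ≤ U ⊓ U' :=
    exists_isAffineOpen_mem_and_subset ⟨hx, hx'⟩
  have hVt := h.restrict hV (hVU.trans inf_le_left)
  choose J hJ using fun i => hVt.exists_sub_sum_mem x hxV (res (hVU.trans inf_le_right) (t' i))
  refine ⟨Matrix.of J, V, hVU.trans inf_le_left, hVU.trans inf_le_right, hxV, fun i => ?_⟩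
  have := hJ i
  simp only [val_res x _ hxV] at this
  exact this

theorem isJacobianAt_res {n : ℕ} {U V : X.Opens} (t : Fin n → Γ(X, U)) (hVU : V ≤ U)
    (x : RatPoint p) (hx : x.pt ∈ V) : IsJacobianAt x t (fun i => res hVU (t i)) 1 := by
  refine ⟨V, hVU, le_rfl, hx, fun i => ?_⟩
  have h1 : res (le_refl V) (res hVU (t i)) = res hVU (t i) := by
    change (X.presheaf.map _) _ = _
    exact congr($(X.presheaf.map_id _) _)
  have h2 : ∀ j, scalar p V ((1 : Matrix (Fin n) (Fin n) K) i j) = if i = j then 1 else 0 := by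
    intro j
    rw [Matrix.one_apply]
    split_ifs <;> simp
  simp only [h2, ite_mul, one_mul, zero_mul, sum_ite_eq, mem_univ, if_true]
  change (res (le_refl V) (res hVU (t i)) - scalar p V (x.val (res hVU (t i)))) -
    (res hVU (t i) - scalar p V (x.val (t i))) ∈ _
  rw [h1, val_eq x hx, val_eq x (hVU hx), evalHom_res]
  simp

end Jacobian

section Derivative

variable {F : Type u} [RCLike F] {X : Scheme.{u}} {p : X ⟶ Spec (of F)}

/-- A function in the square of the maximal ideal of a point has derivative zero there, by the product
rule. This links congruences modulo that square, which define algebraic Jacobians, to derivatives. -/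
theorem hasFDerivAt_zero_of_mem_ker_sq {E : Type*} [NormedAddCommGroup E] [NormedSpace F E]
    {V : X.Opens} {ζ : E → RatPoint p} {e : E} {x : RatPoint p} (hx : ζ e = x) (hV : x.pt ∈ V)
    (hζ : ContinuousAt ζ e) (hd : ∀ f : Γ(X, V), DifferentiableAt F (fun e => (ζ e).val f) e)
    {f : Γ(X, V)} (hf : f ∈ RingHom.ker (x.evalHom V hV) ^ 2) :
    HasFDerivAt (fun e => (ζ e).val f) (0 : E →L[F] F) e := by
  subst hx
  have hev : ∀ᶠ e' in 𝓝 e, (ζ e').pt ∈ V := hζ ((isOpen_setOf_pt_mem V).mem_nhds hV)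
  rw [pow_two] at hf
  refine Submodule.mul_induction_on hf (fun a ha b hb => ?_) (fun a b ha hb => ?_)
  · have h1 := (hd a).hasFDerivAt.mul (hd b).hasFDerivAt
    have ha0 : (ζ e).val a = 0 := by rw [val_eq _ hV]; exact ha
    have hb0 : (ζ e).val b = 0 := by rw [val_eq _ hV]; exact hb
    rw [ha0, hb0, show (0 : F) • fderiv F (fun e => (ζ e).val b) e + (0 : F) • fderiv F (fun e => (ζ e).val a) e = 0 from by
      ext; simp] at h1
    refine h1.congr_of_eventuallyEq (hev.mono fun e' he' => ?_)
    simp [val_eq _ he']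
  · have h1 := ha.add hb
    rw [add_zero] at h1
    refine h1.congr_of_eventuallyEq (hev.mono fun e' he' => ?_)
    simp [val_eq _ he']

/-- The algebraic Jacobian matrix is the matrix of the derivative of the change of coordinates. -/
theorem IsJacobianAt.hasFDerivAt {n : ℕ} {U U' : X.Opens} {t : Fin n → Γ(X, U)}
    {t' : Fin n → Γ(X, U')} {J : Matrix (Fin n) (Fin n) F} {χ : CoordChart p n}
    (hχ : ∀ x, χ x = fun i => x.val (t i))
    (hsm : ∀ x ∈ χ.source, ∀ (V : X.Opens) (f : Γ(X, V)), x.pt ∈ V →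
        ContDiffAt F ∞ (fun e => (χ.symm e).val f) (χ x)) {x : RatPoint p} (hx : x ∈ χ.source)
    (hJ : IsJacobianAt x t t' J) :
    HasFDerivAt (fun e i => (χ.symm e).val (t' i))
      (LinearMap.toContinuousLinearMap (Matrix.toLin' J)) (χ x) := by
  obtain ⟨V, hVU, hVU', hxV, h⟩ := hJ
  refine hasFDerivAt_pi'.2 fun i => ?_
  have hc : ContinuousAt χ.symm (χ x) := χ.continuousAt_symm (χ.map_source hx)
  have hxx : χ.symm (χ x) = x := χ.left_inv hx
  have hev : ∀ᶠ e in 𝓝 (χ x), (χ.symm e).pt ∈ V :=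
    hc ((isOpen_setOf_pt_mem V).mem_nhds (by rwa [Set.mem_ofPred_eq, hxx]))
  have h0 := hasFDerivAt_zero_of_mem_ker_sq hxx hxV hc
    (fun f => (hsm x hx V f hxV).differentiableAt (by simp)) (h i)
  have h1 : HasFDerivAt (fun e : Fin n → F => x.val (t' i) + ∑ j, J i j * (e j - x.val (t j)))
      (∑ j, J i j • ContinuousLinearMap.proj (R := F) (φ := fun _ : Fin n => F) j) (χ x) := by
    refine (HasFDerivAt.fun_sum fun j _ => ?_).const_add _
    exact (((ContinuousLinearMap.proj (R := F) (φ := fun _ : Fin n => F) j).hasFDerivAt).sub_const _).const_mul _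
  have h2 := h0.add h1
  have hL : (0 : (Fin n → F) →L[F] F) + ∑ j, J i j • ContinuousLinearMap.proj
      j = (ContinuousLinearMap.proj i).comp
        (LinearMap.toContinuousLinearMap (Matrix.toLin' J)) := by
    ext v
    simp [Matrix.mulVec, dotProduct]
  rw [hL] at h2
  refine h2.congr_of_eventuallyEq ?_
  filter_upwards [hev, χ.open_target.mem_nhds (χ.map_source hx)] with e he het
  have h3 : ∀ j, e j = (χ.symm e).val (t j) := fun j => by
    exact (congr_fun (χ.right_inv het) j).symm.trans (congr_fun (hχ (χ.symm e)) j)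
  have h4 : ∀ (U : X.Opens) (hV : V ≤ U) (f : Γ(X, U)),
      (χ.symm e).evalHom V he (X.presheaf.map (homOfLE hV).op f) = (χ.symm e).val f :=
    fun U hV f => by
      rw [val_eq _ (hV he)]
      exact evalHom_res _ hV he f
  simp only [Pi.add_apply]
  rw [val_eq _ he]
  simp only [map_sub, map_sum, map_mul, evalHom_scalar, h4, h3]
  ring

end Derivative

/-! ### Descent of coordinates along a conjugation -/

section Conjugation

/-- The structure on `B = A ⊗ K` given by the real and the imaginary part and by the complex
conjugation, where `K` is an algebraic closure of `F = ℝ` or `F = ℂ` and `A` is an `F`-algebra. If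
`F = ℝ`, then `B = A ⊕ ι A` with `ι ^ 2 = -1`; if `F = ℂ`, then `A = B`, and `ι = 0`, `im = 0`. -/
structure Conjugation (A B : Type*) [CommRing A] [CommRing B] [Algebra A B] where
  re : B →ₗ[A] A
  im : B →ₗ[A] A
  conj : B →+* B
  ι : B
  half : B
  half_add : half + half = 1
  eq_add : ∀ b, b = algebraMap A B (re b) + ι * algebraMap A B (im b)
  re_one : re 1 = 1
  im_one : im 1 = 0
  re_conj : ∀ b, re (conj b) = re b
  im_conj : ∀ b, im (conj b) = -im b
  re_ι : re ι = 0
  im_ι : ∀ b, im ι * im b = im b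
  ι_mul : ∀ b, ι * (ι * algebraMap A B (im b)) = -algebraMap A B (im b)

namespace Conjugation

variable {A B : Type*} [CommRing A] [CommRing B] [Algebra A B] (Q : Conjugation A B)

theorem re_algebraMap (a : A) : Q.re (algebraMap A B a) = a := by
  rw [Algebra.algebraMap_eq_smul_one, map_smul, Q.re_one, smul_eq_mul, mul_one]

theorem im_algebraMap (a : A) : Q.im (algebraMap A B a) = 0 := by
  rw [Algebra.algebraMap_eq_smul_one, map_smul, Q.im_one, smul_zero]

theorem conj_eq (b : B) :
    Q.conj b = algebraMap A B (Q.re b) - Q.ι * algebraMap A B (Q.im b) := by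
  rw [Q.eq_add (Q.conj b), Q.re_conj, Q.im_conj, map_neg, mul_neg, sub_eq_add_neg]

theorem conj_ι : Q.conj Q.ι = -Q.ι := by
  have := Q.eq_add Q.ι
  rw [Q.re_ι, map_zero, zero_add] at this
  rw [Q.conj_eq, Q.re_ι, map_zero, zero_sub, ← this]

theorem mul_eq (b c : B) : b * c = algebraMap A B (Q.re b * Q.re c - Q.im b * Q.im c) +
    algebraMap A B (Q.re b * Q.im c + Q.im b * Q.re c) * Q.ι := by
  conv_lhs => rw [Q.eq_add b, Q.eq_add c]
  simp only [map_sub, map_add, map_mul]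
  linear_combination algebraMap A B (Q.im c) * Q.ι_mul b

theorem re_mul (b c : B) : Q.re (b * c) = Q.re b * Q.re c - Q.im b * Q.im c := by
  rw [Q.mul_eq, map_add, Q.re_algebraMap, ← Algebra.smul_def, map_smul, Q.re_ι, smul_zero, add_zero]

theorem im_mul (b c : B) : Q.im (b * c) = Q.re b * Q.im c + Q.im b * Q.re c := by
  rw [Q.mul_eq, map_add, Q.im_algebraMap, ← Algebra.smul_def, map_smul, smul_eq_mul]
  linear_combination Q.re b * Q.im_ι c + Q.re c * Q.im_ι b

theorem re_eq (b : B) : algebraMap A B (Q.re b) = Q.half * (b + Q.conj b) := by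
  rw [Q.conj_eq]
  linear_combination (-Q.half) * Q.eq_add b - algebraMap A B (Q.re b) * Q.half_add

theorem im_eq (b : B) : algebraMap A B (Q.im b) = -(Q.half * Q.ι) * (b - Q.conj b) := by
  rw [Q.conj_eq]
  linear_combination Q.half * Q.ι * Q.eq_add b + 2 * Q.half * Q.ι_mul b -
    algebraMap A B (Q.im b) * Q.half_add

theorem conj_conj (b : B) : Q.conj (Q.conj b) = b := by
  rw [Q.conj_eq, Q.re_conj, Q.im_conj, map_neg]
  conv_rhs => rw [Q.eq_add b]
  ring

theorem conj_algebraMap (a : A) : Q.conj (algebraMap A B a) = algebraMap A B a := by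
  rw [Q.conj_eq, Q.re_algebraMap, Q.im_algebraMap, map_zero, mul_zero, sub_zero]

theorem mul_conj (b : B) : b * Q.conj b = algebraMap A B (Q.re b ^ 2 + Q.im b ^ 2) := by
  have h := Q.ι_mul b
  rw [Q.conj_eq]
  have h2 := Q.eq_add b
  rw [map_add, map_pow, map_pow]
  generalize algebraMap A B (Q.re b) = r at *
  generalize algebraMap A B (Q.im b) = i at *
  rw [h2]
  linear_combination (-i) * h

theorem algebraMap_dvd (Q : Conjugation A B) {a f : A} (h : ∃ b, algebraMap A B f = b * algebraMap A B a) : a ∣ f := by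
  obtain ⟨b, hb⟩ := h
  refine ⟨Q.re b, ?_⟩
  rw [← Q.re_algebraMap f, hb, mul_comm b, ← Algebra.smul_def, map_smul, smul_eq_mul]

end Conjugation

/-- The data attached to a rational point `x` of `Spec A`: the point `x'` of `Spec B` above it, and
the differential `δ` at `x`, with values in `F ^ n`. -/
structure PointData {F K A B : Type*} [Field F] [Field K] [Algebra F K] [CommRing A] [CommRing B]
    [Algebra A B] (Q : Conjugation A B) (s : K →+* B) (n : ℕ) where
  x : A →+* F
  x' : B →+* K
  x'_algebraMap : ∀ a, x' (algebraMap A B a) = algebraMap F K (x a)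
  x'_s : ∀ k, x' (s k) = k
  x'_conj : ∀ b, x' (Q.conj b) = 0 ↔ x' b = 0
  δ : A →+ (Fin n → F)
  leibniz : ∀ a b, δ (a * b) = x a • δ b + x b • δ a
  δ_re : ∀ k, δ (Q.re (s k)) = 0
  δ_im : ∀ k, δ (Q.im (s k)) = 0

namespace PointData

variable {F K A B : Type*} [Field F] [Field K] [Algebra F K] [CommRing A] [CommRing B] [Algebra A B]
    {Q : Conjugation A B} {s : K →+* B} {n : ℕ} (d : PointData (F := F) Q s n)

/-- The differential of a function on `Spec B` at the point above `x`. -/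
def δ' (b : B) : Fin n → K := fun l =>
  algebraMap F K (d.δ (Q.re b) l) + d.x' Q.ι * algebraMap F K (d.δ (Q.im b) l)

theorem δ'_add (b c : B) : d.δ' (b + c) = d.δ' b + d.δ' c := by
  ext l
  simp only [δ', map_add, Pi.add_apply]
  ring

theorem δ'_zero : d.δ' 0 = 0 := by
  ext l
  simp [δ']

theorem δ'_sub (b c : B) : d.δ' (b - c) = d.δ' b - d.δ' c := by
  ext l
  simp only [δ', map_sub, Pi.sub_apply]
  ring

theorem δ'_sum {ι : Type*} (S : Finset ι) (f : ι → B) :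
    d.δ' (∑ i ∈ S, f i) = ∑ i ∈ S, d.δ' (f i) :=
  map_sum (⟨⟨d.δ', d.δ'_zero⟩, d.δ'_add⟩ : B →+ (Fin n → K)) f S

theorem δ'_s (k : K) : d.δ' (s k) = 0 := by
  ext l
  simp [δ', d.δ_re, d.δ_im]

theorem δ'_algebraMap (a : A) (l : Fin n) :
    d.δ' (algebraMap A B a) l = algebraMap F K (d.δ a l) := by
  simp [δ', Q.re_algebraMap, Q.im_algebraMap]

theorem δ'_mul (b c : B) : d.δ' (b * c) = d.x' b • d.δ' c + d.x' c • d.δ' b := by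
  have h (b : B) : d.x' Q.ι * (d.x' Q.ι * algebraMap F K (d.x (Q.im b))) =
      -algebraMap F K (d.x (Q.im b)) := by
    rw [← d.x'_algebraMap, ← map_mul, ← map_mul, Q.ι_mul, map_neg]
  have e (b : B) : d.x' b = algebraMap F K (d.x (Q.re b)) +
      d.x' Q.ι * algebraMap F K (d.x (Q.im b)) := by
    conv_lhs => rw [Q.eq_add b]
    rw [map_add, map_mul, d.x'_algebraMap, d.x'_algebraMap]
  ext l
  simp only [δ', Q.re_mul, Q.im_mul, map_add, map_sub, d.leibniz, Pi.add_apply, Pi.sub_apply,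
    Pi.smul_apply, smul_eq_mul, map_mul, e b, e c]
  linear_combination (-algebraMap F K (d.δ (Q.im c) l)) * h b -
    algebraMap F K (d.δ (Q.im b) l) * h c

theorem δ'_mul_of_eq_zero (b c : B) (hc : d.x' c = 0) : d.δ' (b * c) = d.x' b • d.δ' c := by
  rw [δ'_mul, hc, zero_smul, add_zero]

/-- By the congruences for étale coordinates, differentials of functions on `Spec A` which form a basis
are combinations of those of the coordinates `t`, so the latter form a basis as well. -/
theorem det_δ'_ne_zero (t : Fin n → B) (h : (eval₂Hom s t).Etale) (a : Fin n → A)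
    (ha : (Matrix.of fun i => d.δ (a i)).det ≠ 0) :
    (Matrix.of fun i => d.δ' (t i)).det ≠ 0 := by
  choose c hc using fun i => exists_sub_sum_mem_ker_sq s t h d.x' d.x'_s (algebraMap A B (a i))
  have hsq : ∀ b ∈ RingHom.ker d.x' ^ 2, d.δ' b = 0 := by
    intro b hb
    rw [pow_two] at hb
    refine Submodule.mul_induction_on hb (fun u hu v hv => ?_) fun u v hu hv => ?_
    · rw [δ'_mul_of_eq_zero _ _ _ hv, (RingHom.mem_ker).1 hu, zero_smul]
    · rw [δ'_add, hu, hv, add_zero]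
  have h1 : ∀ i, d.δ' (algebraMap A B (a i)) = ∑ j, c i j • d.δ' (t j) := by
    intro i
    have := hsq _ (hc i)
    rw [δ'_sub, δ'_sub, δ'_s, sub_zero, δ'_sum, sub_eq_zero] at this
    rw [this]
    refine sum_congr rfl fun j _ => ?_
    rw [δ'_mul_of_eq_zero _ _ _ (by simp [d.x'_s]), δ'_sub, δ'_s, sub_zero, d.x'_s]
  have h2 : (algebraMap F K).mapMatrix (Matrix.of fun i => d.δ (a i)) =
      Matrix.of c * Matrix.of fun i => d.δ' (t i) := by
    ext i l
    simp only [RingHom.mapMatrix_apply, Matrix.map_apply, Matrix.of_apply, Matrix.mul_apply]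
    rw [← d.δ'_algebraMap, h1]
    simp
  intro h0
  apply ha
  apply (algebraMap F K).injective
  rw [RingHom.map_det, h2, Matrix.det_mul, h0, mul_zero, map_zero]

end PointData

theorem ne_smul_of_linearIndependent {K V ι : Type*} [Field K] [AddCommGroup V] [Module K V]
    {v : ι → V} (h : LinearIndependent K v) {i k : ι} (hik : i ≠ k) (c : K) : v k ≠ c • v i := by
  classical
  intro hc
  have := linearIndependent_iff'.1 h {i, k} (fun m => if m = i then c else -1)
    (by rw [sum_pair hik]; simp [hik.symm, hc]) k (by simp)
  simp [hik.symm] at this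

/-- Given étale coordinates over the algebraic closure such that each of the primes `pp P` lies under
the prime generated by one of them, there are elements of `A` with independent differentials which
are adapted to these primes: take real or imaginary parts of the given coordinates, after having
replaced the coordinate of a divisor by the conjugate of the coordinate of the conjugate divisor. -/
theorem exists_adapted_of_conjugation {F K A B : Type*} [Field F] [Field K] [Algebra F K] [CommRing A]
    [CommRing B] [Algebra A B] {Q : Conjugation A B} {s : K →+* B} {n : ℕ}
    (d : PointData (F := F) Q s n) (a : Fin n → A) (ha : (Matrix.of fun i => d.δ (a i)).det ≠ 0)
    (t : Fin n → B) (h : (eval₂Hom s t).Etale)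
    {ι₀ : Type*} (pp : ι₀ → Ideal A) (hpp : Function.Injective pp)
    (hx : ∀ P, ∀ f ∈ pp P, d.x f = 0) (j j' : ι₀ → Fin n)
    (hprime : ∀ P, (Ideal.span {t (j P)}).IsPrime)
    (hcomap : ∀ P, (Ideal.span {t (j P)}).comap (algebraMap A B) = pp P)
    (hconj : ∀ P, (Ideal.span {t (j P)}).comap Q.conj = Ideal.span {t (j' P)}) :
    ∃ (v : Fin n → A) (e : ι₀ → Finset (Fin n)) (u : ι₀ → A),
      (Matrix.of fun i => d.δ (v i)).det ≠ 0 ∧ Pairwise (fun P P' => Disjoint (e P) (e P')) ∧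
      ∀ P, ((∃ i, e P = {i} ∧ u P = v i) ∨ (Q.conj ≠ RingHom.id B ∧ ∃ i k, i ≠ k ∧
        e P = {i, k} ∧ u P = v i ^ 2 + v k ^ 2)) ∧ u P ∈ pp P ∧
        ∃ g, d.x g ≠ 0 ∧ ∀ f ∈ pp P, u P ∣ g * f := by
  classical
  have hdet := d.det_δ'_ne_zero t h a ha
  have hli : LinearIndependent K fun i => d.δ' (t i) :=
    Matrix.linearIndependent_rows_of_det_ne_zero hdet
  have hmem : ∀ P f, algebraMap A B f ∈ Ideal.span {t (j P)} ↔ f ∈ pp P := fun P f => by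
    rw [← hcomap P, Ideal.mem_comap]
  have hcmem : ∀ P b, Q.conj b ∈ Ideal.span {t (j P)} ↔ b ∈ Ideal.span {t (j' P)} := fun P b => by
    rw [← hconj P, Ideal.mem_comap]
  have hcomap' : ∀ P, (Ideal.span {t (j' P)}).comap (algebraMap A B) = pp P := fun P => by
    ext f
    rw [← hmem, Ideal.mem_comap, ← hcmem, Q.conj_algebraMap]
  have hxt : ∀ P, d.x' (t (j P)) = 0 := by
    intro P
    have h1 : Q.re (t (j P)) ^ 2 + Q.im (t (j P)) ^ 2 ∈ pp P := by
      rw [← hmem, ← Q.mul_conj]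
      exact Ideal.mul_mem_right _ _ (Ideal.mem_span_singleton_self _)
    have h2 := d.x'_algebraMap (Q.re (t (j P)) ^ 2 + Q.im (t (j P)) ^ 2)
    rw [hx P _ h1, map_zero, ← Q.mul_conj, map_mul, mul_eq_zero, d.x'_conj, or_self] at h2
    exact h2
  have hxt' : ∀ P, d.x' (t (j' P)) = 0 := by
    intro P
    rw [← d.x'_conj]
    obtain ⟨b, hb⟩ := Ideal.mem_span_singleton.1 ((hcmem P _).2 (Ideal.mem_span_singleton_self _))
    rw [hb, map_mul, hxt, zero_mul]
  have hjj : ∀ P P', j P = j P' → P = P' := fun P P' hP => hpp (by rw [← hcomap, ← hcomap, hP])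
  have hjj' : ∀ P P', j' P = j P' → P = P' := fun P P' hP => hpp (by rw [← hcomap', ← hcomap, hP])
  have hj'j' : ∀ P P', j' P = j' P' → P = P' := fun P P' hP => hpp (by rw [← hcomap', ← hcomap', hP])
  let w : Fin n → B := fun i =>
    if hi : ∃ P, j' P ≠ j P ∧ j' P = i then Q.conj (t (j hi.choose)) else t i
  have hw1 : ∀ P, w (j P) = t (j P) := by
    intro P
    refine dif_neg ?_
    rintro ⟨P', h1, h2⟩
    obtain rfl := hjj' P' P h2
    exact h1 h2
  have hw2 : ∀ P, j' P ≠ j P → w (j' P) = Q.conj (t (j P)) := by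
    intro P hP
    have hi : ∃ P', j' P' ≠ j P' ∧ j' P' = j' P := ⟨P, hP, rfl⟩
    have : w (j' P) = Q.conj (t (j hi.choose)) := dif_pos hi
    rw [this, hj'j' _ _ hi.choose_spec.2]
  have hwδ : ∀ i, ∃ c : K, c ≠ 0 ∧ d.δ' (w i) = c • d.δ' (t i) := by
    intro i
    by_cases hi : ∃ P, j' P ≠ j P ∧ j' P = i
    · obtain ⟨P, hP, rfl⟩ := hi
      rw [hw2 P hP]
      obtain ⟨b, hb⟩ := Ideal.mem_span_singleton.1 ((hcmem P _).2 (Ideal.mem_span_singleton_self _))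
      have h1 : t (j' P) = Q.conj b * Q.conj (t (j P)) := by
        rw [← map_mul, mul_comm, ← hb, Q.conj_conj]
      have h2 := d.δ'_mul_of_eq_zero (Q.conj b) (Q.conj (t (j P))) ((d.x'_conj _).2 (hxt P))
      rw [← h1] at h2
      have h3 : d.x' (Q.conj b) ≠ 0 := fun h0 => by
        rw [h0, zero_smul] at h2
        exact hli.ne_zero (j' P) h2
      exact ⟨(d.x' (Q.conj b))⁻¹, inv_ne_zero h3, by rw [h2, inv_smul_smul₀ h3]⟩
    · have : w i = t i := dif_neg hi
      exact ⟨1, one_ne_zero, by rw [this, one_smul]⟩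
  have hwdet : (Matrix.of fun i => (fun l => algebraMap F K (d.δ (Q.re (w i)) l)) +
      d.x' Q.ι • (fun l => algebraMap F K (d.δ (Q.im (w i)) l))).det ≠ 0 := by
    choose c hc0 hc using hwδ
    have : (Matrix.of fun i => (fun l => algebraMap F K (d.δ (Q.re (w i)) l)) +
      d.x' Q.ι • (fun l => algebraMap F K (d.δ (Q.im (w i)) l))) =
      Matrix.of fun i l => c i * (Matrix.of fun i => d.δ' (t i)) i l := by
      ext i l
      exact congr_fun (hc i) l
    rw [this, Matrix.det_mul_column]
    exact mul_ne_zero (prod_ne_zero_iff.2 fun i _ => hc0 i) hdet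
  obtain ⟨S, hS⟩ := exists_det_piecewise_ne_zero _ _ _ hwdet
  let v : Fin n → A := fun i => if i ∈ S then Q.re (w i) else Q.im (w i)
  have hvdet : (Matrix.of fun i => d.δ (v i)).det ≠ 0 := by
    intro h0
    apply hS
    rw [← map_zero (algebraMap F K), ← h0, RingHom.map_det]
    congr 1
    ext i l
    by_cases hi : i ∈ S <;> simp [v, hi]
  have hvli : LinearIndependent F fun i => d.δ (v i) :=
    Matrix.linearIndependent_rows_of_det_ne_zero hvdet
  refine ⟨v, fun P => {j P, j' P}, fun P => if j' P = j P then v (j P) else v (j P) ^ 2 + v (j' P) ^ 2,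
    hvdet, ?_, ?_⟩
  · intro P P' hPP
    simp only [disjoint_left, mem_insert, mem_singleton]
    rintro i (rfl | rfl) (h1 | h1)
    · exact hPP (hjj _ _ h1)
    · exact hPP (hjj' _ _ h1.symm).symm
    · exact hPP (hjj' _ _ h1)
    · exact hPP (hj'j' _ _ h1)
  intro P
  by_cases hP : j' P = j P
  · -- the divisor is geometrically irreducible, and its equation is a multiple of a conjugate
    -- invariant one
    obtain ⟨b, hb⟩ : ∃ b, algebraMap A B (v (j P)) = b * t (j P) := by
      have h1 : Q.conj (t (j P)) ∈ Ideal.span {t (j P)} := by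
        rw [hcmem, hP]
        exact Ideal.mem_span_singleton_self _
      obtain ⟨c, hc⟩ := Ideal.mem_span_singleton.1 h1
      by_cases hi : j P ∈ S
      · refine ⟨Q.half * (1 + c), ?_⟩
        simp only [v, hi, if_true, hw1, Q.re_eq, hc]
        ring
      · refine ⟨-(Q.half * Q.ι) * (1 - c), ?_⟩
        simp only [v, hi, if_false, hw1, Q.im_eq, hc]
        ring
    have hb0 : d.x' b ≠ 0 := by
      intro h0
      have h1 := d.δ'_mul_of_eq_zero b _ (hxt P)
      rw [h0, zero_smul, ← hb] at h1
      refine hvli.ne_zero (j P) (funext fun l => ?_)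
      have := congr_fun h1 l
      rw [d.δ'_algebraMap] at this
      simpa using this
    simp only [hP, if_true]
    refine ⟨Or.inl ⟨j P, by simp, rfl⟩, ?_, Q.re b ^ 2 + Q.im b ^ 2, ?_, ?_⟩
    · rw [← hmem, hb]
      exact Ideal.mul_mem_left _ _ (Ideal.mem_span_singleton_self _)
    · intro h0
      have h1 := d.x'_algebraMap (Q.re b ^ 2 + Q.im b ^ 2)
      rw [h0, map_zero, ← Q.mul_conj, map_mul, mul_eq_zero, d.x'_conj, or_self] at h1
      exact hb0 h1
    · intro f hf
      rw [← hmem] at hf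
      obtain ⟨r, hr⟩ := Ideal.mem_span_singleton.1 hf
      refine Q.algebraMap_dvd ⟨Q.conj b * r, ?_⟩
      rw [map_mul, ← Q.mul_conj, hr, hb]
      ring
  · -- the divisor splits into two conjugate ones
    have hne : j P ≠ j' P := fun h => hP h.symm
    have hre : Q.re (w (j' P)) = Q.re (w (j P)) := by rw [hw2 P hP, hw1, Q.re_conj]
    have him : Q.im (w (j' P)) = -Q.im (w (j P)) := by rw [hw2 P hP, hw1, Q.im_conj]
    have hpair : ∀ c : F, d.δ (v (j' P)) ≠ c • d.δ (v (j P)) := by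
      intro c
      exact ne_smul_of_linearIndependent hvli hne c
    have htj : t (j P) ∉ Ideal.span {t (j' P)} := by
      intro h0
      obtain ⟨c, hc⟩ := Ideal.mem_span_singleton.1 h0
      have h1 := d.δ'_mul_of_eq_zero c _ (hxt' P)
      rw [mul_comm, ← hc] at h1
      exact ne_smul_of_linearIndependent hli (Ne.symm hne) _ h1
    have hu : v (j P) ^ 2 + v (j' P) ^ 2 = Q.re (t (j P)) ^ 2 + Q.im (t (j P)) ^ 2 := by
      by_cases h1 : j P ∈ S <;> by_cases h2 : j' P ∈ S
      · exact absurd (by simp [v, h1, h2, hre]) (hpair 1)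
      · simp only [v, h1, h2, if_true, if_false, him, hw1]
        ring
      · simp only [v, h1, h2, if_true, if_false, hre, hw1]
        ring
      · exact absurd (by simp [v, h1, h2, him]) (hpair (-1))
    simp only [hP, if_false]
    refine ⟨Or.inr ⟨fun hid => htj ?_, j P, j' P, hne, rfl, rfl⟩, ?_, 1, by simp, ?_⟩
    · rw [← hconj P, Ideal.mem_comap, hid]
      exact Ideal.mem_span_singleton_self _
    · rw [← hmem, hu, ← Q.mul_conj]
      exact Ideal.mul_mem_right _ _ (Ideal.mem_span_singleton_self _)
    · intro f hf
      rw [one_mul]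
      have hf1 := hf
      rw [← hmem] at hf
      obtain ⟨r, hr⟩ := Ideal.mem_span_singleton.1 hf
      have hp' : (Ideal.span {t (j' P)}).IsPrime := by
        rw [← hconj P]
        have := hprime P
        infer_instance
      have hr' : t (j P) * r ∈ Ideal.span {t (j' P)} := by
        rw [← hr]
        rw [← hcomap' P] at hf1
        exact hf1
      have hr2 : r ∈ Ideal.span {t (j' P)} := by
        exact (hp'.mem_or_mem hr').resolve_left htj
      rw [← hcmem] at hr2
      obtain ⟨r', hr3⟩ := Ideal.mem_span_singleton.1 hr2
      refine Q.algebraMap_dvd ⟨Q.conj r', ?_⟩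
      rw [hu, ← Q.mul_conj, hr, ← Q.conj_conj r, hr3, map_mul]
      ring

end Conjugation

section BaseChange

open TensorProduct

namespace Conjugation

/-- Transport of a conjugation along an isomorphism. -/
def ofEquiv {A B B' : Type*} [CommRing A] [CommRing B] [CommRing B'] [Algebra A B] [Algebra A B']
    (Q : Conjugation A B) (e : B ≃ₐ[A] B') : Conjugation A B' where
  re := Q.re ∘ₗ e.symm.toLinearMap
  im := Q.im ∘ₗ e.symm.toLinearMap
  conj := (e : B →+* B').comp (Q.conj.comp (e.symm : B' →+* B))
  ι := e Q.ι
  half := e Q.half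
  eq_add b := by
    apply e.symm.injective
    simpa using Q.eq_add (e.symm b)
  half_add := by rw [← map_add, Q.half_add, map_one]
  re_one := by simp [Q.re_one]
  im_one := by simp [Q.im_one]
  re_conj b := by simp [Q.re_conj]
  im_conj b := by simp [Q.im_conj]
  re_ι := by simp [Q.re_ι]
  im_ι b := by simp [Q.im_ι]
  ι_mul b := by
    apply e.symm.injective
    simpa using Q.ι_mul (e.symm b)

/-- The conjugation as an algebra morphism. -/
def conjAlgHom {F K : Type*} [CommRing F] [CommRing K] [Algebra F K] (Q : Conjugation F K) :
    K →ₐ[F] K :=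
  { Q.conj with commutes' := Q.conj_algebraMap }

/-- Base change of a conjugation. -/
def baseChange {F K : Type*} [CommRing F] [CommRing K] [Algebra F K] (Q : Conjugation F K)
    (A : Type*) [CommRing A] [Algebra F A] : Conjugation A (A ⊗[F] K) :=
  have hre : ∀ a k, ((AlgebraTensorModule.rid F A A).toLinearMap ∘ₗ Q.re.baseChange A) (a ⊗ₜ k) =
    Q.re k • a := fun a k => by simp
  have him : ∀ a k, ((AlgebraTensorModule.rid F A A).toLinearMap ∘ₗ Q.im.baseChange A) (a ⊗ₜ k) =
    Q.im k • a := fun a k => by simp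
  have hconj : ∀ a k, ((Algebra.TensorProduct.map (AlgHom.id A A) Q.conjAlgHom : A ⊗[F] K →+* A ⊗[F] K)) (a ⊗ₜ k) =
    a ⊗ₜ Q.conj k := fun a k => by simp [conjAlgHom]
  have hmap : ∀ (r : F) (a : A), algebraMap A (A ⊗[F] K) (r • a) = a ⊗ₜ algebraMap F K r := fun r a => by
    rw [Algebra.TensorProduct.algebraMap_apply, Algebra.algebraMap_self_apply, smul_tmul,
      Algebra.algebraMap_eq_smul_one]
  { re := (AlgebraTensorModule.rid F A A).toLinearMap ∘ₗ Q.re.baseChange A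
    im := (AlgebraTensorModule.rid F A A).toLinearMap ∘ₗ Q.im.baseChange A
    conj := (Algebra.TensorProduct.map (AlgHom.id A A) Q.conjAlgHom : A ⊗[F] K →+* A ⊗[F] K)
    ι := 1 ⊗ₜ Q.ι
    half := 1 ⊗ₜ Q.half
    eq_add := fun b => by
      induction b with
      | zero => simp
      | add x y hx hy =>
        rw [map_add, map_add, map_add, map_add]
        nth_rewrite 1 [hx, hy]
        ring
      | tmul a k =>
        rw [hre, him, hmap, hmap, Algebra.TensorProduct.tmul_mul_tmul, one_mul, ← tmul_add,
          ← Q.eq_add]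
    half_add := by rw [← tmul_add, Q.half_add, Algebra.TensorProduct.one_def]
    re_one := by rw [Algebra.TensorProduct.one_def, hre, Q.re_one, one_smul]
    im_one := by rw [Algebra.TensorProduct.one_def, him, Q.im_one, zero_smul]
    re_conj := fun b => by
      induction b with
      | zero => simp
      | add x y hx hy => rw [map_add, map_add, map_add, hx, hy]
      | tmul a k => rw [hconj, hre, hre, Q.re_conj]
    im_conj := fun b => by
      induction b with
      | zero => simp
      | add x y hx hy => rw [map_add, map_add, map_add, hx, hy, neg_add]
      | tmul a k => rw [hconj, him, him, Q.im_conj, neg_smul]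
    re_ι := by rw [hre, Q.re_ι, zero_smul]
    im_ι := fun b => by
      induction b with
      | zero => simp
      | add x y hx hy => rw [map_add, mul_add, hx, hy]
      | tmul a k => rw [him, him, smul_mul_smul_comm, Q.im_ι, one_mul]
    ι_mul := fun b => by
      induction b with
      | zero => simp
      | add x y hx hy => rw [map_add, map_add, mul_add, mul_add, hx, hy, neg_add]
      | tmul a k =>
        rw [him, hmap, Algebra.TensorProduct.tmul_mul_tmul, Algebra.TensorProduct.tmul_mul_tmul,
          Q.ι_mul, tmul_neg, one_mul, one_mul] }

theorem baseChange_re {F K : Type*} [CommRing F] [CommRing K] [Algebra F K] (Q : Conjugation F K)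
    (A : Type*) [CommRing A] [Algebra F A] (a : A) (k : K) :
    (Q.baseChange A).re (a ⊗ₜ k) = Q.re k • a := by
  simp [baseChange]

theorem baseChange_im {F K : Type*} [CommRing F] [CommRing K] [Algebra F K] (Q : Conjugation F K)
    (A : Type*) [CommRing A] [Algebra F A] (a : A) (k : K) :
    (Q.baseChange A).im (a ⊗ₜ k) = Q.im k • a := by
  simp [baseChange]

theorem baseChange_conj {F K : Type*} [CommRing F] [CommRing K] [Algebra F K] (Q : Conjugation F K)
    (hQ : Q.conj = RingHom.id K) (A : Type*) [CommRing A] [Algebra F A] :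
    (Q.baseChange A).conj = RingHom.id _ := by
  have h : Q.conjAlgHom = AlgHom.id F K := AlgHom.ext fun k => congr($hQ k)
  simp only [baseChange, h]
  rw [Algebra.TensorProduct.map_id]
  rfl

end Conjugation

/-- The algebraic closure is `ℂ` if `F = ℝ`, and `F` with the trivial conjugation if `F = ℂ`. -/
theorem exists_conjugation (F : Type u) [RCLike F] :
    ∃ Q : Conjugation F (AlgebraicClosure F),
      Q.conj ≠ RingHom.id _ → (RCLike.I : F) = 0 := by
  rcases RCLike.I_eq_zero_or_im_I_eq_one (K := F) with hI | hI
  · let e : F ≃+* ℝ := RCLike.realRingEquiv hI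
    let _ : Algebra F ℂ := (Complex.ofRealHom.comp e.toRingHom).toAlgebra
    have hm : ∀ r, algebraMap F ℂ r = (e r : ℂ) := fun r => rfl
    have halg : Algebra.IsAlgebraic F ℂ := by
      refine ⟨fun z => IsIntegral.isAlgebraic ?_⟩
      refine ⟨Polynomial.X ^ 2 - Polynomial.C (e.symm (2 * z.re)) * Polynomial.X +
        Polynomial.C (e.symm (z.re ^ 2 + z.im ^ 2)), by monicity!, ?_⟩
      simp only [Polynomial.eval₂_add, Polynomial.eval₂_sub, Polynomial.eval₂_mul, Polynomial.eval₂_C,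
        Polynomial.eval₂_pow, Polynomial.eval₂_X, hm, RingEquiv.apply_symm_apply]
      apply Complex.ext <;> simp [pow_two] <;> ring
    have hcl : IsAlgClosure F ℂ := ⟨inferInstance, halg⟩
    let f : ℂ ≃ₐ[F] AlgebraicClosure F := IsAlgClosure.equiv F ℂ (AlgebraicClosure F)
    have hsm : ∀ (r : F) (z : ℂ), r • z = (e r : ℂ) * z := fun r z => by rw [Algebra.smul_def, hm]
    let Q : Conjugation F ℂ :=
      { re := { toFun := fun z => e.symm z.re
                map_add' := by simp
                map_smul' := by simp [hsm] }
        im := { toFun := fun z => e.symm z.im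
                map_add' := by simp
                map_smul' := by simp [hsm] }
        conj := starRingEnd ℂ
        ι := Complex.I
        half := 1 / 2
        half_add := by norm_num
        eq_add := fun z => by
          simp only [LinearMap.coe_mk, AddHom.coe_mk, hm, RingEquiv.apply_symm_apply]
          apply Complex.ext <;> simp
        re_one := by simp
        im_one := by simp
        re_conj := by simp
        im_conj := by simp
        re_ι := by simp
        im_ι := by simp
        ι_mul := fun z => by rw [← mul_assoc, Complex.I_mul_I, neg_one_mul] }
    exact ⟨Q.ofEquiv f, fun _ => hI⟩
  · have : IsAlgClosed F := by
      let e : F ≃+* ℂ := RCLike.complexRingEquiv hI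
      refine IsAlgClosed.of_exists_root F fun p _ hp => ?_
      obtain ⟨z, hz⟩ := IsAlgClosed.exists_root (p.map (e : F →+* ℂ))
        (by rw [Polynomial.degree_map]; exact (Polynomial.degree_pos_of_irreducible hp).ne')
      refine ⟨e.symm z, ?_⟩
      have h1 : Polynomial.eval z (p.map (e : F →+* ℂ)) = 0 := hz
      have h2 := Polynomial.hom_eval₂ p (RingHom.id F) (e : F →+* ℂ) (e.symm z)
      apply e.injective
      rw [map_zero, ← h1, Polynomial.eval_map]
      simpa [Polynomial.eval₂_id] using h2
    let f : F ≃ₐ[F] AlgebraicClosure F := AlgEquiv.ofBijective (Algebra.ofId _ _)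
      IsAlgClosed.algebraMap_bijective_of_isIntegral
    let Q : Conjugation F F :=
      { re := LinearMap.id
        im := 0
        conj := RingHom.id F
        ι := 0
        half := 1 / 2
        half_add := by norm_num
        eq_add := by simp
        re_one := by simp
        im_one := by simp
        re_conj := by simp
        im_conj := by simp
        re_ι := by simp
        im_ι := by simp
        ι_mul := by simp }
    refine ⟨Q.ofEquiv f, fun h => (h ?_).elim⟩
    ext z
    simp [Conjugation.ofEquiv, Q]

end BaseChange

section Adapted

open TensorProduct

/-- Affine version of the existence of adapted coordinates: `pp` are the primes of the divisors
through the rational point `x`, and over the algebraic closure each prime above one of them is the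
zero locus of a coordinate. -/
theorem exists_adapted_affine {F : Type u} [RCLike F] {A B : Type u} [CommRing A] [CommRing B]
    [Algebra F A] [Algebra A B] [Algebra (AlgebraicClosure F) B] [Algebra F B] [IsScalarTower F A B]
    [IsScalarTower F (AlgebraicClosure F) B] [Algebra.IsPushout F A (AlgebraicClosure F) B] {n : ℕ}
    [Algebra.IsStandardSmoothOfRelativeDimension n F A] (x : A →ₐ[F] F) (t : Fin n → B)
    (h : (eval₂Hom (algebraMap (AlgebraicClosure F) B) t).Etale) {ι₀ : Type*} (pp : ι₀ → Ideal A)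
    (hpp : Function.Injective pp) [hprime : ∀ P, (pp P).IsPrime] (hx : ∀ P, ∀ f ∈ pp P, x f = 0)
    (hq : ∀ P (q : Ideal B), q.IsPrime → q.comap (algebraMap A B) = pp P →
      ∃ j, ∀ q' : Ideal B, q'.IsPrime → (q ≤ q' ↔ t j ∈ q')) :
    ∃ (v : Fin n → A) (e : ι₀ → Finset (Fin n)) (u : ι₀ → A) (g : A), x g ≠ 0 ∧
      (∀ (A' : Type u) [CommRing A'] [Algebra A A'] [Algebra F A'] [IsScalarTower F A A']
        (g' : A) [IsLocalization.Away g' A'], g ∣ g' →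
        (eval₂Hom (algebraMap F A') fun i => algebraMap A A' (v i)).Etale) ∧
      Pairwise (fun P P' => Disjoint (e P) (e P')) ∧
      ∀ P, IsNormForm F v (e P) (u P) ∧ u P ∈ pp P ∧ ∃ g, x g ≠ 0 ∧ ∀ f ∈ pp P, u P ∣ g * f := by
  let K := AlgebraicClosure F
  obtain ⟨Q₀, hQ₀⟩ := exists_conjugation F
  let E : A ⊗[F] K ≃ₐ[A] B := Algebra.IsPushout.equiv F A K B
  have hE : ∀ k, E (1 ⊗ₜ k) = algebraMap K B k := fun k => by
    rw [Algebra.IsPushout.equiv_tmul, map_one, one_mul]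
  let Q : Conjugation A B := (Q₀.baseChange A).ofEquiv E
  have hxn : Nontrivial A := x.toRingHom.domain_nontrivial
  -- the differentials of some functions form a basis
  obtain ⟨a, b, hb⟩ : ∃ (a : Fin n → A) (b : Basis (Fin n) A Ω[A⁄F]),
      ∀ i, b i = KaehlerDifferential.D F A (a i) := by
    obtain ⟨ι, σ, _, _, P, hP⟩ :=
      Algebra.IsStandardSmoothOfRelativeDimension.out (n := n) (R := F) (S := A)
    have hcard : Module.rank A Ω[A⁄F] = n := by rw [P.rank_kaehlerDifferential, hP]
    have : Fintype ↑(Set.range P.map)ᶜ := Fintype.ofFinite _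
    rw [rank_eq_card_basis P.basisKaehler, Nat.cast_inj] at hcard
    let e := Fintype.equivFinOfCardEq hcard
    exact ⟨fun i => P.val (e.symm i), P.basisKaehler.reindex e, fun i => by simp⟩
  have : Algebra.IsStandardSmooth F A :=
    Algebra.IsStandardSmoothOfRelativeDimension.isStandardSmooth n
  let x' : B →+* K := (Algebra.TensorProduct.lift ((Algebra.ofId F K).comp x) (AlgHom.id F K)
    (fun _ _ => Commute.all _ _) : A ⊗[F] K →+* K).comp (E.symm : B →+* A ⊗[F] K)
  have hx'A : ∀ a, x' (algebraMap A B a) = algebraMap F K (x a) := fun a => by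
    simp [x', Algebra.ofId_apply]
  have hx's : ∀ k, x' (algebraMap K B k) = k := fun k => by
    rw [← hE]
    simp [x']
  have hre : ∀ k, Q.re (algebraMap K B k) = algebraMap F A (Q₀.re k) := fun k => by
    rw [← hE]
    simp [Q, Conjugation.ofEquiv, Conjugation.baseChange_re, Algebra.algebraMap_eq_smul_one]
  have him : ∀ k, Q.im (algebraMap K B k) = algebraMap F A (Q₀.im k) := fun k => by
    rw [← hE]
    simp [Q, Conjugation.ofEquiv, Conjugation.baseChange_im, Algebra.algebraMap_eq_smul_one]
  have hι : Q.ι = algebraMap K B Q₀.ι := by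
    rw [← hE]
    simp [Q, Conjugation.ofEquiv, Conjugation.baseChange]
  have hconj : ∀ b, x' (Q.conj b) = Q₀.conj (x' b) := fun b => by
    conv_rhs => rw [Q.eq_add b]
    rw [Q.conj_eq, hι]
    rw [map_sub, map_add, map_mul, hx'A, hx'A, hx's, map_add, map_mul,
      Q₀.conj_algebraMap (x (Q.re b)), Q₀.conj_algebraMap (x (Q.im b)), Q₀.conj_ι]
    ring
  let d : PointData Q (algebraMap K B) n :=
    { x := x
      x' := x'
      x'_algebraMap := hx'A
      x'_s := hx's
      x'_conj := fun b => by
        rw [hconj]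
        refine ⟨fun h0 => ?_, fun h0 => by rw [h0, map_zero]⟩
        rw [← Q₀.conj_conj (x' b), h0, map_zero]
      δ := { toFun := fun a l => x (b.repr (KaehlerDifferential.D F A a) l)
             map_zero' := by ext; simp
             map_add' := fun a a' => by ext; simp }
      leibniz := fun a a' => by
        ext l
        simp
      δ_re := fun k => by
        ext l
        simp [hre]
      δ_im := fun k => by
        ext l
        simp [him] }
  have hδ : ∀ a l, d.δ a l = x (b.repr (KaehlerDifferential.D F A a) l) := fun _ _ => rfl
  have ha : (Matrix.of fun i => d.δ (a i)).det ≠ 0 := by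
    have : (Matrix.of fun i => d.δ (a i)) = 1 := by
      ext i l
      rw [Matrix.of_apply, hδ, ← hb, Basis.repr_self, Matrix.one_apply, Finsupp.single_apply]
      split_ifs <;> simp
    rw [this]
    simp
  have hint : Algebra.IsIntegral A B := by
    have : Algebra.IsIntegral A (A ⊗[F] K) := inferInstance
    exact Algebra.IsIntegral.of_surjective E.toAlgHom E.surjective
  have hinj : Function.Injective (algebraMap A B) := fun a a' haa => by
    rw [← Q.re_algebraMap a, haa, Q.re_algebraMap]
  have hspan : ∀ P (q : Ideal B), q.IsPrime → q.comap (algebraMap A B) = pp P →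
      ∃ j, q = Ideal.span {t j} := by
    intro P q hqp hqc
    obtain ⟨j, hj⟩ := hq P q hqp hqc
    refine ⟨j, ?_⟩
    have hrad := isRadical_span_of_etale t h j
    rw [← hrad.radical, Ideal.radical_eq_sInf]
    refine le_antisymm (le_sInf fun J hJ => ?_) (sInf_le ⟨?_, hqp⟩)
    · exact (hj J hJ.2).2 ((Ideal.span_singleton_le_iff_mem _).1 hJ.1)
    · exact (Ideal.span_singleton_le_iff_mem _).2 ((hj q hqp).1 le_rfl)
  have hex : ∀ P, ∃ j j', (Ideal.span {t j}).IsPrime ∧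
      (Ideal.span {t j}).comap (algebraMap A B) = pp P ∧
      (Ideal.span {t j}).comap Q.conj = Ideal.span {t j'} := by
    intro P
    obtain ⟨q, -, hqp, hqc⟩ := Ideal.exists_ideal_over_prime_of_isIntegral (pp P) (⊥ : Ideal B)
      (by rw [← RingHom.ker_eq_comap_bot, (RingHom.injective_iff_ker_eq_bot _).1 hinj]; exact bot_le)
    obtain ⟨j, rfl⟩ := hspan P q hqp hqc
    obtain ⟨j', hj'⟩ := hspan P ((Ideal.span {t j}).comap Q.conj) inferInstance (by
      rw [← hqc, Ideal.comap_comap]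
      congr 1
      ext a
      exact Q.conj_algebraMap a)
    exact ⟨j, j', hqp, hqc, hj'⟩
  choose j j' hj1 hj2 hj3 using hex
  obtain ⟨v, e, u, hv, he, hu⟩ :=
    exists_adapted_of_conjugation d a ha t h pp hpp hx j j' hj1 hj2 hj3
  refine ⟨v, e, u, b.det fun i => KaehlerDifferential.D F A (v i), ?_, ?_, he, fun P => ?_⟩
  · intro h0
    apply hv
    rw [← h0, Basis.det_apply]
    change _ = (x : A →+* F) _
    rw [RingHom.map_det, ← Matrix.det_transpose]
    rfl
  · intro A' _ _ _ _ g' _ hg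
    exact etale_eval₂Hom_of_isUnit_det b v g' hg
  · refine ⟨?_, (hu P).2⟩
    rcases (hu P).1 with h1 | ⟨hQ, h1⟩
    · exact Or.inl h1
    · refine Or.inr ⟨hQ₀ fun hid => hQ ?_, h1⟩
      have := Q₀.baseChange_conj hid A
      ext b
      simp [Q, Conjugation.ofEquiv, this]

end Adapted

/-! ### Points over an algebraic closure -/

section Points

variable {X : Scheme.{u}}

/-- The prime ideal which corresponds to a point of an affine open set. -/
abbrev primeAt {U : X.Opens} (hU : IsAffineOpen U) {z : X} (hz : z ∈ U) : Ideal Γ(X, U) :=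
  (hU.primeIdealOf ⟨z, hz⟩).asIdeal

theorem mem_primeIdealOf_iff {U : X.Opens} (hU : IsAffineOpen U) {z : X} (hz : z ∈ U) (f : Γ(X, U)) :
    f ∈ primeAt hU hz ↔ z ∉ X.basicOpen f := by
  have h : z = hU.fromSpec (hU.primeIdealOf ⟨z, hz⟩) := (hU.fromSpec_primeIdealOf ⟨z, hz⟩).symm
  have h2 : hU.fromSpec (hU.primeIdealOf ⟨z, hz⟩) ∈ X.basicOpen f ↔
      hU.primeIdealOf ⟨z, hz⟩ ∈ hU.fromSpec ⁻¹ᵁ X.basicOpen f := Iff.rfl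
  rw [hU.fromSpec_preimage_basicOpen f] at h2
  rw [← h] at h2
  rw [h2]
  exact not_not.symm

theorem specializes_iff_primeIdealOf_le {U : X.Opens} (hU : IsAffineOpen U) {z z' : X} (hz : z ∈ U)
    (hz' : z' ∈ U) :
    z ⤳ z' ↔ primeAt hU hz ≤ primeAt hU hz' := by
  have h : z = hU.fromSpec (hU.primeIdealOf ⟨z, hz⟩) := (hU.fromSpec_primeIdealOf ⟨z, hz⟩).symm
  have h' : z' = hU.fromSpec (hU.primeIdealOf ⟨z', hz'⟩) := (hU.fromSpec_primeIdealOf ⟨z', hz'⟩).symm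
  conv_lhs => rw [h, h']
  exact (hU.fromSpec.isOpenEmbedding.isInducing.specializes_iff).trans
    (PrimeSpectrum.le_iff_specializes _ _).symm

theorem exists_primeIdealOf_eq {U : X.Opens} (hU : IsAffineOpen U) (q : Ideal Γ(X, U)) [hq : q.IsPrime] :
    ∃ (z : X) (hz : z ∈ U), primeAt hU hz = q := by
  let y : Spec Γ(X, U) := (⟨q, hq⟩ : PrimeSpectrum Γ(X, U))
  have hz : hU.fromSpec y ∈ U := by
    have : hU.fromSpec y ∈ Set.range hU.fromSpec := ⟨y, rfl⟩
    rwa [hU.range_fromSpec] at this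
  refine ⟨hU.fromSpec y, hz, ?_⟩
  have h1 := hU.fromSpec_primeIdealOf ⟨hU.fromSpec y, hz⟩
  have h2 := hU.fromSpec.isOpenEmbedding.injective h1
  rw [primeAt, h2]

/-- Two prime ideals of height one, one of which contains the other, are equal. -/
theorem PrimeDivisor.eq_of_specializes {P Q : PrimeDivisor X} (h : Q.pt ⤳ P.pt) : Q = P := by
  obtain ⟨U, hU, hP, -⟩ := exists_isAffineOpen_mem_and_subset (x := P.pt) (U := ⊤) trivial
  have hQ : Q.pt ∈ U := h.mem_open U.2 hP
  have hle := (specializes_iff_primeIdealOf_le hU hQ hP).1 h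
  have hh : ∀ (R : PrimeDivisor X) (hR : R.pt ∈ U), (primeAt hU hR).height = 1 := by
    intro R hR
    let _ := TopCat.Presheaf.algebra_section_stalk X.presheaf (⟨R.pt, hR⟩ : U)
    have := hU.isLocalization_stalk ⟨R.pt, hR⟩
    have h1 := IsLocalization.AtPrime.ringKrullDim_eq_height (primeAt hU hR)
      (X.presheaf.stalk R.pt)
    rw [R.codim_one] at h1
    exact_mod_cast h1.symm
  have heq : primeAt hU hQ = primeAt hU hP := by
    by_contra hne
    have hlt := lt_of_le_of_ne hle hne
    have hf : (primeAt hU hQ).FiniteHeight :=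
      ⟨Or.inr (by rw [hh Q hQ]; exact ENat.one_ne_top)⟩
    have := Ideal.height_strict_mono_of_isPrime hlt
    rw [hh P hP, hh Q hQ] at this
    exact lt_irrefl _ this
  have hpt : Q.pt = P.pt := by
    have h3 := (specializes_iff_primeIdealOf_le hU hP hQ).2 heq.ge
    exact (h.antisymm h3).eq
  cases P; cases Q
  cases hpt
  rfl

theorem isClosed_supportSet (E : EffDivisor X) : IsClosed (supportSet E) := by
  have : supportSet E = ⋃ P ∈ E.support, closure {P.pt} := by
    ext x
    simp [supportSet, specializes_iff_mem_closure]
  rw [this]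
  exact E.support.finite_toSet.isClosed_biUnion fun _ _ => isClosed_closure

end Points

section Geometric

variable {K : Type u} [Field K] {X : Scheme.{u}} {p : X ⟶ Spec (of K)}

/-- The morphism of spectra given by an algebraic closure. -/
abbrev closureMap (K : Type u) [Field K] :
    Spec (of (AlgebraicClosure K)) ⟶ Spec (of K) :=
  Spec.map (ofHom (algebraMap K (AlgebraicClosure K)))

/-- The projection of the base change to an algebraic closure onto `X`. -/
abbrev geomFst (p : X ⟶ Spec (of K)) := pullback.fst p (closureMap K)

/-- The structure morphism of the base change to an algebraic closure. -/
abbrev geomSnd (p : X ⟶ Spec (of K)) := pullback.snd p (closureMap K)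

/-- The regular functions on the preimage of `U` in the base change to an algebraic closure. -/
abbrev GeomSec (p : X ⟶ Spec (of K)) (U : X.Opens) : Type u :=
  Γ(pullback p (closureMap K), geomFst p ⁻¹ᵁ U)

instance isIntegralHom_closureMap : IsIntegralHom (closureMap K) := by
  rw [IsIntegralHom.SpecMap_iff]
  exact algebraMap_isIntegral_iff.2 inferInstance

instance isIntegralHom_fst : IsIntegralHom (geomFst p) :=
  MorphismProperty.of_isPullback
    (IsPullback.of_hasPullback p (closureMap K)).flip isIntegralHom_closureMap

/-- There is only one point above a rational point. -/
theorem eq_of_fst_eq (x : RatPoint p) {z z' : ↑(pullback p (closureMap K))}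
    (hz : geomFst p z = x.pt) (hz' : geomFst p z' = x.pt) : z = z' := by
  obtain ⟨w, -, rfl⟩ := Scheme.Pullback.exists_preimage_pullback (f := x.hom)
    (g := geomFst p) (IsLocalRing.closedPoint K) z hz.symm
  obtain ⟨w', -, rfl⟩ := Scheme.Pullback.exists_preimage_pullback (f := x.hom)
    (IsLocalRing.closedPoint K) z' hz'.symm
  let e := pullbackRightPullbackFstIso p (closureMap K) x.hom
  have : IsIso (x.hom ≫ p) := by rw [x.comp_eq]; infer_instance
  let e' := e ≪≫ asIso (pullback.snd (x.hom ≫ p) (closureMap K))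
  have hinj : Function.Injective e'.hom := e'.hom.homeomorph.injective
  rw [hinj (Subsingleton.elim (e'.hom w) (e'.hom w'))]

theorem exists_fst_eq (x : X) : ∃ z, geomFst p z = x := by
  obtain ⟨z, hz, -⟩ := Scheme.Pullback.exists_preimage_pullback (f := p) (g := closureMap K) x
    (IsLocalRing.closedPoint (AlgebraicClosure K)) (Subsingleton.elim (α := PrimeSpectrum K) _ _)
  exact ⟨z, hz⟩

/-- The points above the generic point of a component `P` are the generic points of the geometric
components above `P`, which are irreducible components of the geometric support. -/
theorem maximal_closure_of_fst_eq (E : EffDivisor X) {P : PrimeDivisor X} (hP : P ∈ E.support)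
    {z : ↑(pullback p (closureMap K))} (hz : geomFst p z = P.pt) :
    Maximal (fun T => IsIrreducible T ∧
      T ⊆ {z | geomFst p z ∈ supportSet E}) (closure {z}) := by
  have hcl : IsClosed {z | geomFst p z ∈ supportSet E} :=
    (isClosed_supportSet E).preimage (geomFst p).continuous
  refine ⟨⟨isIrreducible_singleton.closure, closure_minimal ?_ hcl⟩, ?_⟩
  · rintro _ rfl
    exact ⟨P, hP, by rw [hz]⟩
  rintro T ⟨hT, hTS⟩ hzT
  have hTc : closure T ⊆ {z | geomFst p z ∈ supportSet E} :=
    closure_minimal hTS hcl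
  obtain ⟨η, hη⟩ := QuasiSober.sober hT.closure isClosed_closure
  have hηz : η ⤳ z := hη.specializes (subset_closure (hzT (subset_closure rfl)))
  obtain ⟨Q, hQ, hQη⟩ := hTc hη.mem
  have h1 : geomFst p η ⤳ P.pt := by
    rw [← hz]
    exact hηz.map (geomFst p).continuous
  obtain rfl := PrimeDivisor.eq_of_specializes (hQη.trans h1)
  have h2 : geomFst p η = Q.pt := (h1.antisymm hQη).eq
  -- incomparability for the integral morphism from the base change
  obtain ⟨U, hU, hQU, -⟩ := exists_isAffineOpen_mem_and_subset (x := Q.pt) (U := ⊤) trivial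
  have hV : IsAffineOpen (geomFst p ⁻¹ᵁ U) := hU.preimage _
  have hzV : z ∈ geomFst p ⁻¹ᵁ U := by
    change geomFst p z ∈ U
    rwa [hz]
  have hηV : η ∈ geomFst p ⁻¹ᵁ U := by
    change geomFst p η ∈ U
    rwa [h2]
  have hle := (specializes_iff_primeIdealOf_le hV hηV hzV).1 hηz
  have heq : primeAt hV hηV = primeAt hV hzV := by
    by_contra hne
    have hlt := lt_of_le_of_ne hle hne
    let φ := ((geomFst p).appLE U _ le_rfl).hom
    have hφ : φ.IsIntegral := by
      have := IsIntegralHom.isIntegral_app (geomFst p) U hU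
      simpa [φ, Scheme.Hom.appLE] using this
    let _ := φ.toAlgebra
    have hint : Algebra.IsIntegral Γ(X, U) (GeomSec p U) := ⟨hφ⟩
    have := Ideal.IsIntegral.comap_lt_comap (R := Γ(X, U)) hlt
    have e1 := congr_arg PrimeSpectrum.asIdeal (IsAffineOpen.comap_primeIdealOf_appLE (f := geomFst p) U hU _ hV le_rfl hηV)
    have e2 := congr_arg PrimeSpectrum.asIdeal (IsAffineOpen.comap_primeIdealOf_appLE U hU _ hV le_rfl hzV)
    have e3 : (hU.primeIdealOf ⟨geomFst p η, hηV⟩) = (hU.primeIdealOf ⟨geomFst p z, hzV⟩) := by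
      congr 2
      rw [h2, hz]
    rw [e3, ← e2] at e1
    exact this.ne e1
  have h3 : z ⤳ η := (specializes_iff_primeIdealOf_le hV hzV hηV).2 heq.ge
  intro y hy
  have : η ⤳ y := hη.specializes (subset_closure hy)
  exact (h3.trans this).mem_closure

end Geometric

/-! ### Coordinates adapted to the boundary -/

section SmoothAffine

variable {K : Type u} [Field K] {X : Scheme.{u}} {p : X ⟶ Spec (of K)}

theorem exists_isStandardSmooth_scalar {n : ℕ} (hsm : SmoothOfRelativeDimension n p) (x : X) :
    ∃ V : X.Opens, IsAffineOpen V ∧ x ∈ V ∧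
      (scalar p V).IsStandardSmoothOfRelativeDimension n := by
  obtain ⟨U₀, -, V, hV, hxV, e, h⟩ := hsm.exists_isStandardSmoothOfRelativeDimension x
  have hU₀ : U₀ = ⊤ := by
    refine top_le_iff.1 fun y _ => ?_
    have : y = p x := Subsingleton.elim _ _
    rw [this]
    exact e hxV
  subst hU₀
  refine ⟨V, hV, hxV, ?_⟩
  have h1 := (RingHom.isStandardSmoothOfRelativeDimension_respectsIso).2
    (p.appLE ⊤ V e).hom (Scheme.ΓSpecIso (of K)).symm.commRingCatIsoToRingEquiv h
  exact h1

theorem isStandardSmooth_scalar_basicOpen {n : ℕ} {V : X.Opens} (hV : IsAffineOpen V)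
    (h : (scalar p V).IsStandardSmoothOfRelativeDimension n) (f : Γ(X, V)) :
    (scalar p (X.basicOpen f)).IsStandardSmoothOfRelativeDimension n := by
  let _ := (scalar p V).toAlgebra
  let _ := (scalar p (X.basicOpen f)).toAlgebra
  have h1 : Algebra.IsStandardSmoothOfRelativeDimension n K Γ(X, V) := h
  have h2 := hV.isLocalization_basicOpen f
  have h3 : Algebra.IsStandardSmoothOfRelativeDimension 0 Γ(X, V) Γ(X, X.basicOpen f) :=
    Algebra.IsStandardSmoothOfRelativeDimension.localization_away f
  have : IsScalarTower K Γ(X, V) Γ(X, X.basicOpen f) := IsScalarTower.of_algebraMap_eq fun a =>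
    (scalar_res p (X.basicOpen_le f) a).symm
  have h4 := Algebra.IsStandardSmoothOfRelativeDimension.trans n 0 K Γ(X, V) Γ(X, X.basicOpen f)
  rw [zero_add] at h4
  exact h4

theorem isPushout_scalar {U : X.Opens} (hU : IsAffineOpen U) :
    IsPushout (ofHom (scalar p U))
      (ofHom (algebraMap K (AlgebraicClosure K)))
      ((geomFst p).appLE U (geomFst p ⁻¹ᵁ U) le_rfl)
      (ofHom (scalar (geomSnd p)
        (geomFst p ⁻¹ᵁ U))) := by
  have h := (isIso_pushoutSection_iff (IsPullback.of_hasPullback p (closureMap K)) (US := ⊤) (UT := ⊤)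
    (UX := U) (le_top.trans (closureMap K).preimage_top.ge) (le_top.trans p.preimage_top.ge)
    (UY := geomFst p ⁻¹ᵁ U) (by simp)).1
      (isIso_pushoutSection_of_isAffineOpen _ _ _ _ (isAffineOpen_top _) (isAffineOpen_top _) hU)
  refine h.of_iso (Scheme.ΓSpecIso _) (Iso.refl _) (Scheme.ΓSpecIso _) (Iso.refl _) ?_ ?_ ?_ ?_
  · change _ = (Scheme.ΓSpecIso _).hom ≫ (Scheme.ΓSpecIso _).inv ≫ p.appLE ⊤ U _
    rw [Iso.hom_inv_id_assoc]
    exact Category.comp_id _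
  · rw [← Scheme.ΓSpecIso_naturality]
    congr 1
  · exact (Category.comp_id _).trans (Category.id_comp _).symm
  · change _ = (Scheme.ΓSpecIso _).hom ≫ (Scheme.ΓSpecIso _).inv ≫
      (geomSnd p).appLE ⊤ _ _
    rw [Iso.hom_inv_id_assoc]
    exact Category.comp_id _

end SmoothAffine

section AdaptedCoordinates

variable {F : Type u} [RCLike F] {X : Scheme.{u}} {p : X ⟶ Spec (of F)}

/-- `X` is smooth of pure dimension `n`, and the support of `L` has strict normal crossings over an
algebraic closure. -/
structure IsSmoothSNC (p : X ⟶ Spec (of F)) (n : ℕ) (L : EffDivisor X) : Prop where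
  smooth : SmoothOfRelativeDimension n p
  snc : IsGeometricSNC p n L

/-- Moreover the support of `L` contains that of `D`. -/
structure IsSNCPair (p : X ⟶ Spec (of F)) (n : ℕ) (D L : EffDivisor X) : Prop
    extends IsSmoothSNC p n L where
  support_subset : D.support ⊆ L.support

/-- Near each rational point there are an affine open set, on which `X` is standard smooth, and étale
coordinates on its preimage in the base change to an algebraic closure, which define the components
of the support of `L` there. -/
theorem exists_geometric_coordinates {n : ℕ} {L : EffDivisor X} (hX : IsSmoothSNC p n L) (x : RatPoint p) :
    ∃ (U : X.Opens) (t : Fin n → GeomSec p U),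
      x.pt ∈ U ∧ IsAffineOpen U ∧ (scalar p U).IsStandardSmoothOfRelativeDimension n ∧
      (∀ P ∈ L.support, ¬ P.pt ⤳ x.pt → P.pt ∉ U) ∧
      IsEtaleCoord (geomSnd p) _ t ∧
      ∀ P ∈ L.support, ∀ z, geomFst p z = P.pt →
        z ∈ geomFst p ⁻¹ᵁ U → ∃ j,
          ∀ y ∈ geomFst p ⁻¹ᵁ U, z ⤳ y ↔
            y ∉ (pullback p (closureMap F)).basicOpen (t j) := by
  classical
  obtain ⟨V, hV, hxV, hVs⟩ := exists_isStandardSmooth_scalar hX.1 x.pt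
  obtain ⟨z₀, hz₀⟩ := exists_fst_eq (p := p) x.pt
  obtain ⟨W, t', hz₀W, ht', hW⟩ := hX.2 z₀
  have hclosed : IsClosed (geomFst p '' (W : Set _)ᶜ) :=
    (geomFst p).isClosedMap _ W.2.isClosed_compl
  have hclosed' : IsClosed (⋃ P ∈ L.support.filter fun P => ¬ P.pt ⤳ x.pt, closure {P.pt}) :=
    (finite_toSet _).isClosed_biUnion fun _ _ => isClosed_closure
  let O : X.Opens := ⟨(geomFst p '' (W : Set _)ᶜ)ᶜ ∩
    (⋃ P ∈ L.support.filter fun P => ¬ P.pt ⤳ x.pt, closure {P.pt})ᶜ,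
    hclosed.isOpen_compl.inter hclosed'.isOpen_compl⟩
  have hxO : x.pt ∈ O := by
    refine ⟨?_, ?_⟩
    · rintro ⟨z, hz, hzx⟩
      exact hz (by rw [eq_of_fst_eq x hzx hz₀]; exact hz₀W)
    · simp only [Set.mem_compl_iff, Set.mem_iUnion, not_exists, mem_filter]
      intro P hP h
      exact hP.2 (specializes_iff_mem_closure.2 h)
  obtain ⟨f, hfO, hxf⟩ := hV.exists_basicOpen_le ⟨x.pt, hxO⟩ hxV
  have hU : IsAffineOpen (X.basicOpen f) := hV.basicOpen f
  have hUW : geomFst p ⁻¹ᵁ X.basicOpen f ≤ W := by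
    intro z hz
    by_contra hzW
    exact (hfO hz).1 ⟨z, hzW, rfl⟩
  refine ⟨X.basicOpen f, fun i => res hUW (t' i), hxf, hU, isStandardSmooth_scalar_basicOpen hV hVs f,
    ?_, ht'.restrict (hU.preimage _) hUW, ?_⟩
  · intro P hP hPx hPU
    refine (hfO hPU).2 ?_
    simp only [Set.mem_iUnion]
    exact ⟨P, mem_filter.2 ⟨hP, hPx⟩, subset_closure rfl⟩
  · intro P hP z hz hzU
    obtain ⟨j, hj⟩ := hW (closure {z}) (maximal_closure_of_fst_eq L hP hz)
      ⟨z, subset_closure rfl, hUW hzU⟩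
    refine ⟨j, fun y hy => ?_⟩
    rw [specializes_iff_mem_closure, hj y (hUW hy), Scheme.basicOpen_res]
    exact not_congr ⟨fun h => ⟨hy, h⟩, fun h => h.2⟩

/-- The components of the support of `L` through `x`. -/
abbrev CompAt (L : EffDivisor X) (x : RatPoint p) := {P // P ∈ L.support ∧ P.pt ⤳ x.pt}

/-- The descent of geometric coordinates at a rational point, in terms of regular functions on `U`. The
last clause says that, near `x`, the function `u P` generates the ideal of `P`. -/
theorem exists_adapted_sections {n : ℕ} (L : EffDivisor X) (x : RatPoint p) {U : X.Opens}
    (hxU : x.pt ∈ U) (hU : IsAffineOpen U)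
    (hUs : (scalar p U).IsStandardSmoothOfRelativeDimension n) (t : Fin n → GeomSec p U)
    (ht : IsEtaleCoord (geomSnd p) _ t) (hj : ∀ P ∈ L.support, ∀ z, geomFst p z = P.pt →
        z ∈ geomFst p ⁻¹ᵁ U → ∃ j,
          ∀ y ∈ geomFst p ⁻¹ᵁ U, z ⤳ y ↔
            y ∉ (pullback p (closureMap F)).basicOpen (t j)) :
    ∃ (v : Fin n → Γ(X, U)) (e : CompAt L x → Finset (Fin n))
      (u : CompAt L x → Γ(X, U)) (g : Γ(X, U)),
      x.evalHom U hxU g ≠ 0 ∧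
      (∀ g', g ∣ g' → IsEtaleCoord p (X.basicOpen g') fun i => res (X.basicOpen_le g') (v i)) ∧
      Pairwise (fun P P' => Disjoint (e P) (e P')) ∧
      ∀ P, IsNormForm F v (e P) (u P) ∧ P.1.pt ∉ X.basicOpen (u P) ∧
        ∃ g, x.evalHom U hxU g ≠ 0 ∧ ∀ f, P.1.pt ∉ X.basicOpen f → u P ∣ g * f := by
  have hU' : IsAffineOpen (geomFst p ⁻¹ᵁ U) := hU.preimage _
  let _ : Algebra F Γ(X, U) := (scalar p U).toAlgebra
  let _ : Algebra Γ(X, U) (GeomSec p U) :=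
    ((geomFst p).appLE U _ le_rfl).hom.toAlgebra
  let _ : Algebra (AlgebraicClosure F) (GeomSec p U) :=
    (scalar (geomSnd p) _).toAlgebra
  let _ : Algebra F (GeomSec p U) :=
    ((algebraMap Γ(X, U) _).comp (algebraMap F Γ(X, U))).toAlgebra
  have hpush := isPushout_scalar (p := p) hU
  have : IsScalarTower F Γ(X, U) (GeomSec p U) :=
    IsScalarTower.of_algebraMap_eq fun _ => rfl
  have : IsScalarTower F (AlgebraicClosure F) (GeomSec p U) :=
    IsScalarTower.of_algebraMap_eq fun a => congr($(hpush.w) a)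
  have : Algebra.IsPushout F Γ(X, U) (AlgebraicClosure F) (GeomSec p U) :=
    CommRingCat.isPushout_iff_isPushout.1 hpush
  have : Algebra.IsStandardSmoothOfRelativeDimension n F Γ(X, U) := hUs
  let ev : Γ(X, U) →ₐ[F] F := { x.evalHom U hxU with commutes' := fun a => evalHom_scalar x hxU a }
  have hιU : ∀ P : CompAt L x, P.1.pt ∈ U :=
    fun P => P.2.2.mem_open U.2 hxU
  let pp : CompAt L x → Ideal Γ(X, U) :=
    fun P => primeAt hU (hιU P)
  have hmem : ∀ P f, f ∈ pp P ↔ P.1.pt ∉ X.basicOpen f :=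
    fun P f => mem_primeIdealOf_iff hU (hιU P) f
  have hpp : Function.Injective pp := by
    intro P P' h
    have h1 := (specializes_iff_primeIdealOf_le hU (hιU P) (hιU P')).2 h.le
    exact Subtype.ext (PrimeDivisor.eq_of_specializes h1)
  have hx : ∀ P, ∀ f ∈ pp P, ev f = 0 := by
    intro P f hf
    rw [hmem] at hf
    by_contra h0
    exact hf (P.2.2.mem_open (X.basicOpen f).2 ((mem_basicOpen_iff x hxU f).2 h0))
  have hq : ∀ P (q : Ideal (GeomSec p U)),
      q.IsPrime → q.comap (algebraMap Γ(X, U) _) = pp P →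
      ∃ j, ∀ q' : Ideal (GeomSec p U),
        q'.IsPrime → (q ≤ q' ↔ t j ∈ q') := by
    intro P q hqp hqc
    obtain ⟨z, hzU, rfl⟩ := exists_primeIdealOf_eq hU' q
    have hzP : geomFst p z = P.1.pt := by
      have h1 := congr_arg PrimeSpectrum.asIdeal
        (IsAffineOpen.comap_primeIdealOf_appLE U hU _ hU' le_rfl hzU)
      have h2 : primeAt hU hzU = primeAt hU (hιU P) := h1.symm.trans hqc
      exact (((specializes_iff_primeIdealOf_le hU hzU (hιU P)).2 h2.le).antisymm
        ((specializes_iff_primeIdealOf_le hU (hιU P) hzU).2 h2.ge)).eq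
    obtain ⟨j, hj⟩ := hj P.1 P.2.1 z hzP hzU
    refine ⟨j, fun q' hq' => ?_⟩
    obtain ⟨z', hz'U, rfl⟩ := exists_primeIdealOf_eq hU' q'
    rw [← specializes_iff_primeIdealOf_le hU' hzU hz'U, mem_primeIdealOf_iff hU', hj z' hz'U]
  obtain ⟨v, e, u, g, hg, hv, he, hu⟩ := exists_adapted_affine ev t ht.2 pp hpp hx hq
  refine ⟨v, e, u, g, hg, fun g' hg' => ?_, he, fun P => ⟨(hu P).1, (hmem P _).1 (hu P).2.1, ?_⟩⟩
  · refine ⟨hU.basicOpen g', ?_⟩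
    let _ : Algebra F Γ(X, X.basicOpen g') := (scalar p _).toAlgebra
    have h1 := hU.isLocalization_basicOpen g'
    have h2 : IsScalarTower F Γ(X, U) Γ(X, X.basicOpen g') := IsScalarTower.of_algebraMap_eq fun a =>
      (scalar_res p (X.basicOpen_le g') a).symm
    exact hv Γ(X, X.basicOpen g') g' hg'
  · obtain ⟨g₁, hg₁, hf⟩ := (hu P).2.2
    exact ⟨g₁, hg₁, fun f hfP => hf f ((hmem P f).2 hfP)⟩

/-- Near each rational point there are étale coordinates adapted to all components of `L`. -/
theorem exists_adapted_coordinates {n : ℕ} {L : EffDivisor X} (hX : IsSmoothSNC p n L) (x : RatPoint p) :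
    ∃ (U : X.Opens) (t : Fin n → Γ(X, U)) (e : PrimeDivisor X → Finset (Fin n))
      (u : PrimeDivisor X → Γ(X, U)), x.pt ∈ U ∧ IsEtaleCoord p U t ∧
      (∀ P ∈ L.support, IsLocalEq P U (u P)) ∧
      (∀ P ∈ L.support, P.pt ⤳ x.pt → IsNormForm F t (e P) (u P)) ∧
      (∀ P ∈ L.support, P.pt ⤳ x.pt → ∀ P' ∈ L.support, P'.pt ⤳ x.pt → P ≠ P' →
        Disjoint (e P) (e P')) ∧
      ∀ P ∈ L.support, ¬ P.pt ⤳ x.pt → P.pt ∉ U ∧ u P = 1 ∧ e P = ∅ := by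
  classical
  obtain ⟨U, t, hxU, hU, hUs, hPU, ht, hj⟩ := exists_geometric_coordinates hX x
  obtain ⟨v, e, u, g, hg, hv, he, hu⟩ := exists_adapted_sections L x hxU hU hUs t ht hj
  choose hu1 hu2 gP hgP hu3 using hu
  have : Finite (CompAt L x) :=
    (L.support.finite_toSet.subset fun P hP => hP.1 : {P | P ∈ L.support ∧ P.pt ⤳ x.pt}.Finite)
  have : Fintype (CompAt L x) := Fintype.ofFinite _
  let G : Γ(X, U) := g * ∏ P, gP P
  have hG : x.pt ∈ X.basicOpen G := by
    rw [mem_basicOpen_iff x hxU, map_mul, map_prod]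
    exact mul_ne_zero hg (prod_ne_zero_iff.2 fun P _ => hgP P)
  have hloc := hU.isLocalization_basicOpen G
  have hGu : IsUnit (res (X.basicOpen_le G) G) := IsLocalization.Away.algebraMap_isUnit G
  let e' : PrimeDivisor X → Finset (Fin n) := fun P =>
    if h : P ∈ L.support ∧ P.pt ⤳ x.pt then e ⟨P, h⟩ else ∅
  let u' : PrimeDivisor X → Γ(X, X.basicOpen G) := fun P =>
    if h : P ∈ L.support ∧ P.pt ⤳ x.pt then res (X.basicOpen_le G) (u ⟨P, h⟩) else 1
  refine ⟨X.basicOpen G, fun i => res (X.basicOpen_le G) (v i), e', u', hG, hv G (dvd_mul_right _ _),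
    ?_, ?_, ?_, ?_⟩
  · intro P hP
    by_cases h : P.pt ⤳ x.pt
    · have hu' : u' P = res (X.basicOpen_le G) (u ⟨P, hP, h⟩) := dif_pos ⟨hP, h⟩
      rw [hu']
      refine ⟨hU.basicOpen G, fun f => ⟨?_, fun hf => ?_⟩⟩
      · rintro ⟨c, rfl⟩ hPc
        rw [Scheme.basicOpen_mul, Scheme.basicOpen_res] at hPc
        exact hu2 ⟨P, hP, h⟩ hPc.1.2
      · obtain ⟨k, b, hb⟩ : ∃ (k : ℕ) (b : Γ(X, U)), f * res (X.basicOpen_le G) G ^ k =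
            res (X.basicOpen_le G) b := by
          obtain ⟨⟨b, ⟨_, k, rfl⟩⟩, hb⟩ := IsLocalization.surj (Submonoid.powers G) f
          exact ⟨k, b, by rw [← map_pow]; exact hb⟩
        have hPG : P.pt ∈ X.basicOpen G := h.mem_open (X.basicOpen G).2 hG
        have hb0 : P.pt ∉ X.basicOpen b := by
          intro hPb
          have h1 : P.pt ∈ X.basicOpen (res (X.basicOpen_le G) b) := by
            rw [Scheme.basicOpen_res]
            exact ⟨hPG, hPb⟩
          rw [← hb, Scheme.basicOpen_mul] at h1
          exact hf h1.1
        have h2 := map_dvd (res (X.basicOpen_le G)) (hu3 ⟨P, hP, h⟩ b hb0)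
        have hgu : IsUnit (res (X.basicOpen_le G) (gP ⟨P, hP, h⟩)) := by
          refine isUnit_of_dvd_unit (map_dvd _ ?_) hGu
          exact (dvd_prod_of_mem gP (mem_univ _)).trans (dvd_mul_left _ _)
        rw [map_mul, hgu.dvd_mul_left, ← hb, (hGu.pow k).dvd_mul_right] at h2
        exact h2
    · have hu' : u' P = 1 := dif_neg fun hh => h hh.2
      rw [hu']
      exact isLocalEq_one (hU.basicOpen G) fun hPG => hPU P hP h (X.basicOpen_le G hPG)
  · intro P hP h
    have hu' : u' P = res (X.basicOpen_le G) (u ⟨P, hP, h⟩) := dif_pos ⟨hP, h⟩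
    have he' : e' P = e ⟨P, hP, h⟩ := dif_pos ⟨hP, h⟩
    rw [hu', he']
    rcases hu1 ⟨P, hP, h⟩ with ⟨i, h1, h2⟩ | ⟨hI, i, k, hik, h1, h2⟩
    · exact Or.inl ⟨i, h1, by rw [h2]⟩
    · exact Or.inr ⟨hI, i, k, hik, h1, by rw [h2, map_add, map_pow, map_pow]⟩
  · intro P hP h P' hP' h' hne
    have he1 : e' P = e ⟨P, hP, h⟩ := dif_pos ⟨hP, h⟩
    have he2 : e' P' = e ⟨P', hP', h'⟩ := dif_pos ⟨hP', h'⟩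
    rw [he1, he2]
    exact he fun heq => hne (congr_arg Subtype.val heq)
  · intro P hP h
    exact ⟨fun hPG => hPU P hP h (X.basicOpen_le G hPG), dif_neg fun hh => h hh.2,
      dif_neg fun hh => h hh.2⟩

end AdaptedCoordinates

/-! ### Iterated primitives of a truncated exponential -/

/-- The function `1_{s ≥ 0} e^{-σ s}` (for `m = 0`) and its iterated primitives vanishing on the
negative half-line. -/
def kernel (σ : ℝ) : ℕ → ℝ → ℝ
  | 0 => fun s => if 0 ≤ s then exp (-σ * s) else 0
  | m + 1 => fun s => ∫ x in (0 : ℝ)..s, kernel σ m x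

theorem kernel_zero_eq_indicator (σ : ℝ) :
    kernel σ 0 = (Set.Ici 0).indicator fun s => exp (-σ * s) := by
  ext s; simp [kernel, Set.indicator]

theorem kernel_succ (σ : ℝ) (m : ℕ) (s : ℝ) : kernel σ (m + 1) s = ∫ x in (0 : ℝ)..s, kernel σ m x :=
  rfl

theorem intervalIntegrable_kernel (σ : ℝ) (m : ℕ) (a b : ℝ) :
    IntervalIntegrable (kernel σ m) volume a b := by
  induction m generalizing a b with
  | zero =>
    rw [kernel_zero_eq_indicator]
    have h : IntervalIntegrable (fun s => exp (-σ * s)) volume a b :=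
      Continuous.intervalIntegrable (by fun_prop) a b
    exact ⟨h.1.indicator measurableSet_Ici, h.2.indicator measurableSet_Ici⟩
  | succ m ih => exact (intervalIntegral.continuous_primitive ih 0).intervalIntegrable a b

theorem continuous_kernel_succ (σ : ℝ) (m : ℕ) : Continuous (kernel σ (m + 1)) :=
  intervalIntegral.continuous_primitive (intervalIntegrable_kernel σ m) 0

theorem measurable_kernel (σ : ℝ) : ∀ m, Measurable (kernel σ m)
  | 0 => by
    rw [kernel_zero_eq_indicator]
    exact Measurable.indicator (by fun_prop) measurableSet_Ici
  | m + 1 => (continuous_kernel_succ σ m).measurable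

theorem kernel_of_neg (σ : ℝ) (m : ℕ) {s : ℝ} (hs : s < 0) : kernel σ m s = 0 := by
  induction m generalizing s with
  | zero => simp [kernel, hs]
  | succ m ih =>
    rw [kernel_succ, intervalIntegral.integral_symm, intervalIntegral.integral_of_le hs.le,
      integral_Ioc_eq_integral_Ioo, setIntegral_congr_fun measurableSet_Ioo
      (fun x hx => ih hx.2)]
    simp

theorem kernel_nonneg (σ : ℝ) (m : ℕ) (s : ℝ) : 0 ≤ kernel σ m s := by
  induction m generalizing s with
  | zero => simp only [kernel]; split_ifs <;> positivity
  | succ m ih =>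
    rcases lt_or_ge s 0 with hs | hs
    · rw [kernel_of_neg _ _ hs]
    · exact intervalIntegral.integral_nonneg hs fun x _ => ih x

theorem kernel_sub (σ : ℝ) (m : ℕ) (s s' : ℝ) :
    kernel σ (m + 1) s' - kernel σ (m + 1) s = ∫ x in s..s', kernel σ m x :=
  intervalIntegral.integral_interval_sub_left (intervalIntegrable_kernel _ _ _ _)
    (intervalIntegrable_kernel _ _ _ _)

theorem hasDerivAt_kernel (σ : ℝ) (m : ℕ) (s : ℝ) :
    HasDerivAt (kernel σ (m + 2)) (kernel σ (m + 1) s) s :=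
  intervalIntegral.integral_hasDerivAt_right (intervalIntegrable_kernel _ _ _ _)
    (continuous_kernel_succ σ m).aestronglyMeasurable.stronglyMeasurableAtFilter
    (continuous_kernel_succ σ m).continuousAt

theorem kernel_le_exp {σ : ℝ} (hσ : 0 ≤ σ) {N : ℝ} (hN : 0 < N) (m : ℕ) (s : ℝ) :
    kernel σ m s ≤ (1 / N) ^ m * exp (N * s) := by
  induction m generalizing s with
  | zero =>
    simp only [kernel]
    split_ifs with h
    · simp only [pow_zero, one_mul]
      exact exp_le_exp.2 (by nlinarith)
    · positivity
  | succ m ih =>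
    rcases lt_or_ge s 0 with hs | hs
    · rw [kernel_of_neg _ _ hs]; positivity
    · have h1 : kernel σ (m + 1) s ≤ ∫ x in (0 : ℝ)..s, (1 / N) ^ m * exp (N * x) :=
        intervalIntegral.integral_mono_on hs (intervalIntegrable_kernel _ _ _ _)
          (Continuous.intervalIntegrable (by fun_prop) _ _) fun x _ => ih x
      have h2 : ∫ x in (0 : ℝ)..s, (1 / N) ^ m * exp (N * x) =
          (1 / N) ^ (m + 1) * exp (N * s) - (1 / N) ^ (m + 1) * exp (N * 0) := by
        refine intervalIntegral.integral_eq_sub_of_hasDerivAt (f := fun x => (1 / N) ^ (m + 1) *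
          exp (N * x)) (fun x _ => ?_) (Continuous.intervalIntegrable (by fun_prop) _ _)
        have := (((hasDerivAt_id x).const_mul N).exp).const_mul ((1 / N) ^ (m + 1))
        refine this.congr_deriv ?_
        rw [mul_one, pow_succ, id]
        field_simp
      have h3 : (0 : ℝ) < (1 / N) ^ (m + 1) * exp (N * 0) := by positivity
      linarith

/-- With `le_kernel_zero`, this bounds the kernel of `V` by difference quotients of its primitive. -/
theorem kernel_zero_le {σ : ℝ} (hσ : 0 ≤ σ) {η : ℝ} (hη : 0 < η) (s : ℝ) :
    kernel σ 0 s ≤ exp (σ * η) / η * (kernel σ 1 (s + η) - kernel σ 1 s) := by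
  rw [kernel_sub]
  rcases lt_or_ge s 0 with hs | hs
  · rw [kernel_of_neg _ _ hs]
    have := intervalIntegral.integral_nonneg (μ := volume) (a := s) (b := s + η) (by linarith)
      fun x _ => kernel_nonneg σ 0 x
    positivity
  · have h1 : ∫ x in s..(s + η), exp (-σ * (s + η)) ≤ ∫ x in s..(s + η), kernel σ 0 x := by
      refine intervalIntegral.integral_mono_on (by linarith) (by simp)
        (intervalIntegrable_kernel _ _ _ _) fun x hx => ?_
      simp only [kernel, if_pos (hs.trans hx.1)]
      exact exp_le_exp.2 (by nlinarith [hx.2])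
    rw [intervalIntegral.integral_const, add_sub_cancel_left, smul_eq_mul] at h1
    calc kernel σ 0 s = exp (σ * η) / η * (η * exp (-σ * (s + η))) := by
          simp only [kernel, if_pos hs]
          rw [show -σ * s = σ * η + -σ * (s + η) by ring, exp_add]
          field_simp
      _ ≤ _ := by gcongr

theorem le_kernel_zero {σ : ℝ} (hσ : 0 ≤ σ) {η : ℝ} (hη : 0 < η) (s : ℝ) :
    exp (-σ * η) / η * (kernel σ 1 s - kernel σ 1 (s - η)) ≤ kernel σ 0 s := by
  rcases lt_or_ge s 0 with hs | hs
  · rw [kernel_of_neg _ _ hs, kernel_of_neg _ _ hs, kernel_of_neg _ _ (by linarith)]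
    simp
  · rw [kernel_sub]
    have h1 : ∫ x in (s - η)..s, kernel σ 0 x ≤ ∫ x in (s - η)..s, exp (-σ * (s - η)) := by
      refine intervalIntegral.integral_mono_on (by linarith)
        (intervalIntegrable_kernel _ _ _ _) (by simp) fun x hx => ?_
      simp only [kernel]
      split_ifs
      · exact exp_le_exp.2 (by nlinarith [hx.1])
      · positivity
    rw [intervalIntegral.integral_const, sub_sub_cancel, smul_eq_mul] at h1
    calc _ ≤ exp (-σ * η) / η * (η * exp (-σ * (s - η))) := by gcongr
      _ = kernel σ 0 s := by
          simp only [kernel, if_pos hs]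
          rw [show -σ * s = -σ * η + -σ * (s - η) by ring, exp_add]
          field_simp

theorem exists_derivative_eq (p : Polynomial ℝ) : ∃ q : Polynomial ℝ, q.derivative = p := by
  induction p using Polynomial.induction_on' with
  | add p q hp hq =>
    obtain ⟨p', rfl⟩ := hp
    obtain ⟨q', rfl⟩ := hq
    exact ⟨p' + q', by simp⟩
  | monomial n a =>
    refine ⟨Polynomial.monomial (n + 1) (a / (n + 1)), ?_⟩
    rw [Polynomial.derivative_monomial]
    congr 1
    push_cast
    field_simp

/-- `f` decays exponentially at `+∞`, with an exponential bound on the whole line. -/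
def ExpBounded (δ C : ℝ) (f : ℝ → ℝ) : Prop := ∀ s, |f s| ≤ C * exp (-δ * s)

/-- The primitive of a sum of a polynomial and an exponentially decreasing function is of the same
form. -/
theorem exists_primitive_eq_polynomial_add {δ C : ℝ} (hδ : 0 < δ) (k : ℝ → ℝ) (hk : Measurable k)
    (hki : ∀ a b, IntervalIntegrable k volume a b) (p : Polynomial ℝ)
    (hr : ExpBounded δ C fun s => k s - p.eval s) :
    ∃ (P : Polynomial ℝ), P.derivative = p ∧
      P.coeff 0 = ∫ x in Set.Ioi (0 : ℝ), (k x - p.eval x) ∧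
      ExpBounded δ (C / δ) (fun s => (∫ x in (0 : ℝ)..s, k x) - P.eval s) ∧
      ∀ s s', s ≤ s' → |((∫ x in (0 : ℝ)..s, k x) - P.eval s) -
        ((∫ x in (0 : ℝ)..s', k x) - P.eval s')| ≤ C * exp (-δ * s) * (s' - s) := by
  obtain ⟨P₀, hP₀⟩ := exists_derivative_eq p
  set r := fun s => k s - p.eval s with hrdef
  have hrm : Measurable r := hk.sub (p.continuous.measurable)
  have hC : 0 ≤ C := by
    have := (abs_nonneg _).trans (hr 0)
    simpa using this
  have hint : ∀ s, IntegrableOn (fun x => C * exp (-δ * x)) (Set.Ioi s) := fun s =>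
    (integrableOn_exp_mul_Ioi (by linarith) s).const_mul C
  have hri : ∀ s, IntegrableOn r (Set.Ioi s) := fun s =>
    (hint s).mono' hrm.aestronglyMeasurable (ae_of_all _ fun x => hr x)
  have hIoi : ∀ s, |∫ x in Set.Ioi s, r x| ≤ C / δ * exp (-δ * s) := fun s => by
    calc |∫ x in Set.Ioi s, r x| ≤ ∫ x in Set.Ioi s, C * exp (-δ * x) :=
          norm_integral_le_of_norm_le (f := r) (hint s) (ae_of_all _ fun x => hr x)
      _ = C / δ * exp (-δ * s) := by
          rw [integral_const_mul, integral_exp_mul_Ioi (by linarith)]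
          field_simp
  set c := ∫ x in Set.Ioi (0 : ℝ), r x with hc
  set P := P₀ - Polynomial.C (P₀.coeff 0) + Polynomial.C c with hP
  have hPd : P.derivative = p := by simp [hP, hP₀]
  have hrint : ∀ a b, IntervalIntegrable r volume a b := fun a b =>
    (hki a b).sub (p.continuous.intervalIntegrable a b)
  have hpint : ∀ a b, ∫ x in a..b, p.eval x = P.eval b - P.eval a := fun a b =>
    intervalIntegral.integral_eq_sub_of_hasDerivAt (fun x _ => by
      rw [← hPd]; exact P.hasDerivAt x) (p.continuous.intervalIntegrable _ _)
  have hk' : ∀ a b, ∫ x in a..b, k x = (∫ x in a..b, r x) + (P.eval b - P.eval a) := fun a b => by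
    rw [← hpint, ← intervalIntegral.integral_add (hrint a b) (p.continuous.intervalIntegrable _ _)]
    simp [hrdef]
  have hP0 : P.eval 0 = c := by simp [hP, Polynomial.coeff_zero_eq_eval_zero]
  have hK : ∀ s, (∫ x in (0 : ℝ)..s, k x) - P.eval s = -∫ x in Set.Ioi s, r x := fun s => by
    rw [hk', hP0, hc, ← intervalIntegral.integral_Ioi_sub_Ioi' (hri 0) (hri s)]
    ring
  refine ⟨P, hPd, by simp [hP], fun s => ?_, fun s s' hss => ?_⟩
  · show |(∫ x in (0 : ℝ)..s, k x) - P.eval s| ≤ _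
    rw [hK, abs_neg]; exact hIoi s
  · rw [hK, hK, neg_sub_neg, abs_sub_comm, intervalIntegral.integral_Ioi_sub_Ioi' (hri s) (hri s'),
      ← norm_eq_abs, ← abs_of_nonneg (sub_nonneg.2 hss)]
    refine intervalIntegral.norm_integral_le_of_norm_le_const fun x hx => (hr x).trans ?_
    rw [Set.uIoc_of_le hss] at hx
    gcongr ?_ * exp ?_
    nlinarith [hx.1]

/-- The leading coefficient of the polynomial part of the kernel of index `m + 1`. -/
def kernelLead (σ : ℝ) (m : ℕ) : ℝ :=
  if σ = 0 then 1 / ((m + 1).factorial : ℝ) else 1 / (σ * (m.factorial : ℝ))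

/-- `1` if `σ = 0`, and `0` otherwise: the growth of the kernels is faster for `σ = 0`. -/
def kernelShift (σ : ℝ) : ℕ := if σ = 0 then 1 else 0

/-- The kernels are polynomials up to exponentially decreasing functions. -/
theorem exists_kernel_eq_polynomial_add {σ δ : ℝ} (hσ : 0 ≤ σ) (hδ : 0 < δ) (hδσ : 0 < σ → δ ≤ σ)
    (m : ℕ) : ∃ (p : Polynomial ℝ) (C : ℝ), p.natDegree ≤ m + kernelShift σ ∧
      p.coeff (m + kernelShift σ) = kernelLead σ m ∧
      ExpBounded δ C (fun s => kernel σ (m + 1) s - p.eval s) ∧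
      ∀ s s', s ≤ s' → |(kernel σ (m + 1) s - p.eval s) - (kernel σ (m + 1) s' - p.eval s')| ≤
        C * exp (-δ * s) * (s' - s) := by
  have key : ∀ (p P : Polynomial ℝ) (N : ℕ), P.derivative = p → p.natDegree ≤ N →
      P.natDegree ≤ N + 1 ∧ P.coeff (N + 1) = p.coeff N / (N + 1) := by
    rintro _ P N rfl hN
    refine ⟨?_, ?_⟩
    · refine Polynomial.natDegree_le_iff_coeff_eq_zero.2 fun k hk => ?_
      obtain ⟨j, rfl⟩ : ∃ j, k = j + 1 := ⟨k - 1, by omega⟩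
      have := Polynomial.coeff_eq_zero_of_natDegree_lt (hN.trans_lt (show N < j by omega))
      rw [Polynomial.coeff_derivative] at this
      exact (mul_eq_zero.1 this).resolve_right (by positivity)
    · rw [Polynomial.coeff_derivative]
      field_simp
  -- bounds obtained with different constants are merged into one
  have merge : ∀ (C : ℝ) (f : ℝ → ℝ), 0 ≤ C → ExpBounded δ (C / δ) f →
      (∀ s s', s ≤ s' → |f s - f s'| ≤ C * exp (-δ * s) * (s' - s)) →
      ExpBounded δ (C + C / δ) f ∧
      ∀ s s', s ≤ s' → |f s - f s'| ≤ (C + C / δ) * exp (-δ * s) * (s' - s) := by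
    intro C f hC h1 h2
    have : 0 ≤ C / δ := by positivity
    refine ⟨fun s => (h1 s).trans ?_, fun s s' h => (h2 s s' h).trans ?_⟩
    · gcongr; linarith
    · have := sub_nonneg.2 h
      gcongr; linarith
  have hCnn : ∀ (C : ℝ) (f : ℝ → ℝ), ExpBounded δ C f → 0 ≤ C := fun C f h => by
    simpa using (abs_nonneg _).trans (h 0)
  induction m with
  | zero =>
    rcases hσ.eq_or_lt with rfl | hσ'
    · have h0 : ExpBounded δ 1 fun s => kernel 0 0 s - (1 : Polynomial ℝ).eval s := by
        intro s
        simp only [kernel, neg_zero, zero_mul, exp_zero, Polynomial.eval_one, one_mul]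
        split_ifs with h
        · simp [exp_nonneg]
        · simp; nlinarith
      obtain ⟨P, hP, -, h1, h2⟩ := exists_primitive_eq_polynomial_add hδ _ (measurable_kernel 0 0)
        (intervalIntegrable_kernel 0 0) 1 h0
      obtain ⟨h3, h4⟩ := merge _ _ zero_le_one h1 h2
      obtain ⟨h5, h6⟩ := key _ _ 0 hP (by simp)
      refine ⟨P, _, ?_, ?_, h3, h4⟩
      · simpa [kernelShift] using h5
      · simpa [kernelShift, kernelLead] using h6
    · have h0 : ExpBounded δ 1 fun s => kernel σ 0 s - (0 : Polynomial ℝ).eval s := by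
        intro s
        simp only [kernel, Polynomial.eval_zero, one_mul, sub_zero]
        split_ifs with h
        · rw [abs_of_nonneg (exp_nonneg _)]
          exact exp_le_exp.2 (by nlinarith [hδσ hσ'])
        · simp [exp_nonneg]
      obtain ⟨P, hP, hP0, h1, h2⟩ := exists_primitive_eq_polynomial_add hδ _ (measurable_kernel σ 0)
        (intervalIntegrable_kernel σ 0) 0 h0
      obtain ⟨h3, h4⟩ := merge _ _ zero_le_one h1 h2
      refine ⟨P, _, ?_, ?_, h3, h4⟩
      · simp [kernelShift, hσ'.ne', Polynomial.derivative_eq_zero.1 hP]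
      · simp only [kernelShift, hσ'.ne', kernelLead, if_false, add_zero, hP0, Polynomial.eval_zero,
          sub_zero, Nat.factorial_zero, Nat.cast_one, mul_one]
        rw [setIntegral_congr_fun (g := fun s => exp (-σ * s)) measurableSet_Ioi
          (fun x hx => by simp [kernel, (Set.mem_Ioi.1 hx).le]), integral_exp_mul_Ioi (by linarith)]
        simp
  | succ m ih =>
    obtain ⟨p, C, hp1, hp2, h3, -⟩ := ih
    obtain ⟨P, hP, -, h1, h2⟩ := exists_primitive_eq_polynomial_add hδ _
      (measurable_kernel σ (m + 1)) (intervalIntegrable_kernel σ (m + 1)) p h3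
    obtain ⟨h3, h4⟩ := merge _ _ (hCnn _ _ h3) h1 h2
    obtain ⟨h5, h6⟩ := key _ _ _ hP hp1
    refine ⟨P, _, by omega, ?_, h3, h4⟩
    rw [show m + 1 + kernelShift σ = m + kernelShift σ + 1 by ring, h6, hp2]
    unfold kernelLead kernelShift
    split_ifs with h
    · simp only [Nat.factorial_succ (m + 1)]
      push_cast
      field_simp
    · simp only [Nat.factorial_succ m]
      simp only [add_zero]
      push_cast
      field_simp

/-! ### Blocks of coordinates -/

section Blocks

variable {F : Type u} [RCLike F]

/-- The power of a Haar measure on `F`, as a measure on `ι → F`. -/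
abbrev power (ι : Type*) [Fintype ι] (μ : Measure F) : Measure (ι → F) := Measure.pi fun _ => μ

/-- The modulus of the norm form `N(w)` of a coordinate `w` with values in `F` or in a quadratic
extension of `F`, in terms of the components of `w`. -/
def coordNorm {ι : Type*} [Fintype ι] (w : ι → F) : ℝ :=
  (∑ i, ‖w i‖ ^ 2) ^ ((finrank ℝ F * Fintype.card ι : ℕ) / 2 : ℝ)

/-- The modulus of the norm form of the coordinate whose components are the `t i`, for `i ∈ s`. -/
def blockNorm {n : ℕ} (s : Finset (Fin n)) (t : Fin n → F) : ℝ := coordNorm fun i : s => t i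

/-- The projection which replaces the coordinates in `s` by zero. -/
def zeroOn {n : ℕ} (s : Finset (Fin n)) (t : Fin n → F) : Fin n → F :=
  fun i => if i ∈ s then 0 else t i

theorem coordNorm_nonneg {ι : Type*} [Fintype ι] (w : ι → F) : 0 ≤ coordNorm w := by
  unfold coordNorm; positivity

theorem blockNorm_nonneg {n : ℕ} (s : Finset (Fin n)) (t : Fin n → F) : 0 ≤ blockNorm s t :=
  coordNorm_nonneg _

theorem continuous_coordNorm {ι : Type*} [Fintype ι] : Continuous (coordNorm (F := F) (ι := ι)) :=
  Continuous.rpow_const (by fun_prop) fun _ => Or.inr (by positivity)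

theorem continuous_blockNorm {n : ℕ} (s : Finset (Fin n)) : Continuous (blockNorm (F := F) s) :=
  continuous_coordNorm.comp (by fun_prop)

theorem continuous_zeroOn {n : ℕ} (s : Finset (Fin n)) : Continuous (zeroOn (F := F) s) := by
  refine continuous_pi fun i => ?_
  unfold zeroOn
  split_ifs <;> fun_prop

theorem blockNorm_congr {n : ℕ} {s : Finset (Fin n)} {t t' : Fin n → F} (h : ∀ i ∈ s, t i = t' i) :
    blockNorm s t = blockNorm s t' := by
  unfold blockNorm
  congr 1
  ext i
  exact h i i.2

theorem blockNorm_zeroOn {n : ℕ} {s s' : Finset (Fin n)} (h : Disjoint s s') (t : Fin n → F) :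
    blockNorm s (zeroOn s' t) = blockNorm s t :=
  blockNorm_congr fun i hi => by simp [zeroOn, disjoint_left.1 h hi]

theorem zeroOn_zeroOn {n : ℕ} (s s' : Finset (Fin n)) (t : Fin n → F) :
    zeroOn s (zeroOn s' t) = zeroOn (s ∪ s') t := by
  ext i
  simp only [zeroOn, mem_union]
  split_ifs <;> tauto

theorem finrank_pos (F : Type u) [RCLike F] : 0 < finrank ℝ F := Module.finrank_pos

theorem coordNorm_le_iff {ι : Type*} [Fintype ι] [Nonempty ι] (w : ι → F) {ρ : ℝ} (hρ : 0 ≤ ρ) :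
    coordNorm w ≤ ρ ^ (finrank ℝ F * Fintype.card ι) ↔ ∑ i, ‖w i‖ ^ 2 ≤ ρ ^ 2 := by
  have hd : 0 < finrank ℝ F * Fintype.card ι := Nat.mul_pos (finrank_pos F) Fintype.card_pos
  set d := finrank ℝ F * Fintype.card ι with hd'
  have : ρ ^ d = (ρ ^ 2) ^ ((d : ℕ) / 2 : ℝ) := by
    rw [← rpow_natCast ρ 2, ← rpow_mul hρ, ← rpow_natCast]
    congr 1
    push_cast
    ring
  rw [coordNorm, ← hd', this]
  exact rpow_le_rpow_iff (by positivity) (by positivity) (by positivity)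

variable (μ : Measure F) [μ.IsAddHaarMeasure]

open scoped Pointwise in
theorem measure_coordNorm_le {ι : Type*} [Fintype ι] [Nonempty ι] {ρ : ℝ} (hρ : 0 < ρ) :
    (power ι μ) {w | coordNorm w ≤ ρ ^ (finrank ℝ F * Fintype.card ι)} =
      .ofReal (ρ ^ (finrank ℝ F * Fintype.card ι)) *
        (power ι μ) {w | ∑ i, ‖w i‖ ^ 2 ≤ 1} := by
  have h1 : {w : ι → F | coordNorm w ≤ ρ ^ (finrank ℝ F * Fintype.card ι)} =
      ρ • {w : ι → F | ∑ i, ‖w i‖ ^ 2 ≤ 1} := by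
    ext w
    rw [Set.mem_smul_set_iff_inv_smul_mem₀ hρ.ne']
    simp only [Set.mem_ofPred_eq, coordNorm_le_iff w hρ.le, Pi.smul_apply, norm_smul, mul_pow,
      ← mul_sum]
    rw [norm_eq_abs, sq_abs, inv_pow, inv_mul_le_iff₀ (by positivity), mul_one]
  rw [h1, Measure.addHaar_smul, abs_of_nonneg (by positivity)]
  congr 3
  rw [finrank_pi_fintype]
  simp [mul_comm]

theorem measure_unit_lt_top (ι : Type*) [Fintype ι] :
    (power ι μ) {w | ∑ i, ‖w i‖ ^ 2 ≤ 1} < ⊤ := by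
  refine (measure_mono fun w hw => ?_).trans_lt
    (measure_closedBall_lt_top (x := (0 : ι → F)) (r := 1))
  rw [mem_closedBall_zero_iff, pi_norm_le_iff_of_nonneg zero_le_one]
  intro i
  have := (single_le_sum (f := fun i => ‖w i‖ ^ 2) (fun _ _ => by positivity)
    (mem_univ i)).trans hw
  nlinarith [norm_nonneg (w i)]

/-- By homogeneity of the Haar measure, the modulus of the norm form is uniformly distributed on
the unit ball. -/
theorem map_coordNorm (ι : Type*) [Fintype ι] [Nonempty ι] :
    ((power ι μ).restrict {w | coordNorm w ≤ 1}).map coordNorm =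
      ((power ι μ) {w | ∑ i, ‖w i‖ ^ 2 ≤ 1}) • volume.restrict (Set.Ioc 0 1) := by
  have hd : 0 < finrank ℝ F * Fintype.card ι := Nat.mul_pos (finrank_pos F) Fintype.card_pos
  have hpos : ∀ r : ℝ, 0 < r → (power ι μ) {w | coordNorm w ≤ r} =
      ENNReal.ofReal r * (power ι μ) {w | ∑ i, ‖w i‖ ^ 2 ≤ 1} := by
    intro r hr
    obtain ⟨ρ, hρ, rfl⟩ : ∃ ρ : ℝ, 0 < ρ ∧ ρ ^ (finrank ℝ F * Fintype.card ι) = r :=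
      ⟨r ^ (((finrank ℝ F * Fintype.card ι : ℕ) : ℝ)⁻¹), by positivity,
        rpow_inv_natCast_pow hr.le hd.ne'⟩
    exact measure_coordNorm_le μ hρ
  have h1 := measure_unit_lt_top μ ι
  have hfin : IsFiniteMeasure ((power ι μ).restrict
      {w : ι → F | coordNorm w ≤ 1}) := by
    refine ⟨?_⟩
    rw [Measure.restrict_apply_univ, hpos 1 one_pos]
    simpa using h1
  have hm := (continuous_coordNorm (F := F) (ι := ι)).measurable
  refine Measure.ext_of_Iic _ _ fun r => ?_
  rw [Measure.map_apply hm measurableSet_Iic, Measure.restrict_apply (hm measurableSet_Iic),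
    Measure.smul_apply, Measure.restrict_apply measurableSet_Iic, smul_eq_mul]
  have h2 : coordNorm ⁻¹' Set.Iic r ∩ {w : ι → F | coordNorm w ≤ 1} =
      {w | coordNorm w ≤ min r 1} := by
    ext w; simp
  have h3 : Set.Iic r ∩ Set.Ioc 0 1 = Set.Ioc 0 (min r 1) := by
    ext x; simp only [Set.mem_inter_iff, Set.mem_Iic, Set.mem_Ioc, le_min_iff]; tauto
  rw [h2, h3, volume_Ioc, sub_zero]
  rcases lt_or_ge 0 r with hr | hr
  · rw [hpos _ (lt_min hr one_pos), mul_comm]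
  · rw [min_eq_left (by linarith), ENNReal.ofReal_of_nonpos hr, mul_zero]
    refine measure_mono_null (t := {0}) (fun w hw => ?_)
      (by rw [Measure.pi_singleton]; exact prod_eq_zero (mem_univ (Classical.arbitrary ι))
            (measure_singleton _))
    have h4 : coordNorm w ≤ (0 : ℝ) ^ (finrank ℝ F * Fintype.card ι) := by
      rw [zero_pow hd.ne']; exact hw.trans hr
    rw [coordNorm_le_iff w le_rfl, zero_pow two_ne_zero] at h4
    ext i
    have := (single_le_sum (f := fun i => ‖w i‖ ^ 2) (fun _ _ => by positivity)
      (mem_univ i)).trans h4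
    simpa using this.antisymm (by positivity)

/-- The extension by zero of a vector whose coordinates are indexed by the complement of `s`. -/
def extendZero {n : ℕ} (s : Finset (Fin n)) (y : {i : Fin n // i ∉ s} → F) : Fin n → F :=
  fun i => if h : i ∈ s then 0 else y ⟨i, h⟩

theorem continuous_extendZero {n : ℕ} (s : Finset (Fin n)) : Continuous (extendZero (F := F) s) := by
  refine continuous_pi fun i => ?_
  by_cases h : i ∈ s <;> simp only [extendZero, h, dite_true, dite_false] <;> fun_prop

theorem extendZero_restrict {n : ℕ} (s : Finset (Fin n)) (t : Fin n → F) :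
    extendZero s (fun i => t i) = zeroOn s t := by
  ext i
  by_cases h : i ∈ s <;> simp [extendZero, zeroOn, h]

/-- The measure `m` is, for the block `s` of coordinates, the product of the distribution of the
other coordinates and the uniform distribution of the modulus of the norm form of the block. -/
def SplitsBlock {n : ℕ} (m : Measure (Fin n → F)) (s : Finset (Fin n)) : Prop :=
  m.map (fun t => (zeroOn s t, blockNorm s t)) =
    (m.map (zeroOn s)).prod (volume.restrict (Set.Ioc 0 1))

theorem measurePreserving_blocks {n : ℕ} (s : Finset (Fin n)) :
    MeasurePreserving (MeasurableEquiv.piEquivPiSubtypeProd (fun _ : Fin n => F) (· ∈ s))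
      (power _ μ) ((power s μ).prod (power {i // i ∉ s} μ)) := by
  convert measurePreserving_piEquivPiSubtypeProd (fun _ : Fin n => μ) (· ∈ s)

theorem splitsBlock_restrict {n : ℕ} {s : Finset (Fin n)} (hs : s.Nonempty) {T : Set (Fin n → F)}
    (hT : MeasurableSet T) (hTs : ∀ t, zeroOn s t ∈ T ↔ t ∈ T) :
    SplitsBlock ((power (Fin n) μ).restrict ({t | blockNorm s t ≤ 1} ∩ T)) s := by
  have : Nonempty s := hs.to_subtype
  set Φ := MeasurableEquiv.piEquivPiSubtypeProd (fun _ => F) (· ∈ s)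
  set ν := power s μ
  set ν' := power {i // i ∉ s} μ
  have hΦ : MeasurePreserving Φ (power _ μ) (ν.prod ν') := measurePreserving_blocks μ s
  set j := extendZero (F := F) s
  have hjm : Measurable j := (continuous_extendZero s).measurable
  have hz : ∀ t, zeroOn s t = j (Φ t).2 := fun t => (extendZero_restrict s t).symm
  set B : Set (s → F) := {w | coordNorm w ≤ 1}
  set T' := j ⁻¹' T
  have hset : {t | blockNorm s t ≤ 1} ∩ T = Φ ⁻¹' (B ×ˢ T') := by
    ext t
    rw [Set.mem_inter_iff, Set.mem_preimage, Set.mem_prod, Set.mem_preimage, ← hz, hTs]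
    rfl
  have hBm : MeasurableSet B := (continuous_coordNorm.measurable measurableSet_Iic)
  have hmp : MeasurePreserving Φ ((power (Fin n) μ).restrict
      ({t | blockNorm s t ≤ 1} ∩ T)) ((ν.restrict B).prod (ν'.restrict T')) := by
    rw [hset, Measure.prod_restrict]
    exact hΦ.restrict_preimage (hBm.prod (hjm hT))
  set c := ν {w | ∑ i, ‖w i‖ ^ 2 ≤ 1}
  have hmap : (ν.restrict B).map coordNorm = c • volume.restrict (Set.Ioc 0 1) :=
    map_coordNorm μ s
  have hcm := (continuous_coordNorm (F := F) (ι := s)).measurable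
  have hBc : (ν.restrict B) Set.univ = c := by
    rw [← Set.preimage_univ, ← Measure.map_apply hcm MeasurableSet.univ, hmap]
    simp
  have h1 : Measure.map (fun t => (zeroOn s t, blockNorm s t))
      ((power _ μ).restrict ({t | blockNorm s t ≤ 1} ∩ T)) =
      ((ν'.restrict T').map j).prod (c • volume.restrict (Set.Ioc 0 1)) := by
    rw [← hmap, Measure.map_prod_map _ _ hjm hcm, ← Measure.prod_swap, ← hmp.map_eq,
      Measure.map_map (by fun_prop) Φ.measurable, Measure.map_map (by fun_prop) (by fun_prop)]
    rfl
  have h2 : Measure.map (zeroOn s)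
      ((power _ μ).restrict ({t | blockNorm s t ≤ 1} ∩ T)) =
      c • (ν'.restrict T').map j := by
    have : zeroOn s = j ∘ Prod.snd ∘ Φ := funext hz
    rw [this, ← Measure.map_map hjm (by fun_prop), ← Measure.map_map (by fun_prop) Φ.measurable,
      hmp.map_eq, Measure.map_snd_prod, hBc, Measure.map_smul]
  rw [SplitsBlock, h1, h2, Measure.prod_smul_right, Measure.prod_smul_left]

/-- A product of closed balls, in the blocks `e P` for `P ∈ S` and in the remaining coordinates. -/
def blockRegion {ι : Type*} {n : ℕ} (F : Type u) [RCLike F] (S : Finset ι) (e : ι → Finset (Fin n))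
    (R : ℝ) : Set (Fin n → F) :=
  {t | (∀ P ∈ S, blockNorm (e P) t ≤ 1) ∧ ∀ i, (∀ P ∈ S, i ∉ e P) → ‖t i‖ ≤ R}

theorem measurableSet_blockRegion {ι : Type*} {n : ℕ} (S : Finset ι) (e : ι → Finset (Fin n))
    (R : ℝ) : MeasurableSet (blockRegion F S e R) := by
  refine IsClosed.measurableSet ?_
  refine IsClosed.inter (s₁ := {t | ∀ P ∈ S, blockNorm (e P) t ≤ 1})
    (s₂ := {t | ∀ i, (∀ P ∈ S, i ∉ e P) → ‖t i‖ ≤ R}) ?_ ?_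
  · simp only [Set.ofPred_forall]
    exact isClosed_biInter fun P _ => isClosed_le (continuous_blockNorm _) continuous_const
  · simp only [Set.ofPred_forall]
    exact isClosed_iInter fun i => isClosed_iInter fun _ => isClosed_le (by fun_prop)
      continuous_const

theorem splitsBlock_blockRegion {ι : Type*} [DecidableEq ι] {n : ℕ} {S : Finset ι}
    {e : ι → Finset (Fin n)} (hdisj : (S : Set ι).PairwiseDisjoint e) {R : ℝ} {P : ι} (hP : P ∈ S)
    (he : (e P).Nonempty) :
    SplitsBlock ((power (Fin n) μ).restrict (blockRegion F S e R)) (e P) := by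
  set T : Set (Fin n → F) := {t | (∀ P' ∈ S, P' ≠ P → blockNorm (e P') t ≤ 1) ∧
    ∀ i, (∀ P ∈ S, i ∉ e P) → ‖t i‖ ≤ R} with hTdef
  have h1 : blockRegion F S e R = {t | blockNorm (e P) t ≤ 1} ∩ T := by
    ext t
    simp only [blockRegion, hTdef, Set.mem_inter_iff, Set.mem_ofPred_eq]
    constructor
    · rintro ⟨h, h'⟩
      exact ⟨h P hP, fun P' hP' _ => h P' hP', h'⟩
    · rintro ⟨h, h', h''⟩
      refine ⟨fun P' hP' => ?_, h''⟩
      rcases eq_or_ne P' P with rfl | hne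
      · exact h
      · exact h' P' hP' hne
  rw [h1]
  refine splitsBlock_restrict μ he (IsClosed.measurableSet ?_) fun t => ?_
  · refine IsClosed.inter (s₁ := {t | ∀ P' ∈ S, P' ≠ P → blockNorm (e P') t ≤ 1})
      (s₂ := {t | ∀ i, (∀ P ∈ S, i ∉ e P) → ‖t i‖ ≤ R}) ?_ ?_
    · simp only [Set.ofPred_forall]
      exact isClosed_biInter fun P _ => isClosed_iInter fun _ =>
        isClosed_le (continuous_blockNorm _) continuous_const
    · simp only [Set.ofPred_forall]
      exact isClosed_iInter fun i => isClosed_iInter fun _ => isClosed_le (by fun_prop)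
        continuous_const
  · refine and_congr (forall₂_congr fun P' hP' => forall_congr' fun hne => ?_)
      (forall₂_congr fun i hi => ?_)
    · rw [blockNorm_zeroOn (hdisj hP' hP hne)]
    · simp [zeroOn, hi P hP]

theorem measure_blockRegion_lt_top {ι : Type*} {n : ℕ} (S : Finset ι) (e : ι → Finset (Fin n))
    (R : ℝ) : (power (Fin n) μ) (blockRegion F S e R) < ⊤ := by
  refine (measure_mono fun t ht => ?_).trans_lt
    (measure_closedBall_lt_top (x := (0 : Fin n → F)) (r := max R 1))
  rw [mem_closedBall_zero_iff, pi_norm_le_iff_of_nonneg (by positivity)]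
  intro i
  by_cases hi : ∀ P ∈ S, i ∉ e P
  · exact (ht.2 i hi).trans (le_max_left _ _)
  · push Not at hi
    obtain ⟨P, hP, hiP⟩ := hi
    have : Nonempty (e P) := ⟨⟨i, hiP⟩⟩
    have h1 := ht.1 P hP
    rw [blockNorm, ← one_pow (finrank ℝ F * Fintype.card (e P)),
      coordNorm_le_iff _ zero_le_one] at h1
    have := (single_le_sum (fun _ _ => by positivity)
      (mem_univ ⟨i, hiP⟩)).trans h1
    have h2 : ‖t i‖ ≤ 1 := by nlinarith [norm_nonneg (t i)]
    exact h2.trans (le_max_right _ _)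

section Splits

variable {n : ℕ} {m : Measure (Fin n → F)} {s : Finset (Fin n)}

theorem measurable_zeroOn_blockNorm (s : Finset (Fin n)) :
    Measurable fun t : Fin n → F => (zeroOn s t, blockNorm s t) :=
  ((continuous_zeroOn s).prodMk (continuous_blockNorm s)).measurable

theorem SplitsBlock.lintegral_eq [SFinite m] (h : SplitsBlock m s) {G : (Fin n → F) → ℝ → ENNReal}
    (hG : Measurable (Function.uncurry G)) :
    ∫⁻ t, G (zeroOn s t) (blockNorm s t) ∂m =
      ∫⁻ t, (∫⁻ v in Set.Ioc (0 : ℝ) 1, G (zeroOn s t) v) ∂m := by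
  have h1 := lintegral_map hG (measurable_zeroOn_blockNorm (F := F) s) (μ := m)
  rw [h, lintegral_prod _ hG.aemeasurable, lintegral_map _ (continuous_zeroOn s).measurable] at h1
  · exact h1.symm
  · exact Measurable.lintegral_prod_right hG

theorem SplitsBlock.integral_eq [SFinite m] (h : SplitsBlock m s) {G : (Fin n → F) → ℝ → ℝ}
    (hG : Measurable (Function.uncurry G))
    (hi : Integrable (fun t => G (zeroOn s t) (blockNorm s t)) m) :
    ∫ t, G (zeroOn s t) (blockNorm s t) ∂m =
      ∫ t, (∫ v in Set.Ioc (0 : ℝ) 1, G (zeroOn s t) v) ∂m := by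
  have hm := measurable_zeroOn_blockNorm (F := F) s
  have h1 := integral_map (μ := m) hm.aemeasurable (f := Function.uncurry G)
    hG.aestronglyMeasurable
  have h2 : Integrable (Function.uncurry G) (m.map fun t => (zeroOn s t, blockNorm s t)) :=
    (integrable_map_measure hG.aestronglyMeasurable hm.aemeasurable).2 hi
  rw [h] at h1 h2
  rw [integral_prod _ h2, integral_map (continuous_zeroOn s).measurable.aemeasurable] at h1
  · exact h1.symm
  · exact (hG.stronglyMeasurable.integral_prod_right).aestronglyMeasurable

theorem SplitsBlock.ae_mem [IsFiniteMeasure m] (h : SplitsBlock m s) :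
    ∀ᵐ t ∂m, blockNorm s t ∈ Set.Ioc (0 : ℝ) 1 := by
  have hm := (continuous_blockNorm (F := F) s).measurable
  rw [← ae_map_iff (p := fun v => v ∈ Set.Ioc (0 : ℝ) 1) hm.aemeasurable measurableSet_Ioc]
  have : m.map (blockNorm s) = ((m.map fun t => (zeroOn s t, blockNorm s t))).map Prod.snd := by
    rw [Measure.map_map measurable_snd (measurable_zeroOn_blockNorm s)]
    rfl
  rw [this, h, Measure.map_snd_prod]
  exact Measure.ae_smul_measure (ae_restrict_mem measurableSet_Ioc) _

/-- The moduli of the norm forms of disjoint blocks are independent, uniformly distributed, and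
independent of the other coordinates. -/
theorem lintegral_mul_prod_blockNorm [SFinite m] {ι : Type*} [DecidableEq ι] (S : Finset ι)
    {e : ι → Finset (Fin n)} (hdisj : (S : Set ι).PairwiseDisjoint e)
    (h : ∀ P ∈ S, SplitsBlock m (e P)) (φ : ι → ℝ → ENNReal) (hφ : ∀ P, Measurable (φ P))
    {g : (Fin n → F) → ENNReal} (hg : Measurable g) (hgS : ∀ P ∈ S, ∀ t, g (zeroOn (e P) t) = g t) :
    ∫⁻ t, g t * ∏ P ∈ S, φ P (blockNorm (e P) t) ∂m =
      (∫⁻ t, g t ∂m) * ∏ P ∈ S, ∫⁻ v in Set.Ioc (0 : ℝ) 1, φ P v := by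
  induction S using Finset.induction_on with
  | empty => simp
  | insert P S hP ih =>
    have hd : ∀ P' ∈ S, Disjoint (e P') (e P) := fun P' hP' =>
      hdisj (by simp [hP']) (by simp) (fun hne => hP (hne ▸ hP'))
    have hpm : Measurable fun t : Fin n → F => g t * ∏ P ∈ S, φ P (blockNorm (e P) t) :=
      hg.mul (measurable_prod _ fun P _ => (hφ P).comp (continuous_blockNorm _).measurable)
    have h1 := (h P (by simp)).lintegral_eq
      (G := fun t v => φ P v * (g t * ∏ P ∈ S, φ P (blockNorm (e P) t)))
      (((hφ P).comp measurable_snd).mul (hpm.comp measurable_fst))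
    have h2 : ∀ t : Fin n → F, ∏ P' ∈ S, φ P' (blockNorm (e P') (zeroOn (e P) t)) =
        ∏ P' ∈ S, φ P' (blockNorm (e P') t) := fun t =>
      prod_congr rfl fun P' hP' => by rw [blockNorm_zeroOn (hd P' hP')]
    simp only [h2, hgS P (by simp)] at h1
    simp only [prod_insert hP]
    rw [lintegral_congr fun t => mul_left_comm (g t) _ _, h1]
    simp_rw [lintegral_mul_const _ (hφ P)]
    rw [lintegral_const_mul _ hpm, ih (hdisj.subset (by simp)) (fun P' hP' => h P' (by simp [hP']))
      fun P' hP' => hgS P' (by simp [hP'])]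
    ring

theorem lintegral_prod_blockNorm [SFinite m] {ι : Type*} [DecidableEq ι] (S : Finset ι)
    {e : ι → Finset (Fin n)} (hdisj : (S : Set ι).PairwiseDisjoint e)
    (h : ∀ P ∈ S, SplitsBlock m (e P)) (φ : ι → ℝ → ENNReal) (hφ : ∀ P, Measurable (φ P)) :
    ∫⁻ t, ∏ P ∈ S, φ P (blockNorm (e P) t) ∂m =
      m Set.univ * ∏ P ∈ S, ∫⁻ v in Set.Ioc (0 : ℝ) 1, φ P v := by
  simpa using lintegral_mul_prod_blockNorm S hdisj h φ hφ (g := fun _ => 1) measurable_const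
    fun _ _ _ => rfl

theorem integrable_prod_blockNorm_rpow [IsFiniteMeasure m] {ι : Type*} [DecidableEq ι]
    (S : Finset ι) {e : ι → Finset (Fin n)} (hdisj : (S : Set ι).PairwiseDisjoint e)
    (h : ∀ P ∈ S, SplitsBlock m (e P)) (a : ι → ℝ) (ha : ∀ P ∈ S, -1 < a P) :
    Integrable (fun t => ∏ P ∈ S, blockNorm (e P) t ^ a P) m := by
  have hm : Measurable fun t : Fin n → F => ∏ P ∈ S, blockNorm (e P) t ^ a P :=
    measurable_prod _ fun P _ => (continuous_blockNorm _).measurable.pow_const _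
  refine ⟨hm.aestronglyMeasurable, ?_⟩
  have h1 : ∀ t : Fin n → F, ‖∏ P ∈ S, blockNorm (e P) t ^ a P‖ₑ =
      ∏ P ∈ S, ENNReal.ofReal (blockNorm (e P) t ^ a P) := fun t => by
    rw [enorm_of_nonneg (prod_nonneg fun P _ => rpow_nonneg (blockNorm_nonneg _ _) _),
      ENNReal.ofReal_prod_of_nonneg fun P _ => rpow_nonneg (blockNorm_nonneg _ _) _]
  rw [HasFiniteIntegral]
  simp only [h1]
  rw [lintegral_prod_blockNorm S hdisj h (fun P v => ENNReal.ofReal (v ^ a P)) fun P => by fun_prop]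
  refine ENNReal.mul_lt_top (measure_lt_top _ _) (ENNReal.prod_lt_top fun P hP => ?_)
  have h2 := (intervalIntegral.intervalIntegrable_rpow' (a := 0) (b := 1) (ha P hP)).1
  exact (lintegral_ofReal_le_lintegral_enorm _).trans_lt h2.hasFiniteIntegral

end Splits

end Blocks

/-! ### Asymptotic expansion of local integrals -/

theorem exists_factor_le (δ K : ℝ) (hδ : 0 < δ) (hK : 0 ≤ K) (q : Polynomial ℝ) :
    ∃ C, 0 ≤ C ∧ ∀ s ≤ K, |q.eval s| ≤ C * exp (-δ * s) := by
  induction q using Polynomial.induction_on' with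
  | add p q hp hq =>
    obtain ⟨C, hC, h⟩ := hp
    obtain ⟨C', hC', h'⟩ := hq
    refine ⟨C + C', by positivity, fun s hs => ?_⟩
    rw [Polynomial.eval_add, add_mul]
    exact (abs_add_le _ _).trans (add_le_add (h s hs) (h' s hs))
  | monomial k c =>
    refine ⟨|c| * (k.factorial / δ ^ k * exp (2 * δ * K)), by positivity, fun s hs => ?_⟩
    have h1 := pow_div_factorial_le_exp (δ * |s|) (by positivity) k
    have h2 : |s| ≤ 2 * K - s := by
      rcases abs_cases s with h | h <;> linarith
    have h3 : exp (δ * |s|) ≤ exp (2 * δ * K) * exp (-δ * s) := by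
      rw [← exp_add]
      exact exp_le_exp.2 (by nlinarith)
    rw [Polynomial.eval_monomial, abs_mul, abs_pow]
    rw [mul_pow, div_le_iff₀ (by positivity)] at h1
    have h4 : |s| ^ k ≤ k.factorial / δ ^ k * exp (δ * |s|) := by
      rw [div_mul_eq_mul_div, le_div_iff₀ (by positivity)]
      linarith
    calc |c| * |s| ^ k ≤ |c| * (k.factorial / δ ^ k *
          (exp (2 * δ * K) * exp (-δ * s))) := by
          gcongr; exact h4.trans (by gcongr)
      _ = _ := by ring

/-- On the half-line `s ≤ K`, the function `φ` and its difference quotients are bounded by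
`C e ^ (-δ s)`. -/
def ExpLipschitz (δ K C : ℝ) (φ : ℝ → ℝ) : Prop :=
  (∀ s ≤ K, |φ s| ≤ C * exp (-δ * s)) ∧
    ∀ s s', s ≤ s' → s' ≤ K → |φ s - φ s'| ≤ C * exp (-δ * s) * (s' - s)

theorem exists_expLipschitz_polynomial {δ K : ℝ} (hδ : 0 < δ) (hK : 0 ≤ K) (q : Polynomial ℝ) :
    ∃ C, ExpLipschitz δ K C fun s => q.eval s := by
  obtain ⟨C, hC, h⟩ := exists_factor_le δ K hδ hK q
  obtain ⟨C', hC', h'⟩ := exists_factor_le δ K hδ hK q.derivative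
  refine ⟨C + C', fun s hs => (h s hs).trans (by gcongr; linarith), fun s s' hss hs' => ?_⟩
  have h1 := Convex.norm_image_sub_le_of_norm_hasDerivWithin_le (f := fun s => q.eval s)
    (f' := fun s => q.derivative.eval s) (s := Set.Icc s s') (C := C' * exp (-δ * s))
    (x := s') (y := s)
    (fun x _ => (q.hasDerivAt x).hasDerivWithinAt)
    (fun x hx => (h' x (hx.2.trans hs')).trans (by gcongr ?_ * exp ?_; nlinarith [hx.1]))
    (convex_Icc s s') (Set.right_mem_Icc.2 hss) (Set.left_mem_Icc.2 hss)
  rw [norm_eq_abs, norm_eq_abs, abs_sub_comm s s', abs_of_nonneg (sub_nonneg.2 hss)] at h1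
  have := sub_nonneg.2 hss
  exact h1.trans (by gcongr; linarith)

theorem polynomial_eval_add_eq_sum (p : Polynomial ℝ) {N : ℕ} (hN : p.natDegree ≤ N) (T s : ℝ) :
    p.eval (T + s) = ∑ l ∈ range (N + 1), (Polynomial.hasseDeriv l p).eval s * T ^ l := by
  rw [add_comm, add_comm s T, ← Polynomial.taylor_eval s p T, Polynomial.eval_eq_sum_range' (n := N + 1)
    (by rw [Polynomial.natDegree_taylor]; omega)]
  simp [Polynomial.taylor_coeff]

theorem hasseDeriv_eval_of_natDegree_le (p : Polynomial ℝ) {N : ℕ} (hN : p.natDegree ≤ N) (s : ℝ) :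
    (Polynomial.hasseDeriv N p).eval s = p.coeff N := by
  have : Polynomial.hasseDeriv N p = Polynomial.C (p.coeff N) := by
    ext j
    rw [Polynomial.hasseDeriv_coeff, Polynomial.coeff_C]
    split_ifs with h
    · simp [h]
    · rw [Polynomial.coeff_eq_zero_of_natDegree_lt (by omega), mul_zero]
  rw [this, Polynomial.eval_C]

/-- Inclusion and exclusion over the critical blocks. -/
theorem sum_powerset_sum_powerset_neg_one_pow {ι : Type*} [DecidableEq ι] (Q : Finset ι)
    (h : Finset ι → ℝ) :
    ∑ I ∈ Q.powerset, ∑ J ∈ (Q \ I).powerset, (-1) ^ J.card * h (I ∪ J) = h ∅ := by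
  have h1 : ∑ I ∈ Q.powerset, ∑ J ∈ (Q \ I).powerset, (-1 : ℝ) ^ J.card * h (I ∪ J) =
      ∑ K ∈ Q.powerset, ∑ J ∈ K.powerset, (-1 : ℝ) ^ J.card * h K := by
    rw [sum_sigma', sum_sigma']
    refine sum_bij' (fun x _ => ⟨x.1 ∪ x.2, x.2⟩) (fun x _ => ⟨x.1 \ x.2, x.2⟩) ?_ ?_ ?_ ?_ ?_
    · rintro ⟨I, J⟩ hx
      simp only [mem_sigma, mem_powerset] at hx ⊢
      exact ⟨union_subset hx.1 (hx.2.trans sdiff_subset), subset_union_right⟩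
    · rintro ⟨K, J⟩ hx
      simp only [mem_sigma, mem_powerset] at hx ⊢
      refine ⟨sdiff_subset.trans hx.1, fun i hi => ?_⟩
      simp [hx.1 (hx.2 hi), hi]
    · rintro ⟨I, J⟩ hx
      simp [mem_sigma, mem_powerset] at hx ⊢
      have : Disjoint I J := (disjoint_sdiff).mono_right hx.2
      simp [union_sdiff_cancel_right this]
    · rintro ⟨K, J⟩ hx
      simp only [mem_sigma, mem_powerset] at hx ⊢
      simp [sdiff_union_of_subset hx.2]
    · simp
  rw [h1]
  have h2 : ∀ K, ∑ J ∈ K.powerset, (-1 : ℝ) ^ J.card * h K = if K = ∅ then h K else 0 := by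
    intro K
    rw [← sum_mul]
    have := sum_powerset_neg_one_pow_card (x := K)
    have h3 : ∑ J ∈ K.powerset, (-1 : ℝ) ^ J.card = if K = ∅ then 1 else 0 := by
      exact_mod_cast this
    rw [h3]
    split_ifs <;> simp
  simp only [h2]
  rw [sum_ite_eq_of_mem' _ _ _ (by simp)]

/-- Integrating out a critical block raises the order of the kernel, and so the degree in `T`. -/
theorem integral_inv_mul_kernel (σ : ℝ) (k : ℕ) {lam : ℝ} (hl : 0 < lam) (y : ℝ) :
    ∫ v in Set.Ioc (0 : ℝ) 1, v⁻¹ * kernel σ (k + 1) (y + lam * log v) =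
      1 / lam * kernel σ (k + 2) y := by
  set ε : ℝ := min 1 (exp ((-1 - y) / lam))
  have hε0 : 0 < ε := lt_min one_pos (exp_pos _)
  have hε1 : ε ≤ 1 := min_le_left _ _
  have hneg : ∀ v, 0 < v → v ≤ ε → y + lam * log v < 0 := by
    intro v hv hvε
    have h1 : log v ≤ (-1 - y) / lam := by
      rw [← log_exp ((-1 - y) / lam)]
      exact log_le_log hv (hvε.trans (min_le_right _ _))
    rw [le_div_iff₀ hl] at h1
    linarith
  have h1 : ∫ v in Set.Ioc (0 : ℝ) 1, v⁻¹ * kernel σ (k + 1) (y + lam * log v) =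
      ∫ v in Set.Ioc ε 1, v⁻¹ * kernel σ (k + 1) (y + lam * log v) := by
    refine setIntegral_eq_of_subset_of_forall_sdiff_eq_zero measurableSet_Ioc
      (Set.Ioc_subset_Ioc_left hε0.le) fun v hv => ?_
    have : v ≤ ε := by
      by_contra! h
      exact hv.2 ⟨h, hv.1.2⟩
    rw [kernel_of_neg _ _ (hneg v hv.1.1 this), mul_zero]
  have h2 : ∀ v ∈ Set.uIcc ε 1, HasDerivAt (fun v => 1 / lam * kernel σ (k + 2)
      (y + lam * log v)) (v⁻¹ * kernel σ (k + 1) (y + lam * log v)) v := by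
    intro v hv
    rw [Set.uIcc_of_le hε1] at hv
    have hv0 : v ≠ 0 := (hε0.trans_le hv.1).ne'
    have := ((hasDerivAt_kernel σ k (y + lam * log v)).comp v
      (((hasDerivAt_log hv0).const_mul lam).const_add y)).const_mul (1 / lam)
    refine this.congr_deriv ?_
    field_simp
  rw [h1, ← intervalIntegral.integral_of_le hε1, intervalIntegral.integral_eq_sub_of_hasDerivAt h2,
    kernel_of_neg _ _ (hneg ε hε0 le_rfl)]
  · simp
  · refine ContinuousOn.intervalIntegrable fun v hv => ?_
    rw [Set.uIcc_of_le hε1] at hv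
    have hv0 : v ≠ 0 := (hε0.trans_le hv.1).ne'
    have := (continuous_kernel_succ σ k).continuousAt (x := y + lam * log v)
    exact (ContinuousAt.mul (by fun_prop (disch := exact hv0))
      (ContinuousAt.comp (f := fun v => y + lam * log v) this
        (by fun_prop))).continuousWithinAt

section Local

variable {F : Type u} [RCLike F] {n : ℕ}

/-- Integration of a kernel over one block of coordinates. -/
theorem SplitsBlock.integral_kernel {m : Measure (Fin n → F)} [IsFiniteMeasure m]
    {s : Finset (Fin n)} (h : SplitsBlock m s) (σ : ℝ) (k : ℕ) {lam : ℝ} (hl : 0 < lam)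
    {G y : (Fin n → F) → ℝ} (hGm : Measurable G) (hym : Measurable y)
    (hG : ∀ t, G (zeroOn s t) = G t) (hy : ∀ t, y (zeroOn s t) = y t)
    (hi : Integrable (fun t => G t * ((blockNorm s t)⁻¹ *
      kernel σ (k + 1) (y t + lam * log (blockNorm s t)))) m) :
    ∫ t, G t * ((blockNorm s t)⁻¹ * kernel σ (k + 1) (y t + lam * log (blockNorm s t))) ∂m =
      1 / lam * ∫ t, G t * kernel σ (k + 2) (y t) ∂m := by
  have h1 := h.integral_eq (G := fun t v => G t * (v⁻¹ * kernel σ (k + 1) (y t + lam * log v)))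
    (by
      have := measurable_kernel σ (k + 1)
      have h2 : Measurable fun q : (Fin n → F) × ℝ => G q.1 := hGm.comp measurable_fst
      exact h2.mul ((measurable_snd.inv).mul (this.comp (by fun_prop))))
    (by simpa only [hG, hy] using hi)
  simp only [hG, hy] at h1
  rw [h1, ← integral_const_mul]
  congr 1
  ext t
  rw [integral_const_mul, integral_inv_mul_kernel σ k hl]
  ring

/-- The exponent such that `‖t i‖ ≤ v ^ (holder F n)`, if the modulus `v ≤ 1` of a block bounds
`|t i|`. -/
def holder (F : Type*) [RCLike F] (n : ℕ) : ℝ := 1 / ((finrank ℝ F * n : ℕ) : ℝ)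

theorem norm_sub_zeroOn_le {s : Finset (Fin n)} (hs : s.Nonempty) {t : Fin n → F}
    (ht : blockNorm s t ≤ 1) :
    ‖t - zeroOn s t‖ ≤ blockNorm s t ^ holder F n := by
  unfold holder
  have : Nonempty s := hs.to_subtype
  have hd : 0 < finrank ℝ F * Fintype.card s := Nat.mul_pos (finrank_pos F) Fintype.card_pos
  have hle : finrank ℝ F * Fintype.card s ≤ finrank ℝ F * n :=
    Nat.mul_le_mul_left _ (by simpa using card_le_univ s)
  set d := finrank ℝ F * Fintype.card s
  have h0 := blockNorm_nonneg s t
  have h1 : ∀ i ∈ s, ‖t i‖ ≤ blockNorm s t ^ (1 / (d : ℝ)) := by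
    intro i hi
    have h2 : coordNorm (fun i : s => t i) ≤ (blockNorm s t ^ (1 / (d : ℝ))) ^ d := by
      rw [one_div, rpow_inv_natCast_pow h0 hd.ne']
      rfl
    rw [coordNorm_le_iff _ (by positivity)] at h2
    have := (single_le_sum (fun _ _ => by positivity)
      (mem_univ ⟨i, hi⟩)).trans h2
    exact le_of_sq_le_sq this (by positivity)
  refine (pi_norm_le_iff_of_nonneg (by positivity)).2 fun i => ?_
  by_cases hi : i ∈ s
  · simp only [Pi.sub_apply, zeroOn, hi, if_true, sub_zero]
    refine (h1 i hi).trans (rpow_le_rpow_of_exponent_ge_of_imp h0 ht ?_ ?_)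
    · have : (d : ℝ) ≤ ((finrank ℝ F * n : ℕ) : ℝ) := by exact_mod_cast hle
      gcongr
    · intro _ h
      have : (0 : ℝ) < 1 / (d : ℝ) := by positivity
      exact absurd h this.ne'
  · simp only [Pi.sub_apply, zeroOn, hi, if_false, sub_self, norm_zero]
    positivity

end Local

section Local

variable {F : Type u} [RCLike F] {n : ℕ}

/-- The data of a local integral: a measure which splits in disjoint blocks of coordinates, exponents
`lam` and `a`, and bounded Lipschitz functions `g` and `ell`. -/
structure LocalDatum (F : Type u) [RCLike F] (n : ℕ) (ι : Type*) where
  m : Measure (Fin n → F)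
  fin : IsFiniteMeasure m
  S : Finset ι
  e : ι → Finset (Fin n)
  disj : (S : Set ι).PairwiseDisjoint e
  nonempty : ∀ P ∈ S, (e P).Nonempty
  splits : ∀ P ∈ S, SplitsBlock m (e P)
  lam : ι → ℝ
  lam_pos : ∀ P ∈ S, 0 < lam P
  a : ι → ℝ
  a_le : ∀ P ∈ S, a P ≤ 1
  g : (Fin n → F) → ℝ
  ell : (Fin n → F) → ℝ
  K : ℝ
  g_le : ∀ t, |g t| ≤ K
  ell_le : ∀ t, |ell t| ≤ K
  g_lip : ∀ t t', |g t - g t'| ≤ K * ‖t - t'‖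
  ell_lip : ∀ t t', |ell t - ell t'| ≤ K * ‖t - t'‖

namespace LocalDatum

variable {ι : Type*} (d : LocalDatum F n ι)

instance : IsFiniteMeasure d.m := d.fin

/-- The weight `∏ v_P ^ (-a_P)`, over the blocks in `S'`. -/
def wt (S' : Finset ι) (t : Fin n → F) : ℝ := ∏ P ∈ S', blockNorm (d.e P) t ^ (-d.a P)

/-- The function `∑ λ_P log v_P`, over the blocks in `S'`. -/
def ht (S' : Finset ι) (t : Fin n → F) : ℝ := ∑ P ∈ S', d.lam P * log (blockNorm (d.e P) t)

/-- The projection replacing by zero the coordinates of the blocks in `I`. -/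
def proj (I : Finset ι) : (Fin n → F) → Fin n → F := zeroOn (I.biUnion d.e)

/-- The critical blocks, those with exponent `1`. -/
def crit : Finset ι := d.S.filter fun P => d.a P = 1

theorem K_nonneg : 0 ≤ d.K := (abs_nonneg _).trans (d.g_le 0)

theorem continuous_of_lip {f : (Fin n → F) → ℝ} {K : ℝ} (h : ∀ t t', |f t - f t'| ≤ K * ‖t - t'‖) :
    Continuous f := by
  have hK : ∀ t t', dist (f t) (f t') ≤ K.toNNReal * dist t t' := fun t t' => by
    rw [dist_eq, dist_eq_norm]
    refine (h t t').trans ?_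
    gcongr
    exact le_coe_toNNReal K
  exact (LipschitzWith.of_dist_le_mul hK).continuous

theorem measurable_wt (S' : Finset ι) : Measurable (d.wt S') :=
  measurable_prod _ fun _ _ => (continuous_blockNorm _).measurable.pow_const _

theorem measurable_ht (S' : Finset ι) : Measurable (d.ht S') :=
  measurable_sum _ fun _ _ =>
    ((measurable_log.comp (continuous_blockNorm _).measurable).const_mul _)

theorem measurable_g_proj (I : Finset ι) : Measurable fun t => d.g (d.proj I t) :=
  ((continuous_of_lip d.g_lip).comp (continuous_zeroOn _)).measurable

theorem measurable_ell_proj (I : Finset ι) : Measurable fun t => d.ell (d.proj I t) :=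
  ((continuous_of_lip d.ell_lip).comp (continuous_zeroOn _)).measurable

theorem ae_mem : ∀ᵐ t ∂d.m, ∀ P ∈ d.S, blockNorm (d.e P) t ∈ Set.Ioc (0 : ℝ) 1 :=
  (Finset.eventually_all _).2 fun P hP => (d.splits P hP).ae_mem

theorem proj_zeroOn {I : Finset ι} {P : ι} (hP : P ∈ I) (t : Fin n → F) :
    d.proj I (zeroOn (d.e P) t) = d.proj I t := by
  rw [proj, zeroOn_zeroOn, union_eq_left.2 (subset_biUnion_of_mem d.e hP)]

theorem proj_insert' [DecidableEq ι] (I : Finset ι) (P : ι) (t : Fin n → F) :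
    d.proj (insert P I) t = d.proj I (zeroOn (d.e P) t) := by
  rw [proj, proj, zeroOn_zeroOn, biUnion_insert, union_comm]

theorem exp_ht_eq {S' : Finset ι} {t : Fin n → F}
    (ht : ∀ P ∈ S', blockNorm (d.e P) t ∈ Set.Ioc (0 : ℝ) 1) (N : ℝ) :
    exp (N * d.ht S' t) = ∏ P ∈ S', blockNorm (d.e P) t ^ (N * d.lam P) := by
  rw [LocalDatum.ht, mul_sum, exp_sum]
  refine prod_congr rfl fun P hP => ?_
  rw [rpow_def_of_pos (ht P hP).1]
  congr 1
  ring

/-- The integrands are bounded, because the kernels vanish on the negative half-line. -/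
theorem integrable_kernel {σ : ℝ} (hσ : 0 ≤ σ) (k : ℕ) {S' : Finset ι} (hS : S' ⊆ d.S) (T : ℝ)
    {f l : (Fin n → F) → ℝ} {K : ℝ} (hf : Measurable f) (hl : Measurable l) (hfK : ∀ t, |f t| ≤ K)
    (hlK : ∀ t, |l t| ≤ K) :
    Integrable (fun t => f t * (d.wt S' t * kernel σ k (T + l t + d.ht S' t))) d.m := by
  set N : ℝ := 1 + ∑ P ∈ d.S, |d.a P| / d.lam P
  have hterm : ∀ P ∈ d.S, 0 ≤ |d.a P| / d.lam P := fun P hP =>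
    div_nonneg (abs_nonneg _) (d.lam_pos P hP).le
  have hN0 : 0 < N := by have := sum_nonneg hterm; linarith
  have hNa : ∀ P ∈ d.S, d.a P ≤ N * d.lam P := fun P hP => by
    have h1 := single_le_sum hterm hP
    have h2 : |d.a P| / d.lam P ≤ N := by linarith
    rw [div_le_iff₀ (d.lam_pos P hP)] at h2
    exact (le_abs_self _).trans h2
  have hm : Measurable fun t => f t * (d.wt S' t * kernel σ k (T + l t + d.ht S' t)) :=
    hf.mul ((d.measurable_wt S').mul ((measurable_kernel σ k).comp
      ((hl.const_add T).add (d.measurable_ht S'))))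
  refine Integrable.of_bound hm.aestronglyMeasurable
    (K * ((1 / N) ^ k * exp (N * (T + K)))) ?_
  filter_upwards [d.ae_mem] with t ht
  have hpos : 0 ≤ d.wt S' t := prod_nonneg fun P _ => rpow_nonneg (blockNorm_nonneg _ _) _
  rw [norm_eq_abs, abs_mul, abs_mul, abs_of_nonneg hpos, abs_of_nonneg (kernel_nonneg _ _ _)]
  have h1 : d.wt S' t * exp (N * d.ht S' t) ≤ 1 := by
    rw [d.exp_ht_eq (fun P hP => ht P (hS hP)), wt, ← prod_mul_distrib]
    refine prod_le_one (fun P hP => by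
      have := blockNorm_nonneg (d.e P) t; positivity) fun P hP => ?_
    rw [← rpow_add (ht P (hS hP)).1]
    exact rpow_le_one (ht P (hS hP)).1.le (ht P (hS hP)).2 (by linarith [hNa P (hS hP)])
  have h2 := kernel_le_exp hσ hN0 k (T + l t + d.ht S' t)
  have h3 : exp (N * (T + l t + d.ht S' t)) ≤
      exp (N * (T + K)) * exp (N * d.ht S' t) := by
    rw [← exp_add]
    have := (le_abs_self _).trans (hlK t)
    exact exp_le_exp.2 (by nlinarith)
  have hK : 0 ≤ K := (abs_nonneg _).trans (hfK t)
  calc |f t| * (d.wt S' t * kernel σ k (T + l t + d.ht S' t))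
      ≤ K * (d.wt S' t * ((1 / N) ^ k * (exp (N * (T + K)) * exp (N * d.ht S' t)))) := by
        have h4 := h2.trans (mul_le_mul_of_nonneg_left h3 (by positivity))
        exact mul_le_mul (hfK t) (mul_le_mul_of_nonneg_left h4 hpos)
          (mul_nonneg hpos (kernel_nonneg _ _ _)) hK
    _ = K * ((1 / N) ^ k * exp (N * (T + K))) * (d.wt S' t * exp (N * d.ht S' t)) := by
        ring
    _ ≤ K * ((1 / N) ^ k * exp (N * (T + K))) * 1 := by gcongr
    _ = _ := mul_one _

variable [DecidableEq ι]

/-- Integration over the blocks in `I`, whose exponents are equal to `1`. -/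
theorem integral_blocks {σ : ℝ} (hσ : 0 ≤ σ) {I : Finset ι} (hI : I ⊆ d.crit) (T : ℝ)
    {f l : (Fin n → F) → ℝ} {K : ℝ} (hf : Measurable f) (hl : Measurable l) (hfK : ∀ t, |f t| ≤ K)
    (hlK : ∀ t, |l t| ≤ K) (hfI : ∀ P ∈ I, ∀ t, f (zeroOn (d.e P) t) = f t)
    (hlI : ∀ P ∈ I, ∀ t, l (zeroOn (d.e P) t) = l t) :
    ∫ t, f t * (d.wt d.S t * kernel σ 1 (T + l t + d.ht d.S t)) ∂d.m =
      (∏ P ∈ I, 1 / d.lam P) *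
        ∫ t, f t * (d.wt (d.S \ I) t * kernel σ (I.card + 1) (T + l t + d.ht (d.S \ I) t)) ∂d.m := by
  induction I using Finset.induction_on with
  | empty => simp
  | insert P I hP ih =>
    have hPc := hI (mem_insert_self P I)
    obtain ⟨hPS, hPa⟩ : P ∈ d.S ∧ d.a P = 1 := by simpa [crit] using hPc
    rw [ih (fun i hi => hI (mem_insert_of_mem hi))
      (fun i hi => hfI i (mem_insert_of_mem hi))
      (fun i hi => hlI i (mem_insert_of_mem hi)), prod_insert hP,
      card_insert_of_notMem hP, mul_comm (1 / d.lam P), mul_assoc]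
    congr 1
    have hS : d.S \ I = insert P (d.S \ insert P I) := by
      ext i
      by_cases hi : i = P
      · subst hi; simp [hPS, hP]
      · simp [hi]
    have hPn : P ∉ d.S \ insert P I := by simp
    have hwt : ∀ t, d.wt (d.S \ I) t = (blockNorm (d.e P) t)⁻¹ * d.wt (d.S \ insert P I) t := by
      intro t
      rw [hS, wt, prod_insert hPn, hPa, rpow_neg_one]
      rfl
    have hht : ∀ t, d.ht (d.S \ I) t =
        d.ht (d.S \ insert P I) t + d.lam P * log (blockNorm (d.e P) t) := by
      intro t
      rw [hS, ht, sum_insert hPn, add_comm]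
      rfl
    have hbn : ∀ P' ∈ d.S \ insert P I, ∀ t : Fin n → F,
        blockNorm (d.e P') (zeroOn (d.e P) t) = blockNorm (d.e P') t := by
      intro P' hP' t
      simp only [Finset.mem_sdiff, mem_insert, not_or] at hP'
      exact blockNorm_zeroOn (d.disj hP'.1 hPS hP'.2.1) t
    have h1 := (d.splits P hPS).integral_kernel σ I.card (d.lam_pos P hPS)
      (G := fun t => f t * d.wt (d.S \ insert P I) t)
      (y := fun t => T + l t + d.ht (d.S \ insert P I) t)
      (hf.mul (d.measurable_wt _)) ((hl.const_add T).add (d.measurable_ht _))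
      (fun t => by
        rw [hfI P (mem_insert_self _ _), wt, wt]
        congr 1
        exact prod_congr rfl fun P' hP' => by rw [hbn P' hP'])
      (fun t => by
        rw [hlI P (mem_insert_self _ _), ht, ht]
        congr 1
        exact sum_congr rfl fun P' hP' => by rw [hbn P' hP'])
    have h2 : ∀ t, f t * d.wt (d.S \ insert P I) t * ((blockNorm (d.e P) t)⁻¹ * kernel σ (I.card + 1)
        (T + l t + d.ht (d.S \ insert P I) t + d.lam P * log (blockNorm (d.e P) t))) =
        f t * (d.wt (d.S \ I) t * kernel σ (I.card + 1) (T + l t + d.ht (d.S \ I) t)) := by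
      intro t
      rw [hwt, hht, add_assoc (T + l t)]
      ring
    simp only [h2] at h1
    rw [h1 (d.integrable_kernel hσ _ sdiff_subset T hf hl hfK hlK)]
    simp only [mul_assoc]

end LocalDatum
end Local

theorem exists_pos_forall_le {ι : Type*} (S : Finset ι) (f : ι → ℝ) (h : ∀ P ∈ S, 0 < f P) :
    ∃ c > 0, ∀ P ∈ S, c ≤ f P := by
  classical
  induction S using Finset.induction_on with
  | empty => exact ⟨1, one_pos, by simp⟩
  | insert P S hP ih =>
    obtain ⟨c, hc, hle⟩ := ih fun P' hP' => h P' (mem_insert_of_mem hP')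
    refine ⟨min c (f P), lt_min hc (h P (mem_insert_self _ _)), fun P' hP' => ?_⟩
    rcases mem_insert.1 hP' with rfl | hP'
    · exact min_le_right _ _
    · exact (min_le_left _ _).trans (hle P' hP')

theorem ExpLipschitz.const_nonneg {δ K C : ℝ} {φ : ℝ → ℝ} (h : ExpLipschitz δ K C φ) : 0 ≤ C := by
  have := (abs_nonneg _).trans (h.1 K le_rfl)
  exact nonneg_of_mul_nonneg_left this (exp_pos _)

/-- Differences of products `g φ(l + y)`, when `φ` decays exponentially. -/
theorem ExpLipschitz.abs_sub_le {δ K C : ℝ} {φ : ℝ → ℝ} (h : ExpLipschitz δ K C φ) (hδ : 0 ≤ δ)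
    {g g' l l' y r : ℝ} (hg' : |g'| ≤ K) (hl : |l| ≤ K) (hl' : |l'| ≤ K) (hy : y ≤ 0)
    (hgg : |g - g'| ≤ K * r) (hll : |l - l'| ≤ K * r) :
    |g * φ (l + y) - g' * φ (l' + y)| ≤
      C * (exp (δ * K) * (K + K ^ 2)) * exp (-δ * y) * r := by
  have hC := h.const_nonneg
  have hK : 0 ≤ K := (abs_nonneg _).trans hg'
  have hb : ∀ x, |x| ≤ K → C * exp (-δ * (x + y)) ≤
      C * (exp (δ * K) * exp (-δ * y)) := by
    intro x hx
    rw [← exp_add]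
    have := (abs_le.1 hx).1
    gcongr
    nlinarith
  have h1 : |φ (l + y)| ≤ C * (exp (δ * K) * exp (-δ * y)) :=
    (h.1 _ (by have := (abs_le.1 hl).2; linarith)).trans (hb l hl)
  have h2 : |φ (l + y) - φ (l' + y)| ≤
      C * (exp (δ * K) * exp (-δ * y)) * |l - l'| := by
    rcases le_total l l' with hle | hle
    · have := h.2 (l + y) (l' + y) (by linarith) (by have := (abs_le.1 hl').2; linarith)
      rw [abs_sub_comm l l', abs_of_nonneg (sub_nonneg.2 hle)]
      have h0 := sub_nonneg.2 hle
      calc _ ≤ _ := this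
        _ = C * exp (-δ * (l + y)) * (l' - l) := by ring
        _ ≤ _ := by gcongr ?_ * _; exact hb l hl
    · have := h.2 (l' + y) (l + y) (by linarith) (by have := (abs_le.1 hl).2; linarith)
      rw [abs_sub_comm, abs_of_nonneg (sub_nonneg.2 hle)]
      have h0 := sub_nonneg.2 hle
      calc _ ≤ _ := this
        _ = C * exp (-δ * (l' + y)) * (l - l') := by ring
        _ ≤ _ := by gcongr ?_ * _; exact hb l' hl'
  calc |g * φ (l + y) - g' * φ (l' + y)|
      = |(g - g') * φ (l + y) + g' * (φ (l + y) - φ (l' + y))| := by ring_nf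
    _ ≤ |g - g'| * |φ (l + y)| + |g'| * |φ (l + y) - φ (l' + y)| := by
        rw [← abs_mul, ← abs_mul]; exact abs_add_le _ _
    _ ≤ (K * r) * (C * (exp (δ * K) * exp (-δ * y))) +
          K * (C * (exp (δ * K) * exp (-δ * y)) * (K * r)) := by
        gcongr
        · exact (abs_nonneg _).trans hgg
        · exact h2.trans (by gcongr)
    _ = _ := by ring

section Local

variable {F : Type u} [RCLike F] {n : ℕ}

namespace LocalDatum

variable {ι : Type*} (d : LocalDatum F n ι)

/-- The gain, in terms of the moduli of the critical blocks, of the Lipschitz estimates. -/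
def gain : ℝ := holder F n / (d.crit.card + 1)

theorem gain_nonneg : 0 ≤ d.gain := by unfold gain holder; positivity

theorem ht_nonpos {S' : Finset ι} (hS : S' ⊆ d.S) {t : Fin n → F}
    (ht : ∀ P ∈ d.S, blockNorm (d.e P) t ∈ Set.Ioc (0 : ℝ) 1) : d.ht S' t ≤ 0 :=
  sum_nonpos fun P hP => mul_nonpos_of_nonneg_of_nonpos (d.lam_pos P (hS hP)).le
    (log_nonpos (ht P (hS hP)).1.le (ht P (hS hP)).2)

theorem norm_proj_sub_proj_le (I : Finset ι) (t t' : Fin n → F) :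
    ‖d.proj I t - d.proj I t'‖ ≤ ‖t - t'‖ := by
  refine (pi_norm_le_iff_of_nonneg (norm_nonneg _)).2 fun i => ?_
  simp only [proj, zeroOn, Pi.sub_apply]
  split_ifs
  · simp
  · exact norm_le_pi_norm (t - t') i

variable [DecidableEq ι]

/-- The exponents of the bounds for the remainders. -/
def expo (δ : ℝ) (P : ι) : ℝ := -d.a P - δ * d.lam P + if P ∈ d.crit then d.gain else 0

theorem exists_expo_gt : ∃ δ₀ > 0, ∀ δ, 0 < δ → δ ≤ δ₀ → ∀ P ∈ d.S, -1 < d.expo δ P := by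
  have h1 : ∀ P ∈ d.S, ∃ δ₀ > 0, ∀ δ, 0 < δ → δ ≤ δ₀ → -1 < d.expo δ P := by
    intro P hP
    have hl := d.lam_pos P hP
    have hslack : 0 < 1 - d.a P + if P ∈ d.crit then d.gain else 0 := by
      by_cases hc : P ∈ d.crit
      · have h2 : 0 < d.gain := by
          obtain ⟨i, -⟩ := d.nonempty P hP
          have hn : 0 < n := Fin.pos i
          have := finrank_pos F
          unfold gain holder
          positivity
        have := d.a_le P hP
        simp only [hc, if_true]; linarith
      · have h2 : d.a P ≠ 1 := fun h => hc (by simp [crit, hP, h])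
        have := lt_of_le_of_ne (d.a_le P hP) h2
        simp only [hc, if_false]; linarith
    refine ⟨(1 - d.a P + if P ∈ d.crit then d.gain else 0) / (2 * d.lam P), by positivity,
      fun δ hδ hle => ?_⟩
    rw [le_div_iff₀ (by positivity)] at hle
    unfold expo
    nlinarith
  choose! f hf hf' using h1
  obtain ⟨δ₀, hδ₀, hle₀⟩ := exists_pos_forall_le d.S f hf
  exact ⟨δ₀, hδ₀, fun δ hδ hle P hP => hf' P hP δ hδ (hle.trans (hle₀ P hP))⟩

/-- The terms of `alt`. -/
def altTerm (I : Finset ι) (φ : ℝ → ℝ) (t : Fin n → F) (J : Finset ι) : ℝ :=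
  (-1) ^ J.card * (d.g (d.proj (I ∪ J) t) * φ (d.ell (d.proj (I ∪ J) t) + d.ht (d.S \ I) t))

/-- The alternating sum of the functions `g φ(ell + ht)` over the coordinate subspaces obtained by
annihilating the blocks in `I` and some other critical blocks. The weight of the blocks in `I`, over
which one has integrated, is omitted. -/
def alt (I : Finset ι) (φ : ℝ → ℝ) (t : Fin n → F) : ℝ :=
  d.wt (d.S \ I) t * ∑ J ∈ (d.crit \ I).powerset, d.altTerm I φ t J

theorem measurable_alt (I : Finset ι) {φ : ℝ → ℝ} (hφ : Measurable φ) : Measurable (d.alt I φ) := by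
  refine (d.measurable_wt _).mul (measurable_sum _ fun J _ => ?_)
  exact ((d.measurable_g_proj _).mul (hφ.comp ((d.measurable_ell_proj _).add
    (d.measurable_ht _)))).const_mul _

/-- The constant of the Lipschitz estimates. -/
def altConst (δ : ℝ) : ℝ := 2 ^ d.crit.card * (exp (δ * d.K) * (d.K + d.K ^ 2))

/-- An alternating sum pairs the terms with and without the block `P`, so it vanishes to positive order
as that block tends to zero. -/
theorem abs_alternating_sum_le {δ C : ℝ} (hδ : 0 ≤ δ) (I : Finset ι) {φ : ℝ → ℝ}
    (h : ExpLipschitz δ d.K C φ) {t : Fin n → F}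
    (ht : ∀ P ∈ d.S, blockNorm (d.e P) t ∈ Set.Ioc (0 : ℝ) 1) {P : ι} (hP : P ∈ d.crit \ I) :
    |∑ J ∈ (d.crit \ I).powerset, d.altTerm I φ t J| ≤ C * d.altConst δ * exp (-δ * d.ht (d.S \ I) t) *
      blockNorm (d.e P) t ^ holder F n := by
  have hPS : P ∈ d.S := (mem_filter.1 (Finset.mem_sdiff.1 hP).1).1
  set J₀ := (d.crit \ I).erase P with hJ₀
  have hPJ : P ∉ J₀ := by simp [hJ₀]
  rw [← insert_erase hP, ← hJ₀, sum_powerset_insert hPJ, ← sum_add_distrib]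
  have hterm : ∀ J ∈ J₀.powerset, |d.altTerm I φ t J + d.altTerm I φ t (insert P J)| ≤
      C * (exp (δ * d.K) * (d.K + d.K ^ 2)) * exp (-δ * d.ht (d.S \ I) t) *
        blockNorm (d.e P) t ^ holder F n := by
    intro J hJ
    have hPn : P ∉ J := fun h => hPJ (mem_powerset.1 hJ h)
    rw [altTerm, altTerm, card_insert_of_notMem hPn, pow_succ, mul_neg_one, neg_mul, ← sub_eq_add_neg, ← mul_sub,
      abs_mul, abs_pow, abs_neg, abs_one, one_pow, one_mul, union_insert, d.proj_insert']
    set K := I ∪ J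
    have hr : ‖d.proj K t - d.proj K (zeroOn (d.e P) t)‖ ≤
        blockNorm (d.e P) t ^ holder F n :=
      (d.norm_proj_sub_proj_le K _ _).trans
        (norm_sub_zeroOn_le (d.nonempty P hPS) (ht P hPS).2)
    have hK := d.K_nonneg
    exact h.abs_sub_le hδ (d.g_le _) (d.ell_le _) (d.ell_le _) (d.ht_nonpos sdiff_subset ht)
      ((d.g_lip _ _).trans (by gcongr)) ((d.ell_lip _ _).trans (by gcongr))
  refine (abs_sum_le_sum_abs _ _).trans ((sum_le_sum hterm).trans ?_)
  rw [sum_const, card_powerset, nsmul_eq_mul]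
  have hC := h.const_nonneg
  have hK := d.K_nonneg
  have hb := blockNorm_nonneg (d.e P) t
  have hcard : J₀.card ≤ d.crit.card :=
    card_le_card ((erase_subset _ _).trans sdiff_subset)
  have h2 : ((2 ^ J₀.card : ℕ) : ℝ) ≤ 2 ^ d.crit.card := by
    push_cast
    exact pow_le_pow_right₀ one_le_two hcard
  calc _ ≤ 2 ^ d.crit.card * (C * (exp (δ * d.K) * (d.K + d.K ^ 2)) *
        exp (-δ * d.ht (d.S \ I) t) *
        blockNorm (d.e P) t ^ holder F n) := by gcongr
    _ = _ := by unfold altConst; ring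

/-- The gain at the critical blocks makes all exponents larger than `-1`, hence integrable. -/
theorem abs_alt_le {δ C : ℝ} (hδ : 0 ≤ δ) (I : Finset ι) {φ : ℝ → ℝ} (h : ExpLipschitz δ d.K C φ)
    {t : Fin n → F} (ht : ∀ P ∈ d.S, blockNorm (d.e P) t ∈ Set.Ioc (0 : ℝ) 1) :
    |d.alt I φ t| ≤ C * d.altConst δ * ∏ P ∈ d.S \ I, blockNorm (d.e P) t ^ d.expo δ P := by
  have hC := h.const_nonneg
  have hK := d.K_nonneg
  have hA : 0 ≤ d.altConst δ := by unfold altConst; positivity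
  have hb : ∀ P, 0 ≤ blockNorm (d.e P) t := fun P => blockNorm_nonneg (d.e P) t
  have hcrit : d.crit ⊆ d.S := filter_subset _ _
  have hsum : |∑ J ∈ (d.crit \ I).powerset, d.altTerm I φ t J| ≤ C * d.altConst δ * exp (-δ * d.ht (d.S \ I) t) *
        ∏ P ∈ d.crit \ I, blockNorm (d.e P) t ^ d.gain := by
    rcases (d.crit \ I).eq_empty_or_nonempty with h0 | h0
    · rw [h0]
      simp only [altTerm, powerset_empty, sum_singleton, card_empty, pow_zero, one_mul,
        union_empty, prod_empty, mul_one]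
      have h1 := h.abs_sub_le hδ (g' := 0) (g := d.g (d.proj I t)) (l := d.ell (d.proj I t))
        (l' := d.ell (d.proj I t)) (y := d.ht (d.S \ I) t) (r := 1) (by simpa using hK)
        (d.ell_le _) (d.ell_le _) (d.ht_nonpos sdiff_subset ht)
        (by simpa using d.g_le _) (by simpa using hK)
      rw [zero_mul, sub_zero, mul_one] at h1
      refine h1.trans ?_
      have h2 : (1 : ℝ) ≤ 2 ^ d.crit.card := one_le_pow₀ one_le_two
      have h3 : exp (δ * d.K) * (d.K + d.K ^ 2) ≤ d.altConst δ :=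
        le_mul_of_one_le_left (by positivity) h2
      gcongr
    · -- the best of the estimates is the one for the smallest block
      obtain ⟨P₀, hP₀, hmin⟩ := exists_min_image _ (fun P => blockNorm (d.e P) t) h0
      refine (d.abs_alternating_sum_le hδ I h ht hP₀).trans ?_
      have hP₀S : P₀ ∈ d.S := hcrit (Finset.mem_sdiff.1 hP₀).1
      have hb0 := (ht P₀ hP₀S).1
      have h1 : ∏ P ∈ d.crit \ I, blockNorm (d.e P₀) t ^ d.gain ≤
          ∏ P ∈ d.crit \ I, blockNorm (d.e P) t ^ d.gain :=
        Finset.prod_le_prod (fun _ _ => by positivity) fun P hP =>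
          rpow_le_rpow (hb _) (hmin P hP) d.gain_nonneg
      rw [prod_const, ← rpow_natCast, ← rpow_mul hb0.le] at h1
      have h2 : blockNorm (d.e P₀) t ^ holder F n ≤
          blockNorm (d.e P₀) t ^ (d.gain * ((d.crit \ I).card : ℝ)) := by
        refine rpow_le_rpow_of_exponent_ge hb0 (ht P₀ hP₀S).2 ?_
        have h3 : ((d.crit \ I).card : ℝ) ≤ d.crit.card + 1 := by
          have := card_le_card (sdiff_subset (s := d.crit) (t := I))
          have : ((d.crit \ I).card : ℝ) ≤ d.crit.card := by exact_mod_cast this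
          linarith
        unfold gain
        rw [div_mul_eq_mul_div, div_le_iff₀ (by positivity)]
        have : 0 ≤ holder F n := by unfold holder; positivity
        gcongr
      have h4 := h2.trans h1
      gcongr
  have hprod : ∏ P ∈ d.S \ I, blockNorm (d.e P) t ^ d.expo δ P =
      d.wt (d.S \ I) t * exp (-δ * d.ht (d.S \ I) t) *
        ∏ P ∈ d.crit \ I, blockNorm (d.e P) t ^ d.gain := by
    have h1 : ∏ P ∈ d.crit \ I, blockNorm (d.e P) t ^ d.gain =
        ∏ P ∈ d.S \ I, blockNorm (d.e P) t ^ (if P ∈ d.crit then d.gain else 0) := by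
      rw [← prod_subset (sdiff_subset_sdiff hcrit le_rfl)]
      · exact prod_congr rfl fun P hP => by rw [if_pos (Finset.mem_sdiff.1 hP).1]
      · intro P hP hP'
        have : P ∉ d.crit := fun hc => hP' (Finset.mem_sdiff.2 ⟨hc, (Finset.mem_sdiff.1 hP).2⟩)
        rw [if_neg this, rpow_zero]
    rw [d.exp_ht_eq (fun P hP => ht P (Finset.mem_sdiff.1 hP).1), h1, wt, ← prod_mul_distrib,
      ← prod_mul_distrib]
    refine prod_congr rfl fun P hP => ?_
    have := (ht P (Finset.mem_sdiff.1 hP).1).1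
    rw [← rpow_add this, ← rpow_add this, expo]
    congr 1
    ring
  have hw : 0 ≤ d.wt (d.S \ I) t := prod_nonneg fun P _ => rpow_nonneg (hb P) _
  rw [alt, abs_mul, abs_of_nonneg hw, hprod]
  calc _ ≤ d.wt (d.S \ I) t * _ := mul_le_mul_of_nonneg_left hsum hw
    _ = _ := by ring

/-- The bound for the integrals of the alternating sums. -/
def altBound (δ : ℝ) (I : Finset ι) : ℝ :=
  d.altConst δ * ∫ t, ∏ P ∈ d.S \ I, blockNorm (d.e P) t ^ d.expo δ P ∂d.m

theorem integrable_alt {δ C : ℝ} (hδ : 0 ≤ δ) (hexp : ∀ P ∈ d.S, -1 < d.expo δ P) (I : Finset ι)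
    {φ : ℝ → ℝ} (hφ : Measurable φ) (h : ExpLipschitz δ d.K C φ) :
    Integrable (d.alt I φ) d.m ∧ |∫ t, d.alt I φ t ∂d.m| ≤ C * d.altBound δ I := by
  have hsub : d.S \ I ⊆ d.S := sdiff_subset
  have h1 := integrable_prod_blockNorm_rpow (d.S \ I)
    (d.disj.subset (by exact_mod_cast hsub)) (fun P hP => d.splits P (hsub hP)) (d.expo δ)
    fun P hP => hexp P (hsub hP)
  have h2 : ∀ᵐ t ∂d.m, ‖d.alt I φ t‖ ≤
      C * d.altConst δ * ∏ P ∈ d.S \ I, blockNorm (d.e P) t ^ d.expo δ P :=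
    d.ae_mem.mono fun t ht => d.abs_alt_le hδ I h ht
  refine ⟨(h1.const_mul _).mono' (d.measurable_alt I hφ).aestronglyMeasurable h2, ?_⟩
  refine (norm_integral_le_of_norm_le (h1.const_mul _) h2).trans_eq ?_
  rw [integral_const_mul, altBound, mul_assoc]

end LocalDatum
end Local

section Local

variable {F : Type u} [RCLike F] {n : ℕ}

namespace LocalDatum

variable {ι : Type*} [DecidableEq ι] (d : LocalDatum F n ι)

/-- The local integral of the kernel of index one. -/
def localIntegral (σ T : ℝ) : ℝ :=
  ∫ t, d.g t * (d.wt d.S t * kernel σ 1 (T + d.ell t + d.ht d.S t)) ∂d.m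

/-- The integral over the intersection of the critical coordinate subspaces. -/
def residue : ℝ := ∫ t, d.g (d.proj d.crit t) * d.wt (d.S \ d.crit) t ∂d.m

/-- Each term telescopes over sets of critical blocks; the blocks in `I` are integrated out exactly, and
the others occur through alternating sums, which are integrable. -/
theorem localIntegral_eq_sum {σ : ℝ} (hσ : 0 ≤ σ) (T : ℝ) :
    d.localIntegral σ T = ∑ I ∈ d.crit.powerset, (∏ P ∈ I, 1 / d.lam P) *
      ∫ t, d.alt I (fun s => kernel σ (I.card + 1) (T + s)) t ∂d.m := by
  have h0 := sum_powerset_sum_powerset_neg_one_pow d.crit fun K =>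
    ∫ t, d.g (d.proj K t) * (d.wt d.S t * kernel σ 1 (T + d.ell (d.proj K t) + d.ht d.S t)) ∂d.m
  have h1 : ∀ t, d.proj ∅ t = t := fun t => by ext i; simp [proj, zeroOn]
  simp only [h1] at h0
  rw [localIntegral, ← h0]
  refine sum_congr rfl fun I hI => ?_
  rw [mem_powerset] at hI
  have hint : ∀ J, Integrable (fun t => d.g (d.proj (I ∪ J) t) * (d.wt (d.S \ I) t *
      kernel σ (I.card + 1) (T + d.ell (d.proj (I ∪ J) t) + d.ht (d.S \ I) t))) d.m := fun J =>
    d.integrable_kernel hσ _ sdiff_subset T (d.measurable_g_proj _) (d.measurable_ell_proj _)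
      (fun t => d.g_le _) (fun t => d.ell_le _)
  have h2 : ∀ J, ∫ t, d.g (d.proj (I ∪ J) t) * (d.wt d.S t *
      kernel σ 1 (T + d.ell (d.proj (I ∪ J) t) + d.ht d.S t)) ∂d.m =
      (∏ P ∈ I, 1 / d.lam P) * ∫ t, d.g (d.proj (I ∪ J) t) * (d.wt (d.S \ I) t *
        kernel σ (I.card + 1) (T + d.ell (d.proj (I ∪ J) t) + d.ht (d.S \ I) t)) ∂d.m := fun J =>
    d.integral_blocks hσ hI T (d.measurable_g_proj _) (d.measurable_ell_proj _)
      (fun t => d.g_le _) (fun t => d.ell_le _)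
      (fun P hP t => by rw [d.proj_zeroOn (mem_union_left _ hP)])
      (fun P hP t => by rw [d.proj_zeroOn (mem_union_left _ hP)])
  have h3 : ∀ t, d.alt I (fun s => kernel σ (I.card + 1) (T + s)) t =
      ∑ J ∈ (d.crit \ I).powerset, (-1) ^ J.card * (d.g (d.proj (I ∪ J) t) * (d.wt (d.S \ I) t *
        kernel σ (I.card + 1) (T + d.ell (d.proj (I ∪ J) t) + d.ht (d.S \ I) t))) := by
    intro t
    rw [alt, mul_sum]
    refine sum_congr rfl fun J _ => ?_
    rw [altTerm, ← add_assoc]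
    ring
  simp only [h3]
  rw [integral_finsetSum _ fun J _ => (hint J).const_mul _, mul_sum]
  refine sum_congr rfl fun J _ => ?_
  rw [h2, integral_const_mul]
  ring

/-- The asymptotic expansion of one of the terms: the contribution of the polynomial part of the
kernel is a polynomial, and that of the remainder is exponentially small. -/
theorem exists_alt_expansion {σ δ : ℝ} (hσ : 0 ≤ σ) (hδ : 0 < δ) (hδσ : 0 < σ → δ ≤ σ)
    (hexp : ∀ P ∈ d.S, -1 < d.expo δ P) (I : Finset ι) :
    ∃ (R : Polynomial ℝ) (C : ℝ), R.natDegree ≤ I.card + kernelShift σ ∧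
      R.coeff (I.card + kernelShift σ) = ∫ t, d.alt I (fun _ => kernelLead σ I.card) t ∂d.m ∧
      ∀ T, |(∫ t, d.alt I (fun s => kernel σ (I.card + 1) (T + s)) t ∂d.m) - R.eval T| ≤
        C * exp (-δ * T) := by
  obtain ⟨p, C, hp1, hp2, hr1, hr2⟩ := exists_kernel_eq_polynomial_add hσ hδ hδσ I.card
  set N := I.card + kernelShift σ
  set q : ℕ → ℝ → ℝ := fun l s => (Polynomial.hasseDeriv l p).eval s with hq
  set r : ℝ → ℝ := fun s => kernel σ (I.card + 1) s - p.eval s with hr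
  have hqm : ∀ l, Measurable (q l) := fun l => (Polynomial.continuous _).measurable
  have hrm : Measurable r := (measurable_kernel _ _).sub p.continuous.measurable
  have hqi : ∀ l, Integrable (d.alt I (q l)) d.m := fun l => by
    obtain ⟨C, hC⟩ := exists_expLipschitz_polynomial hδ d.K_nonneg (Polynomial.hasseDeriv l p)
    exact (d.integrable_alt hδ.le hexp I (hqm l) hC).1
  have hri : ∀ T, Integrable (d.alt I fun s => r (T + s)) d.m ∧
      |∫ t, d.alt I (fun s => r (T + s)) t ∂d.m| ≤
        (C * exp (-δ * T)) * d.altBound δ I := fun T => by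
    refine d.integrable_alt hδ.le hexp I (hrm.comp (measurable_const_add T)) ⟨fun s _ => ?_,
      fun s s' hss _ => ?_⟩
    · refine (hr1 (T + s)).trans_eq ?_
      rw [mul_add, exp_add, mul_assoc]
    · refine (hr2 (T + s) (T + s') (by linarith)).trans_eq ?_
      rw [mul_add, exp_add]
      ring
  have hdec : ∀ T t, d.alt I (fun s => kernel σ (I.card + 1) (T + s)) t =
      (∑ l ∈ range (N + 1), d.alt I (q l) t * T ^ l) + d.alt I (fun s => r (T + s)) t := by
    intro T t
    have h1 : ∀ s, kernel σ (I.card + 1) (T + s) =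
        (∑ l ∈ range (N + 1), q l s * T ^ l) + r (T + s) := fun s => by
      rw [hr, hq, ← polynomial_eval_add_eq_sum p hp1]
      ring
    simp only [alt, altTerm, h1, mul_add, sum_add_distrib]
    congr 1
    simp only [mul_sum, sum_mul]
    rw [sum_comm]
    refine sum_congr rfl fun l _ => sum_congr rfl fun J _ => ?_
    ring
  refine ⟨∑ l ∈ range (N + 1), Polynomial.C (∫ t, d.alt I (q l) t ∂d.m) * Polynomial.X ^ l,
    C * d.altBound δ I, ?_, ?_, fun T => ?_⟩
  · refine Polynomial.natDegree_sum_le_of_forall_le _ _ fun l hl => ?_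
    have := mem_range.1 hl
    exact (Polynomial.natDegree_C_mul_X_pow_le _ _).trans (by omega)
  · rw [Polynomial.finsetSum_coeff]
    simp only [Polynomial.coeff_C_mul, Polynomial.coeff_X_pow, mul_ite, mul_one, mul_zero]
    rw [sum_ite_eq, if_pos (by simp)]
    congr 1
    ext t
    congr 1
    ext s
    rw [hq, ← hp2]
    exact hasseDeriv_eval_of_natDegree_le p hp1 s
  · have h1 : ∫ t, d.alt I (fun s => kernel σ (I.card + 1) (T + s)) t ∂d.m =
        (∑ l ∈ range (N + 1), (∫ t, d.alt I (q l) t ∂d.m) * T ^ l) +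
          ∫ t, d.alt I (fun s => r (T + s)) t ∂d.m := by
      simp only [hdec]
      rw [integral_add (integrable_finsetSum _ fun l _ => (hqi l).mul_const _) (hri T).1,
        integral_finsetSum _ fun l _ => (hqi l).mul_const _]
      simp only [integral_mul_const]
    rw [h1, Polynomial.eval_finsetSum]
    simp only [Polynomial.eval_mul, Polynomial.eval_C, Polynomial.eval_pow, Polynomial.eval_X]
    rw [add_sub_cancel_left]
    exact (hri T).2.trans_eq (by ring)

theorem integrable_residue : Integrable (fun t => d.g (d.proj d.crit t) * d.wt (d.S \ d.crit) t) d.m := by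
  have hsub : d.S \ d.crit ⊆ d.S := sdiff_subset
  have h1 := integrable_prod_blockNorm_rpow (d.S \ d.crit)
    (d.disj.subset (by exact_mod_cast hsub)) (fun P hP => d.splits P (hsub hP)) (fun P => -d.a P)
    fun P hP => by
      have h2 : d.a P ≠ 1 := fun h => (Finset.mem_sdiff.1 hP).2 (by simp [crit, hsub hP, h])
      have := lt_of_le_of_ne (d.a_le P (hsub hP)) h2
      linarith
  exact h1.bdd_mul (d.measurable_g_proj _).aestronglyMeasurable (ae_of_all _ fun t => d.g_le _)

/-- The asymptotic expansion of local integrals. -/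
theorem exists_expansion {σ : ℝ} (hσ : 0 ≤ σ) : ∃ δ₀ > 0, ∀ δ, 0 < δ → δ ≤ δ₀ →
    ∃ (R : Polynomial ℝ) (C : ℝ), R.natDegree ≤ d.crit.card + kernelShift σ ∧
      R.coeff (d.crit.card + kernelShift σ) =
        kernelLead σ d.crit.card * (∏ P ∈ d.crit, 1 / d.lam P) * d.residue ∧
      ∀ T, |d.localIntegral σ T - R.eval T| ≤ C * exp (-δ * T) := by
  obtain ⟨δ₁, hδ₁, hexp⟩ := d.exists_expo_gt
  obtain ⟨δ₀, hδ₀, hle1, hleσ⟩ : ∃ δ₀ > 0, δ₀ ≤ δ₁ ∧ (0 < σ → δ₀ ≤ σ) := by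
    rcases hσ.eq_or_lt with h | h
    · exact ⟨δ₁, hδ₁, le_rfl, fun h' => absurd h h'.ne⟩
    · exact ⟨min δ₁ σ, lt_min hδ₁ h, min_le_left _ _, fun _ => min_le_right _ _⟩
  refine ⟨δ₀, hδ₀, fun δ hδ hle => ?_⟩
  choose R C h1 h2 h3 using d.exists_alt_expansion hσ hδ (fun h => hle.trans (hleσ h))
    (hexp δ hδ (hle.trans hle1))
  refine ⟨∑ I ∈ d.crit.powerset, Polynomial.C (∏ P ∈ I, 1 / d.lam P) * R I,
    ∑ I ∈ d.crit.powerset, |∏ P ∈ I, 1 / d.lam P| * C I, ?_, ?_, fun T => ?_⟩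
  · refine Polynomial.natDegree_sum_le_of_forall_le _ _ fun I hI => ?_
    have := card_le_card (mem_powerset.1 hI)
    exact (Polynomial.natDegree_C_mul_le _ _).trans ((h1 I).trans (by omega))
  · rw [Polynomial.finsetSum_coeff, sum_eq_single d.crit]
    · rw [Polynomial.coeff_C_mul, h2, residue, ← integral_const_mul, ← integral_const_mul]
      congr 1
      ext t
      simp [alt, altTerm]
      ring
    · intro I hI hne
      have := card_lt_card ((mem_powerset.1 hI).ssubset_of_ne hne)
      rw [Polynomial.coeff_C_mul, Polynomial.coeff_eq_zero_of_natDegree_lt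
        ((h1 I).trans_lt (by omega)), mul_zero]
    · intro h
      exact absurd (mem_powerset_self _) h
  · rw [d.localIntegral_eq_sum hσ, Polynomial.eval_finsetSum, ← sum_sub_distrib,
      sum_mul]
    refine (abs_sum_le_sum_abs _ _).trans (sum_le_sum fun I _ => ?_)
    rw [Polynomial.eval_mul, Polynomial.eval_C, ← mul_sub, abs_mul, mul_assoc]
    exact mul_le_mul_of_nonneg_left (h3 I T) (abs_nonneg _)

end LocalDatum
end Local

/-! ### A Tauberian argument -/

theorem exists_le_exp_of_nonneg (q : Polynomial ℝ) {ε : ℝ} (hε : 0 < ε) :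
    ∃ C, 0 ≤ C ∧ ∀ s, 0 ≤ s → |q.eval s| ≤ C * exp (ε * s) := by
  obtain ⟨C, hC, h⟩ := exists_factor_le ε 0 hε le_rfl (q.comp (-Polynomial.X))
  refine ⟨C, hC, fun s hs => ?_⟩
  simpa using h (-s) (by simpa using hs)

/-- Taylor's formula at order one for polynomials. -/
theorem exists_taylor_le (R : Polynomial ℝ) {ε : ℝ} (hε : 0 < ε) :
    ∃ C, 0 ≤ C ∧ ∀ T h : ℝ, 0 ≤ T → |h| ≤ 1 →
      |R.eval (T + h) - R.eval T - h * R.derivative.eval T| ≤ C * exp (ε * T) * h ^ 2 := by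
  choose C hC hle using fun l => exists_le_exp_of_nonneg (Polynomial.hasseDeriv l R) hε
  refine ⟨∑ l ∈ range R.natDegree, C (l + 2), sum_nonneg fun l _ => hC _,
    fun T h hT hh => ?_⟩
  have h1 : R.eval (T + h) - R.eval T - h * R.derivative.eval T =
      ∑ l ∈ range R.natDegree, (Polynomial.hasseDeriv (l + 2) R).eval T * h ^ (l + 2) := by
    rw [add_comm, polynomial_eval_add_eq_sum R (N := R.natDegree + 1) (by omega),
      sum_range_succ', sum_range_succ']
    simp
    ring
  rw [h1, sum_mul, sum_mul]
  refine (abs_sum_le_sum_abs _ _).trans (sum_le_sum fun l _ => ?_)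
  rw [abs_mul, abs_pow, pow_add, sq_abs, mul_comm (|h| ^ l), ← mul_assoc]
  calc _ ≤ C (l + 2) * exp (ε * T) * h ^ 2 * 1 := by
        have := hC (l + 2)
        gcongr
        · exact hle _ T hT
        · exact pow_le_one₀ (abs_nonneg _) hh
    _ = _ := mul_one _

/-- If the difference quotients of a function `A`, which is a polynomial up to an exponentially
small error, enclose the function `W`, then `W` is the derivative of this polynomial up to an
exponentially small error. -/
theorem exists_tauberian {A W : ℝ → ℝ} {σ δ C : ℝ} (hσ : 0 ≤ σ) (hδ : 0 < δ) (R : Polynomial ℝ)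
    (hA : ∀ T, |A T - R.eval T| ≤ C * exp (-δ * T))
    (hle : ∀ T η, 0 < η → W T ≤ exp (σ * η) / η * (A (T + η) - A T))
    (hge : ∀ T η, 0 < η → exp (-σ * η) / η * (A T - A (T - η)) ≤ W T) :
    ∃ C', ∀ T, 0 ≤ T → |W T - R.derivative.eval T| ≤ C' * exp (-(δ / 4) * T) := by
  obtain ⟨C₁, hC₁, h1⟩ := exists_taylor_le R (ε := δ / 4) (by positivity)
  obtain ⟨C₂, hC₂, h2⟩ := exists_le_exp_of_nonneg R.derivative (ε := δ / 4) (by positivity)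
  have hC : 0 ≤ C := by simpa using (abs_nonneg _).trans (hA 0)
  -- the bound for the difference quotients
  set B : ℝ := C₁ + 2 * C * exp δ with hB
  have key : ∀ T, 0 ≤ T → ∀ h, |h| = exp (-(δ / 2) * T) →
      |(A (T + h) - A T) / h - R.derivative.eval T| ≤ B * exp (-(δ / 4) * T) := by
    intro T hT h hh
    have hh0 : 0 < |h| := by rw [hh]; positivity
    have hh1 : |h| ≤ 1 := by rw [hh]; exact exp_le_one_iff.2 (by nlinarith)
    have hne : h ≠ 0 := abs_pos.1 hh0
    have e1 : |A (T + h) - A T - h * R.derivative.eval T| ≤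
        C₁ * exp (δ / 4 * T) * h ^ 2 + 2 * C * exp δ * exp (-δ * T) := by
      have i1 := h1 T h hT hh1
      have i2 := hA T
      have i3 := hA (T + h)
      have i4 : exp (-δ * (T + h)) ≤ exp δ * exp (-δ * T) := by
        rw [← exp_add]
        exact exp_le_exp.2 (by nlinarith [(abs_le.1 hh1).1])
      have i5 : exp (-δ * T) ≤ exp δ * exp (-δ * T) :=
        le_mul_of_one_le_left (by positivity) (one_le_exp hδ.le)
      rw [abs_le] at i1 i2 i3 ⊢
      constructor <;> nlinarith
    have e2 : (A (T + h) - A T) / h - R.derivative.eval T =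
        (A (T + h) - A T - h * R.derivative.eval T) / h := by field_simp
    rw [e2, abs_div, div_le_iff₀ hh0]
    refine e1.trans ?_
    have e3 : h ^ 2 = |h| * exp (-(δ / 2) * T) := by rw [← hh, ← sq, sq_abs]
    have e4 : exp (-δ * T) = |h| * exp (-(δ / 2) * T) := by
      rw [hh, ← exp_add]; congr 1; ring
    have e5 : exp (δ / 4 * T) * exp (-(δ / 2) * T) = exp (-(δ / 4) * T) := by
      rw [← exp_add]; congr 1; ring
    have e6 : exp (-(δ / 2) * T) ≤ exp (-(δ / 4) * T) :=
      exp_le_exp.2 (by nlinarith)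
    rw [e3, e4, hB]
    calc _ = C₁ * |h| * (exp (δ / 4 * T) * exp (-(δ / 2) * T)) +
          2 * C * exp δ * |h| * exp (-(δ / 2) * T) := by ring
      _ ≤ C₁ * |h| * exp (-(δ / 4) * T) +
          2 * C * exp δ * |h| * exp (-(δ / 4) * T) := by rw [e5]; gcongr
      _ = _ := by ring
  -- the factors `exp (± σ η)` are close to `1`
  have fac : ∀ T, 0 ≤ T → ∀ x c, |x - R.derivative.eval T| ≤ B * exp (-(δ / 4) * T) →
      |c| ≤ σ * exp (-(δ / 2) * T) →
      |exp c * x - R.derivative.eval T| ≤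
        exp σ * (B + σ * C₂) * exp (-(δ / 4) * T) := by
    intro T hT x c hx hc
    have hη1 : exp (-(δ / 2) * T) ≤ 1 := exp_le_one_iff.2 (by nlinarith)
    have hcσ : |c| ≤ σ := hc.trans (by nlinarith)
    have hec : exp c ≤ exp σ := exp_le_exp.2 ((le_abs_self _).trans hcσ)
    have hc1 : |exp c - 1| ≤ exp σ * |c| := by
      rcases le_total 0 c with h | h
      · rw [abs_of_nonneg (by linarith [one_le_exp h]), abs_of_nonneg h]
        have := add_one_le_exp (-c)
        have h3 : exp c * exp (-c) = 1 := by rw [← exp_add]; simp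
        nlinarith [exp_pos c]
      · rw [abs_of_nonpos (by linarith [exp_le_one_iff.2 h]), abs_of_nonpos h]
        have := add_one_le_exp c
        nlinarith [one_le_exp hσ]
    have e5 : exp (-(δ / 2) * T) * exp (δ / 4 * T) = exp (-(δ / 4) * T) := by
      rw [← exp_add]; congr 1; ring
    calc |exp c * x - R.derivative.eval T|
        = |exp c * (x - R.derivative.eval T) + (exp c - 1) * R.derivative.eval T| := by
          congr 1; ring
      _ ≤ exp c * |x - R.derivative.eval T| + |exp c - 1| * |R.derivative.eval T| := by
          refine (abs_add_le _ _).trans_eq ?_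
          rw [abs_mul, abs_mul, abs_of_pos (exp_pos c)]
      _ ≤ exp σ * (B * exp (-(δ / 4) * T)) +
          (exp σ * (σ * exp (-(δ / 2) * T))) * (C₂ * exp (δ / 4 * T)) := by
          gcongr
          · exact hc1.trans (by gcongr)
          · exact h2 T hT
      _ = exp σ * (B * exp (-(δ / 4) * T)) +
          exp σ * σ * C₂ * (exp (-(δ / 2) * T) * exp (δ / 4 * T)) := by ring
      _ = _ := by rw [e5]; ring
  refine ⟨exp σ * (B + σ * C₂), fun T hT => ?_⟩
  set η := exp (-(δ / 2) * T)
  have hη0 : 0 < η := exp_pos _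
  have u1 := fac T hT _ (σ * η) (key T hT η (abs_of_pos hη0)) (by rw [abs_of_nonneg (by positivity)])
  have u2 := fac T hT _ (-σ * η) (key T hT (-η) (by rw [abs_neg, abs_of_pos hη0]))
    (by rw [neg_mul, abs_neg, abs_of_nonneg (by positivity)])
  have v1 := hle T η hη0
  have v2 := hge T η hη0
  have w1 : exp (σ * η) / η * (A (T + η) - A T) =
      exp (σ * η) * ((A (T + η) - A T) / η) := by ring
  have w2 : exp (-σ * η) / η * (A T - A (T - η)) =
      exp (-σ * η) * ((A (T + -η) - A T) / -η) := by
    rw [← sub_eq_add_neg]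
    field_simp
    ring
  rw [w1] at v1
  rw [w2] at v2
  rw [abs_le] at u1 u2 ⊢
  constructor <;> linarith [u1.2, u2.1]

/-! ### Concentration on coordinate subspaces -/

section Blocks

variable {F : Type u} [RCLike F]

theorem unitBallConst_pos (μ : Measure F) [μ.IsAddHaarMeasure] {n : ℕ} (s : Finset (Fin n)) :
    0 < unitBallConst μ s := by
  refine ENNReal.toReal_pos ?_ (measure_unit_lt_top μ s).ne
  refine ((?_ : 0 < (power s μ) {w | ∑ i, ‖w i‖ ^ 2 < 1}).trans_le
    (measure_mono fun w (hw : ∑ i, ‖w i‖ ^ 2 < 1) => hw.le)).ne'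
  refine IsOpen.measure_pos _ (isOpen_lt (by fun_prop) continuous_const) ⟨0, ?_⟩
  simp

theorem measure_coordNorm_le_one (μ : Measure F) [μ.IsAddHaarMeasure] {n : ℕ} {s : Finset (Fin n)}
    (hs : s.Nonempty) : (power s μ) {w | coordNorm w ≤ 1} =
      .ofReal (unitBallConst μ s) := by
  have : Nonempty s := hs.to_subtype
  rw [unitBallConst, measureReal_def, ENNReal.ofReal_toReal (measure_unit_lt_top μ s).ne]
  congr 1
  ext w
  have := coordNorm_le_iff w zero_le_one
  simpa using this

/-- The measure of a product of unit balls, one for each block. -/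
theorem measure_pi_blocks (μ : Measure F) [μ.IsAddHaarMeasure] {n : ℕ} {ι : Type*} [DecidableEq ι]
    (S : Finset ι) {e : ι → Finset (Fin n)} (hdisj : (S : Set ι).PairwiseDisjoint e)
    (hne : ∀ P ∈ S, (e P).Nonempty) (s : Finset (Fin n)) (hs : s = S.biUnion e) :
    (power s μ) {w | ∀ P ∈ S, ∀ h : e P ⊆ s,
      coordNorm (fun i : e P => w ⟨i, h i.2⟩) ≤ 1} =
    .ofReal (∏ P ∈ S, unitBallConst μ (e P)) := by
  induction S using Finset.induction_on generalizing s with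
  | empty =>
    rw [biUnion_empty] at hs
    subst hs
    have : {w : (∅ : Finset (Fin n)) → F | ∀ P ∈ (∅ : Finset ι), ∀ h : e P ⊆ ∅,
      coordNorm (fun i : e P => w ⟨i, h i.2⟩) ≤ 1} = Set.univ := by ext; simp
    rw [this, Measure.pi_univ]
    simp
  | insert P S hP ih =>
    rw [biUnion_insert] at hs
    subst hs
    have hd : Disjoint (e P) (S.biUnion e) := by
      rw [disjoint_biUnion_right]
      intro P' hP'
      exact hdisj (by simp) (by simp [hP']) (fun h => hP (h ▸ hP'))
    have hmp := measurePreserving_piFinsetUnion hd (fun _ => μ)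
    have hset : (MeasurableEquiv.piFinsetUnion (fun _ => F) hd) ⁻¹'
        {w | ∀ P' ∈ insert P S, ∀ h : e P' ⊆ e P ∪ S.biUnion e,
          coordNorm (fun i : e P' => w ⟨i, h i.2⟩) ≤ 1} =
        {w : e P → F | coordNorm w ≤ 1} ×ˢ {w : S.biUnion e → F | ∀ P' ∈ S, ∀ h : e P' ⊆ S.biUnion e,
          coordNorm (fun i : e P' => w ⟨i, h i.2⟩) ≤ 1} := by
      ext ⟨w, w'⟩
      have hl : ∀ (i : Fin n) (hi : i ∈ e P) (hi' : i ∈ e P ∪ S.biUnion e),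
          (MeasurableEquiv.piFinsetUnion (fun _ => F) hd) (w, w') ⟨i, hi'⟩ = w ⟨i, hi⟩ :=
        fun i hi hi' => Equiv.piFinsetUnion_left (fun _ => F) hd hi hi'
      have hr : ∀ (i : Fin n) (hi : i ∈ S.biUnion e) (hi' : i ∈ e P ∪ S.biUnion e),
          (MeasurableEquiv.piFinsetUnion (fun _ => F) hd) (w, w') ⟨i, hi'⟩ = w' ⟨i, hi⟩ :=
        fun i hi hi' => Equiv.piFinsetUnion_right (fun _ => F) hd hi hi'
      simp only [Set.mem_preimage, Set.mem_ofPred_eq, Set.mem_prod, forall_mem_insert]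
      refine and_congr ⟨fun h => ?_, fun h h' => ?_⟩ (forall₂_congr fun P' hP' =>
        ⟨fun h h' => ?_, fun h h' => ?_⟩)
      · have := h subset_union_left
        convert this using 2
        ext i
        exact (hl i i.2 _).symm
      · convert h using 2
        ext i
        exact hl i i.2 _
      · have := h (h'.trans subset_union_right)
        convert this using 2
        ext i
        exact (hr i (h' i.2) _).symm
      · have h'' := subset_biUnion_of_mem e hP'
        convert h h'' using 2
        ext i
        exact hr i (h'' i.2) _
    rw [← hmp.measure_preimage_equiv, hset, Measure.prod_prod, measure_coordNorm_le_one μ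
      (hne P (mem_insert_self _ _)), ih (hdisj.subset (by simp))
      (fun P' hP' => hne P' (mem_insert_of_mem hP')) _ rfl, prod_insert hP,
      ENNReal.ofReal_mul (unitBallConst_pos μ _).le]

/-- Integration over the blocks of a function of the other coordinates. -/
theorem lintegral_blockRegion_zeroOn (μ : Measure F) [μ.IsAddHaarMeasure] {n : ℕ} {ι : Type*}
    [DecidableEq ι] (S : Finset ι) {e : ι → Finset (Fin n)} (hdisj : (S : Set ι).PairwiseDisjoint e)
    (hne : ∀ P ∈ S, (e P).Nonempty) (R : ℝ) {G : (Fin n → F) → ENNReal} (hG : Measurable G) :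
    ∫⁻ t in blockRegion F S e R, G (zeroOn (S.biUnion e) t) ∂(power (Fin n) μ) =
      ENNReal.ofReal (∏ P ∈ S, unitBallConst μ (e P)) *
        ∫⁻ y in {y | ∀ i, ‖y i‖ ≤ R}, G (extendZero (S.biUnion e) y)
          ∂(power {i : Fin n // i ∉ S.biUnion e} μ) := by
  set s := S.biUnion e with hs
  set Φ := MeasurableEquiv.piEquivPiSubtypeProd (fun _ : Fin n => F) (· ∈ s)
  set ν := power s μ
  set ν' := power {i // i ∉ s} μ
  have hΦ : MeasurePreserving Φ (power (Fin n) μ) (ν.prod ν') := measurePreserving_blocks μ s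
  have hz : ∀ t, zeroOn s t = extendZero s (Φ t).2 := fun t => (extendZero_restrict s t).symm
  set B : Set (s → F) := {w | ∀ P ∈ S, ∀ h : e P ⊆ s, coordNorm (fun i : e P => w ⟨i, h i.2⟩) ≤ 1}
  set Y : Set ({i // i ∉ s} → F) := {y | ∀ i, ‖y i‖ ≤ R}
  have hset : blockRegion F S e R = Φ ⁻¹' (B ×ˢ Y) := by
    ext t
    simp only [blockRegion, Set.mem_ofPred_eq, Set.mem_preimage, Set.mem_prod, B, Y]
    refine and_congr (forall₂_congr fun P hP => ?_) ?_
    · have h := subset_biUnion_of_mem e hP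
      exact ⟨fun h' _ => h', fun h' => h' h⟩
    · rw [Subtype.forall]
      refine forall_congr' fun i => ?_
      simp only [hs, mem_biUnion, not_exists, not_and]
      rfl
  have hemb := Φ.measurableEmbedding
  simp only [hz]
  have hGm : Measurable fun y => G (extendZero s y) := hG.comp (continuous_extendZero s).measurable
  rw [hset, hΦ.setLIntegral_comp_preimage_emb hemb (fun q => G (extendZero s q.2)),
    ← Measure.prod_restrict, ← lintegral_map (f := fun y => G (extendZero s y)) hGm measurable_snd,
    Measure.map_snd_prod, lintegral_smul_measure, Measure.restrict_apply_univ, smul_eq_mul,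
    ← measure_pi_blocks μ S hdisj hne s rfl]

theorem lintegral_eq_setLIntegral {T : Type*} [MeasurableSpace T] {m : Measure T} {S : Set T}
    (hS : MeasurableSet S) {f : T → ENNReal} (h : ∀ x, x ∉ S → f x = 0) :
    ∫⁻ x, f x ∂m = ∫⁻ x in S, f x ∂m := by
  rw [← lintegral_indicator hS]
  refine lintegral_congr fun x => ?_
  by_cases hx : x ∈ S
  · rw [Set.indicator_of_mem hx]
  · rw [Set.indicator_of_notMem hx, h x hx]

/-- The integral over a region, which is a product of balls in the blocks near the support `V` of the
integrand, of a function of the other coordinates. -/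
theorem setLIntegral_zeroOn (μ : Measure F) [μ.IsAddHaarMeasure] {n : ℕ} {ι : Type*} [DecidableEq ι]
    (S : Finset ι) {e : ι → Finset (Fin n)} (hdisj : (S : Set ι).PairwiseDisjoint e)
    (hne : ∀ P ∈ S, (e P).Nonempty) {B V : Set (Fin n → F)} (hB : MeasurableSet B)
    (hBV : ∀ t, zeroOn (S.biUnion e) t ∈ V →
      (t ∈ B ↔ ∀ P ∈ S, blockNorm (e P) t ≤ 1)) {R : ℝ}
    (hVR : ∀ z ∈ V, ∀ i ∉ S.biUnion e, ‖z i‖ ≤ R) (hV : MeasurableSet V)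
    {G : (Fin n → F) → ENNReal} (hG : Measurable G) (hGV : ∀ z, z ∉ V → G z = 0) :
    ∫⁻ t in B, G (zeroOn (S.biUnion e) t) ∂(power _ μ) =
      ∫⁻ y in extendZero (S.biUnion e) ⁻¹' V, ENNReal.ofReal (∏ P ∈ S, unitBallConst μ (e P)) *
        G (extendZero (S.biUnion e) y) ∂(power {i : Fin n // i ∉ S.biUnion e} μ) := by
  have h1 : ∫⁻ t in B, G (zeroOn (S.biUnion e) t) ∂(power (Fin n) μ) =
      ∫⁻ t in blockRegion F S e R, G (zeroOn (S.biUnion e) t) ∂(power _ μ) := by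
    rw [← lintegral_indicator hB, ← lintegral_indicator (measurableSet_blockRegion S e R)]
    refine lintegral_congr fun t => ?_
    by_cases ht : zeroOn (S.biUnion e) t ∈ V
    · have h2 : t ∈ B ↔ t ∈ blockRegion F S e R := by
        refine (hBV t ht).trans ⟨fun h => ⟨h, fun i hi => ?_⟩, fun h => h.1⟩
        have hi' : i ∉ S.biUnion e := fun h => by
          obtain ⟨P, hP, h'⟩ := mem_biUnion.1 h
          exact hi P hP h'
        simpa [zeroOn, hi'] using hVR _ ht i hi'
      by_cases h : t ∈ B
      · rw [Set.indicator_of_mem h, Set.indicator_of_mem (h2.1 h)]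
      · rw [Set.indicator_of_notMem h, Set.indicator_of_notMem fun h' => h (h2.2 h')]
    · simp only [Set.indicator, hGV _ ht, ite_self]
  have hY : MeasurableSet {y : {i : Fin n // i ∉ S.biUnion e} → F | ∀ i, ‖y i‖ ≤ R} := by
    rw [Set.ofPred_forall]
    exact MeasurableSet.iInter fun i => measurableSet_le (by fun_prop) measurable_const
  have hm := (continuous_extendZero (F := F) (S.biUnion e)).measurable
  rw [h1, lintegral_blockRegion_zeroOn μ S hdisj hne R hG, ← lintegral_eq_setLIntegral hY,
    ← lintegral_const_mul _ (f := fun y => G (extendZero (S.biUnion e) y)) (hG.comp hm),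
    lintegral_eq_setLIntegral (hm hV)]
  · intro y hy
    rw [hGV _ hy, mul_zero]
  · intro y hy
    refine hGV _ fun h => hy fun i => ?_
    simpa [extendZero, i.2] using hVR _ h i.1 i.2

section Limit

variable {n : ℕ} {m : Measure (Fin n → F)}

theorem lintegral_ofReal_mul_rpow {ε θ : ℝ} (hε : 0 < ε) (hθ : 0 ≤ θ) :
    ∫⁻ v in Set.Ioc (0 : ℝ) 1, ENNReal.ofReal (ε * v ^ (ε + θ - 1)) = ENNReal.ofReal (ε / (ε + θ)) := by
  have hi := (intervalIntegral.intervalIntegrable_rpow' (a := 0) (b := 1)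
    (show -1 < ε + θ - 1 by linarith)).const_mul ε
  rw [← ofReal_integral_eq_lintegral_ofReal hi.1]
  · congr 1
    rw [← intervalIntegral.integral_of_le zero_le_one, intervalIntegral.integral_const_mul,
      integral_rpow (Or.inl (by linarith))]
    rw [sub_add_cancel, one_rpow, zero_rpow (by positivity)]
    ring
  · filter_upwards [ae_restrict_mem measurableSet_Ioc] with v hv
    have := hv.1.le
    positivity

/-- The probability density `∏ ε v_P ^ (ε - 1)`, which is concentrated, as `ε` tends to `0`, near the
intersection of the coordinate subspaces `v_P = 0`. -/
def epsDensity {ι : Type*} (S : Finset ι) (e : ι → Finset (Fin n)) (ε : ℝ) (t : Fin n → F) : ℝ :=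
  ∏ P ∈ S, (ε * blockNorm (e P) t ^ (ε - 1))

theorem measurable_epsDensity {ι : Type*} (S : Finset ι) (e : ι → Finset (Fin n)) (ε : ℝ) :
    Measurable (epsDensity (F := F) S e ε) :=
  measurable_prod _ fun _ _ =>
    ((continuous_blockNorm _).measurable.pow_const _).const_mul _

/-- The densities have mass one in the directions of the blocks. -/
theorem lintegral_epsDensity [SFinite m] {ι : Type*} [DecidableEq ι] {S : Finset ι}
    {e : ι → Finset (Fin n)} (hdisj : (S : Set ι).PairwiseDisjoint e)
    (h : ∀ P ∈ S, SplitsBlock m (e P)) {ε : ℝ} (hε : 0 < ε) {g : (Fin n → F) → ENNReal}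
    (hg : Measurable g) (hgS : ∀ P ∈ S, ∀ t, g (zeroOn (e P) t) = g t) :
    ∫⁻ t, g t * .ofReal (epsDensity S e ε t) ∂m = ∫⁻ t, g t ∂m := by
  have h1 := lintegral_mul_prod_blockNorm S hdisj h (fun _ v => .ofReal (ε * v ^ (ε - 1)))
    (fun P => by fun_prop) hg hgS
  have h2 := lintegral_ofReal_mul_rpow hε le_rfl
  rw [add_zero, div_self hε.ne', ENNReal.ofReal_one] at h2
  simp only [h2, prod_const_one, mul_one] at h1
  rw [← h1]
  refine lintegral_congr fun t => ?_
  rw [epsDensity, ENNReal.ofReal_prod_of_nonneg]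
  intro P _
  have := blockNorm_nonneg (e P) t
  positivity

/-- The moments tend to zero with `ε`, so the masses concentrate on the coordinate subspace. -/
theorem lintegral_epsDensity_mul [SFinite m] {ι : Type*} [DecidableEq ι] {S : Finset ι}
    {e : ι → Finset (Fin n)} (hdisj : (S : Set ι).PairwiseDisjoint e)
    (h : ∀ P ∈ S, SplitsBlock m (e P)) {ε θ : ℝ} (hε : 0 < ε) (hθ : 0 ≤ θ) {P : ι} (hP : P ∈ S)
    (hpos : ∀ᵐ t ∂m, 0 < blockNorm (e P) t) :
    ∫⁻ t, .ofReal (blockNorm (e P) t ^ θ) * .ofReal (epsDensity S e ε t) ∂m =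
      m Set.univ * .ofReal (ε / (ε + θ)) := by
  have h1 := lintegral_prod_blockNorm S hdisj h (fun P' v => ENNReal.ofReal
    (ε * v ^ (ε + (if P' = P then θ else 0) - 1))) (fun P => by fun_prop)
  have h2 : ∏ P' ∈ S, ∫⁻ v in Set.Ioc (0 : ℝ) 1, ENNReal.ofReal
      (ε * v ^ (ε + (if P' = P then θ else 0) - 1)) = .ofReal (ε / (ε + θ)) := by
    rw [prod_eq_single P]
    · rw [if_pos rfl, lintegral_ofReal_mul_rpow hε hθ]
    · intro P' _ hne
      rw [if_neg hne, lintegral_ofReal_mul_rpow hε le_rfl, add_zero, div_self hε.ne',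
        ENNReal.ofReal_one]
    · intro h; exact absurd hP h
  rw [h2] at h1
  rw [← h1]
  refine lintegral_congr_ae (hpos.mono fun t ht => ?_)
  have hnn : ∀ P', 0 ≤ blockNorm (e P') t := fun P' => blockNorm_nonneg _ _
  unfold epsDensity
  dsimp only
  rw [← ENNReal.ofReal_mul (by have := hnn P; positivity),
    ← ENNReal.ofReal_prod_of_nonneg fun P' _ => by have := hnn P'; positivity]
  congr 1
  rw [← mul_prod_erase S _ hP, ← mul_prod_erase S _ hP, ← mul_assoc, if_pos rfl]
  congr 1
  · rw [add_sub_right_comm, rpow_add ht]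
    ring
  · refine prod_congr rfl fun P' hP' => ?_
    rw [if_neg (ne_of_mem_erase hP'), add_zero]

end Limit

end Blocks

section Blocks

variable {F : Type u} [RCLike F] {n : ℕ} {m : Measure (Fin n → F)}

theorem zeroOn_biUnion_zeroOn {ι : Type*} {S : Finset ι} (e : ι → Finset (Fin n)) {P : ι}
    (hP : P ∈ S) (t : Fin n → F) : zeroOn (S.biUnion e) (zeroOn (e P) t) = zeroOn (S.biUnion e) t := by
  rw [zeroOn_zeroOn, union_eq_left.2 (subset_biUnion_of_mem e hP)]

theorem norm_sub_zeroOn_biUnion_le {ι : Type*} (S : Finset ι) (e : ι → Finset (Fin n))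
    (t : Fin n → F) : ‖t - zeroOn (S.biUnion e) t‖ ≤ ∑ P ∈ S, ‖t - zeroOn (e P) t‖ := by
  refine (pi_norm_le_iff_of_nonneg (sum_nonneg fun _ _ => norm_nonneg _)).2 fun i => ?_
  by_cases hi : i ∈ S.biUnion e
  · obtain ⟨P, hP, hiP⟩ := mem_biUnion.1 hi
    refine le_trans ?_ ((norm_le_pi_norm (t - zeroOn (e P) t) i).trans
      (single_le_sum (f := fun P => ‖t - zeroOn (e P) t‖) (fun _ _ => norm_nonneg _) hP))
    simp [zeroOn, hi, hiP]
  · simp only [Pi.sub_apply, zeroOn, hi, if_false, sub_self, norm_zero]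
    exact sum_nonneg fun _ _ => norm_nonneg _

/-- The measures `∏ ε v_P ^ (ε - 1) m` tend to the image of `m` by the projection on the coordinate
subspace `v_P = 0` for `P ∈ S`. -/
theorem tendsto_integral_epsDensity [IsFiniteMeasure m] {ι : Type*} [DecidableEq ι] {S : Finset ι}
    {e : ι → Finset (Fin n)} (hdisj : (S : Set ι).PairwiseDisjoint e)
    (hne : ∀ P ∈ S, (e P).Nonempty) (h : ∀ P ∈ S, SplitsBlock m (e P)) {H ell : (Fin n → F) → ℝ}
    (hH : Continuous H) (hHc : HasCompactSupport H) (hell : Measurable ell) {K : ℝ}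
    (hK : ∀ t, H t ≠ 0 → |ell t| ≤ K) :
    Tendsto (fun ε : ℝ => ∫ t, H t * exp (ε * ell t) * epsDensity S e ε t ∂m) (𝓝[>] 0)
      (𝓝 (∫ t, H (zeroOn (S.biUnion e) t) ∂m)) := by
  set Z : (Fin n → F) → Fin n → F := zeroOn (S.biUnion e)
  have hZm : Measurable Z := (continuous_zeroOn _).measurable
  obtain ⟨C, hC⟩ : ∃ C, ∀ t, |H t| ≤ C := hHc.exists_bound_of_continuous hH
  have hC0 : 0 ≤ C := (abs_nonneg _).trans (hC 0)
  set K' := max K 0 with hK'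
  have hK'0 : 0 ≤ K' := le_max_right _ _
  have hKK : ∀ t, H t ≠ 0 → |ell t| ≤ K' := fun t ht => (hK t ht).trans (le_max_left _ _)
  have huc : UniformContinuous H := hHc.uniformContinuous_of_continuous hH
  set θ : ℝ := holder F n with hθ
  have hmem : ∀ P ∈ S, ∀ᵐ t ∂m, blockNorm (e P) t ∈ Set.Ioc (0 : ℝ) 1 := fun P hP => (h P hP).ae_mem
  set M : ℝ := m.real Set.univ
  have hM0 : 0 ≤ M := measureReal_nonneg
  -- the weighted measures
  set w : ℝ → (Fin n → F) → ENNReal := fun ε t => .ofReal (epsDensity S e ε t) with hw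
  have hwm : ∀ ε, Measurable (w ε) := fun ε => (measurable_epsDensity S e ε).ennreal_ofReal
  have hw0 : ∀ ε, 0 < ε → ∀ t : Fin n → F, 0 ≤ epsDensity S e ε t := fun ε hε t => prod_nonneg fun P _ => by
    have := blockNorm_nonneg (e P) t; positivity
  have hmap : ∀ ε, 0 < ε → (m.withDensity (w ε)).map Z = m.map Z := by
    intro ε hε
    ext s hs
    rw [Measure.map_apply hZm hs, Measure.map_apply hZm hs, withDensity_apply _ (hZm hs),
      ← lintegral_indicator (hZm hs)]
    have h1 := lintegral_epsDensity hdisj h hε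
      (measurable_one.indicator (hZm hs)) (fun P hP t => by
        have hz : Z (zeroOn (e P) t) = Z t := zeroOn_biUnion_zeroOn e hP t
        by_cases ht : Z t ∈ s <;> simp [Set.indicator, hz, ht])
    rw [lintegral_indicator_one (hZm hs)] at h1
    rw [← h1]
    refine lintegral_congr fun t => ?_
    by_cases ht : t ∈ Z ⁻¹' s <;> simp [ht, hw]
  have huniv : ∀ ε, 0 < ε → m.withDensity (w ε) Set.univ = m Set.univ := by
    intro ε hε
    simpa [Measure.map_apply hZm MeasurableSet.univ] using congrArg (· Set.univ) (hmap ε hε)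
  have hfin : ∀ ε, 0 < ε → IsFiniteMeasure (m.withDensity (w ε)) := fun ε hε =>
    ⟨by rw [huniv ε hε]; exact measure_lt_top _ _⟩
  have hmom : ∀ ε, 0 < ε → ∀ P ∈ S, Integrable (fun t => blockNorm (e P) t ^ θ) (m.withDensity (w ε)) ∧
      ∫ t, blockNorm (e P) t ^ θ ∂(m.withDensity (w ε)) ≤ M * (ε / θ) := by
    intro ε hε P hP
    obtain ⟨i, -⟩ := hne P hP
    have hn : 0 < n := Fin.pos i
    have := finrank_pos F
    have hθ0 : 0 < θ := by rw [hθ, holder]; positivity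
    have h1 := lintegral_epsDensity_mul hdisj h hε hθ0.le hP ((hmem P hP).mono fun t ht => ht.1)
    have hbm : Measurable fun t : Fin n → F => ENNReal.ofReal (blockNorm (e P) t ^ θ) :=
      ((continuous_blockNorm _).measurable.pow_const _).ennreal_ofReal
    have h2 : ∫⁻ t, ENNReal.ofReal (blockNorm (e P) t ^ θ) ∂(m.withDensity (w ε)) =
        m Set.univ * .ofReal (ε / (ε + θ)) := by
      rw [lintegral_withDensity_eq_lintegral_mul _ (hwm ε) hbm, ← h1]
      exact lintegral_congr fun t => by rw [Pi.mul_apply, mul_comm]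
    have hnn : ∀ t : Fin n → F, 0 ≤ blockNorm (e P) t ^ θ := fun t =>
      rpow_nonneg (blockNorm_nonneg _ _) _
    have hms : AEStronglyMeasurable (fun t => blockNorm (e P) t ^ θ)
      (m.withDensity (w ε)) := ((continuous_blockNorm _).measurable.pow_const _).aestronglyMeasurable
    refine ⟨⟨hms, ?_⟩, ?_⟩
    · rw [hasFiniteIntegral_iff_ofReal (ae_of_all _ hnn), h2]
      exact ENNReal.mul_lt_top (measure_lt_top _ _) ENNReal.ofReal_lt_top
    · rw [integral_eq_lintegral_of_nonneg_ae (ae_of_all _ hnn) hms, h2, ENNReal.toReal_mul,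
        ENNReal.toReal_ofReal (by positivity)]
      refine mul_le_mul_of_nonneg_left ?_ hM0
      gcongr
      linarith
  have hbound : ∀ η > 0, ∃ B, 0 ≤ B ∧ ∀ ε, 0 < ε → ε * K' ≤ 1 →
      |(∫ t, H t * exp (ε * ell t) * epsDensity S e ε t ∂m) - ∫ t, H (Z t) ∂m| ≤
        η * M + ε * B := by
    intro η hη
    obtain ⟨ρ, hρ, hρη⟩ := Metric.uniformContinuous_iff.1 huc η hη
    have hdiff : ∀ t t', |H t - H t'| ≤ η + 2 * C / ρ * ‖t - t'‖ := by
      intro t t'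
      rcases lt_or_ge ‖t - t'‖ ρ with hlt | hge
      · have h1 := hρη (by rwa [dist_eq_norm])
        rw [dist_eq] at h1
        have : 0 ≤ 2 * C / ρ * ‖t - t'‖ := by positivity
        linarith
      · have h1 : |H t - H t'| ≤ 2 * C := by
          have h2 := hC t
          have h3 := hC t'
          rw [abs_le] at h2 h3 ⊢
          constructor <;> linarith
        have h2 : 2 * C ≤ 2 * C / ρ * ‖t - t'‖ := by
          rw [div_mul_eq_mul_div, le_div_iff₀ hρ]
          gcongr
        linarith
    refine ⟨2 * C * K' * M + 2 * C / ρ * ∑ P ∈ S, M / θ, ?_, fun ε hε hεK => ?_⟩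
    · have : 0 ≤ θ := by rw [hθ, holder]; positivity
      positivity
    set ν := m.withDensity (w ε) with hν
    have := hfin ε hε
    have hνM : ν.real Set.univ = M := by rw [measureReal_def, huniv ε hε]; rfl
    have hHe : Measurable fun t => H t * exp (ε * ell t) :=
      hH.measurable.mul (hell.const_mul ε).exp
    have e1 : ∫ t, H t * exp (ε * ell t) * epsDensity S e ε t ∂m =
        ∫ t, H t * exp (ε * ell t) ∂ν := by
      rw [hν, integral_withDensity_eq_integral_toReal_smul (hwm ε) (ae_of_all _ fun t => by simp [hw])]
      simp only [hw, ENNReal.toReal_ofReal (hw0 ε hε _), smul_eq_mul, mul_comm]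
    have e2 : ∫ t, H (Z t) ∂m = ∫ t, H (Z t) ∂ν := by
      rw [← integral_map hZm.aemeasurable hH.aestronglyMeasurable, ← hmap ε hε,
        integral_map hZm.aemeasurable hH.aestronglyMeasurable]
    have hexp : ∀ t, |H t * exp (ε * ell t) - H t| ≤ 2 * C * K' * ε := by
      intro t
      by_cases ht : H t = 0
      · rw [ht]; simp; positivity
      · have h1 : |ε * ell t| ≤ ε * K' := by
          rw [abs_mul, abs_of_pos hε]
          exact mul_le_mul_of_nonneg_left (hKK t ht) hε.le
        have h2 := abs_exp_sub_one_le (h1.trans hεK)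
        rw [← mul_sub_one, abs_mul]
        calc _ ≤ C * (2 * (ε * K')) := mul_le_mul (hC t) (h2.trans (by linarith)) (abs_nonneg _) hC0
          _ = _ := by ring
    have i1 : Integrable (fun t => H t * exp (ε * ell t)) ν := by
      refine Integrable.of_bound hHe.aestronglyMeasurable (C + 2 * C * K' * ε) (ae_of_all _ fun t => ?_)
      rw [norm_eq_abs]
      have h1 := hexp t
      have h2 := hC t
      rw [abs_le] at h1 h2 ⊢
      constructor <;> linarith
    have i2 : Integrable (fun t => H (Z t)) ν :=
      Integrable.of_bound (hH.measurable.comp hZm).aestronglyMeasurable C (ae_of_all _ fun t => hC _)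
    have hae : ∀ᵐ t ∂ν, ‖H t * exp (ε * ell t) - H (Z t)‖ ≤
        2 * C * K' * ε + (η + 2 * C / ρ * ∑ P ∈ S, blockNorm (e P) t ^ θ) := by
      have h1 : ∀ᵐ t ∂ν, ∀ P ∈ S, blockNorm (e P) t ∈ Set.Ioc (0 : ℝ) 1 :=
        (withDensity_absolutelyContinuous m (w ε)).ae_le ((Finset.eventually_all S).2 hmem)
      filter_upwards [h1] with t ht
      have h2 := hexp t
      have h3 := hdiff t (Z t)
      have h4 : ‖t - Z t‖ ≤ ∑ P ∈ S, blockNorm (e P) t ^ θ :=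
        (norm_sub_zeroOn_biUnion_le S e t).trans
          (sum_le_sum fun P hP => norm_sub_zeroOn_le (hne P hP) (ht P hP).2)
      have h5 := mul_le_mul_of_nonneg_left h4 (show 0 ≤ 2 * C / ρ by positivity)
      rw [norm_eq_abs]
      rw [abs_le] at h2 h3 ⊢
      constructor <;> linarith
    have isum : Integrable (fun t => ∑ P ∈ S, blockNorm (e P) t ^ θ) ν :=
      integrable_finsetSum _ fun P hP => (hmom ε hε P hP).1
    have icm : Integrable (fun t => 2 * C / ρ * ∑ P ∈ S, blockNorm (e P) t ^ θ) ν := isum.const_mul _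
    have iadd : Integrable (fun t => η + 2 * C / ρ * ∑ P ∈ S, blockNorm (e P) t ^ θ) ν :=
      (integrable_const _).add icm
    have ib : Integrable (fun t => 2 * C * K' * ε + (η + 2 * C / ρ * ∑ P ∈ S, blockNorm (e P) t ^ θ))
        ν := (integrable_const _).add iadd
    rw [e1, e2, ← integral_sub i1 i2]
    refine (norm_integral_le_of_norm_le ib hae).trans ?_
    rw [integral_add (integrable_const _) iadd, integral_add (integrable_const _) icm,
      integral_const, integral_const, integral_const_mul,
      integral_finsetSum _ fun P hP => (hmom ε hε P hP).1, hνM]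
    have h6 : ∑ P ∈ S, ∫ t, blockNorm (e P) t ^ θ ∂ν ≤ ∑ P ∈ S, ε * (M / θ) :=
      sum_le_sum fun P hP => ((hmom ε hε P hP).2).trans_eq (by ring)
    rw [← mul_sum] at h6
    have h7 := mul_le_mul_of_nonneg_left h6 (show 0 ≤ 2 * C / ρ by positivity)
    simp only [smul_eq_mul]
    nlinarith
  rw [Metric.tendsto_nhds]
  intro η hη
  obtain ⟨B, hB0, hB⟩ := hbound (η / (2 * (M + 1))) (by positivity)
  have hev : ∀ᶠ ε in 𝓝[>] (0 : ℝ), ε < min (1 / (K' + 1)) (η / (2 * (B + 1))) :=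
    eventually_nhdsWithin_of_eventually_nhds (Iio_mem_nhds (by positivity))
  filter_upwards [hev, self_mem_nhdsWithin] with ε hε hε0
  rw [Set.mem_Ioi] at hε0
  have h1 := hε.trans_le (min_le_left _ _)
  have h2 := hε.trans_le (min_le_right _ _)
  rw [lt_div_iff₀ (by positivity)] at h1 h2
  rw [dist_eq]
  refine (hB ε hε0 (by nlinarith)).trans_lt ?_
  have h3 : η / (2 * (M + 1)) * M ≤ η / 2 := by
    rw [div_mul_eq_mul_div, div_le_div_iff₀ (by positivity) two_pos]
    nlinarith
  nlinarith

end Blocks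

/-! ### Patching of measures -/

section Patching

variable {X : Type*} [TopologicalSpace X] [SecondCountableTopology X] [MeasurableSpace X]

/-- Measures which are locally equal on an open set are equal there. -/
theorem restrict_eq_of_locally_eq {μ ν : Measure X} {W : Set X}
    (h : ∀ x ∈ W, ∃ O, IsOpen O ∧ x ∈ O ∧ μ.restrict O = ν.restrict O) :
    μ.restrict W = ν.restrict W := by
  choose! O hO hx hOe using h
  obtain ⟨T, hTc, hT⟩ := TopologicalSpace.isOpen_iUnion_countable (fun x : W => O x)
    fun x => hO x x.2
  have h1 : μ.restrict (⋃ x ∈ T, O x) = ν.restrict (⋃ x ∈ T, O x) :=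
    (Measure.restrict_biUnion_congr hTc).2 fun x _ => hOe x x.2
  have h2 : W ⊆ ⋃ x ∈ T, O x := by
    rw [hT]
    exact fun x hx' => Set.mem_iUnion.2 ⟨⟨x, hx'⟩, hx x hx'⟩
  exact Measure.restrict_congr_mono h2 h1

variable [BorelSpace X]

/-- Measures living on open sets and agreeing locally on the overlaps are the restrictions of their
supremum. -/
theorem sSup_patching {s : Set (Measure X)} {σ : Measure X} {rel : Measure X → Set X → Prop}
    (hσ : σ = sSup s) (hs : ∀ ν, ν ∈ s ↔ ∃ W, rel ν W) (hopen : ∀ ν W, rel ν W → IsOpen W)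
    (hnull : ∀ ν W, rel ν W → ν Wᶜ = 0) (hloc : ∀ ν W ν' W', rel ν W → rel ν' W' → ∀ x ∈ W ∩ W',
      ∃ O, IsOpen O ∧ x ∈ O ∧ ν.restrict O = ν'.restrict O) :
    (∀ ν W, rel ν W → σ.restrict W = ν) ∧
      ∀ E : Set X, (∀ ν W, rel ν W → Disjoint E W) → σ E = 0 := by
  classical
  obtain rfl : s = {ν | ∃ W, rel ν W} := Set.ext hs
  subst hσ
  set κ := {q : Measure X × Set X // rel q.1 q.2}
  have hagree : ∀ i j : κ, i.1.1.restrict (i.1.2 ∩ j.1.2) = j.1.1.restrict (i.1.2 ∩ j.1.2) :=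
    fun i j => restrict_eq_of_locally_eq (hloc _ _ _ _ i.2 j.2)
  rcases isEmpty_or_nonempty κ with hκ | hκ
  · have hempty : {ν | ∃ W, rel ν W} = ∅ := by
      ext ν
      simp only [Set.mem_ofPred_eq, Set.mem_empty_iff_false, iff_false, not_exists]
      exact fun W h => hκ.elim ⟨(ν, W), h⟩
    refine ⟨fun ν W h => hκ.elim ⟨(ν, W), h⟩, fun E _ => ?_⟩
    rw [hempty, _root_.sSup_empty]
    rfl
  obtain ⟨T, hTc, hT⟩ := TopologicalSpace.isOpen_iUnion_countable (fun i : κ => i.1.2)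
    fun i => hopen _ _ i.2
  obtain ⟨f, hf⟩ : ∃ f : ℕ → κ, ⋃ k, (f k).1.2 = ⋃ i : κ, i.1.2 := by
    rcases T.eq_empty_or_nonempty with h0 | h0
    · refine ⟨fun _ => Classical.arbitrary κ, ?_⟩
      rw [h0] at hT
      have h1 : ⋃ i : κ, i.1.2 = ∅ := by rw [← hT]; simp
      rw [h1]
      exact Set.eq_empty_of_subset_empty (h1 ▸ Set.iUnion_subset fun k =>
        Set.subset_iUnion (fun i : κ => i.1.2) (Classical.arbitrary κ))
    · obtain ⟨f, hf⟩ := hTc.exists_eq_range h0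
      refine ⟨f, ?_⟩
      rw [← hT, hf, Set.biUnion_range]
  set A : ℕ → Set X := disjointed fun k => (f k).1.2 with hA
  have hAm : ∀ k, MeasurableSet (A k) := fun k =>
    MeasurableSet.disjointed (fun k => (hopen _ _ (f k).2).measurableSet) k
  have hAW : ∀ k, A k ⊆ (f k).1.2 := fun k => disjointed_subset _ k
  have hAd : Pairwise (Function.onFun Disjoint A) := disjoint_disjointed _
  have hAU : ⋃ k, A k = ⋃ i : κ, i.1.2 := by rw [hA, iUnion_disjointed, hf]
  set τ : Measure X := Measure.sum fun k => (f k).1.1.restrict (A k) with hτ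
  have hτE : ∀ E, MeasurableSet E → τ E = ∑' k, (f k).1.1 (E ∩ A k) := fun E hE => by
    rw [hτ, Measure.sum_apply _ hE]
    simp only [Measure.restrict_apply hE]
  have hrestr : ∀ i : κ, τ.restrict i.1.2 = i.1.1 := by
    intro i
    have hWm := (hopen _ _ i.2).measurableSet
    ext E hE
    rw [Measure.restrict_apply hE, hτE _ (hE.inter hWm)]
    have h1 : ∀ k, (f k).1.1 (E ∩ i.1.2 ∩ A k) = i.1.1 (E ∩ i.1.2 ∩ A k) := by
      intro k
      have h2 : E ∩ i.1.2 ∩ A k ⊆ i.1.2 ∩ (f k).1.2 := fun x hx => ⟨hx.1.2, hAW k hx.2⟩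
      have h3 := congrArg (fun μ : Measure X => μ (E ∩ i.1.2 ∩ A k)) (hagree i (f k))
      simp only [Measure.restrict_apply ((hE.inter hWm).inter (hAm k)),
        Set.inter_eq_left.2 h2] at h3
      exact h3.symm
    simp only [h1]
    rw [← measure_iUnion (fun k l hkl => (hAd hkl).mono Set.inter_subset_right
      Set.inter_subset_right) (fun k => (hE.inter hWm).inter (hAm k)), ← Set.inter_iUnion, hAU]
    have h4 : E ∩ i.1.2 ∩ ⋃ i : κ, i.1.2 = E ∩ i.1.2 :=
      Set.inter_eq_left.2 fun x hx => Set.mem_iUnion.2 ⟨i, hx.2⟩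
    rw [h4]
    exact measure_inter_conull (hnull _ _ i.2) |>.trans rfl
  have hlub : IsLUB {ν | ∃ W, rel ν W} τ := by
    refine ⟨?_, fun ρ hρ => ?_⟩
    · rintro ν ⟨W, h⟩
      exact (hrestr ⟨(ν, W), h⟩).symm.le.trans Measure.restrict_le_self
    · refine Measure.le_iff.2 fun E hE => ?_
      rw [hτE E hE]
      have h1 : ∀ k, (f k).1.1 (E ∩ A k) ≤ ρ (E ∩ A k) := fun k =>
        hρ ⟨(f k).1.2, (f k).2⟩ _
      refine (ENNReal.tsum_le_tsum h1).trans ?_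
      rw [← measure_iUnion (fun k l hkl => (hAd hkl).mono Set.inter_subset_right
        Set.inter_subset_right) (fun k => hE.inter (hAm k)), ← Set.inter_iUnion]
      exact measure_mono Set.inter_subset_left
  rw [hlub.sSup_eq]
  refine ⟨fun ν W h => hrestr ⟨(ν, W), h⟩, fun E hE => ?_⟩
  have hUm : MeasurableSet (⋃ i : κ, i.1.2) :=
    (isOpen_iUnion fun i : κ => hopen _ _ i.2).measurableSet
  refine measure_mono_null (t := (⋃ i : κ, i.1.2)ᶜ) (fun x hx hx' => ?_) ?_
  · obtain ⟨i, hi⟩ := Set.mem_iUnion.1 hx'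
    exact Set.disjoint_left.1 (hE _ _ i.2) hx hi
  · rw [hτE _ hUm.compl, ENNReal.tsum_eq_zero]
    intro k
    have : (⋃ i : κ, i.1.2)ᶜ ∩ A k = ∅ := by
      rw [← hAU]
      ext x
      simp only [Set.mem_inter_iff, Set.mem_compl_iff, Set.mem_iUnion, not_exists,
        Set.mem_empty_iff_false, iff_false, not_and]
      exact fun h => h k
    rw [this, measure_empty]

end Patching

/-- Integration with respect to a measure defined by coordinates `j` on a subset `S₀` and a density
`ρ`, on a part `O` of `S₀` where the coordinates have the inverse `g`. -/
theorem setLIntegral_map_comap_withDensity {X E : Type*} [MeasurableSpace X] [MeasurableSpace E]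
    {m : Measure E} {S₀ : Set X} (hS₀ : MeasurableSet S₀) {j : S₀ → E} (hj : MeasurableEmbedding j)
    {ρ : S₀ → ENNReal} (hρ : Measurable ρ) {O : Set X} (hO : MeasurableSet O) {V : Set E}
    (hV : MeasurableSet V) {g : E → X} (h1 : ∀ z : S₀, z.1 ∈ O → j z ∈ V ∧ g (j z) = z)
    (h2 : ∀ y ∈ V, ∃ z : S₀, z.1 ∈ O ∧ j z = y) {ρ' : X → ENNReal} (hρ' : ∀ z : S₀, ρ z = ρ' z)
    {f : X → ENNReal} (hf : Measurable f) :
    ∫⁻ x in O, f x ∂(((m.comap j).withDensity ρ).map Subtype.val) =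
      ∫⁻ y in V, f (g y) * ρ' (g y) ∂m := by
  rw [← lintegral_indicator hO, (MeasurableEmbedding.subtype_coe hS₀).lintegral_map,
    lintegral_withDensity_eq_lintegral_mul _ hρ (g := fun z : S₀ => O.indicator f z)
      ((hf.indicator hO).comp measurable_subtype_coe)]
  have h3 : ∀ z : S₀, (ρ * fun z : S₀ => O.indicator f z) z =
      (V.indicator fun y => f (g y) * ρ' (g y)) (j z) := by
    intro z
    by_cases hz : z.1 ∈ O
    · rw [Set.indicator_of_mem (h1 z hz).1, Pi.mul_apply, Set.indicator_of_mem hz, (h1 z hz).2, hρ',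
        mul_comm]
    · have hz' : j z ∉ V := fun h => by
        obtain ⟨z', hz', he⟩ := h2 _ h
        exact hz (hj.injective he ▸ hz')
      rw [Set.indicator_of_notMem hz', Pi.mul_apply, Set.indicator_of_notMem hz, mul_zero]
  rw [lintegral_congr h3, ← hj.lintegral_map (fun y => (V.indicator fun y => f (g y) * ρ' (g y)) y),
    hj.map_comap, lintegral_indicator hV, Measure.restrict_restrict hV]
  congr 2
  refine Set.inter_eq_left.2 fun y hy => ?_
  obtain ⟨z, -, he⟩ := h2 y hy
  exact ⟨z, he⟩

/-! ### Norms of the canonical sections in local coordinates -/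

section Norms

variable {F : Type u} [RCLike F] {X : Scheme.{u}} {p : X ⟶ Spec (of F)}

theorem IsSmoothOn.continuousAt {g : RatPoint p → ℝ} {S : Set (RatPoint p)} (h : IsSmoothOn g S)
    {x : RatPoint p} (hx : x ∈ S) : ContinuousAt g x := by
  obtain ⟨U, m, f, G, hxU, hG, hev⟩ := h x hx
  refine ContinuousAt.congr ?_ (hev.mono fun y hy => hy.symm)
  exact (hG.continuous.continuousAt).comp
    (continuousAt_pi.2 fun i => continuousAt_val _ hxU)

theorem modulus_nonneg (a : F) : 0 ≤ modulus a := by unfold modulus; positivity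

theorem modulus_one : modulus (1 : F) = 1 := by simp [modulus]

theorem modulus_eq_zero {a : F} : modulus a = 0 ↔ a = 0 := by
  simp [modulus, (finrank_pos F).ne']

theorem continuous_modulus : Continuous (modulus : F → ℝ) := by unfold modulus; fun_prop

theorem IsLocalEq.modulus_eq_zero_iff {P : PrimeDivisor X} {U : X.Opens} {f : Γ(X, U)}
    (h : IsLocalEq P U f) {x : RatPoint p} (hx : x.pt ∈ U) :
    modulus (x.val f) = 0 ↔ P.pt ⤳ x.pt := by
  rw [modulus_eq_zero, val_eq x hx, ← h.specializes_iff x hx]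

/-- The modulus of the norm form of an adapted coordinate, in terms of the components. -/
theorem IsNormForm.modulus_val {n : ℕ} {U : X.Opens} {t : Fin n → Γ(X, U)} {s : Finset (Fin n)}
    {f : Γ(X, U)} (h : IsNormForm F t s f) {x : RatPoint p} (hx : x.pt ∈ U) :
    modulus (x.val f) = blockNorm s fun i => x.val (t i) := by
  rcases h with ⟨j, rfl, rfl⟩ | ⟨hI, j, k, hjk, rfl, rfl⟩
  · have h1 : ∑ i : ({j} : Finset (Fin n)), ‖x.val (t i)‖ ^ 2 = ‖x.val (t j)‖ ^ 2 :=
      sum_coe_sort {j} (fun i => ‖x.val (t i)‖ ^ 2) |>.trans (sum_singleton _ _)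
    rw [blockNorm, coordNorm, h1, modulus, ← rpow_natCast (‖x.val (t j)‖) 2, ← rpow_mul
      (norm_nonneg _), ← rpow_natCast]
    congr 1
    simp
    ring
  · have h1 : ∑ i : ({j, k} : Finset (Fin n)), ‖x.val (t i)‖ ^ 2 =
        ‖x.val (t j)‖ ^ 2 + ‖x.val (t k)‖ ^ 2 :=
      sum_coe_sort {j, k} (fun i => ‖x.val (t i)‖ ^ 2) |>.trans (sum_pair hjk)
    have hre : ∀ a, ((RCLike.re a : ℝ) : F) = a := fun a => by
      conv_rhs => rw [← RCLike.re_add_im a, hI]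
      simp
    have hfin : finrank ℝ F = 1 := by
      refine finrank_eq_one (1 : F) one_ne_zero fun a => ⟨RCLike.re a, ?_⟩
      rw [RCLike.real_smul_eq_coe_mul, mul_one, hre]
    have hval : x.val (t j ^ 2 + t k ^ 2) = x.val (t j) ^ 2 + x.val (t k) ^ 2 := by
      simp only [val_eq x hx, map_add, map_pow]
    have hsq : ∀ a, a ^ 2 = ((‖a‖ ^ 2 : ℝ) : F) := fun a => by
      rw [← hre a, RCLike.norm_ofReal, sq_abs]
      push_cast
      rfl
    rw [blockNorm, coordNorm, h1, modulus, hfin, hval, hsq, hsq, ← RCLike.ofReal_add,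
      RCLike.norm_ofReal, pow_one, abs_of_nonneg (by positivity), Fintype.card_coe,
      card_pair hjk]
    norm_num

/-- In a smaller affine neighbourhood of a rational point, the given étale coordinates and local
equations are still available together. -/
theorem exists_common_restriction {n : ℕ} {L : EffDivisor X} {U U₀ : X.Opens} {t : Fin n → Γ(X, U)}
    (ht : IsEtaleCoord p U t) {u₀ : PrimeDivisor X → Γ(X, U₀)} (hU₀ : IsAffineOpen U₀)
    (hu₀ : ∀ P ∈ L.support, IsLocalEq P U₀ (u₀ P)) {x : RatPoint p} (hx : x.pt ∈ U)
    (hx₀ : x.pt ∈ U₀) :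
    ∃ (V : X.Opens) (hVU : V ≤ U) (u : PrimeDivisor X → Γ(X, V)), x.pt ∈ V ∧
      IsEtaleCoord p V (fun i => res hVU (t i)) ∧ ∀ P ∈ L.support, IsLocalEq P V (u P) := by
  obtain ⟨f, g, hfg, hxf⟩ := exists_basicOpen_le_affine_inter ht.1 hU₀ x.pt ⟨hx, hx₀⟩
  refine ⟨X.basicOpen f, X.basicOpen_le f, fun P => res (hfg.le.trans (X.basicOpen_le g)) (u₀ P),
    hxf, ht.restrict (ht.1.basicOpen f) _, fun P hP => ?_⟩
  have h1 := (hu₀ P hP).res_basicOpen g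
  revert hfg
  generalize X.basicOpen f = V
  rintro rfl
  exact h1

theorem DivisorMetric.exists_single {α : PrimeDivisor X} (m : DivisorMetric p (Finsupp.single α 1))
    {U : X.Opens} {f : Γ(X, U)} (hf : IsLocalEq α U f) :
    ∃ q : RatPoint p → ℝ, IsSmoothOn q {x | x.pt ∈ U} ∧
      ∀ x, x.pt ∈ U → 0 < q x ∧ m.norm x = modulus (x.val f) * q x := by
  obtain ⟨q, hq, h⟩ := m.local_form U (fun _ => f) fun P hP => by
    rw [Finsupp.support_single _ one_ne_zero, mem_singleton] at hP
    exact hP ▸ hf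
  refine ⟨q, hq, fun x hx => ⟨(h x hx).1, ?_⟩⟩
  rw [(h x hx).2, Finsupp.support_single _ one_ne_zero, prod_singleton,
    Finsupp.single_eq_same]
  simp

variable {n : ℕ} {D L : EffDivisor X}

theorem CanonicalMetric.norm_res (M : CanonicalMetric p n D) {U V : X.Opens} {t : Fin n → Γ(X, U)}
    (ht : IsEtaleCoord p U t) (hV : IsAffineOpen V) (hVU : V ≤ U) {x : RatPoint p} (hx : x.pt ∈ V) :
    M.norm V (fun i => res hVU (t i)) x = M.norm U t x := by
  have := M.change U V t _ ht (ht.restrict hV hVU) x 1 (isJacobianAt_res t hVU x hx)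
  rwa [Matrix.det_one, modulus_one, one_mul] at this

/-- Metrics on the line bundles `𝒪_X(P)`, for all prime divisors `P`. -/
abbrev ComponentMetrics (p : X ⟶ Spec (of F)) :=
  ∀ P, DivisorMetric p (Finsupp.single P 1)

/-- The local expressions of the norms of the canonical sections, and of the limits of their
quotients. -/
structure LocalNorms (M : CanonicalMetric p n D) (ML : DivisorMetric p L) (Mc : ComponentMetrics p)
    (U : X.Opens) (t : Fin n → Γ(X, U)) (u : PrimeDivisor X → Γ(X, U)) where
  hM : RatPoint p → ℝ
  hL : RatPoint p → ℝ
  q : PrimeDivisor X → RatPoint p → ℝ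
  smooth_hM : IsSmoothOn hM {x | x.pt ∈ U}
  smooth_hL : IsSmoothOn hL {x | x.pt ∈ U}
  smooth_q : ∀ P ∈ L.support, IsSmoothOn (q P) {x | x.pt ∈ U}
  hM_pos : ∀ x, x.pt ∈ U → 0 < hM x
  hL_pos : ∀ x, x.pt ∈ U → 0 < hL x
  q_pos : ∀ P ∈ L.support, ∀ x, x.pt ∈ U → 0 < q P x
  norm_M : ∀ x, x.pt ∈ U →
    M.norm U t x = (∏ P ∈ D.support, modulus (x.val (u P)) ^ (D P : ℝ)) * hM x
  norm_ML : ∀ x, x.pt ∈ U →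
    ML.norm x = (∏ P ∈ L.support, modulus (x.val (u P)) ^ (L P : ℝ)) * hL x
  norm_Mc : ∀ P ∈ L.support, ∀ x, x.pt ∈ U →
    (Mc P).norm x = modulus (x.val (u P)) * q P x

theorem exists_localNorms (hDL : D.support ⊆ L.support) (M : CanonicalMetric p n D)
    (ML : DivisorMetric p L) (Mc : ComponentMetrics p) {U : X.Opens} {t : Fin n → Γ(X, U)}
    (ht : IsEtaleCoord p U t) {u : PrimeDivisor X → Γ(X, U)}
    (hu : ∀ P ∈ L.support, IsLocalEq P U (u P)) : Nonempty (LocalNorms M ML Mc U t u) := by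
  obtain ⟨hM, hM1, hM2⟩ := M.local_form U t ht u fun P hP => hu P (hDL hP)
  obtain ⟨hL, hL1, hL2⟩ := ML.local_form U u hu
  choose! q hq1 hq2 using fun P (hP : P ∈ L.support) => (Mc P).exists_single (hu P hP)
  exact ⟨⟨hM, hL, q, hM1, hL1, hq1, fun x hx => (hM2 x hx).1, fun x hx => (hL2 x hx).1,
    fun P hP x hx => (hq2 P hP x hx).1, fun x hx => (hM2 x hx).2, fun x hx => (hL2 x hx).2,
    fun P hP x hx => (hq2 P hP x hx).2⟩⟩

theorem limUnder_eq_of_continuousAt {T : Type*} [TopologicalSpace T] {S : Set T} (hS : Dense S)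
    {f g : T → ℝ} {x : T} (hg : ContinuousAt g x) (h : ∀ᶠ y in 𝓝 x, y ∈ S → f y = g y) :
    limUnder (𝓝[S] x) f = g x := by
  have hne : (𝓝[S] x).NeBot := mem_closure_iff_nhdsWithin_neBot.1 (hS x)
  refine Tendsto.limUnder_eq ((hg.tendsto.mono_left nhdsWithin_le_nhds).congr' ?_)
  filter_upwards [self_mem_nhdsWithin, nhdsWithin_le_nhds h] with y hy hy'
  exact (hy' hy).symm

namespace LocalNorms

variable {M : CanonicalMetric p n D} {ML : DivisorMetric p L} {Mc : ComponentMetrics p}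
  {U : X.Opens} {t : Fin n → Γ(X, U)} {u : PrimeDivisor X → Γ(X, U)}

theorem modulus_pos (hu : ∀ P ∈ L.support, IsLocalEq P U (u P)) (hDL : D.support ⊆ L.support)
    {y : RatPoint p} (hy : y.pt ∈ U) (hyD : y ∈ (ratSupport p D)ᶜ) {P : PrimeDivisor X}
    (hP : P ∈ D.support) : 0 < modulus (y.val (u P)) := by
  refine lt_of_le_of_ne (modulus_nonneg _) fun h0 => hyD ?_
  exact ⟨P, hP, ((hu P (hDL hP)).modulus_eq_zero_iff hy).1 h0.symm⟩

/-- The norm is defined as a limit from outside `D`; in local coordinates the zeros of the factors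
cancel. -/
theorem canonicalNorm_eq (N : LocalNorms M ML Mc U t u) (hu : ∀ P ∈ L.support, IsLocalEq P U (u P))
    (hDL : D.support ⊆ L.support) (hd : Dense (ratSupport p D)ᶜ) {x : RatPoint p} (hx : x.pt ∈ U) :
    canonicalNorm M Mc U t x = N.hM x / ∏ P ∈ D.support, N.q P x ^ (D P : ℝ) := by
  refine limUnder_eq_of_continuousAt (g := fun x => N.hM x / ∏ P ∈ D.support, N.q P x ^ (D P : ℝ)) hd
    ?_ ?_
  · refine (N.smooth_hM.continuousAt hx).div (tendsto_finsetProd _ fun P hP =>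
      ((N.smooth_q P (hDL hP)).continuousAt hx).rpow_const (Or.inr (by positivity))) ?_
    exact (prod_pos fun P hP => rpow_pos_of_pos (N.q_pos P (hDL hP) x hx) _).ne'
  · filter_upwards [(isOpen_setOf_pt_mem U).mem_nhds hx] with y hy hyD
    have h1 : ∏ P ∈ D.support, modulus (y.val (u P)) ^ (D P : ℝ) ≠ 0 :=
      (prod_pos fun P hP => rpow_pos_of_pos (modulus_pos hu hDL hy hyD hP) _).ne'
    have h2 : ∏ P ∈ D.support, (Mc P).norm y ^ (D P : ℝ) =
        (∏ P ∈ D.support, modulus (y.val (u P)) ^ (D P : ℝ)) *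
          ∏ P ∈ D.support, N.q P y ^ (D P : ℝ) := by
      rw [← prod_mul_distrib]
      exact prod_congr rfl fun P hP => by
        rw [N.norm_Mc P (hDL hP) y hy, mul_rpow (modulus_nonneg _) (N.q_pos P (hDL hP) y hy).le]
    rw [N.norm_M y hy, h2, mul_div_mul_left _ _ h1]

theorem residualNorm_eq [DecidableEq (PrimeDivisor X)] (N : LocalNorms M ML Mc U t u)
    (hu : ∀ P ∈ L.support, IsLocalEq P U (u P)) (hDL : D.support ⊆ L.support)
    (hd : Dense (ratSupport p D)ᶜ) {x : RatPoint p} (hx : x.pt ∈ U) :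
    residualNorm D ML Mc x = (∏ P ∈ L.support \ D.support, modulus (x.val (u P)) ^ (L P : ℝ)) *
      N.hL x / ∏ P ∈ D.support, N.q P x ^ (L P : ℝ) := by
  refine limUnder_eq_of_continuousAt (g := fun x => (∏ P ∈ L.support \ D.support,
    modulus (x.val (u P)) ^ (L P : ℝ)) * N.hL x / ∏ P ∈ D.support, N.q P x ^ (L P : ℝ)) hd ?_ ?_
  · refine ((tendsto_finsetProd _ fun P hP => ?_).mul (N.smooth_hL.continuousAt hx)).div
      (tendsto_finsetProd _ fun P hP =>
      ((N.smooth_q P (hDL hP)).continuousAt hx).rpow_const (Or.inr (by positivity))) ?_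
    · exact (continuous_modulus.continuousAt.comp (continuousAt_val (u P) hx)).rpow_const
        (Or.inr (by positivity))
    · exact (prod_pos fun P hP => rpow_pos_of_pos (N.q_pos P (hDL hP) x hx) _).ne'
  · filter_upwards [(isOpen_setOf_pt_mem U).mem_nhds hx] with y hy hyD
    have h1 : ∏ P ∈ D.support, modulus (y.val (u P)) ^ (L P : ℝ) ≠ 0 :=
      (prod_pos fun P hP => rpow_pos_of_pos (modulus_pos hu hDL hy hyD hP) _).ne'
    have h2 : ∏ P ∈ D.support, (Mc P).norm y ^ (L P : ℝ) =
        (∏ P ∈ D.support, modulus (y.val (u P)) ^ (L P : ℝ)) *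
          ∏ P ∈ D.support, N.q P y ^ (L P : ℝ) := by
      rw [← prod_mul_distrib]
      exact prod_congr rfl fun P hP => by
        rw [N.norm_Mc P (hDL hP) y hy, mul_rpow (modulus_nonneg _) (N.q_pos P (hDL hP) y hy).le]
    rw [N.norm_ML y hy, h2, ← prod_sdiff hDL, mul_comm (∏ P ∈ L.support \ D.support, _),
      mul_assoc, mul_div_mul_left _ _ h1]

theorem limUnder_Mc_eq (N : LocalNorms M ML Mc U t u) (hu : ∀ P ∈ L.support, IsLocalEq P U (u P))
    (hDL : D.support ⊆ L.support) (hd : Dense (ratSupport p D)ᶜ) {x : RatPoint p} (hx : x.pt ∈ U)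
    {P : PrimeDivisor X} (hP : P ∈ D.support) :
    limUnder (𝓝[(ratSupport p D)ᶜ] x) (fun y => (Mc P).norm y / modulus (y.val (u P))) = N.q P x := by
  refine limUnder_eq_of_continuousAt hd ((N.smooth_q P (hDL hP)).continuousAt hx) ?_
  filter_upwards [(isOpen_setOf_pt_mem U).mem_nhds hx] with y hy hyD
  rw [N.norm_Mc P (hDL hP) y hy, mul_div_cancel_left₀ _ (modulus_pos hu hDL hy hyD hP).ne']

end LocalNorms

end Norms

/-! ### The measure `τ_{(X,D)}` in local coordinates -/

section ChangeOfVariables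

variable {F : Type u} [RCLike F]

/-- Multiplication by `z` scales the Haar measure of `F` by `|z|`. -/
theorem abs_norm_eq_modulus (z : F) : |Algebra.norm ℝ z| = modulus z := by
  rcases eq_or_ne z 0 with rfl | hz
  · rw [Algebra.norm_zero, abs_zero, modulus_eq_zero.2 rfl]
  set ν : Measure F := Measure.addHaar
  have h1 := Measure.addHaar_image_linearMap ν (LinearMap.mul ℝ F z) (Metric.ball 0 1)
  have h2 : (LinearMap.mul ℝ F z) '' Metric.ball 0 1 = Metric.ball 0 ‖z‖ := by
    ext y
    simp only [Set.mem_image, mem_ball_zero_iff, LinearMap.mul_apply']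
    constructor
    · rintro ⟨x, hx, rfl⟩
      rw [norm_mul]
      exact mul_lt_of_lt_one_right (norm_pos_iff.2 hz) hx
    · intro hy
      refine ⟨z⁻¹ * y, ?_, by field_simp⟩
      rw [norm_mul, norm_inv, inv_mul_lt_iff₀ (norm_pos_iff.2 hz), mul_one]
      exact hy
  rw [h2, Measure.addHaar_ball_of_pos ν 0 (norm_pos_iff.2 hz)] at h1
  have h3 := (ENNReal.mul_left_inj (Metric.measure_ball_pos ν (0 : F) one_pos).ne'
    measure_ball_lt_top.ne).1 h1
  rw [ENNReal.ofReal_eq_ofReal_iff (by positivity) (abs_nonneg _)] at h3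
  rw [modulus, h3]
  rfl

theorem abs_det_restrictScalars {n : ℕ} (J : Matrix (Fin n) (Fin n) F) :
    |((LinearMap.toContinuousLinearMap (Matrix.toLin' J)).restrictScalars ℝ).det| =
      modulus J.det := by
  rw [← abs_norm_eq_modulus, ← LinearMap.det_toLin', ← LinearMap.det_restrictScalars]
  rfl

end ChangeOfVariables

section Charts

variable {F : Type u} [RCLike F] {X : Scheme.{u}} {p : X ⟶ Spec (of F)} {n : ℕ}
  {U : X.Opens} {t : Fin n → Γ(X, U)} {χ : CoordChart p n} {x : RatPoint p} {O : Set (RatPoint p)} {f : RatPoint p → ENNReal} {W : Set (RatPoint p)}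

/-- The coordinates `t` are the components of the chart `χ` of the analytic space `X(F)`, and regular
functions are smooth in this chart. -/
structure IsChart (t : Fin n → Γ(X, U)) (χ : CoordChart p n) : Prop where
  mem : ∀ x ∈ χ.source, x.pt ∈ U
  eq : ∀ x, χ x = fun i => x.val (t i)
  smooth : ∀ x ∈ χ.source, ∀ (V : X.Opens) (f : Γ(X, V)), x.pt ∈ V →
    ContDiffAt F ∞ (fun e => (χ.symm e).val f) (χ x)

theorem IsEtaleCoord.exists_isChart (h : IsEtaleCoord p U t) (hx : x.pt ∈ U) :
    ∃ χ : CoordChart p n, x ∈ χ.source ∧ IsChart t χ := by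
  obtain ⟨χ, h1, h2, h3, h4⟩ := h.exists_chart hx
  exact ⟨χ, h1, h2, h3, h4⟩

theorem isOpenEmbedding_coord (h : IsEtaleCoord p U t) (hW : IsOpen W) (hWU : W ⊆ {x | x.pt ∈ U})
    (hinj : Set.InjOn (fun x i => x.val (t i)) W) :
    IsOpenEmbedding fun (x : W) i => x.1.val (t i) := by
  refine .of_continuous_injective_isOpenMap ?_ ?_ ?_
  · exact continuous_iff_continuousAt.2 fun x => continuousAt_pi.2 fun i =>
      (continuousAt_val (t i) (hWU x.2)).comp continuousAt_subtype_val
  · exact fun x y hxy => Subtype.ext (hinj x.2 y.2 hxy)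
  · refine IsOpenMap.of_nhds_le fun x => ?_
    obtain ⟨χ, hxs, hχ⟩ := h.exists_isChart (hWU x.2)
    have h1 : (fun (x : W) i => x.1.val (t i)) = χ ∘ Subtype.val := by
      ext x : 1
      exact (hχ.eq x.1).symm
    rw [h1, ← Filter.map_map, hW.isOpenEmbedding_subtypeVal.map_nhds_eq, χ.map_nhds_eq hxs]
    exact (congrArg 𝓝 (hχ.eq x.1).symm).le

variable {D L : EffDivisor X} (M : CanonicalMetric p n D)

theorem CanonicalMetric.exists_local_form (hX : IsSNCPair p n D L) (ht : IsEtaleCoord p U t)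
    (hx : x.pt ∈ U) :
    ∃ (V : X.Opens) (u : PrimeDivisor X → Γ(X, V)) (h : RatPoint p → ℝ), x.pt ∈ V ∧
      (∀ P ∈ L.support, IsLocalEq P V (u P)) ∧ IsSmoothOn h {x | x.pt ∈ V} ∧
      ∀ y, y.pt ∈ V → 0 < h y ∧
        M.norm U t y = (∏ P ∈ D.support, modulus (y.val (u P)) ^ (D P : ℝ)) * h y := by
  obtain ⟨U₀, t₀, e₀, u₀, hx₀, ht₀, hu₀, -⟩ := exists_adapted_coordinates hX.1 x
  obtain ⟨V, hVU, u, hxV, htV, hu⟩ := exists_common_restriction ht ht₀.1 hu₀ hx hx₀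
  obtain ⟨h, hh, hnorm⟩ := M.local_form V _ htV u fun P hP => hu P (hX.2 hP)
  refine ⟨V, u, h, hxV, hu, hh, fun y hy => ⟨(hnorm y hy).1, ?_⟩⟩
  rw [← M.norm_res ht htV.1 hVU hy, (hnorm y hy).2]

theorem CanonicalMetric.continuousAt_norm (hX : IsSNCPair p n D L) (ht : IsEtaleCoord p U t)
    (hx : x.pt ∈ U) : ContinuousAt (M.norm U t) x := by
  obtain ⟨V, u, h, hxV, hu, hh, hnorm⟩ := M.exists_local_form hX ht hx
  have h1 : ContinuousAt (fun x => (∏ P ∈ D.support, modulus (x.val (u P)) ^ (D P : ℝ)) * h x) x :=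
    (tendsto_finsetProd _ fun P _ => (continuous_modulus.continuousAt.comp
      (continuousAt_val (u P) hxV)).rpow_const (Or.inr (by positivity))).mul (hh.continuousAt hxV)
  refine h1.congr ?_
  filter_upwards [(isOpen_setOf_pt_mem V).mem_nhds hxV] with y hy
  rw [(hnorm y hy).2]

theorem CanonicalMetric.norm_pos (hX : IsSNCPair p n D L) (ht : IsEtaleCoord p U t) (hx : x.pt ∈ U)
    (hxD : x ∉ ratSupport p D) :
    0 < M.norm U t x := by
  obtain ⟨V, u, h, hxV, hu, hh, hnorm⟩ := M.exists_local_form hX ht hx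
  rw [(hnorm x hxV).2]
  refine mul_pos (prod_pos fun P hP => rpow_pos_of_pos ?_ _) (hnorm x hxV).1
  exact LocalNorms.modulus_pos hu hX.2 hxV hxD hP

theorem CanonicalMetric.norm_eq_zero (hX : IsSNCPair p n D L) (ht : IsEtaleCoord p U t)
    (hx : x.pt ∈ U) (hxD : x ∈ ratSupport p D) :
    M.norm U t x = 0 := by
  obtain ⟨V, u, h, hxV, hu, hh, hnorm⟩ := M.exists_local_form hX ht hx
  obtain ⟨P, hP, hPx⟩ := hxD
  rw [(hnorm x hxV).2, prod_eq_zero hP, zero_mul]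
  rw [((hu P (hX.2 hP)).modulus_eq_zero_iff hxV).2 hPx, zero_rpow]
  exact_mod_cast Finsupp.mem_support_iff.1 hP

variable (μ : Measure F)

/-- Integration with respect to a chart measure. -/
theorem setLIntegral_chartMeasure (hX : IsSNCPair p n D L) (ht : IsEtaleCoord p U t) (hW : IsOpen W)
    (hWU : W ⊆ {x | x.pt ∈ U}) (hinj : Set.InjOn (fun x i => x.val (t i)) W) (hχ : IsChart t χ)
    (hO : IsOpen O) (hOW : O ⊆ W) (hOχ : O ⊆ χ.source) (hf : Measurable f) :
    ∫⁻ x in O, f x ∂(chartMeasure μ M U t W) =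
      ∫⁻ e in χ '' O, f (χ.symm e) * .ofReal (1 / M.norm U t (χ.symm e))
        ∂(power _ μ) := by
  have hρ : Continuous fun x : W => M.norm U t x.1 := continuous_iff_continuousAt.2 fun x =>
    (M.continuousAt_norm hX ht (hWU x.2)).comp continuousAt_subtype_val
  refine setLIntegral_map_comap_withDensity hW.measurableSet
    (isOpenEmbedding_coord ht hW hWU hinj).measurableEmbedding
    (((hρ.measurable).const_div 1).ennreal_ofReal) hO.measurableSet
    (χ.isOpen_image_of_subset_source hO hOχ).measurableSet (g := χ.symm) ?_ ?_
    (ρ' := fun x => ENNReal.ofReal (1 / M.norm U t x)) (fun _ => rfl) hf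
  · intro z hz
    have h1 : (fun i => z.1.val (t i)) = χ z.1 := (hχ.eq _).symm
    simp only [h1]
    exact ⟨Set.mem_image_of_mem _ hz, χ.left_inv (hOχ hz)⟩
  · rintro _ ⟨x, hx, rfl⟩
    exact ⟨⟨x, hOW hx⟩, hx, (hχ.eq x).symm⟩

variable [μ.IsAddHaarMeasure]

/-- Change of variables between two charts. -/
theorem lintegral_chart_change {U' : X.Opens} {t' : Fin n → Γ(X, U')} {χ' : CoordChart p n}
    (hχ : IsChart t χ) (hχ' : IsChart t' χ') (hO : IsOpen O) (hOχ : O ⊆ χ.source)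
    (hOχ' : O ⊆ χ'.source) {J : RatPoint p → Matrix (Fin n) (Fin n) F}
    (hJ : ∀ y ∈ O, IsJacobianAt y t t' (J y)) (g : (Fin n → F) → ENNReal) :
    ∫⁻ e in χ' '' O, g e ∂(power _ μ) =
      ∫⁻ e in χ '' O, .ofReal (modulus (J (χ.symm e)).det) * g (χ' (χ.symm e))
        ∂(power _ μ) := by
  have himg : χ' '' O = (fun e => χ' (χ.symm e)) '' (χ '' O) := by
    rw [Set.image_image]
    exact Set.image_congr fun y hy => by rw [χ.left_inv (hOχ hy)]
  have hder : ∀ e ∈ χ '' O, HasFDerivWithinAt (fun e => χ' (χ.symm e))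
      ((LinearMap.toContinuousLinearMap (Matrix.toLin' (J (χ.symm e)))).restrictScalars ℝ)
      (χ '' O) e := by
    rintro _ ⟨y, hy, rfl⟩
    rw [χ.left_inv (hOχ hy)]
    have h1 := (hJ y hy).hasFDerivAt hχ.eq hχ.smooth (hOχ hy)
    have h2 : (fun e => χ' (χ.symm e)) = fun e i => (χ.symm e).val (t' i) := by
      ext e : 1
      exact hχ'.eq _
    rw [h2]
    exact (h1.restrictScalars ℝ).hasFDerivWithinAt
  have hinjφ : Set.InjOn (fun e => χ' (χ.symm e)) (χ '' O) := by
    rintro _ ⟨y, hy, rfl⟩ _ ⟨z, hz, rfl⟩ h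
    simp only [χ.left_inv (hOχ hy), χ.left_inv (hOχ hz)] at h
    rw [χ'.injOn (hOχ' hy) (hOχ' hz) h]
  have hVm := (χ.isOpen_image_of_subset_source hO hOχ).measurableSet
  rw [himg, lintegral_image_eq_lintegral_abs_det_fderiv_mul _ hVm hder hinjφ]
  simp only [abs_det_restrictScalars]

/-- The chart measures agree on the overlaps, by the formula of change of variables. -/
theorem chartMeasure_locally_eq (hX : IsSNCPair p n D L) {U' : X.Opens} {t' : Fin n → Γ(X, U')}
    (ht : IsEtaleCoord p U t) (ht' : IsEtaleCoord p U' t') {W' : Set (RatPoint p)} (hW : IsOpen W)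
    (hW' : IsOpen W') (hWU : W ⊆ {x | x.pt ∈ U}) (hWU' : W' ⊆ {x | x.pt ∈ U'})
    (hWD : Disjoint W (ratSupport p D)) (hinj : Set.InjOn (fun x i => x.val (t i)) W)
    (hinj' : Set.InjOn (fun x i => x.val (t' i)) W') (hx : x ∈ W) (hx' : x ∈ W') :
    ∃ O, IsOpen O ∧ x ∈ O ∧
      (chartMeasure μ M U t W).restrict O = (chartMeasure μ M U' t' W').restrict O := by
  obtain ⟨χ, hxχ, hχ⟩ := ht.exists_isChart (hWU hx)
  obtain ⟨χ', hxχ', hχ'⟩ := ht'.exists_isChart (hWU' hx')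
  set O := (W ∩ W') ∩ (χ.source ∩ χ'.source)
  have hO : IsOpen O := (hW.inter hW').inter (χ.open_source.inter χ'.open_source)
  refine ⟨O, hO, ⟨⟨hx, hx'⟩, hxχ, hxχ'⟩, ?_⟩
  have hOχ : O ⊆ χ.source := fun y hy => hy.2.1
  have hOχ' : O ⊆ χ'.source := fun y hy => hy.2.2
  ext E hE
  have e1 := setLIntegral_chartMeasure M μ hX ht hW hWU hinj hχ hO (fun y hy => hy.1.1) hOχ
    (measurable_one.indicator hE)
  have e2 := setLIntegral_chartMeasure M μ hX ht' hW' hWU' hinj' hχ' hO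
    (fun y hy => hy.1.2) hOχ' (measurable_one.indicator hE)
  rw [lintegral_indicator_one hE] at e1 e2
  rw [e1, e2]
  choose! J hJ using fun y (hy : y ∈ O) => ht.exists_isJacobianAt y (hWU hy.1.1) (hWU' hy.1.2)
  have hVm := (χ.isOpen_image_of_subset_source hO hOχ).measurableSet
  rw [lintegral_chart_change μ hχ hχ' hO hOχ hOχ' hJ]
  refine setLIntegral_congr_fun hVm ?_
  rintro _ ⟨y, hy, rfl⟩
  simp only [χ.left_inv (hOχ hy), χ'.left_inv (hOχ' hy)]
  rw [mul_left_comm, ← ENNReal.ofReal_mul (modulus_nonneg _)]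
  congr 2
  have h3 := M.change U U' t t' ht ht' y (J y) (hJ y hy)
  have h4 : 0 < M.norm U' t' y := M.norm_pos hX ht' (hWU' hy.1.2)
    (Set.disjoint_left.1 hWD hy.1.1)
  rw [h3] at h4 ⊢
  have h5 : modulus (J y).det ≠ 0 := fun h0 => by rw [h0, zero_mul] at h4; exact h4.false
  field_simp

theorem isClosed_ratSupport (hX : IsSNCPair p n D L) : IsClosed (ratSupport p D) := by
  refine isOpen_compl_iff.1 (isOpen_iff_mem_nhds.2 fun x hx => ?_)
  obtain ⟨U, t, e, u, hxU, ht, hu, -⟩ := exists_adapted_coordinates hX.1 x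
  have h1 : ∀ P ∈ D.support, ∀ᶠ y in 𝓝 x, ¬ P.pt ⤳ RatPoint.pt y := by
    intro P hP
    have h2 : x.val (u P) ≠ 0 := fun h0 => hx ⟨P, hP, ((hu P (hX.2 hP)).modulus_eq_zero_iff hxU).1
      (modulus_eq_zero.2 h0)⟩
    filter_upwards [(continuousAt_val (u P) hxU).eventually_ne h2,
      (isOpen_setOf_pt_mem U).mem_nhds hxU] with y hy hyU hPy
    exact hy (modulus_eq_zero.1 (((hu P (hX.2 hP)).modulus_eq_zero_iff hyU).2 hPy))
  filter_upwards [(Finset.eventually_all D.support).2 h1] with y hy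
  rintro ⟨P, hP, hPy⟩
  exact hy P hP hPy

/-- The measure `τ_{(X,D)}` in local coordinates. (Over `D` the norm of the form vanishes, and the
density `1 / 0 = 0` too.) -/
theorem setLIntegral_tauPair [SecondCountableTopology (RatPoint p)] (hX : IsSNCPair p n D L)
    (ht : IsEtaleCoord p U t) (hχ : IsChart t χ) (hO : IsOpen O) (hOχ : O ⊆ χ.source)
    (hf : Measurable f) :
    ∫⁻ x in O, f x ∂(tauPair μ M) =
      ∫⁻ e in χ '' O, f (χ.symm e) * ENNReal.ofReal (1 / M.norm U t (χ.symm e))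
        ∂(power _ μ) := by
  set rel : Measure (RatPoint p) → Set (RatPoint p) → Prop := fun ν W =>
    ∃ (U : X.Opens) (t : Fin n → Γ(X, U)), IsEtaleCoord p U t ∧ IsOpen W ∧ W ⊆ {x | x.pt ∈ U} ∧
      Disjoint W (ratSupport p D) ∧ Set.InjOn (fun x i => x.val (t i)) W ∧ ν = chartMeasure μ M U t W
  obtain ⟨h1, h2⟩ := sSup_patching (σ := tauPair μ M) (rel := rel) rfl (fun ν =>
    ⟨fun ⟨U, t, W, h⟩ => ⟨W, U, t, h⟩, fun ⟨W, U, t, h⟩ => ⟨U, t, W, h⟩⟩) (fun ν W ⟨_, _, _, h, _⟩ => h)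
    (by
      rintro _ W ⟨U, t, _, hW, _, _, _, rfl⟩
      rw [chartMeasure, Measure.map_apply measurable_subtype_coe hW.measurableSet.compl]
      have h0 : (Subtype.val ⁻¹' Wᶜ : Set W) = ∅ := by
        ext x
        simp
      rw [h0, measure_empty])
    (by
      rintro _ W _ W' ⟨U, t, ht, hW, hWU, hWD, hinj, rfl⟩ ⟨U', t', ht', hW', hWU', hWD', hinj', rfl⟩ x
        ⟨hx, hx'⟩
      exact chartMeasure_locally_eq M μ hX ht ht' hW hW' hWU hWU' hWD hinj hinj' hx hx')
  have hc := isClosed_ratSupport hX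
  set O' := O ∩ (ratSupport p D)ᶜ
  have hO' : IsOpen O' := hO.inter hc.isOpen_compl
  have hOU : O' ⊆ {x | x.pt ∈ U} := fun y hy => hχ.mem y (hOχ hy.1)
  have hinj : Set.InjOn (fun x i => x.val (t i)) O' := by
    intro y hy z hz h
    refine χ.injOn (hOχ hy.1) (hOχ hz.1) ?_
    rw [hχ.eq, hχ.eq]
    exact h
  have hD0 : tauPair μ M (ratSupport p D) = 0 := h2 _ fun ν W ⟨_, _, _, _, _, h, _⟩ => h.symm
  have h3 : ∫⁻ x in O, f x ∂(tauPair μ M) = ∫⁻ x in O', f x ∂(tauPair μ M) := by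
    refine setLIntegral_congr ?_
    refine (inter_ae_eq_left_of_ae_eq_univ ?_).symm
    rw [ae_eq_univ, compl_compl]
    exact hD0
  have h4 := h1 (chartMeasure μ M U t O') O' ⟨U, t, ht, hO', hOU,
    Set.disjoint_left.2 fun y hy => hy.2, hinj, rfl⟩
  have h5 : ∫⁻ x in O', f x ∂(tauPair μ M) = ∫⁻ x in O', f x ∂(chartMeasure μ M U t O') := by
    rw [← h4, Measure.restrict_restrict hO'.measurableSet, Set.inter_self]
  have hO'χ : O' ⊆ χ.source := fun y hy => hOχ hy.1
  rw [h3, h5, setLIntegral_chartMeasure M μ hX ht hO' hOU hinj hχ hO' le_rfl hO'χ hf]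
  have h6 : ∫⁻ e in χ '' O \ χ '' O', f (χ.symm e) * ENNReal.ofReal (1 / M.norm U t (χ.symm e))
      ∂(power _ μ) = 0 := by
    refine setLIntegral_eq_zero ((χ.isOpen_image_of_subset_source hO hOχ).measurableSet.diff
      (χ.isOpen_image_of_subset_source hO' hO'χ).measurableSet) ?_
    rintro _ ⟨⟨y, hy, rfl⟩, hy'⟩
    have hyD : y ∈ ratSupport p D := by
      by_contra hyD
      exact hy' ⟨y, ⟨hy, hyD⟩, rfl⟩
    simp only [χ.left_inv (hOχ hy)]
    rw [M.norm_eq_zero hX ht (hχ.mem y (hOχ hy)) hyD]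
    simp
  rw [← lintegral_inter_add_sdiff _ (χ '' O) (χ.isOpen_image_of_subset_source hO' hO'χ).measurableSet,
    Set.inter_eq_right.2 (Set.image_mono Set.inter_subset_left), h6, add_zero]

end Charts

section Variety

variable {F : Type u} [RCLike F] {X : Scheme.{u}} {p : X ⟶ Spec (of F)} {n : ℕ}

/-! ### Charts adapted to a divisor -/

section AdaptedCharts

theorem blockNorm_eq_zero {s : Finset (Fin n)} (hs : s.Nonempty) {t : Fin n → F} :
    blockNorm s t = 0 ↔ ∀ i ∈ s, t i = 0 := by
  have : Nonempty s := hs.to_subtype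
  have hd : 0 < finrank ℝ F * Fintype.card s := Nat.mul_pos (finrank_pos F) Fintype.card_pos
  rw [blockNorm, coordNorm, rpow_eq_zero (by positivity) (by positivity),
    sum_eq_zero_iff_of_nonneg fun _ _ => by positivity]
  simp

theorem blockNorm_empty (t : Fin n → F) : blockNorm ∅ t = 1 := by
  simp [blockNorm, coordNorm]

theorem zeroOn_eq_self {s : Finset (Fin n)} {t : Fin n → F} : zeroOn s t = t ↔ ∀ i ∈ s, t i = 0 := by
  constructor
  · intro h i hi
    rw [← h]
    simp [zeroOn, hi]
  · intro h
    ext i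
    by_cases hi : i ∈ s
    · simp [zeroOn, hi, h i hi]
    · simp [zeroOn, hi]

/-- A chart of `X(F)` in which the components of the divisor `L` are given by the vanishing of
disjoint blocks of coordinates: `S` is the set of the components which meet the chart. -/
structure AdaptedChart (p : X ⟶ Spec (of F)) (n : ℕ) (L : EffDivisor X) where
  U : X.Opens
  t : Fin n → Γ(X, U)
  e : PrimeDivisor X → Finset (Fin n)
  u : PrimeDivisor X → Γ(X, U)
  χ : CoordChart p n
  S : Finset (PrimeDivisor X)
  etale : IsEtaleCoord p U t
  chart : IsChart t χ
  subset : S ⊆ L.support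
  localEq : ∀ P ∈ L.support, IsLocalEq P U (u P)
  normForm : ∀ P ∈ S, IsNormForm F t (e P) (u P)
  disj : (S : Set (PrimeDivisor X)).PairwiseDisjoint e
  eq_one : ∀ P ∈ L.support, P ∉ S → u P = 1 ∧ e P = ∅

/-- Each rational point has an adapted chart whose components `C.S` all pass through it. -/
theorem exists_adaptedChart {L : EffDivisor X} (hX : IsSmoothSNC p n L) (x : RatPoint p) :
    ∃ C : AdaptedChart p n L, x ∈ C.χ.source ∧ ∀ P ∈ C.S, P.pt ⤳ x.pt := by
  classical
  obtain ⟨U, t, e, u, hxU, ht, hu, hform, hdisj, hone⟩ := exists_adapted_coordinates hX x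
  obtain ⟨χ, hx, hχ⟩ := ht.exists_isChart hxU
  refine ⟨⟨U, t, e, u, χ, L.support.filter fun P => P.pt ⤳ x.pt, ht, hχ, filter_subset _ _,
    hu, ?_, ?_, ?_⟩, hx, fun P hP => (mem_filter.1 hP).2⟩
  · intro P hP
    exact hform P (mem_filter.1 hP).1 (mem_filter.1 hP).2
  · intro P hP P' hP' hne
    simp only [coe_filter, Set.mem_ofPred_eq] at hP hP'
    exact hdisj P hP.1 hP.2 P' hP'.1 hP'.2 hne
  · intro P hP hPS
    exact (hone P hP fun h => hPS (mem_filter.2 ⟨hP, h⟩)).2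

theorem IsNormForm.nonempty {R : Type*} [CommRing R] {t : Fin n → R} {s : Finset (Fin n)} {u : R}
    (h : IsNormForm F t s u) : s.Nonempty := by
  rcases h with ⟨j, rfl, -⟩ | ⟨-, j, k, -, rfl, -⟩
  · exact singleton_nonempty _
  · exact insert_nonempty _ _

namespace AdaptedChart

variable {L : EffDivisor X} (C : AdaptedChart p n L)

theorem coord_eq (y : RatPoint p) : (fun i => y.val (C.t i)) = C.χ y := (C.chart.eq y).symm

theorem mem_U {y : RatPoint p} (hy : y ∈ C.χ.source) : y.pt ∈ C.U := C.chart.mem y hy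

theorem modulus_val {P : PrimeDivisor X} (hP : P ∈ L.support) {y : RatPoint p} (hy : y ∈ C.χ.source)
    :
    modulus (y.val (C.u P)) = blockNorm (C.e P) (C.χ y) := by
  by_cases hS : P ∈ C.S
  · rw [(C.normForm P hS).modulus_val (C.mem_U hy), C.coord_eq]
  · rw [(C.eq_one P hP hS).1, val_eq y (C.mem_U hy), map_one, modulus_one,
      (C.eq_one P hP hS).2, blockNorm_empty]

theorem specializes_iff {P : PrimeDivisor X} (hP : P ∈ L.support) {y : RatPoint p}
    (hy : y ∈ C.χ.source) : P.pt ⤳ y.pt ↔ P ∈ C.S ∧ blockNorm (C.e P) (C.χ y) = 0 := by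
  rw [← (C.localEq P hP).modulus_eq_zero_iff (C.mem_U hy), C.modulus_val hP hy]
  refine ⟨fun h => ⟨?_, h⟩, fun h => h.2⟩
  by_contra hS
  rw [(C.eq_one P hP hS).2, blockNorm_empty] at h
  exact one_ne_zero h

variable (μ : Measure F) [μ.IsAddHaarMeasure]

/-- The points where a block of coordinates vanishes form a null set. -/
theorem measure_blockNorm_eq_zero {s : Finset (Fin n)} (hs : s.Nonempty) :
    (power _ μ) {e | blockNorm s e = 0} = 0 := by
  obtain ⟨i, hi⟩ := hs
  refine measure_mono_null (fun e he => (blockNorm_eq_zero ⟨i, hi⟩).1 he i hi) ?_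
  exact Measure.pi_hyperplane _ i 0

theorem ae_blockNorm_pos : ∀ᵐ e ∂(power _ μ), ∀ P ∈ C.S, 0 < blockNorm (C.e P) e := by
  refine (Finset.eventually_all C.S).2 fun P hP => ?_
  have h : ∀ᵐ e ∂(power _ μ), blockNorm (C.e P) e ≠ 0 :=
    measure_eq_zero_iff_ae_notMem.1 (measure_blockNorm_eq_zero μ (C.normForm P hP).nonempty)
  filter_upwards [h] with e he
  exact lt_of_le_of_ne (blockNorm_nonneg _ _) (Ne.symm he)

end AdaptedChart

variable {L D : EffDivisor X} (μ : Measure F) [μ.IsAddHaarMeasure]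

/-- Locally the boundary is the zero set of block norms, so it is negligible. -/
theorem measure_ratSupport_chart_eq_zero (hX : IsSNCPair p n D L) {U : X.Opens}
    {t : Fin n → Γ(X, U)} {χ : CoordChart p n} (hχ : IsChart t χ) :
    (power _ μ) {e | e ∈ χ.target ∧ χ.symm e ∈ ratSupport p D} = 0 := by
  refine measure_null_of_locally_null _ ?_
  rintro e₀ ⟨he₀, -⟩
  set x := χ.symm e₀
  have hx : x ∈ χ.source := χ.map_target he₀
  obtain ⟨C, hxC, -⟩ := exists_adaptedChart hX.1 x
  set O := χ.source ∩ C.χ.source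
  have hO : IsOpen O := χ.open_source.inter C.χ.open_source
  have hOχ : O ⊆ χ.source := Set.inter_subset_left
  have hOC : O ⊆ C.χ.source := Set.inter_subset_right
  refine ⟨_, inter_mem_nhdsWithin _ ((χ.isOpen_image_of_subset_source hO hOχ).mem_nhds
    ⟨x, ⟨hx, hxC⟩, χ.right_inv he₀⟩), ?_⟩
  have hc := isClosed_ratSupport hX
  have hDm : MeasurableSet (χ '' (O ∩ (ratSupport p D)ᶜ)) := (χ.isOpen_image_of_subset_source
    (hO.inter hc.isOpen_compl) fun y hy => hOχ hy.1).measurableSet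
  choose! J hJ using fun y (hy : y ∈ O) => C.etale.exists_isJacobianAt y (C.mem_U (hOC hy))
    (hχ.mem y (hOχ hy))
  have h1 := lintegral_chart_change μ C.chart hχ hO hOC hOχ hJ
    ((χ '' (O ∩ (ratSupport p D)ᶜ))ᶜ.indicator 1)
  rw [lintegral_indicator_one hDm.compl, Measure.restrict_apply hDm.compl] at h1
  refine measure_mono_null ?_ (h1.trans ?_)
  · rintro e ⟨⟨he, heD⟩, y, hy, rfl⟩
    refine ⟨?_, ⟨y, hy, rfl⟩⟩
    rintro ⟨z, hz, hzy⟩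
    rw [χ.left_inv (hOχ hy)] at heD
    rw [χ.injOn (hOχ hz.1) (hOχ hy) hzy] at hz
    exact hz.2 heD
  · rw [← lintegral_zero (μ := (power _ μ).restrict (C.χ '' O))]
    refine lintegral_congr_ae ?_
    rw [EventuallyEq, ae_restrict_iff' (C.χ.isOpen_image_of_subset_source hO hOC).measurableSet]
    filter_upwards [C.ae_blockNorm_pos μ] with e he
    rintro ⟨y, hy, rfl⟩
    rw [C.χ.left_inv (hOC hy), Set.indicator_of_notMem, mul_zero]
    rw [Set.notMem_compl_iff]
    refine ⟨y, ⟨hy, ?_⟩, rfl⟩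
    rintro ⟨P, hP, hPy⟩
    have := (C.specializes_iff (hX.2 hP) (hOC hy)).1 hPy
    exact (he P this.1).ne' this.2

theorem dense_compl_ratSupport (hX : IsSNCPair p n D L) : Dense (ratSupport p D)ᶜ := by
  set μ : Measure F := Measure.addHaar
  rw [dense_iff_inter_open]
  rintro O hO ⟨x, hx⟩
  obtain ⟨C, hxC, -⟩ := exists_adaptedChart hX.1 x
  by_contra hemp
  have h1 : IsOpen (C.χ '' (O ∩ C.χ.source)) :=
    C.χ.isOpen_image_of_subset_source (hO.inter C.χ.open_source) Set.inter_subset_right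
  refine (h1.measure_pos (power _ μ) ⟨_, x, ⟨hx, hxC⟩, rfl⟩).ne'
    (measure_mono_null ?_ (measure_ratSupport_chart_eq_zero μ hX C.chart))
  rintro _ ⟨y, hy, rfl⟩
  refine ⟨C.χ.map_source hy.2, ?_⟩
  rw [C.χ.left_inv hy.2]
  by_contra hyD
  exact hemp ⟨y, hy.1, hyD⟩

/-- The space `X(F)` of a smooth projective variety is compact and metrizable. -/
theorem secondCountable_and_metrizable (hX : IsSmoothSNC p n L) (hproj : IsProjectiveOver p) :
    SecondCountableTopology (RatPoint p) ∧ TopologicalSpace.MetrizableSpace (RatPoint p) := by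
  obtain ⟨hc, ht2⟩ := compactSpace_and_t2Space hproj
  choose C hC _ using fun x => exists_adaptedChart hX x
  obtain ⟨T, hT⟩ := isCompact_univ.elim_finite_subcover (fun x => (C x).χ.source)
    (fun x => (C x).χ.open_source) fun x _ => Set.mem_iUnion.2 ⟨x, hC x⟩
  have : ∀ x, SecondCountableTopology (C x).χ.source := fun x =>
    (C x).χ.secondCountableTopology_source
  have h2 : SecondCountableTopology (RatPoint p) := by
    refine TopologicalSpace.secondCountableTopology_of_countable_cover (ι := T)
      (U := fun x => (C x).χ.source) (fun x => (C x).χ.open_source) ?_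
    rw [Set.eq_univ_iff_forall]
    intro x
    obtain ⟨i, hi, hx⟩ := Set.mem_iUnion₂.1 (hT (Set.mem_univ x))
    exact Set.mem_iUnion.2 ⟨⟨i, hi⟩, hx⟩
  exact ⟨h2, TopologicalSpace.metrizableSpace_of_t3_secondCountable _⟩

end AdaptedCharts

/-! ### Residue measures in local coordinates -/

section Extension

variable {T E : Type*} [TopologicalSpace T] [TopologicalSpace E] {χ : OpenPartialHomeomorph T E}
  {g : T → ℝ} {K : Set T}

theorem indicator_chart_apply {x : T} (hx : x ∈ χ.source) :
    χ.target.indicator (g ∘ χ.symm) (χ x) = g x := by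
  rw [Set.indicator_of_mem (χ.map_source hx), Function.comp_apply, χ.left_inv hx]

theorem indicator_chart_nonneg (hg : ∀ x ∈ χ.source, 0 ≤ g x) (e : E) :
    0 ≤ χ.target.indicator (g ∘ χ.symm) e :=
  Set.indicator_nonneg (fun _ he => hg _ (χ.map_target he)) e

theorem indicator_chart_eq_zero (hg : ∀ x, x ∉ K → g x = 0) {e : E} (he : e ∉ χ '' K) :
    χ.target.indicator (g ∘ χ.symm) e = 0 :=
  Set.indicator_apply_eq_zero.2 fun h => hg _ fun hx => he ⟨_, hx, χ.right_inv h⟩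

variable [T2Space E]

theorem hasCompactSupport_indicator_chart (hK : IsCompact K) (hKχ : K ⊆ χ.source)
    (hg : ∀ x, x ∉ K → g x = 0) : HasCompactSupport (χ.target.indicator (g ∘ χ.symm)) :=
  .intro (hK.image_of_continuousOn (χ.continuousOn.mono hKχ)) fun _ => indicator_chart_eq_zero hg

theorem eventually_indicator_chart (hK : IsCompact K) (hKχ : K ⊆ χ.source)
    (hg : ∀ x, x ∉ K → g x = 0) (e : E) :
    (e ∈ χ.target ∧ χ.target.indicator (g ∘ χ.symm) =ᶠ[𝓝 e] g ∘ χ.symm) ∨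
      χ.target.indicator (g ∘ χ.symm) =ᶠ[𝓝 e] 0 := by
  by_cases h : e ∈ χ.target
  · refine Or.inl ⟨h, ?_⟩
    filter_upwards [χ.open_target.mem_nhds h] with e' he'
    rw [Set.indicator_of_mem he']
  · refine Or.inr ?_
    have hK' := (hK.image_of_continuousOn (χ.continuousOn.mono hKχ)).isClosed
    have he : e ∈ (χ '' K)ᶜ := by
      rintro ⟨x, hx, rfl⟩
      exact h (χ.map_source (hKχ hx))
    filter_upwards [hK'.isOpen_compl.mem_nhds he] with e' he' using indicator_chart_eq_zero hg he'

theorem continuous_indicator_chart (hK : IsCompact K) (hKχ : K ⊆ χ.source)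
    (hg : ∀ x, x ∉ K → g x = 0) (hc : ∀ x ∈ χ.source, ContinuousAt g x) :
    Continuous (χ.target.indicator (g ∘ χ.symm)) := by
  refine continuous_iff_continuousAt.2 fun e => ?_
  rcases eventually_indicator_chart hK hKχ hg e with ⟨he, h⟩ | h
  · refine ContinuousAt.congr ?_ h.symm
    exact (hc _ (χ.map_target he)).comp (χ.continuousAt_symm he)
  · exact continuousAt_const.congr h.symm

end Extension

section Residue

variable {U : X.Opens} {t : Fin n → Γ(X, U)} {χ : CoordChart p n} {x : RatPoint p} {W : Set (RatPoint p)} {e : PrimeDivisor X → Finset (Fin n)} {u : PrimeDivisor X → Γ(X, U)}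

theorem IsAdapted.modulus_val {A : Finset (PrimeDivisor X)} (ha : IsAdapted p A U t e u)
    (hx : x.pt ∈ U) {α : PrimeDivisor X} (hα : α ∈ A) :
    modulus (x.val (u α)) = blockNorm (e α) fun i => x.val (t i) :=
  (ha.2.2 α hα).1.modulus_val hx

theorem IsAdapted.mem_stratum_iff {A : Finset (PrimeDivisor X)} (ha : IsAdapted p A U t e u)
    (hx : x.pt ∈ U) :
    x ∈ stratum p A ↔ ∀ i ∈ A.biUnion e, x.val (t i) = 0 := by
  have h1 : ∀ α ∈ A, α.pt ⤳ x.pt ↔ ∀ i ∈ e α, x.val (t i) = 0 := fun α hα => by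
    rw [← (ha.2.2 α hα).2.modulus_eq_zero_iff hx, ha.modulus_val hx hα,
      blockNorm_eq_zero (ha.2.2 α hα).1.nonempty]
  constructor
  · intro h i hi
    obtain ⟨α, hα, hi⟩ := mem_biUnion.1 hi
    exact (h1 α hα).1 (h α hα) i hi
  · intro h α hα
    exact (h1 α hα).2 fun i hi => h i (mem_biUnion.2 ⟨α, hα, hi⟩)

variable {D L : EffDivisor X}

theorem isClosed_stratum (hX : IsSmoothSNC p n L) {A : Finset (PrimeDivisor X)} (hA : A ⊆ L.support)
    : IsClosed (stratum p A) := by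
  have h1 : stratum p A = ⋂ α ∈ A, ratSupport p (Finsupp.single α 1) := by
    ext x
    simp only [stratum, ratSupport, supportSet, Set.mem_ofPred_eq, Set.mem_iInter]
    refine forall₂_congr fun α hα => ?_
    rw [Finsupp.support_single _ one_ne_zero]
    simp
  rw [h1]
  refine isClosed_biInter fun α hα => isClosed_ratSupport ⟨hX, ?_⟩
  rw [Finsupp.support_single _ one_ne_zero, singleton_subset_iff]
  exact hA hα

variable (M : CanonicalMetric p n D) (Mc : ComponentMetrics p)

/-- The norm `‖dt₁ ∧ ⋯ ∧ dtₙ‖` on `ω_X` is continuous and positive, also over `D`. -/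
theorem canonicalNorm_spec (ML : DivisorMetric p L) (hX : IsSNCPair p n D L) (ht : IsEtaleCoord p U t)
    (hx : x.pt ∈ U) :
    ContinuousAt (canonicalNorm M Mc U t) x ∧ 0 < canonicalNorm M Mc U t x ∧
      (x ∉ ratSupport p D → M.norm U t x =
        canonicalNorm M Mc U t x * ∏ P ∈ D.support, (Mc P).norm x ^ (D P : ℝ)) := by
  have hd := dense_compl_ratSupport hX
  obtain ⟨U₀, t₀, e₀, u₀, hx₀, ht₀, hu₀, -⟩ := exists_adapted_coordinates hX.1 x
  obtain ⟨V, hVU, u, hxV, htV, hu⟩ := exists_common_restriction ht ht₀.1 hu₀ hx hx₀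
  obtain ⟨N⟩ := exists_localNorms hX.2 M ML Mc htV hu
  have h1 : ∀ y, y.pt ∈ V → canonicalNorm M Mc U t y =
      N.hM y / ∏ P ∈ D.support, N.q P y ^ (D P : ℝ) := by
    intro y hy
    rw [← N.canonicalNorm_eq hu hX.2 hd hy]
    unfold canonicalNorm limUnder
    congr 1
    refine Filter.map_congr (nhdsWithin_le_nhds ?_)
    filter_upwards [(isOpen_setOf_pt_mem V).mem_nhds hy] with z hz
    rw [M.norm_res ht htV.1 hVU hz]
  have hq : 0 < ∏ P ∈ D.support, N.q P x ^ (D P : ℝ) :=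
    prod_pos fun P hP => rpow_pos_of_pos (N.q_pos P (hX.2 hP) x hxV) _
  refine ⟨?_, ?_, fun hxD => ?_⟩
  · refine ContinuousAt.congr (f := fun y => N.hM y / ∏ P ∈ D.support, N.q P y ^ (D P : ℝ)) ?_ ?_
    · exact (N.smooth_hM.continuousAt hxV).div (tendsto_finsetProd _ fun P hP =>
        ((N.smooth_q P (hX.2 hP)).continuousAt hxV).rpow_const (Or.inr (by positivity))) hq.ne'
    · filter_upwards [(isOpen_setOf_pt_mem V).mem_nhds hxV] with z hz
      rw [h1 z hz]
  · rw [h1 x hxV]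
    exact div_pos (N.hM_pos x hxV) hq
  · have h2 : ∏ P ∈ D.support, (Mc P).norm x ^ (D P : ℝ) =
        (∏ P ∈ D.support, modulus (x.val (u P)) ^ (D P : ℝ)) *
          ∏ P ∈ D.support, N.q P x ^ (D P : ℝ) := by
      rw [← prod_mul_distrib]
      exact prod_congr rfl fun P hP => by
        rw [N.norm_Mc P (hX.2 hP) x hxV, mul_rpow (modulus_nonneg _) (N.q_pos P (hX.2 hP) x hxV).le]
    rw [h1 x hxV, ← M.norm_res ht htV.1 hVU hxV, N.norm_M x hxV, h2]
    field_simp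

/-- The functions `‖f_α‖ / |u_α|` are continuous and positive, also over `D`. -/
theorem exists_quotient (hX : IsSNCPair p n D L) {A : Finset (PrimeDivisor X)} (hA : A ⊆ D.support)
    (hu : ∀ α ∈ A, IsLocalEq α U (u α)) :
    ∃ q : PrimeDivisor X → RatPoint p → ℝ, ∀ α ∈ A, ∀ x, x.pt ∈ U →
      ContinuousAt (q α) x ∧ 0 < q α x ∧ (Mc α).norm x = modulus (x.val (u α)) * q α x ∧
      limUnder (𝓝[(ratSupport p D)ᶜ] x) (fun y => (Mc α).norm y / modulus (y.val (u α))) = q α x := by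
  choose! q hq1 hq2 using fun P (hP : P ∈ A) => (Mc P).exists_single (hu P hP)
  refine ⟨q, fun α hα x hx => ⟨(hq1 α hα).continuousAt hx, (hq2 α hα x hx).1, (hq2 α hα x hx).2, ?_⟩⟩
  refine limUnder_eq_of_continuousAt (dense_compl_ratSupport hX)
    ((hq1 α hα).continuousAt hx) ?_
  filter_upwards [(isOpen_setOf_pt_mem U).mem_nhds hx] with y hy hyD
  rw [(hq2 α hα y hy).2, mul_div_cancel_left₀]
  intro h0
  exact hyD ⟨α, hA hα, ((hu α hα).modulus_eq_zero_iff hy).1 h0⟩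

variable {A : Finset (PrimeDivisor X)}

theorem IsAdapted.extendZero_coord (ha : IsAdapted p A U t e u) (hχ : IsChart t χ) (hx : x.pt ∈ U)
    (hxA : x ∈ stratum p A) :
    extendZero (A.biUnion e) (fun i => x.val (t i)) = χ x := by
  rw [extendZero_restrict _ fun i => x.val (t i), hχ.eq, zeroOn_eq_self]
  exact (ha.mem_stratum_iff hx).1 hxA

theorem IsAdapted.mem_stratum_of_extendZero (ha : IsAdapted p A U t e u) (hχ : IsChart t χ)
    (hx : x.pt ∈ U) {y : {i : Fin n // i ∉ A.biUnion e} → F} (hy : χ x = extendZero (A.biUnion e) y)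
    :
    x ∈ stratum p A ∧ (fun i : {i : Fin n // i ∉ A.biUnion e} => x.val (t i)) = y := by
  rw [hχ.eq] at hy
  constructor
  · refine (ha.mem_stratum_iff hx).2 fun i hi => ?_
    rw [show x.val (t i) = extendZero (A.biUnion e) y i from congrFun hy i]
    simp only [extendZero, hi, dite_true]
  · ext i
    rw [show x.val (t i) = extendZero (A.biUnion e) y i from congrFun hy i]
    simp only [extendZero, i.2, dite_false]

/-- An open set of points of `U` on which the coordinates outside of the blocks are injective on the
stratum of `A`. -/
structure IsFaceDomain (p : X ⟶ Spec (of F)) (A : Finset (PrimeDivisor X)) (U : X.Opens)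
    (t : Fin n → Γ(X, U)) (e : PrimeDivisor X → Finset (Fin n)) (W : Set (RatPoint p)) : Prop where
  isOpen : IsOpen W
  subset : W ⊆ {x | x.pt ∈ U}
  injOn : Set.InjOn (fun x (i : {i : Fin n // i ∉ A.biUnion e}) => x.val (t i)) (W ∩ stratum p A)

theorem IsAdapted.isOpenEmbedding (ha : IsAdapted p A U t e u) (hW : IsFaceDomain p A U t e W) :
    IsOpenEmbedding fun (x : (W ∩ stratum p A : Set (RatPoint p)))
      (i : {i : Fin n // i ∉ A.biUnion e}) => x.1.val (t i) := by
  refine .of_continuous_injective_isOpenMap ?_ ?_ ?_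
  · exact continuous_iff_continuousAt.2 fun x => continuousAt_pi.2 fun i =>
      (continuousAt_val (t i) (hW.2 x.2.1)).comp continuousAt_subtype_val
  · exact fun x y hxy => Subtype.ext (hW.3 x.2 y.2 hxy)
  · refine IsOpenMap.of_nhds_le fun x N hN => ?_
    obtain ⟨χ, hxs, hχ⟩ := ha.1.exists_isChart (hW.2 x.2.1)
    obtain ⟨N', hN', hNN'⟩ := mem_nhds_subtype _ _ _ |>.1 (mem_map.1 hN)
    obtain ⟨O, hON, hO, hxO⟩ := mem_nhds_iff.1 hN'
    set O' := (O ∩ W) ∩ χ.source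
    have hO' : IsOpen (χ '' O') := χ.isOpen_image_of_subset_source
      ((hO.inter hW.1).inter χ.open_source) Set.inter_subset_right
    refine mem_of_superset ((hO'.preimage (continuous_extendZero (A.biUnion e))).mem_nhds ?_) ?_
    · exact ⟨x.1, ⟨⟨hxO, x.2.1⟩, hxs⟩, (ha.extendZero_coord hχ (hW.2 x.2.1) x.2.2).symm⟩
    · rintro y ⟨w, hw, hwy⟩
      obtain ⟨h1, h2⟩ := ha.mem_stratum_of_extendZero hχ (hW.2 hw.1.2) hwy
      have := hNN' (a := ⟨w, hw.1.2, h1⟩) (hON hw.1.1)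
      rw [Set.mem_preimage] at this
      rwa [h2] at this

/-- The density of the residue measure in adapted coordinates. -/
def residueDensity (μ : Measure F) (A : Finset (PrimeDivisor X)) (t : Fin n → Γ(X, U))
    (e : PrimeDivisor X → Finset (Fin n)) (u : PrimeDivisor X → Γ(X, U)) (x : RatPoint p) : ℝ :=
  (∏ α ∈ A, unitBallConst μ (e α)) / (canonicalNorm M Mc U t x *
    ∏ α ∈ A, limUnder (𝓝[(ratSupport p D)ᶜ] x) fun y => (Mc α).norm y / modulus (y.val (u α)))

variable (μ : Measure F) [μ.IsAddHaarMeasure]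

/-- The limits in the definition of the density exist, by smoothness of the metrics. -/
theorem residueDensity_spec (ML : DivisorMetric p L) (hX : IsSNCPair p n D L) (hA : A ⊆ D.support) (ha : IsAdapted p A U t e u)
    (hx : x.pt ∈ U) : ContinuousAt (residueDensity M Mc μ A t e u) x ∧
      0 < residueDensity M Mc μ A t e u x := by
  obtain ⟨q, hq⟩ := exists_quotient Mc hX hA fun α hα => (ha.2.2 α hα).2
  have h1 : ∀ y, y.pt ∈ U → residueDensity M Mc μ A t e u y =
      (∏ α ∈ A, unitBallConst μ (e α)) / (canonicalNorm M Mc U t y * ∏ α ∈ A, q α y) := by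
    intro y hy
    rw [residueDensity]
    congr 2
    exact prod_congr rfl fun α hα => (hq α hα y hy).2.2.2
  have hpos : 0 < canonicalNorm M Mc U t x * ∏ α ∈ A, q α x :=
    mul_pos (canonicalNorm_spec M Mc ML hX ha.1 hx).2.1
      (prod_pos fun α hα => (hq α hα x hx).2.1)
  constructor
  · refine ContinuousAt.congr (f := fun y => (∏ α ∈ A, unitBallConst μ (e α)) /
      (canonicalNorm M Mc U t y * ∏ α ∈ A, q α y)) ?_ ?_
    · exact continuousAt_const.div ((canonicalNorm_spec M Mc ML hX ha.1 hx).1.mul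
        (tendsto_finsetProd _ fun α hα => (hq α hα x hx).1)) hpos.ne'
    · filter_upwards [(isOpen_setOf_pt_mem U).mem_nhds hx] with z hz
      rw [h1 z hz]
  · rw [h1 x hx]
    exact div_pos (prod_pos fun α _ => unitBallConst_pos μ _) hpos

/-- A face is parametrized by the coordinates outside the blocks of `A`, the others being zero. -/
theorem setLIntegral_residueChartMeasure (ML : DivisorMetric p L) (hX : IsSNCPair p n D L) (hA : A ⊆ D.support)
    (ha : IsAdapted p A U t e u) (hW : IsFaceDomain p A U t e W) (hχ : IsChart t χ)
    {O : Set (RatPoint p)} (hO : IsOpen O) (hOW : O ⊆ W) (hOχ : O ⊆ χ.source)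
    {f : RatPoint p → ENNReal} (hf : Measurable f) :
    ∫⁻ x in O, f x ∂(residueChartMeasure μ M Mc A U t e u W) =
      ∫⁻ y in extendZero (A.biUnion e) ⁻¹' (χ '' O), f (χ.symm (extendZero (A.biUnion e) y)) *
        .ofReal (residueDensity M Mc μ A t e u (χ.symm (extendZero (A.biUnion e) y)))
        ∂(power _ μ) := by
  have hρ : Continuous fun x : (W ∩ stratum p A : Set (RatPoint p)) =>
      residueDensity M Mc μ A t e u x.1 := continuous_iff_continuousAt.2 fun x =>
    (residueDensity_spec M Mc μ ML hX hA ha (hW.2 x.2.1)).1.comp continuousAt_subtype_val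
  refine setLIntegral_map_comap_withDensity
    (hW.1.measurableSet.inter (isClosed_stratum hX.1 (hA.trans hX.2)).measurableSet)
    (ha.isOpenEmbedding hW).measurableEmbedding
    hρ.measurable.ennreal_ofReal hO.measurableSet
    ((χ.isOpen_image_of_subset_source hO hOχ).preimage (continuous_extendZero _)).measurableSet
    (g := fun y => χ.symm (extendZero (A.biUnion e) y)) ?_ ?_
    (ρ' := fun x => ENNReal.ofReal (residueDensity M Mc μ A t e u x)) (fun _ => rfl) hf
  · intro z hz
    have h1 := ha.extendZero_coord hχ (hW.2 z.2.1) z.2.2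
    simp only [Set.mem_preimage, h1]
    exact ⟨⟨_, hz, rfl⟩, χ.left_inv (hOχ hz)⟩
  · rintro y ⟨x, hx, hxy⟩
    obtain ⟨h1, h2⟩ := ha.mem_stratum_of_extendZero hχ (hW.2 (hOW hx)) hxy
    exact ⟨⟨x, hOW hx, h1⟩, hx, h2⟩

end Residue

section Residue

variable {D L : EffDivisor X}

theorem DivisorMetric.continuous_norm {E : EffDivisor X} (m : DivisorMetric p E)
    (hX : IsSNCPair p n E L) : Continuous m.norm := by
  refine continuous_iff_continuousAt.2 fun x => ?_
  obtain ⟨C, hx, -⟩ := exists_adaptedChart hX.1 x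
  obtain ⟨h, hh, hnorm⟩ := m.local_form C.U C.u fun P hP => C.localEq P (hX.2 hP)
  have hxU := C.mem_U hx
  refine ContinuousAt.congr (f := fun x => (∏ P ∈ E.support, modulus (x.val (C.u P)) ^ (E P : ℝ)) * h x)
    ?_ ?_
  · exact (tendsto_finsetProd _ fun P _ => (continuous_modulus.continuousAt.comp
      (continuousAt_val (C.u P) hxU)).rpow_const (Or.inr (by positivity))).mul (hh.continuousAt hxU)
  · filter_upwards [(isOpen_setOf_pt_mem C.U).mem_nhds hxU] with y hy
    rw [(hnorm y hy).2]

theorem DivisorMetric.norm_nonneg {E : EffDivisor X} (m : DivisorMetric p E)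
    (hX : IsSNCPair p n E L) (x : RatPoint p) : 0 ≤ m.norm x := by
  obtain ⟨C, hx, -⟩ := exists_adaptedChart hX.1 x
  obtain ⟨h, hh, hnorm⟩ := m.local_form C.U C.u fun P hP => C.localEq P (hX.2 hP)
  rw [(hnorm x (C.mem_U hx)).2]
  exact mul_nonneg (prod_nonneg fun P _ => rpow_nonneg (modulus_nonneg _) _)
    (hnorm x (C.mem_U hx)).1.le

theorem continuous_norm_single {α : PrimeDivisor X} (m : DivisorMetric p (Finsupp.single α 1))
    (hX : IsSmoothSNC p n L) (hα : α ∈ L.support) :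
    Continuous m.norm :=
  m.continuous_norm ⟨hX, by rwa [Finsupp.support_single _ one_ne_zero, singleton_subset_iff]⟩

/-- The weights whose product with `τ_{(X,D)}` tends to the residue measure on `D_A(F)`, as `ε`
tends to zero. -/
def residueWeight (D : EffDivisor X) (Mc : ComponentMetrics p) (A : Finset (PrimeDivisor X)) (ε : ℝ)
    (x : RatPoint p) : ℝ :=
  (∏ α ∈ A, ε * (Mc α).norm x ^ (ε - 1)) * ∏ β ∈ D.support, (Mc β).norm x ^ (D β : ℝ)

variable (M : CanonicalMetric p n D) (Mc : ComponentMetrics p) {A : Finset (PrimeDivisor X)}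
  {U : X.Opens} {t : Fin n → Γ(X, U)} {e : PrimeDivisor X → Finset (Fin n)}
  {u : PrimeDivisor X → Γ(X, U)} (μ : Measure F) [μ.IsAddHaarMeasure]

theorem integrable_epsDensity {m : Measure (Fin n → F)} [IsFiniteMeasure m] {ι : Type*}
    [DecidableEq ι] {S : Finset ι} {e : ι → Finset (Fin n)} (hdisj : (S : Set ι).PairwiseDisjoint e)
    (h : ∀ P ∈ S, SplitsBlock m (e P)) {ε : ℝ} (hε : 0 < ε) : Integrable (epsDensity S e ε) m := by
  refine ⟨(measurable_epsDensity S e ε).aestronglyMeasurable, ?_⟩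
  rw [hasFiniteIntegral_iff_ofReal (.of_forall fun t => ?_)]
  · have := lintegral_epsDensity hdisj h hε measurable_one (fun _ _ _ => rfl)
    simp only [Pi.one_apply, one_mul, lintegral_one] at this
    rw [this]
    exact measure_lt_top _ _
  · exact prod_nonneg fun P _ => mul_nonneg hε.le (rpow_nonneg (blockNorm_nonneg _ _) _)

/-- The residue measure is, in each adapted chart, the limit of the same measures on `X(F)`. -/
theorem tendsto_lintegral_residueWeight [SecondCountableTopology (RatPoint p)]
    [T2Space (RatPoint p)] (ML : DivisorMetric p L) (hX : IsSNCPair p n D L) (hA : A ⊆ D.support)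
    (ha : IsAdapted p A U t e u) {W : Set (RatPoint p)} (hW : IsFaceDomain p A U t e W)
    {χ : CoordChart p n} (hχ : IsChart t χ) {O : Set (RatPoint p)} (hO : IsOpen O) (hOW : O ⊆ W)
    (hOχ : O ⊆ χ.source) {R : ℝ} (hOR : χ '' O ⊆ blockRegion F A e R) {ψ : RatPoint p → ℝ}
    (hψ : Continuous ψ) (hψ0 : ∀ x, 0 ≤ ψ x) {K : Set (RatPoint p)} (hK : IsCompact K) (hKO : K ⊆ O)
    (hψK : ∀ x, x ∉ K → ψ x = 0) :
    Tendsto (fun ε => ∫⁻ x, ENNReal.ofReal (ψ x * residueWeight D Mc A ε x) ∂(tauPair μ M))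
      (𝓝[>] 0) (𝓝 (∫⁻ x in O, ENNReal.ofReal (ψ x) ∂(residueChartMeasure μ M Mc A U t e u W))) ∧
    ∫⁻ x in O, ENNReal.ofReal (ψ x) ∂(residueChartMeasure μ M Mc A U t e u W) < ⊤ := by
  classical
  obtain ⟨q, hq⟩ := exists_quotient Mc hX hA fun α hα => (ha.2.2 α hα).2
  have hUO : ∀ y ∈ O, y.pt ∈ U := fun y hy => hW.2 (hOW hy)
  have hUχ : ∀ y ∈ χ.source, y.pt ∈ U := hχ.mem
  have hKχ : K ⊆ χ.source := hKO.trans hOχ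
  set cn := canonicalNorm M Mc U t with hcn
  have hcs := fun (y : RatPoint p) (hy : y.pt ∈ U) => canonicalNorm_spec M Mc ML hX ha.1 hy
  set G : RatPoint p → ℝ := fun x => ψ x / (cn x * ∏ α ∈ A, q α x) with hG
  have hqpos : ∀ y : RatPoint p, y.pt ∈ U → 0 < ∏ α ∈ A, q α y := fun y hy =>
    prod_pos fun α hα => (hq α hα y hy).2.1
  have hGK : ∀ x, x ∉ K → G x = 0 := fun x hx => by rw [hG]; simp only [hψK x hx, zero_div]
  have hGc : ∀ x ∈ χ.source, ContinuousAt G x := fun x hx =>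
    hψ.continuousAt.div ((hcs x (hUχ x hx)).1.mul (tendsto_finsetProd _ fun α hα =>
      (hq α hα x (hUχ x hx)).1)) (mul_pos (hcs x (hUχ x hx)).2.1 (hqpos x (hUχ x hx))).ne'
  have hG0 : ∀ x ∈ χ.source, 0 ≤ G x := fun x hx =>
    div_nonneg (hψ0 x) (mul_pos (hcs x (hUχ x hx)).2.1 (hqpos x (hUχ x hx))).le
  set H := χ.target.indicator (G ∘ χ.symm)
  have hHc : Continuous H := continuous_indicator_chart hK hKχ hGK hGc
  have hHs : HasCompactSupport H := hasCompactSupport_indicator_chart hK hKχ hGK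
  have hHχ : ∀ y ∈ χ.source, H (χ y) = G y := fun y hy => indicator_chart_apply hy
  have hH0 : ∀ z, 0 ≤ H z := indicator_chart_nonneg hG0
  have hHO : ∀ z, z ∉ χ '' K → H z = 0 := fun z => indicator_chart_eq_zero hGK
  have hOV : IsOpen (χ '' O) := χ.isOpen_image_of_subset_source hO hOχ
  set ell : (Fin n → F) → ℝ := (χ '' O).indicator fun z => ∑ α ∈ A, log (q α (χ.symm z)) with hell
  have hlogc : ∀ y ∈ O, ContinuousAt (fun y => ∑ α ∈ A, log (q α y)) y := fun y hy =>
    tendsto_finsetSum _ fun α hα =>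
      (hq α hα y (hUO y hy)).1.log (hq α hα y (hUO y hy)).2.1.ne'
  have hellm : Measurable ell := by
    rw [hell, ← Set.piecewise_eq_indicator]
    refine ContinuousOn.measurable_piecewise ?_ continuousOn_const hOV.measurableSet
    rintro _ ⟨y, hy, rfl⟩
    refine (ContinuousAt.comp (g := fun y => ∑ α ∈ A, log (q α y)) ?_
      (χ.continuousAt_symm (χ.map_source (hOχ hy)))).continuousWithinAt
    rw [χ.left_inv (hOχ hy)]
    exact hlogc y hy
  obtain ⟨K₁, hK₁⟩ : ∃ K₁, ∀ y ∈ K, |∑ α ∈ A, log (q α y)| ≤ K₁ :=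
    hK.exists_bound_of_continuousOn fun y hy => (hlogc y (hKO hy)).continuousWithinAt
  have hellK : ∀ z, H z ≠ 0 → |ell z| ≤ K₁ := by
    intro z hz
    by_contra hcon
    refine hz (hHO z ?_)
    rintro ⟨y, hy, rfl⟩
    rw [hell, Set.indicator_of_mem (Set.mem_image_of_mem _ (hKO hy)), χ.left_inv (hKχ hy)] at hcon
    exact hcon (hK₁ y hy)
  have hne : ∀ α ∈ A, (e α).Nonempty := fun α hα => (ha.2.2 α hα).1.nonempty
  set m := (power (Fin n) μ).restrict (blockRegion F A e R) with hm
  have : IsFiniteMeasure m := ⟨by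
    rw [hm, Measure.restrict_apply_univ]
    exact measure_blockRegion_lt_top μ A e R⟩
  have hsplit : ∀ α ∈ A, SplitsBlock m (e α) := fun α hα =>
    splitsBlock_blockRegion μ ha.2.1 hα (hne α hα)
  have hlim := tendsto_integral_epsDensity ha.2.1 hne hsplit hHc hHs hellm hellK
  have hlim2 := (ENNReal.continuous_ofReal.tendsto _).comp hlim
  have hBm := measurableSet_blockRegion (F := F) A e R
  have hKV : χ '' K ⊆ χ '' O := Set.image_mono hKO
  -- the limit is the integral with respect to the residue measure
  have hright : ENNReal.ofReal (∫ z, H (zeroOn (A.biUnion e) z) ∂m) =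
      ∫⁻ x in O, ENNReal.ofReal (ψ x) ∂(residueChartMeasure μ M Mc A U t e u W) := by
    obtain ⟨B, hB⟩ := hHs.exists_bound_of_continuous hHc
    rw [ofReal_integral_eq_lintegral_ofReal
      (f := fun z => H (zeroOn (A.biUnion e) z))
      (Integrable.of_bound (hHc.comp (continuous_zeroOn _)).aestronglyMeasurable B
        (.of_forall fun z => hB _)) (.of_forall fun z => hH0 _), hm,
      setLIntegral_zeroOn μ A ha.2.1 hne hBm (fun z hz => ?_) (fun z hz i hi => (hOR hz).2 i fun α hα h =>
        hi (mem_biUnion.2 ⟨α, hα, h⟩)) hOV.measurableSet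
        (G := fun z => ENNReal.ofReal (H z)) hHc.measurable.ennreal_ofReal
        (fun z hz => by rw [hHO _ fun h => hz (hKV h), ENNReal.ofReal_zero]),
      setLIntegral_residueChartMeasure M Mc μ ML hX hA ha hW hχ hO hOW hOχ
        hψ.measurable.ennreal_ofReal]
    · refine setLIntegral_congr_fun
        (hOV.preimage (continuous_extendZero (A.biUnion e))).measurableSet ?_
      rintro y ⟨x, hx, hxy⟩
      simp only
      rw [← hxy, χ.left_inv (hOχ hx), hHχ x (hOχ hx), ← ENNReal.ofReal_mul
        (prod_nonneg fun α _ => (unitBallConst_pos μ _).le), ← ENNReal.ofReal_mul (hψ0 x),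
        residueDensity, prod_congr rfl fun α hα => (hq α hα x (hUO x hx)).2.2.2]
      congr 1
      rw [hG]
      ring
    · refine ⟨fun h => h.1, fun h => ⟨h, fun i hi => ?_⟩⟩
      have h2 := (hOR hz).2 i hi
      rwa [zeroOn, if_neg fun h => by
        obtain ⟨α, hα, h'⟩ := mem_biUnion.1 h
        exact hi α hα h'] at h2
  rw [← hright]
  refine ⟨?_, ENNReal.ofReal_lt_top⟩
  refine hlim2.congr' ?_
  filter_upwards [self_mem_nhdsWithin] with ε (hε : 0 < ε)
  have hwm : Measurable fun x => ENNReal.ofReal (ψ x * residueWeight D Mc A ε x) := by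
    have hc : ∀ α ∈ D.support, Measurable (Mc α).norm := fun α hα =>
      (continuous_norm_single (Mc α) hX.1 (hX.2 hα)).measurable
    refine (hψ.measurable.mul ((Finset.measurable_fun_prod _ fun α hα =>
      ((hc α (hA hα)).pow_const _).const_mul _).mul
      (Finset.measurable_fun_prod _ fun α hα => (hc α hα).pow_const _))).ennreal_ofReal
  rw [lintegral_eq_setLIntegral hO.measurableSet fun x hx => by
      rw [hψK x fun h => hx (hKO h), zero_mul, ENNReal.ofReal_zero],
    setLIntegral_tauPair M μ hX ha.1 hχ hO hOχ hwm, Function.comp_apply,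
    ofReal_integral_eq_lintegral_ofReal]
  · rw [← lintegral_eq_setLIntegral hBm, lintegral_eq_setLIntegral hOV.measurableSet]
    · refine lintegral_congr_ae ?_
      rw [EventuallyEq, ae_restrict_iff' hOV.measurableSet]
      have hnull := measure_eq_zero_iff_ae_notMem.1
        (measure_ratSupport_chart_eq_zero μ hX hχ)
      filter_upwards [hnull] with z hz
      rintro ⟨y, hy, rfl⟩
      rw [χ.left_inv (hOχ hy)] at hz ⊢
      have hyD : y ∉ ratSupport p D := fun h => hz ⟨χ.map_source (hOχ hy), h⟩
      have hyU := hUO y hy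
      rw [hHχ y (hOχ hy), hell, Set.indicator_of_mem (Set.mem_image_of_mem _ hy), χ.left_inv (hOχ hy)]
      have hMn := M.norm_pos hX ha.1 hyU hyD
      rw [(hcs y hyU).2.2 hyD] at hMn ⊢
      have hcnpos := (hcs y hyU).2.1
      have hQ : 0 < ∏ β ∈ D.support, (Mc β).norm y ^ (D β : ℝ) := pos_of_mul_pos_right hMn hcnpos.le
      have h1 : ∏ α ∈ A, ε * (Mc α).norm y ^ (ε - 1) =
          epsDensity A e ε (χ y) * exp (ε * ∑ α ∈ A, log (q α y)) / ∏ α ∈ A, q α y := by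
        rw [mul_sum, exp_sum, epsDensity, ← prod_mul_distrib,
          ← prod_div_distrib]
        refine prod_congr rfl fun α hα => ?_
        have hqp := (hq α hα y hyU).2.1
        rw [(hq α hα y hyU).2.2.1, ha.modulus_val hyU hα, ← hχ.eq,
          mul_rpow (blockNorm_nonneg _ _) hqp.le, rpow_sub_one hqp.ne',
          rpow_def_of_pos hqp, mul_comm (log _)]
        ring
      rw [residueWeight, ← ENNReal.ofReal_mul' (by positivity), h1]
      congr 1
      have := (hqpos y hyU).ne'
      have := hcnpos.ne'
      have := hQ.ne'
      simp only [hG, hcn]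
      field_simp
    · intro z hz
      rw [hHO z fun h => hz (hKV h)]
      simp
    · intro z hz
      rw [hHO z fun h => hz (hOR (hKV h))]
      simp
  · obtain ⟨B, hB⟩ := hHs.exists_bound_of_continuous hHc
    refine (integrable_epsDensity ha.2.1 hsplit hε).bdd_mul (c := B * exp (ε * K₁))
      (hHc.measurable.mul (hellm.const_mul ε).exp).aestronglyMeasurable (.of_forall fun z => ?_)
    by_cases hz : H z = 0
    · rw [hz, zero_mul, norm_zero]
      exact mul_nonneg ((norm_nonneg _).trans (hB z)) (exp_pos _).le
    · rw [norm_mul, norm_of_nonneg (exp_pos _).le]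
      refine mul_le_mul (hB z) (exp_le_exp.2 ?_) (exp_pos _).le
        ((norm_nonneg _).trans (hB z))
      exact mul_le_mul_of_nonneg_left ((le_abs_self _).trans (hellK z hz)) hε.le
  · refine .of_forall fun z => mul_nonneg (mul_nonneg (hH0 z) (exp_pos _).le) ?_
    exact prod_nonneg fun P _ => mul_nonneg hε.le (rpow_nonneg (blockNorm_nonneg _ _) _)

end Residue

section Residue

/-- A supremum of measures which vanish on `E` vanishes on `E`. -/
theorem sSup_measure_eq_zero {T : Type*} [MeasurableSpace T] {s : Set (Measure T)} {E : Set T}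
    (hE : MeasurableSet E) (h : ∀ ν ∈ s, ν E = 0) : sSup s E = 0 := by
  have h1 : sSup s ≤ (sSup s).restrict Eᶜ := by
    refine sSup_le fun ν hν => ?_
    have h2 : ν.restrict Eᶜ = ν := by
      refine Measure.restrict_eq_self_of_ae_mem ?_
      rw [ae_iff]
      simpa using h ν hν
    rw [← h2]
    exact Measure.restrict_mono le_rfl (le_sSup hν)
  refine le_antisymm ((h1 E).trans ?_) zero_le
  rw [Measure.restrict_apply hE, Set.inter_compl_self, measure_empty]

variable {U : X.Opens} {t : Fin n → Γ(X, U)} {χ : CoordChart p n} {x : RatPoint p} {e : PrimeDivisor X → Finset (Fin n)} {u : PrimeDivisor X → Γ(X, U)}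
  {D L : EffDivisor X} (M : CanonicalMetric p n D) (Mc : ComponentMetrics p) (μ : Measure F)
  {A : Finset (PrimeDivisor X)}

theorem residueChartMeasure_compl
    {W : Set (RatPoint p)}
    {E : Set (RatPoint p)} (hE : MeasurableSet E) (hd : Disjoint E (W ∩ stratum p A)) :
    residueChartMeasure μ M Mc A U t e u W E = 0 := by
  rw [residueChartMeasure, Measure.map_apply measurable_subtype_coe hE]
  have h0 : (Subtype.val ⁻¹' E : Set (W ∩ stratum p A : Set (RatPoint p))) = ∅ := by
    ext x
    simpa using fun h => Set.disjoint_left.1 hd h x.2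
  rw [h0, measure_empty]

theorem residueMeasure_compl_stratum (hX : IsSmoothSNC p n L) (hA : A ⊆ L.support) :
    residueMeasure μ M Mc A (stratum p A)ᶜ = 0 := by
  refine sSup_measure_eq_zero (isClosed_stratum hX hA).measurableSet.compl ?_
  rintro ν ⟨U, t, e, u, W, -, -, -, -, rfl⟩
  exact residueChartMeasure_compl M Mc μ (isClosed_stratum hX hA).measurableSet.compl
    (Set.disjoint_left.2 fun x hx hx' => hx hx'.2)

theorem IsAdapted.exists_bounded_nhds
    (ha : IsAdapted p A U t e u)
    (hχ : IsChart t χ)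
    (hx : x ∈ χ.source) (hxA : x ∈ stratum p A) :
    ∃ O R, IsOpen O ∧ x ∈ O ∧ O ⊆ χ.source ∧
      ∀ y ∈ O, ‖χ y‖ ≤ R ∧ χ y ∈ blockRegion F A e R := by
  set V : Set (Fin n → F) := {z | (∀ α ∈ A, blockNorm (e α) z < 1) ∧ ‖z‖ < ‖χ x‖ + 1}
  have hV : IsOpen V := by
    have h : V = (⋂ α ∈ A, {z | blockNorm (e α) z < 1}) ∩ {z | ‖z‖ < ‖χ x‖ + 1} := by
      ext
      simp [V]
    rw [h]
    refine IsOpen.inter ?_ (isOpen_lt continuous_norm continuous_const)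
    exact isOpen_biInter_finset fun α _ => isOpen_lt (continuous_blockNorm _) continuous_const
  refine ⟨χ.source ∩ χ ⁻¹' V, ‖χ x‖ + 1, χ.isOpen_inter_preimage hV, ⟨hx, fun α hα => ?_, by simp⟩,
    Set.inter_subset_left, ?_⟩
  · rw [hχ.eq, ← ha.modulus_val (hχ.mem x hx) hα,
      ((ha.2.2 α hα).2.modulus_eq_zero_iff (hχ.mem x hx)).2 (hxA α hα)]
    exact one_pos
  · exact fun y hy => ⟨hy.2.2.le, fun α hα => (hy.2.1 α hα).le,
      fun i _ => (norm_le_pi_norm _ i).trans hy.2.2.le⟩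

variable [μ.IsAddHaarMeasure] [SecondCountableTopology (RatPoint p)] [CompactSpace (RatPoint p)]
  [T2Space (RatPoint p)]

/-- The residue measures in two adapted charts agree on the overlap. -/
theorem residueChartMeasure_locally_eq (ML : DivisorMetric p L) (hX : IsSNCPair p n D L)
    (hA : A ⊆ D.support) {U' : X.Opens} {t' : Fin n → Γ(X, U')}
    {e' : PrimeDivisor X → Finset (Fin n)} {u' : PrimeDivisor X → Γ(X, U')} {W' : Set (RatPoint p)}
    (ha : IsAdapted p A U t e u) (hW : IsFaceDomain p A U t e W) (ha' : IsAdapted p A U' t' e' u')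
    (hW' : IsFaceDomain p A U' t' e' W') (hx : x ∈ W) (hx' : x ∈ W') :
    ∃ O, IsOpen O ∧ x ∈ O ∧ (residueChartMeasure μ M Mc A U t e u W).restrict O =
      (residueChartMeasure μ M Mc A U' t' e' u' W').restrict O := by
  have : TopologicalSpace.MetrizableSpace (RatPoint p) :=
    TopologicalSpace.metrizableSpace_of_t3_secondCountable _
  set ν := residueChartMeasure μ M Mc A U t e u W
  set ν' := residueChartMeasure μ M Mc A U' t' e' u' W' with hν'
  have hcl := isClosed_stratum hX.1 (hA.trans hX.2)
  by_cases hxA : x ∈ stratum p A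
  swap
  · refine ⟨(stratum p A)ᶜ, hcl.isOpen_compl, hxA, ?_⟩
    rw [Measure.restrict_eq_zero.2, Measure.restrict_eq_zero.2] <;>
      exact residueChartMeasure_compl M Mc μ hcl.measurableSet.compl
        (Set.disjoint_left.2 fun x hx hx' => hx hx'.2)
  obtain ⟨χ, hxχ, hχ⟩ := ha.1.exists_isChart (hW.2 hx)
  obtain ⟨χ', hxχ', hχ'⟩ := ha'.1.exists_isChart (hW'.2 hx')
  obtain ⟨O₁, R, hO₁, hxO₁, hO₁χ, hO₁R⟩ := ha.exists_bounded_nhds hχ hxχ hxA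
  obtain ⟨O₂, R', hO₂, hxO₂, hO₂χ, hO₂R⟩ := ha'.exists_bounded_nhds hχ' hxχ' hxA
  set O := (O₁ ∩ O₂) ∩ (W ∩ W')
  have hO : IsOpen O := (hO₁.inter hO₂).inter (hW.1.inter hW'.1)
  have hxO : x ∈ O := ⟨⟨hxO₁, hxO₂⟩, hx, hx'⟩
  obtain ⟨N₂, hN₂, hxN₂, hN₂O, hN₂c⟩ := exists_open_between_and_isCompact_closure
    (isCompact_singleton) hO (Set.singleton_subset_iff.2 hxO)
  obtain ⟨N₁, hN₁, hxN₁, hN₁₂, -⟩ := exists_open_between_and_isCompact_closure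
    (isCompact_singleton) hN₂ hxN₂
  obtain ⟨b, hb0, hb1, hb⟩ := exists_continuous_zero_one_of_isClosed hN₂.isClosed_compl
    (isClosed_closure) (Set.disjoint_left.2 fun y hy hy' => hy (hN₁₂ hy'))
  -- the two measures, multiplied by the function `b`
  have hbm : Measurable fun y => ENNReal.ofReal (b y) := b.continuous.measurable.ennreal_ofReal
  have key : ∀ f : BoundedContinuousFunction (RatPoint p) NNReal,
      ∫⁻ y in O, .ofReal (f y * b y) ∂ν = ∫⁻ y in O, .ofReal (f y * b y) ∂ν' ∧
        ∫⁻ y in O, .ofReal (f y * b y) ∂ν < ⊤ ∧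
        ∫⁻ y in O, .ofReal (f y * b y) ∂ν' < ⊤ := by
    intro f
    have hc : Continuous fun y => (f y : ℝ) * b y :=
      (NNReal.continuous_coe.comp f.continuous).mul b.continuous
    have h0 : ∀ y, 0 ≤ (f y : ℝ) * b y := fun y => mul_nonneg (f y).2 (hb y).1
    have hK : ∀ y, y ∉ closure N₂ → (f y : ℝ) * b y = 0 := fun y hy => by
      have : b y = 0 := hb0 fun h => hy (subset_closure h)
      rw [this, mul_zero]
    have h1 := tendsto_lintegral_residueWeight M Mc μ ML hX hA ha hW hχ hO
      (fun y hy => hy.2.1) (fun y hy => hO₁χ hy.1.1)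
      (Set.image_subset_iff.2 fun y hy => (hO₁R y hy.1.1).2) hc h0 hN₂c hN₂O hK
    have h2 := tendsto_lintegral_residueWeight M Mc μ ML hX hA ha' hW' hχ' hO
      (fun y hy => hy.2.2) (fun y hy => hO₂χ hy.1.2)
      (Set.image_subset_iff.2 fun y hy => (hO₂R y hy.1.2).2) hc h0 hN₂c hN₂O hK
    exact ⟨tendsto_nhds_unique h1.1 h2.1, h1.2, h2.2⟩
  have hlint : ∀ (ρ : Measure (RatPoint p)) (f : BoundedContinuousFunction (RatPoint p) NNReal),
      ∫⁻ y, f y ∂((ρ.restrict O).withDensity fun y => .ofReal (b y)) =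
        ∫⁻ y in O, .ofReal (f y * b y) ∂ρ := by
    intro ρ f
    rw [lintegral_withDensity_eq_lintegral_mul _ hbm (g := fun y => (f y : ENNReal))
      (ENNReal.continuous_coe.comp f.continuous).measurable]
    refine lintegral_congr fun y => ?_
    rw [Pi.mul_apply, mul_comm, ENNReal.ofReal_mul (p := (f y : ℝ)) (f y).2,
      ENNReal.ofReal_coe_nnreal]
  have hfin : IsFiniteMeasure ((ν.restrict O).withDensity fun y => .ofReal (b y)) := by
    refine ⟨?_⟩
    have h1 := (key (BoundedContinuousFunction.const _ 1)).2.1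
    rw [← hlint] at h1
    simpa using h1
  have heq : (ν.restrict O).withDensity (fun y => .ofReal (b y)) =
      (ν'.restrict O).withDensity fun y => .ofReal (b y) :=
    ext_of_forall_lintegral_eq_of_IsFiniteMeasure fun f => by rw [hlint, hlint, (key f).1]
  have hrestr : ∀ ρ : Measure (RatPoint p),
      ((ρ.restrict O).withDensity fun y => .ofReal (b y)).restrict N₁ = ρ.restrict N₁ := by
    intro ρ
    have hN₁O : N₁ ⊆ O := subset_closure.trans (hN₁₂.trans (subset_closure.trans hN₂O))
    rw [restrict_withDensity hN₁.measurableSet, Measure.restrict_restrict hN₁.measurableSet,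
      Set.inter_eq_left.2 hN₁O]
    have h1 : (fun y => ENNReal.ofReal (b y)) =ᵐ[ρ.restrict N₁] 1 := by
      rw [EventuallyEq, ae_restrict_iff' hN₁.measurableSet]
      refine .of_forall fun y hy => ?_
      rw [hb1 (subset_closure hy)]
      simp
    rw [withDensity_congr_ae h1, withDensity_one]
  refine ⟨N₁, hN₁, hxN₁ rfl, ?_⟩
  rw [← hrestr ν, ← hrestr ν', heq]

/-- The residue measure in adapted coordinates. -/
theorem setLIntegral_residueMeasure (ML : DivisorMetric p L) (hX : IsSNCPair p n D L)
    (hA : A ⊆ D.support) (ha : IsAdapted p A U t e u) (hχ : IsChart t χ) {O : Set (RatPoint p)}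
    (hO : IsOpen O) (hOχ : O ⊆ χ.source) {f : RatPoint p → ENNReal} (hf : Measurable f) :
    ∫⁻ x in O, f x ∂(residueMeasure μ M Mc A) =
      ∫⁻ y in extendZero (A.biUnion e) ⁻¹' (χ '' O), f (χ.symm (extendZero (A.biUnion e) y)) *
        ENNReal.ofReal (residueDensity M Mc μ A t e u (χ.symm (extendZero (A.biUnion e) y)))
        ∂(power _ μ) := by
  set rel : Measure (RatPoint p) → Set (RatPoint p) → Prop := fun ν W =>
    ∃ (U : X.Opens) (t : Fin n → Γ(X, U)) (e : PrimeDivisor X → Finset (Fin n))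
      (u : PrimeDivisor X → Γ(X, U)), IsAdapted p A U t e u ∧ IsOpen W ∧ W ⊆ {x | x.pt ∈ U} ∧
      Set.InjOn (fun x (i : {i : Fin n // i ∉ A.biUnion e}) => x.val (t i)) (W ∩ stratum p A) ∧
      ν = residueChartMeasure μ M Mc A U t e u W
  obtain ⟨h1, -⟩ := sSup_patching (σ := residueMeasure μ M Mc A) (rel := rel) rfl (fun ν =>
    ⟨fun ⟨U, t, e, u, W, h⟩ => ⟨W, U, t, e, u, h⟩, fun ⟨W, U, t, e, u, h⟩ => ⟨U, t, e, u, W, h⟩⟩) (fun ν W ⟨_, _, _, _, _, h, _⟩ => h)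
    (by
      rintro _ W ⟨U, t, e, u, _, hW, _, _, rfl⟩
      exact residueChartMeasure_compl M Mc μ hW.measurableSet.compl
        (Set.disjoint_left.2 fun x hx hx' => hx hx'.1))
    (by
      rintro _ W _ W' ⟨U, t, e, u, ha, hW, hWU, hinj, rfl⟩
        ⟨U', t', e', u', ha', hW', hWU', hinj', rfl⟩ x ⟨hx, hx'⟩
      exact residueChartMeasure_locally_eq M Mc μ ML hX hA ha ⟨hW, hWU, hinj⟩ ha'
        ⟨hW', hWU', hinj'⟩ hx hx')
  have hOF : IsFaceDomain p A U t e O := by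
    refine ⟨hO, fun y hy => hχ.mem y (hOχ hy), ?_⟩
    intro y hy z hz h
    refine χ.injOn (hOχ hy.1) (hOχ hz.1) ?_
    rw [← ha.extendZero_coord hχ (hχ.mem y (hOχ hy.1)) hy.2, ← ha.extendZero_coord hχ (hχ.mem z (hOχ hz.1)) hz.2]
    exact congrArg _ h
  have h2 := h1 _ O ⟨U, t, e, u, ha, hO, hOF.2, hOF.3, rfl⟩
  have h3 : ∫⁻ x in O, f x ∂(residueMeasure μ M Mc A) =
      ∫⁻ x in O, f x ∂(residueChartMeasure μ M Mc A U t e u O) := by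
    rw [← h2, Measure.restrict_restrict hO.measurableSet, Set.inter_self]
  rw [h3, setLIntegral_residueChartMeasure M Mc μ ML hX hA ha hOF hχ hO le_rfl
    hOχ hf]

end Residue

/-! ### Smooth functions on the analytic space -/

section Smooth

variable {U : X.Opens} {t : Fin n → Γ(X, U)} {χ : CoordChart p n}

theorem IsSmoothOn.contDiffAt {g : RatPoint p → ℝ} {S : Set (RatPoint p)} (h : IsSmoothOn g S)
    (hχ : IsChart t χ) {y : RatPoint p} (hy : y ∈ χ.source) (hyS : y ∈ S) :
    ContDiffAt ℝ ∞ (g ∘ χ.symm) (χ y) := by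
  obtain ⟨V, m, f, G, hyV, hG, hev⟩ := h y hyS
  have h1 : ContDiffAt ℝ ∞ (fun e => G fun i => (χ.symm e).val (f i)) (χ y) :=
    hG.contDiffAt.comp _ (contDiffAt_pi.2 fun i => (hχ.smooth y hy V (f i) hyV).restrict_scalars ℝ)
  refine h1.congr_of_eventuallyEq ?_
  have h2 := χ.continuousAt_symm (χ.map_source hy)
  rw [ContinuousAt, χ.left_inv hy] at h2
  exact h2.eventually hev

/-- A function on `X(F)` is smooth in all charts with values in `F ^ n`. -/
def ChartSmooth (n : ℕ) (f : RatPoint p → ℝ) : Prop :=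
  ∀ (U : X.Opens) (t : Fin n → Γ(X, U)) (χ : CoordChart p n),
    IsChart t χ → ∀ y ∈ χ.source, ContDiffAt ℝ ∞ (f ∘ χ.symm) (χ y)

/-- There are smooth functions with small support, equal to `1` near a given point. -/
theorem exists_chartSmooth_bump [T2Space (RatPoint p)] (hχ : IsChart t χ) {x : RatPoint p}
    {O : Set (RatPoint p)} (hO : IsOpen O) (hxO : x ∈ O) (hOχ : O ⊆ χ.source) :
    ∃ (θ : RatPoint p → ℝ) (K : Set (RatPoint p)), ChartSmooth n θ ∧ IsCompact K ∧ K ⊆ O ∧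
      (∀ y, y ∉ K → θ y = 0) ∧ (∀ y, θ y ∈ Set.Icc 0 1) ∧ ∃ Ω, IsOpen Ω ∧ x ∈ Ω ∧ Ω ⊆ O ∧
        ∀ y ∈ Ω, θ y = 1 := by
  classical
  have hV := χ.isOpen_image_of_subset_source hO hOχ
  obtain ⟨r, hr, hrV⟩ := Metric.isOpen_iff.1 hV _ ⟨x, hxO, rfl⟩
  let b : ContDiffBump (χ x) := ⟨r / 4, r / 2, by linarith, by linarith⟩
  have hbV : Metric.closedBall (χ x) (r / 2) ⊆ χ '' O :=
    (Metric.closedBall_subset_ball (by linarith)).trans hrV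
  have hVt : χ '' O ⊆ χ.target := by
    rintro _ ⟨y, hy, rfl⟩
    exact χ.map_source (hOχ hy)
  set K := χ.symm '' Metric.closedBall (χ x) (r / 2)
  have hK : IsCompact K := (isCompact_closedBall _ _).image_of_continuousOn
    (χ.symm.continuousOn.mono (hbV.trans hVt))
  have hKO : K ⊆ O := by
    rintro _ ⟨z, hz, rfl⟩
    obtain ⟨y, hy, rfl⟩ := hbV hz
    rwa [χ.left_inv (hOχ hy)]
  set θ : RatPoint p → ℝ := χ.source.indicator fun y => b (χ y) with hθ
  have hθK : ∀ y, y ∉ K → θ y = 0 := by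
    intro y hy
    by_cases hys : y ∈ χ.source
    · rw [hθ, Set.indicator_of_mem hys]
      refine b.zero_of_le_dist (le_of_not_gt fun h => hy ⟨χ y, ?_, χ.left_inv hys⟩)
      exact Metric.mem_closedBall.2 h.le
    · rw [hθ, Set.indicator_of_notMem hys]
  refine ⟨θ, K, ?_, hK, hKO, hθK, fun y => ?_, χ.source ∩ χ ⁻¹' Metric.ball (χ x) (r / 4),
    χ.isOpen_inter_preimage Metric.isOpen_ball, ⟨hOχ hxO, Metric.mem_ball_self (by linarith)⟩, ?_, ?_⟩
  · have hsm : IsSmoothOn θ Set.univ := by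
      intro y _
      by_cases hys : y ∈ χ.source
      · refine ⟨U, n, t, b, hχ.mem y hys, b.contDiff, ?_⟩
        filter_upwards [χ.open_source.mem_nhds hys] with z hz
        rw [hθ, Set.indicator_of_mem hz]
        exact congrArg (b : (Fin n → F) → ℝ) (hχ.eq z)
      · refine ⟨⊤, 0, fun _ => 0, 0, trivial, contDiff_const, ?_⟩
        filter_upwards [hK.isClosed.isOpen_compl.mem_nhds fun h => hys (hOχ (hKO h))] with z hz
        exact hθK z hz
    exact fun U t χ hχ y hy => hsm.contDiffAt hχ hy trivial
  · by_cases hys : y ∈ χ.source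
    · rw [hθ, Set.indicator_of_mem hys]
      exact ⟨b.nonneg, b.le_one⟩
    · rw [hθ, Set.indicator_of_notMem hys]
      simp
  · rintro y ⟨hy, hyb⟩
    obtain ⟨z, hz, hzy⟩ := hbV (Metric.ball_subset_closedBall (Metric.ball_subset_ball (by linarith) hyb))
    rwa [← χ.injOn (hOχ hz) hy hzy]
  · rintro y ⟨hy, hyb⟩
    rw [hθ, Set.indicator_of_mem hy]
    exact b.one_of_mem_closedBall (Metric.ball_subset_closedBall hyb)

/-- A smooth function with compact support in a chart is bounded and Lipschitz there. -/
theorem exists_lipschitz_indicator_chart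
    {g : RatPoint p → ℝ} {K : Set (RatPoint p)} (hK : IsCompact K) (hKχ : K ⊆ χ.source)
    (hg : ∀ x, x ∉ K → g x = 0) (hc : ∀ x ∈ χ.source, ContDiffAt ℝ ∞ (g ∘ χ.symm) (χ x)) :
    ∃ B, ∀ t t', |χ.target.indicator (g ∘ χ.symm) t| ≤ B ∧
      |χ.target.indicator (g ∘ χ.symm) t - χ.target.indicator (g ∘ χ.symm) t'| ≤ B * ‖t - t'‖ := by
  set H := χ.target.indicator (g ∘ χ.symm)
  have hs : HasCompactSupport H := hasCompactSupport_indicator_chart hK hKχ hg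
  have hH : ContDiff ℝ 1 H := contDiff_iff_contDiffAt.2 fun e => by
    rcases eventually_indicator_chart hK hKχ hg e with ⟨he, h⟩ | h
    · refine ContDiffAt.congr_of_eventuallyEq ?_ h
      have := (hc _ (χ.map_target he)).of_le (m := 1) (by exact_mod_cast le_top)
      rwa [χ.right_inv he] at this
    · exact contDiffAt_const.congr_of_eventuallyEq h
  obtain ⟨B₁, hB₁⟩ := hs.exists_bound_of_continuous hH.continuous
  obtain ⟨B₂, hB₂⟩ := hH.lipschitzWith_of_hasCompactSupport hs one_ne_zero
  refine ⟨max B₁ B₂, fun t t' => ⟨(hB₁ t).trans (le_max_left _ _), ?_⟩⟩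
  have := hB₂.dist_le_mul t t'
  rw [dist_eq, dist_eq_norm] at this
  exact this.trans (mul_le_mul_of_nonneg_right (le_max_right _ _) (norm_nonneg _))

/-- An equality of integrals of nonnegative functions, from the one of lower integrals. -/
theorem integrable_and_integral_eq {α β : Type*} [MeasurableSpace α] [MeasurableSpace β]
    {ν : Measure α} {m : Measure β} {f : α → ℝ} {g : β → ℝ} (hf : Measurable f) (hf0 : 0 ≤ f)
    (hg : Integrable g m) (hg0 : 0 ≤ g) (h : ∫⁻ x, .ofReal (f x) ∂ν = ∫⁻ t, .ofReal (g t) ∂m) :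
    Integrable f ν ∧ ∫ x, f x ∂ν = ∫ t, g t ∂m := by
  refine ⟨⟨hf.aestronglyMeasurable, ?_⟩, ?_⟩
  · rw [hasFiniteIntegral_iff_ofReal (.of_forall hf0), h,
      ← hasFiniteIntegral_iff_ofReal (.of_forall hg0)]
    exact hg.2
  · rw [integral_eq_lintegral_of_nonneg_ae (.of_forall hf0) hf.aestronglyMeasurable, h,
      integral_eq_lintegral_of_nonneg_ae (.of_forall hg0) hg.1]

end Smooth

/-! ### The local expansions on the variety -/

section LocalExpansion

variable {D L : EffDivisor X} {M : CanonicalMetric p n D} {ML : DivisorMetric p L}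
  {Mc : ComponentMetrics p}

namespace AdaptedChart

variable (C : AdaptedChart p n L)

theorem prod_eq {E : EffDivisor X} (hEL : E.support ⊆ L.support) {y : RatPoint p}
    (hy : y ∈ C.χ.source) (s : ℝ) :
    ∏ P ∈ E.support, modulus (y.val (C.u P)) ^ (s * E P) =
      ∏ P ∈ C.S, blockNorm (C.e P) (C.χ y) ^ (s * E P) := by
  have h1 : ∏ P ∈ L.support, blockNorm (C.e P) (C.χ y) ^ (s * E P) =
      ∏ P ∈ C.S, blockNorm (C.e P) (C.χ y) ^ (s * E P) :=
    (prod_subset C.subset fun P hP hPS => by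
      rw [(C.eq_one P hP hPS).2, blockNorm_empty, one_rpow]).symm
  rw [← h1, ← prod_subset hEL fun P _ hP => by
    rw [Finsupp.notMem_support_iff.1 hP]
    simp]
  exact prod_congr rfl fun P hP => by rw [C.modulus_val (hEL hP) hy]

theorem isAdapted {A : Finset (PrimeDivisor X)} (hA : A ⊆ C.S) : IsAdapted p A C.U C.t C.e C.u :=
  ⟨C.etale, C.disj.subset (by exact_mod_cast hA), fun P hP =>
    ⟨C.normForm P (hA hP), C.localEq P (C.subset (hA hP))⟩⟩

/-- The integrand of the volume integrals in an adapted chart. -/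
theorem density_eq (N : LocalNorms M ML Mc C.U C.t C.u) (hDL : D.support ⊆ L.support) (σ : ℝ)
    {y : RatPoint p} (hy : y ∈ C.χ.source) (hpos : ∀ P ∈ C.S, 0 < blockNorm (C.e P) (C.χ y)) :
    ML.norm y ^ σ * (1 / M.norm C.U C.t y) = N.hL y ^ σ / N.hM y *
        ∏ P ∈ C.S, blockNorm (C.e P) (C.χ y) ^ (-((D P : ℝ) - σ * L P)) ∧
      log (ML.norm y) =
        log (N.hL y) + ∑ P ∈ C.S, (L P : ℝ) * log (blockNorm (C.e P) (C.χ y)) := by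
  have hyU := C.mem_U hy
  have hL := C.prod_eq le_rfl hy 1
  have hD := C.prod_eq hDL hy 1
  simp only [one_mul] at hL hD
  have hLpos : 0 < ∏ P ∈ C.S, blockNorm (C.e P) (C.χ y) ^ (L P : ℝ) :=
    prod_pos fun P hP => rpow_pos_of_pos (hpos P hP) _
  rw [N.norm_M y hyU, N.norm_ML y hyU, hL, hD]
  constructor
  · rw [mul_rpow hLpos.le (N.hL_pos y hyU).le, ← finsetProd_rpow _ _ fun P hP =>
      rpow_nonneg (hpos P hP).le _]
    have h1 : ∏ P ∈ C.S, blockNorm (C.e P) (C.χ y) ^ (-((D P : ℝ) - σ * L P)) =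
        (∏ P ∈ C.S, (blockNorm (C.e P) (C.χ y) ^ (L P : ℝ)) ^ σ) /
          ∏ P ∈ C.S, blockNorm (C.e P) (C.χ y) ^ (D P : ℝ) := by
      rw [← prod_div_distrib]
      refine prod_congr rfl fun P hP => ?_
      rw [← rpow_mul (hpos P hP).le, ← rpow_sub (hpos P hP)]
      congr 1
      ring
    rw [h1]
    have := (prod_pos fun P hP => rpow_pos_of_pos (hpos P hP) (D P : ℝ)).ne'
    have := (N.hM_pos y hyU).ne'
    field_simp
  · rw [log_mul hLpos.ne' (N.hL_pos y hyU).ne', log_prod fun P hP =>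
      (rpow_pos_of_pos (hpos P hP) _).ne', add_comm]
    congr 1
    exact sum_congr rfl fun P hP => log_rpow (hpos P hP) _

open Classical in
/-- The integrand of the integrals over the faces in an adapted chart. -/
theorem faceIntegrand_eq (μ : Measure F) [μ.IsAddHaarMeasure] (hX : IsSNCPair p n D L) (N : LocalNorms M ML Mc C.U C.t C.u)
    {σ : ℝ} {Q : Finset (PrimeDivisor X)} (hQD : Q ⊆ D.support)
    (hQ : ∀ α ∈ Q, (D α : ℝ) = L α * σ + 1) {y : RatPoint p} (hy : y ∈ C.χ.source) :
    faceIntegrand D ML Mc Q σ y * residueDensity M Mc μ Q C.t C.e C.u y =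
      (∏ α ∈ Q, unitBallConst μ (C.e α)) * (N.hL y ^ σ / N.hM y *
        ∏ P ∈ C.S \ Q, blockNorm (C.e P) (C.χ y) ^ (-((D P : ℝ) - σ * L P))) ∧
      0 ≤ faceIntegrand D ML Mc Q σ y := by
  have hyU := C.mem_U hy
  have hd := dense_compl_ratSupport hX
  have hq := fun α (hα : α ∈ D.support) => N.q_pos α (hX.2 hα) y hyU
  set v := fun P => blockNorm (C.e P) (C.χ y) with hvdef
  have hv : ∀ P, 0 ≤ v P := fun P => blockNorm_nonneg (C.e P) (C.χ y)
  set w := fun P => v P ^ (-((D P : ℝ) - σ * L P)) with hw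
  have hmod : ∀ P ∈ L.support, modulus (y.val (C.u P)) = v P := fun P hP => C.modulus_val hP hy
  have hR : residualNorm D ML Mc y ^ σ =
      (∏ P ∈ L.support \ D.support, w P) * N.hL y ^ σ / ∏ P ∈ D.support, N.q P y ^ (σ * L P) := by
    rw [N.residualNorm_eq C.localEq hX.2 hd hyU, div_rpow (mul_nonneg (prod_nonneg
      fun P _ => rpow_nonneg (modulus_nonneg _) _) (N.hL_pos y hyU).le) (prod_nonneg
      fun P hP => rpow_nonneg (hq P hP).le _), mul_rpow (prod_nonneg fun P _ =>
      rpow_nonneg (modulus_nonneg _) _) (N.hL_pos y hyU).le, ← finsetProd_rpow _ _ fun P _ =>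
      rpow_nonneg (modulus_nonneg _) _, ← finsetProd_rpow _ _ fun P hP =>
      rpow_nonneg (hq P hP).le _]
    refine congrArg₂ (· / ·) (congrArg (· * _) (prod_congr rfl fun P hP => ?_))
      (prod_congr rfl fun P hP => by rw [← rpow_mul (hq P hP).le, mul_comm])
    obtain ⟨hPL, hPD⟩ := Finset.mem_sdiff.1 hP
    simp only [hw]
    rw [hmod P hPL, ← rpow_mul (hv P), Finsupp.notMem_support_iff.1 hPD]
    congr 1
    push_cast
    ring
  have hMc : ∏ α ∈ D.support \ Q, (Mc α).norm y ^ (σ * (L α : ℝ) - (D α : ℝ)) =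
      (∏ α ∈ D.support \ Q, w α) * ∏ α ∈ D.support \ Q, N.q α y ^ (σ * (L α : ℝ) - (D α : ℝ)) := by
    rw [← prod_mul_distrib]
    refine prod_congr rfl fun α hα => ?_
    have hαD := (Finset.mem_sdiff.1 hα).1
    simp only [hw, neg_sub]
    rw [N.norm_Mc α (hX.2 hαD) y hyU, hmod α (hX.2 hαD), mul_rpow (hv α) (hq α hαD).le]
  have hww : (∏ P ∈ L.support \ D.support, w P) * ∏ α ∈ D.support \ Q, w α = ∏ P ∈ C.S \ Q, w P := by
    have h1 : L.support \ Q = (L.support \ D.support) ∪ (D.support \ Q) := by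
      rw [sdiff_union_sdiff_cancel hX.2 hQD]
    rw [← prod_union (disjoint_left.2 fun P hP hP' =>
      (Finset.mem_sdiff.1 hP).2 (Finset.mem_sdiff.1 hP').1), ← h1]
    refine (prod_subset (sdiff_subset_sdiff C.subset le_rfl) fun P hP hPS => ?_).symm
    obtain ⟨hPL, hPQ⟩ := Finset.mem_sdiff.1 hP
    have hPS' : P ∉ C.S := fun h => hPS (Finset.mem_sdiff.2 ⟨h, hPQ⟩)
    simp only [hw, hvdef]
    rw [(C.eq_one P hPL hPS').2, blockNorm_empty, one_rpow]
  have hqq : (∏ α ∈ D.support \ Q, N.q α y ^ (σ * (L α : ℝ) - (D α : ℝ))) *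
      ∏ P ∈ D.support, N.q P y ^ (D P : ℝ) =
      (∏ P ∈ D.support, N.q P y ^ (σ * (L P : ℝ))) * ∏ α ∈ Q, N.q α y := by
    have e1 : (∏ α ∈ D.support \ Q, N.q α y ^ (σ * (L α : ℝ) - (D α : ℝ))) *
        ∏ α ∈ D.support \ Q, N.q α y ^ (D α : ℝ) = ∏ α ∈ D.support \ Q, N.q α y ^ (σ * (L α : ℝ)) := by
      rw [← prod_mul_distrib]
      exact prod_congr rfl fun α hα => by
        rw [← rpow_add (hq α (Finset.mem_sdiff.1 hα).1), sub_add_cancel]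
    have e2 : ∏ α ∈ Q, N.q α y ^ (D α : ℝ) =
        (∏ α ∈ Q, N.q α y ^ (σ * (L α : ℝ))) * ∏ α ∈ Q, N.q α y := by
      rw [← prod_mul_distrib]
      exact prod_congr rfl fun α hα => by
        rw [hQ α hα, rpow_add_one (hq α (hQD hα)).ne', mul_comm (L α : ℝ)]
    rw [← prod_sdiff hQD, ← prod_sdiff hQD, ← mul_assoc, e1, e2, mul_assoc]
  have hpos : ∀ s : PrimeDivisor X → ℝ, 0 < ∏ P ∈ D.support, N.q P y ^ s P := fun s =>
    prod_pos fun P hP => rpow_pos_of_pos (hq P hP) _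
  have hqQ : 0 < ∏ α ∈ Q, N.q α y := prod_pos fun α hα => hq α (hQD hα)
  have hlim : ∏ α ∈ Q, limUnder (𝓝[(ratSupport p D)ᶜ] y)
      (fun z => (Mc α).norm z / modulus (z.val (C.u α))) = ∏ α ∈ Q, N.q α y :=
    prod_congr rfl fun α hα => N.limUnder_Mc_eq C.localEq hX.2 hd hyU (hQD hα)
  have hw0 : ∀ P, 0 ≤ w P := fun P => rpow_nonneg (hv P) _
  rw [faceIntegrand, hR, hMc]
  constructor
  · rw [residueDensity, hlim, N.canonicalNorm_eq C.localEq hX.2 hd hyU, ← hww]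
    have h1 := (hpos fun P => D P).ne'
    have h2 := (hpos fun P => σ * L P).ne'
    have h3 := (N.hM_pos y hyU).ne'
    field_simp
    linear_combination (∏ α ∈ Q, unitBallConst μ (C.e α)) * N.hL y ^ σ *
      (∏ P ∈ L.support \ D.support, w P) * (∏ α ∈ D.support \ Q, w α) * hqq
  · exact mul_nonneg (div_nonneg (mul_nonneg (prod_nonneg fun P _ => hw0 P)
      (rpow_nonneg (N.hL_pos y hyU).le _)) (hpos _).le) (mul_nonneg (prod_nonneg
      fun P _ => hw0 P) (prod_nonneg fun α hα =>
      rpow_nonneg (hq α (Finset.mem_sdiff.1 hα).1).le _))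

end AdaptedChart

end LocalExpansion

section LocalExpansion

variable {D L : EffDivisor X}

/-- The integrand whose integral with respect to `τ_{(X,D)}` is `exp (-σ * T) * V(exp T)` for `k = 0`,
and a `k`-fold primitive of this function of `T` in general. -/
abbrev DivisorMetric.weight (ML : DivisorMetric p L) (σ : ℝ) (k : ℕ) (T : ℝ) (y : RatPoint p) : ℝ :=
  ML.norm y ^ σ * kernel σ k (T + log (ML.norm y))

theorem ChartSmooth.continuous (hX : IsSmoothSNC p n L) {φ : RatPoint p → ℝ} (hφ : ChartSmooth n φ)
    : Continuous φ := by
  refine continuous_iff_continuousAt.2 fun y => ?_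
  obtain ⟨C, hy, -⟩ := exists_adaptedChart hX y
  refine ((hφ _ _ _ C.chart y hy).continuousAt.comp (C.χ.continuousAt hy)).congr ?_
  filter_upwards [C.χ.open_source.mem_nhds hy] with z hz
  rw [Function.comp_apply, Function.comp_apply, C.χ.left_inv hz]

open Classical in
theorem measurable_faceIntegrand (ML : DivisorMetric p L) (Mc : ComponentMetrics p)
    (M : CanonicalMetric p n D) (hX : IsSNCPair p n D L) (A : Finset (PrimeDivisor X)) (σ : ℝ) :
    Measurable (faceIntegrand D ML Mc A σ) := by
  have hd := dense_compl_ratSupport hX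
  have h1 : Continuous (residualNorm D ML Mc) := by
    refine continuous_iff_continuousAt.2 fun y => ?_
    obtain ⟨C, hy, -⟩ := exists_adaptedChart hX.1 y
    obtain ⟨N⟩ := exists_localNorms hX.2 M ML Mc C.etale C.localEq
    have hyU := C.mem_U hy
    refine ContinuousAt.congr (f := fun x => (∏ P ∈ L.support \ D.support,
      modulus (x.val (C.u P)) ^ (L P : ℝ)) * N.hL x / ∏ P ∈ D.support, N.q P x ^ (L P : ℝ)) ?_ ?_
    · refine ((tendsto_finsetProd _ fun P hP => ?_).mul (N.smooth_hL.continuousAt hyU)).div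
        (tendsto_finsetProd _ fun P hP =>
        ((N.smooth_q P (hX.2 hP)).continuousAt hyU).rpow_const (Or.inr (by positivity))) ?_
      · exact (continuous_modulus.continuousAt.comp (continuousAt_val (C.u P) hyU)).rpow_const
          (Or.inr (by positivity))
      · exact (prod_pos fun P hP => rpow_pos_of_pos (N.q_pos P (hX.2 hP) y hyU) _).ne'
    · filter_upwards [(isOpen_setOf_pt_mem C.U).mem_nhds hyU] with z hz
      rw [N.residualNorm_eq C.localEq hX.2 hd hz]
  exact (h1.measurable.pow_const _).mul (Finset.measurable_fun_prod _ fun α hα =>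
    (continuous_norm_single (Mc α) hX.1 (hX.2 (Finset.mem_sdiff.1 hα).1)).measurable.pow_const _)

open Classical in
/-- The expansion of the local contributions: near each point `x`, the critical components which pass
through `x` form a set `Q`, and the integrals against functions with support near `x` have
polynomial main terms, whose leading coefficients are integrals over `D_Q(F)`. -/
theorem exists_local_expansion [SecondCountableTopology (RatPoint p)] [CompactSpace (RatPoint p)]
    [T2Space (RatPoint p)] (μ : Measure F) [μ.IsAddHaarMeasure] (M : CanonicalMetric p n D)
    (ML : DivisorMetric p L) (Mc : ComponentMetrics p) (hX : IsSNCPair p n D L) {σ : ℝ}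
    (hσ0 : 0 ≤ σ) (hσ : ∀ α ∈ D.support, (stratum p {α}).Nonempty → ((D α : ℝ) - 1) / L α ≤ σ)
    (x : RatPoint p) :
    ∃ (Ω : Set (RatPoint p)) (Q : Finset (PrimeDivisor X)), IsOpen Ω ∧ x ∈ Ω ∧ Q ⊆ D.support ∧
      (∀ α ∈ Q, (D α : ℝ) = L α * σ + 1) ∧ x ∈ stratum p Q ∧
      (∀ A ⊆ D.support, (∀ α ∈ A, (D α : ℝ) = L α * σ + 1) → (stratum p A ∩ Ω).Nonempty → A ⊆ Q) ∧
      ∀ φ : RatPoint p → ℝ, ChartSmooth n φ → 0 ≤ φ →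
        (∃ K, IsCompact K ∧ K ⊆ Ω ∧ ∀ y, y ∉ K → φ y = 0) →
        (∀ k T, Integrable (fun y => φ y * ML.weight σ k T y)
          (tauPair μ M)) ∧
        (∃ δ₀ > 0, ∀ δ, 0 < δ → δ ≤ δ₀ → ∃ (R : Polynomial ℝ) (c : ℝ),
          R.natDegree ≤ Q.card + kernelShift σ ∧ R.coeff (Q.card + kernelShift σ) =
            kernelLead σ Q.card * (∏ P ∈ Q, 1 / (L P : ℝ)) *
              ∫ y, φ y * faceIntegrand D ML Mc Q σ y ∂(residueMeasure μ M Mc Q) ∧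
          ∀ T, |(∫ y, φ y * ML.weight σ 1 T y ∂(tauPair μ M)) -
            R.eval T| ≤ c * exp (-δ * T)) ∧
        Integrable (fun y => φ y * faceIntegrand D ML Mc Q σ y) (residueMeasure μ M Mc Q) ∧
        (0 < φ x → 0 < ∫ y, φ y * faceIntegrand D ML Mc Q σ y ∂(residueMeasure μ M Mc Q)) := by
  obtain ⟨C, hx, hCx⟩ := exists_adaptedChart hX.1 x
  obtain ⟨N⟩ := exists_localNorms hX.2 M ML Mc C.etale C.localEq
  have ha := C.isAdapted le_rfl
  obtain ⟨O, R, hO, hxO, hOχ, hOR⟩ := ha.exists_bounded_nhds C.chart hx hCx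
  obtain ⟨θ, K₀, hθ, hK₀, hK₀O, hθK₀, -, Ω, hΩ, hxΩ, hΩO, hθ1⟩ :=
    exists_chartSmooth_bump C.chart hO hxO hOχ
  have hΩχ : Ω ⊆ C.χ.source := hΩO.trans hOχ
  have hΩV := C.χ.isOpen_image_of_subset_source hΩ hΩχ
  have hSL : ∀ P ∈ C.S, (0 : ℝ) < L P := fun P hP => by
    exact_mod_cast pos_iff_ne_zero.2 (Finsupp.mem_support_iff.1 (C.subset hP))
  set a : PrimeDivisor X → ℝ := fun P => (D P : ℝ) - σ * L P with ha_def
  have ha_le : ∀ P ∈ C.S, a P ≤ 1 := by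
    intro P hP
    by_cases hPD : P ∈ D.support
    · have h1 := hσ P hPD ⟨x, fun β hβ => by
        rw [mem_singleton.1 hβ]
        exact hCx P hP⟩
      rw [div_le_iff₀ (hSL P hP)] at h1
      simp only [ha_def]
      linarith
    · simp only [ha_def, Finsupp.notMem_support_iff.1 hPD]
      have := mul_nonneg hσ0 (hSL P hP).le
      push_cast
      linarith
  set Q := C.S.filter fun P => a P = 1
  have hQS : Q ⊆ C.S := filter_subset _ _
  have hQ1 : ∀ α ∈ Q, (D α : ℝ) = L α * σ + 1 := fun α hα => by
    have := (mem_filter.1 hα).2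
    simp only [ha_def] at this
    linarith
  have hQD : Q ⊆ D.support := fun α hα => by
    rw [Finsupp.mem_support_iff]
    intro h0
    have := hQ1 α hα
    rw [h0] at this
    have := mul_nonneg (hSL α (hQS hα)).le hσ0
    push_cast at *
    linarith
  refine ⟨Ω, Q, hΩ, hxΩ, hQD, hQ1, fun α hα => hCx α (hQS hα), ?_, ?_⟩
  · rintro A hAD hA ⟨z, hzA, hz⟩ α hα
    refine mem_filter.2 ⟨((C.specializes_iff (hX.2 (hAD hα)) (hΩχ hz)).1 (hzA α hα)).1, ?_⟩
    simp only [ha_def, hA α hα]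
    ring
  rintro φ hφ hφ0 ⟨K, hK, hKΩ, hφK⟩
  have hKχ : K ⊆ C.χ.source := hKΩ.trans hΩχ
  have hφc : Continuous φ := hφ.continuous hX.1
  -- the functions `g` and `ell` of the local integral
  have hLs := fun y (hy : y ∈ C.χ.source) => N.smooth_hL.contDiffAt C.chart hy (C.mem_U hy)
  have hMs := fun y (hy : y ∈ C.χ.source) => N.smooth_hM.contDiffAt C.chart hy (C.mem_U hy)
  have hLp : ∀ y ∈ C.χ.source, 0 < N.hL y := fun y hy => N.hL_pos y (C.mem_U hy)
  have hMp : ∀ y ∈ C.χ.source, 0 < N.hM y := fun y hy => N.hM_pos y (C.mem_U hy)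
  set g₀ : RatPoint p → ℝ := fun y => φ y * (N.hL y ^ σ / N.hM y) with hg₀
  set l₀ : RatPoint p → ℝ := fun y => θ y * log (N.hL y) with hl₀
  have hg₀K : ∀ y, y ∉ K → g₀ y = 0 := fun y hy => by rw [hg₀]; simp only [hφK y hy, zero_mul]
  obtain ⟨B₁, hB₁⟩ := exists_lipschitz_indicator_chart hK hKχ hg₀K fun y hy => by
      have hy' : C.χ.symm (C.χ y) = y := C.χ.left_inv hy
      have h1 : (N.hL ∘ C.χ.symm) (C.χ y) ≠ 0 := by
        rw [Function.comp_apply, hy']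
        exact (hLp y hy).ne'
      exact (hφ _ _ _ C.chart y hy).mul (((hLs y hy).rpow_const_of_ne h1).div (hMs y hy)
        (by simp only [hy']; exact (hMp y hy).ne'))
  obtain ⟨B₂, hB₂⟩ := exists_lipschitz_indicator_chart (g := l₀) hK₀ (hK₀O.trans hOχ)
    (fun y hy => by rw [hl₀]; simp only [hθK₀ y hy, zero_mul]) fun y hy => by
      have hy' : C.χ.symm (C.χ y) = y := C.χ.left_inv hy
      exact (hθ _ _ _ C.chart y hy).mul ((hLs y hy).log
        (by simp only [Function.comp_apply, hy']; exact (hLp y hy).ne'))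
  set m := (power (Fin n) μ).restrict (blockRegion F C.S C.e R) with hm
  have hBm := measurableSet_blockRegion (F := F) C.S C.e R
  have hOB : ∀ y ∈ O, C.χ y ∈ blockRegion F C.S C.e R := fun y hy => (hOR y hy).2
  have hne : ∀ P ∈ C.S, (C.e P).Nonempty := fun P hP => (C.normForm P hP).nonempty
  let d : LocalDatum F n (PrimeDivisor X) :=
    { m := m
      fin := ⟨by
        rw [hm, Measure.restrict_apply_univ]
        exact measure_blockRegion_lt_top μ _ _ R⟩
      S := C.S
      e := C.e
      disj := C.disj
      nonempty := hne
      splits := fun P hP => splitsBlock_blockRegion μ C.disj hP (hne P hP)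
      lam := fun P => L P
      lam_pos := hSL
      a := a
      a_le := ha_le
      g := C.χ.target.indicator (g₀ ∘ C.χ.symm)
      ell := C.χ.target.indicator (l₀ ∘ C.χ.symm)
      K := max B₁ B₂
      g_le := fun t => (hB₁ t t).1.trans (le_max_left _ _)
      ell_le := fun t => (hB₂ t t).1.trans (le_max_right _ _)
      g_lip := fun t t' => (hB₁ t t').2.trans
        (mul_le_mul_of_nonneg_right (le_max_left _ _) (norm_nonneg _))
      ell_lip := fun t t' => (hB₂ t t').2.trans
        (mul_le_mul_of_nonneg_right (le_max_right _ _) (norm_nonneg _)) }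
  have hgχ : ∀ y ∈ C.χ.source, d.g (C.χ y) = g₀ y := fun y hy => indicator_chart_apply hy
  have hlχ : ∀ y ∈ Ω, d.ell (C.χ y) = log (N.hL y) := fun y hy =>
    (indicator_chart_apply (hΩχ hy)).trans (by rw [hl₀]; simp only [hθ1 y hy, one_mul])
  have hg0 : ∀ z, 0 ≤ d.g z := indicator_chart_nonneg fun y hy =>
    mul_nonneg (hφ0 _) (div_nonneg (rpow_nonneg (hLp _ hy).le _) (hMp _ hy).le)
  have hgV : ∀ z, z ∉ C.χ '' Ω → d.g z = 0 := fun z hz =>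
    indicator_chart_eq_zero hg₀K fun h => hz (Set.image_mono hKΩ h)
  have hwt0 : ∀ S' t, 0 ≤ d.wt S' t := fun S' t =>
    prod_nonneg fun P _ => rpow_nonneg (blockNorm_nonneg _ _) _
  have hMLc : Measurable ML.norm := (ML.continuous_norm ⟨hX.1, le_rfl⟩).measurable
  have hML0 := ML.norm_nonneg ⟨hX.1, le_rfl⟩
  -- the integrals with respect to `τ` in the chart
  have hτ : ∀ k T, Integrable (fun y => φ y * ML.weight σ k T y)
      (tauPair μ M) ∧ ∫ y, φ y * ML.weight σ k T y ∂(tauPair μ M) =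
      ∫ t, d.g t * (d.wt d.S t * kernel σ k (T + d.ell t + d.ht d.S t)) ∂m := by
    intro k T
    have hfm : Measurable fun y => φ y * ML.weight σ k T y :=
      hφc.measurable.mul ((hMLc.pow_const _).mul ((measurable_kernel σ k).comp
        ((measurable_log.comp hMLc).const_add T)))
    have hf0 : ∀ y, 0 ≤ φ y * ML.weight σ k T y := fun y =>
      mul_nonneg (hφ0 y) (mul_nonneg (rpow_nonneg (hML0 y) _) (kernel_nonneg _ _ _))
    refine integrable_and_integral_eq hfm hf0 (d.integrable_kernel hσ0 k le_rfl T
      (LocalDatum.continuous_of_lip d.g_lip).measurable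
      (LocalDatum.continuous_of_lip d.ell_lip).measurable d.g_le d.ell_le)
      (fun t => mul_nonneg (hg0 t) (mul_nonneg (hwt0 _ _) (kernel_nonneg _ _ _))) ?_
    rw [lintegral_eq_setLIntegral hΩ.measurableSet fun y hy => by
        rw [hφK y fun h => hy (hKΩ h), zero_mul, ENNReal.ofReal_zero],
      setLIntegral_tauPair M μ hX C.etale C.chart hΩ hΩχ hfm.ennreal_ofReal, hm,
      ← lintegral_eq_setLIntegral hBm, lintegral_eq_setLIntegral hΩV.measurableSet
        (f := fun t => ENNReal.ofReal (d.g t * (d.wt d.S t * kernel σ k (T + d.ell t + d.ht d.S t))))]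
    · refine lintegral_congr_ae ?_
      rw [EventuallyEq, ae_restrict_iff' hΩV.measurableSet]
      filter_upwards [C.ae_blockNorm_pos μ] with z hz
      rintro ⟨y, hy, rfl⟩
      obtain ⟨h1, h2⟩ := C.density_eq N hX.2 σ (hΩχ hy) hz
      rw [C.χ.left_inv (hΩχ hy), ← ENNReal.ofReal_mul (hf0 y), hgχ y (hΩχ hy), hlχ y hy, DivisorMetric.weight, h2,
        add_assoc]
      congr 1
      change _ = g₀ y * ((∏ P ∈ C.S, blockNorm (C.e P) (C.χ y) ^ (-a P)) * kernel σ k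
        (T + (log (N.hL y) + ∑ P ∈ C.S, (L P : ℝ) * log (blockNorm (C.e P) (C.χ y)))))
      simp only [hg₀]
      linear_combination φ y * kernel σ k (T + (log (N.hL y) +
        ∑ P ∈ C.S, (L P : ℝ) * log (blockNorm (C.e P) (C.χ y)))) * h1
    · intro z hz
      rw [hgV z hz, zero_mul, ENNReal.ofReal_zero]
    · intro z hz
      rw [hgV z, zero_mul, ENNReal.ofReal_zero]
      rintro ⟨y, hy, rfl⟩
      exact hz (hOB y (hΩO hy))
  -- the integrals with respect to the residue measure in the chart
  have hface : ∀ y ∈ Ω, _ := fun y hy =>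
    C.faceIntegrand_eq μ hX N hQD hQ1 (hΩχ hy)
  have hres : Integrable (fun y => φ y * faceIntegrand D ML Mc Q σ y) (residueMeasure μ M Mc Q) ∧
      ∫ y, φ y * faceIntegrand D ML Mc Q σ y ∂(residueMeasure μ M Mc Q) = d.residue := by
    have hfm : Measurable fun y => φ y * faceIntegrand D ML Mc Q σ y :=
      hφc.measurable.mul (measurable_faceIntegrand ML Mc M hX Q σ)
    have hf0 : ∀ y, 0 ≤ φ y * faceIntegrand D ML Mc Q σ y := fun y => by
      by_cases hy : y ∈ Ω
      · exact mul_nonneg (hφ0 y) (hface y hy).2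
      · rw [hφK y fun h => hy (hKΩ h), zero_mul]
    refine integrable_and_integral_eq hfm hf0 d.integrable_residue
      (fun t => mul_nonneg (hg0 _) (hwt0 _ _)) ?_
    have hGm : Measurable fun z => ENNReal.ofReal (d.g z * d.wt (C.S \ Q) z) :=
      ((LocalDatum.continuous_of_lip d.g_lip).measurable.mul (d.measurable_wt _)).ennreal_ofReal
    have hproj : ∀ t, ENNReal.ofReal (d.g (d.proj d.crit t) * d.wt (d.S \ d.crit) t) =
        (fun z => ENNReal.ofReal (d.g z * d.wt (C.S \ Q) z)) (zeroOn (Q.biUnion C.e) t) := by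
      intro t
      simp only
      congr 2
      refine prod_congr rfl fun P hP => ?_
      obtain ⟨hPS, hPQ⟩ := Finset.mem_sdiff.1 hP
      rw [blockNorm_zeroOn]
      refine (disjoint_biUnion_right _ _ _).2 fun P' hP' => ?_
      exact C.disj hPS (hQS hP') fun h => hPQ (h ▸ hP')
    have haQ := C.isAdapted hQS
    rw [lintegral_congr hproj, show d.m = m from rfl, hm, setLIntegral_zeroOn μ Q haQ.2.1 (fun P hP => hne P (hQS hP)) hBm
      (V := C.χ '' Ω) (R := R) ?_ ?_ hΩV.measurableSet hGm
      (fun z hz => by rw [hgV z hz, zero_mul, ENNReal.ofReal_zero]),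
      lintegral_eq_setLIntegral hΩ.measurableSet fun y hy => by
        rw [hφK y fun h => hy (hKΩ h), zero_mul, ENNReal.ofReal_zero],
      setLIntegral_residueMeasure M Mc μ ML hX hQD haQ C.chart hΩ hΩχ hfm.ennreal_ofReal]
    · refine setLIntegral_congr_fun (hΩV.preimage (continuous_extendZero _)).measurableSet ?_
      rintro z ⟨y, hy, hyz⟩
      simp only
      rw [← hyz, C.χ.left_inv (hΩχ hy), ← ENNReal.ofReal_mul (hf0 y), ← ENNReal.ofReal_mul
        (prod_nonneg fun α _ => (unitBallConst_pos μ _).le), hgχ y (hΩχ hy), mul_assoc,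
        (hface y hy).1]
      congr 1
      simp only [hg₀, LocalDatum.wt]
      ring
    · rintro t ⟨y, hy, hyt⟩
      refine ⟨fun h P hP => h.1 P (hQS hP), fun h => ?_⟩
      have hyB := hOB y (hΩO hy)
      rw [hyt] at hyB
      refine ⟨fun P hP => ?_, fun i hi => ?_⟩
      · by_cases hPQ : P ∈ Q
        · exact h P hPQ
        · rw [← blockNorm_zeroOn (s' := Q.biUnion C.e)]
          · exact hyB.1 P hP
          · exact (disjoint_biUnion_right _ _ _).2 fun P' hP' =>
              C.disj hP (hQS hP') fun h => hPQ (h ▸ hP')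
      · have := hyB.2 i hi
        rwa [zeroOn, if_neg] at this
        intro h'
        obtain ⟨P, hP, hiP⟩ := mem_biUnion.1 h'
        exact hi P (hQS hP) hiP
    · rintro _ ⟨y, hy, rfl⟩ i -
      exact (norm_le_pi_norm _ i).trans (hOR y (hΩO hy)).1
  refine ⟨fun k T => (hτ k T).1, ?_, hres.1, fun hφx => ?_⟩
  · obtain ⟨δ₀, hδ₀, hexp⟩ := d.exists_expansion hσ0
    refine ⟨δ₀, hδ₀, fun δ h1 h2 => ?_⟩
    obtain ⟨P, c, hP1, hP2, hP3⟩ := hexp δ h1 h2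
    refine ⟨P, c, hP1, ?_, fun T => ?_⟩
    · rw [hres.2]
      exact hP2
    · rw [(hτ 1 T).2]
      exact hP3 T
  · rw [hres.2, LocalDatum.residue, integral_pos_iff_support_of_nonneg
      (fun t => mul_nonneg (hg0 _) (hwt0 _ _)) d.integrable_residue, pos_iff_ne_zero]
    intro h0
    have hQx : d.proj d.crit (C.χ x) = C.χ x := by
      rw [← C.coord_eq]
      exact zeroOn_eq_self.2 (((C.isAdapted hQS).mem_stratum_iff (C.mem_U hx)).1
        fun α hα => hCx α (hQS hα))
    have hV : IsOpen ({t | 0 < d.g (d.proj d.crit t)} ∩ C.χ '' Ω) :=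
      (isOpen_lt continuous_const ((LocalDatum.continuous_of_lip d.g_lip).comp
        (continuous_zeroOn _))).inter hΩV
    refine (hV.measure_pos (power (Fin n) μ) ⟨C.χ x, ?_, x, hxΩ, rfl⟩).ne' ?_
    · rw [Set.mem_ofPred_eq, hQx, hgχ x hx]
      exact mul_pos hφx (div_pos (rpow_pos_of_pos (hLp x hx) _) (hMp x hx))
    · have h1 := measure_eq_zero_iff_ae_notMem.1 h0
      rw [show d.m = m from rfl, hm, ae_restrict_iff' hBm] at h1
      refine measure_eq_zero_iff_ae_notMem.2 ?_
      filter_upwards [h1, C.ae_blockNorm_pos μ] with t ht htp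
      rintro ⟨htg, y, hy, rfl⟩
      exact ht (hOB y (hΩO hy)) (mul_pos htg (prod_pos fun P hP =>
        rpow_pos_of_pos (htp P (Finset.mem_sdiff.1 hP).1) _)).ne'

end LocalExpansion

/-! ### The volume asymptotics -/

section Global

variable {D L : EffDivisor X}

theorem ae_norm_pos [SecondCountableTopology (RatPoint p)] (μ : Measure F) [μ.IsAddHaarMeasure]
    (M : CanonicalMetric p n D) (ML : DivisorMetric p L) (hX : IsSNCPair p n D L)
    : ∀ᵐ y ∂(tauPair μ M), y ∉ ratSupport p D ∧ 0 < ML.norm y := by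
  have hcl := isClosed_ratSupport (D := L) ⟨hX.1, le_rfl⟩
  have h0 : tauPair μ M (ratSupport p L) = 0 := by
    refine measure_null_of_locally_null _ fun x _ => ?_
    obtain ⟨C, hx, -⟩ := exists_adaptedChart hX.1 x
    refine ⟨_, inter_mem_nhdsWithin _ (C.χ.open_source.mem_nhds hx), ?_⟩
    have h1 := setLIntegral_tauPair M μ hX C.etale C.chart C.χ.open_source le_rfl
      (measurable_one.indicator hcl.measurableSet)
    rw [lintegral_indicator_one hcl.measurableSet, Measure.restrict_apply hcl.measurableSet] at h1
    rw [h1, ← lintegral_zero (μ := (power _ μ).restrict (C.χ '' C.χ.source))]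
    refine lintegral_congr_ae ?_
    rw [EventuallyEq, ae_restrict_iff'
      (C.χ.isOpen_image_of_subset_source C.χ.open_source le_rfl).measurableSet]
    filter_upwards [C.ae_blockNorm_pos μ] with e he
    rintro ⟨y, hy, rfl⟩
    rw [C.χ.left_inv hy, Set.indicator_of_notMem, zero_mul]
    rintro ⟨P, hP, hPy⟩
    have := (C.specializes_iff hP hy).1 hPy
    exact (he P this.1).ne' this.2
  filter_upwards [measure_eq_zero_iff_ae_notMem.1 h0] with y hy
  refine ⟨fun ⟨P, hP, h⟩ => hy ⟨P, hX.2 hP, h⟩, ?_⟩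
  obtain ⟨C, hyC, -⟩ := exists_adaptedChart hX.1 y
  obtain ⟨h, -, hh⟩ := ML.local_form C.U C.u C.localEq
  obtain ⟨h3, h4⟩ := hh y (C.mem_U hyC)
  rw [h4]
  exact mul_pos (prod_pos fun P hP => rpow_pos_of_pos
    (LocalNorms.modulus_pos C.localEq le_rfl (C.mem_U hyC) hy hP) _) h3

/-- A finite smooth partition of unity subordinate to neighbourhoods `Ω x` of the points `x`. -/
theorem exists_partition [CompactSpace (RatPoint p)] [T2Space (RatPoint p)] (hX : IsSmoothSNC p n L)
    {Ω : RatPoint p → Set (RatPoint p)} (hΩ : ∀ x, IsOpen (Ω x)) (hx : ∀ x, x ∈ Ω x) :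
    ∃ (T : Finset (RatPoint p)) (φ : RatPoint p → RatPoint p → ℝ), (∀ y, ∑ x ∈ T, φ x y = 1) ∧
      ∀ x ∈ T, ChartSmooth n (φ x) ∧ 0 ≤ φ x ∧
        ∃ K, IsCompact K ∧ K ⊆ Ω x ∧ ∀ y, y ∉ K → φ x y = 0 := by
  have h1 : ∀ x, ∃ (θ : RatPoint p → ℝ) (K : Set (RatPoint p)), ChartSmooth n θ ∧ IsCompact K ∧
      K ⊆ Ω x ∧ (∀ y, y ∉ K → θ y = 0) ∧ (∀ y, 0 ≤ θ y) ∧ ∃ Ω', IsOpen Ω' ∧ x ∈ Ω' ∧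
        ∀ y ∈ Ω', θ y = 1 := by
    intro x
    obtain ⟨C, hxC, -⟩ := exists_adaptedChart hX x
    obtain ⟨θ, K, h1, h2, h3, h4, h5, Ω', h6, h7, -, h8⟩ := exists_chartSmooth_bump C.chart
      ((hΩ x).inter C.χ.open_source) ⟨hx x, hxC⟩ Set.inter_subset_right
    exact ⟨θ, K, h1, h2, h3.trans Set.inter_subset_left, h4, fun y => (h5 y).1, Ω', h6, h7, h8⟩
  choose θ K hθ hK hKΩ hθK hθ0 Ω' hΩ' hxΩ' hθ1 using h1
  obtain ⟨T, hT⟩ := isCompact_univ.elim_finite_subcover Ω' hΩ' fun x _ => Set.mem_iUnion.2 ⟨x, hxΩ' x⟩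
  have hpos : ∀ y, 0 < ∑ x ∈ T, θ x y := fun y => by
    obtain ⟨x, hxT, hy⟩ := Set.mem_iUnion₂.1 (hT (Set.mem_univ y))
    exact sum_pos' (fun x _ => hθ0 x y) ⟨x, hxT, by rw [hθ1 x y hy]; exact one_pos⟩
  refine ⟨T, fun x y => θ x y / ∑ x' ∈ T, θ x' y, fun y => ?_, fun x _ => ⟨?_, fun y =>
    div_nonneg (hθ0 x y) (hpos y).le, K x, hK x, hKΩ x, fun y hy => by
      simp only [hθK x y hy, zero_div]⟩⟩
  · rw [← sum_div, div_self (hpos y).ne']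
  · exact fun U t χ hχ y hy => (hθ x U t χ hχ y hy).div
      (ContDiffAt.sum fun x' _ => hθ x' U t χ hχ y hy) (hpos _).ne'

theorem degree_derivative_and_leadingCoeff {R : Polynomial ℝ} {N : ℕ} (hdeg : R.natDegree ≤ N + 1)
    (hc : R.coeff (N + 1) ≠ 0) : R.derivative.degree = N ∧
      R.derivative.leadingCoeff = (N + 1) * R.coeff (N + 1) := by
  have h1 : R.derivative.coeff N = (N + 1) * R.coeff (N + 1) := by
    rw [Polynomial.coeff_derivative, mul_comm]
  have h2 : R.derivative.coeff N ≠ 0 := by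
    rw [h1]
    exact mul_ne_zero (by positivity) hc
  have h3 : R.derivative.natDegree = N := le_antisymm
    ((Polynomial.natDegree_derivative_le R).trans (by omega)) (Polynomial.le_natDegree_of_ne_zero h2)
  refine ⟨?_, by rw [Polynomial.leadingCoeff, h3, h1]⟩
  rw [Polynomial.degree_eq_natDegree (fun h => h2 (by rw [h, Polynomial.coeff_zero])), h3]

/-- The volume of a ball as an integral of the kernel. -/
theorem volumeBall_eq [SecondCountableTopology (RatPoint p)] (μ : Measure F) [μ.IsAddHaarMeasure]
    (M : CanonicalMetric p n D) (ML : DivisorMetric p L) (hX : IsSNCPair p n D L) {σ B : ℝ}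
    (hB : 0 < B) (hint : Integrable (ML.weight σ 0 (log B)) (tauPair μ M)) :
    volumeBall μ M ML B < ⊤ ∧ (volumeBall μ M ML B).toReal = B ^ σ *
      ∫ y, ML.weight σ 0 (log B) y ∂(tauPair μ M) := by
  set s : Set (RatPoint p) := {x | x ∉ ratSupport p D ∧ 1 / B ≤ ML.norm x} with hs
  have hsm' : MeasurableSet s := (isClosed_ratSupport hX).measurableSet.compl.inter
    (measurableSet_le measurable_const (ML.continuous_norm ⟨hX.1, le_rfl⟩).measurable)
  have h1 : ML.weight σ 0 (log B) =ᵐ[tauPair μ M]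
      s.indicator fun _ => B ^ (-σ) := by
    filter_upwards [ae_norm_pos μ M ML hX] with y ⟨hyD, hy⟩
    have h2 : 0 ≤ log B + log (ML.norm y) ↔ y ∈ s := by
      rw [← log_mul hB.ne' hy.ne', log_nonneg_iff (mul_pos hB hy), hs, Set.mem_ofPred_eq,
        div_le_iff₀' hB]
      exact ⟨fun h => ⟨hyD, h⟩, fun h => h.2⟩
    by_cases hys : y ∈ s
    · simp only [DivisorMetric.weight, kernel]
      rw [Set.indicator_of_mem hys, if_pos (h2.2 hys), mul_add, exp_add,
        mul_comm (-σ) (log B), mul_comm (-σ) (log (ML.norm y)), ← rpow_def_of_pos hB,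
        ← rpow_def_of_pos hy, mul_left_comm, ← rpow_add hy, add_neg_cancel, rpow_zero,
        mul_one]
    · simp only [DivisorMetric.weight, kernel]
      rw [Set.indicator_of_notMem hys, if_neg fun h => hys (h2.1 h), mul_zero]
  have hpos : B ^ (-σ) ≠ 0 := (rpow_pos_of_pos hB _).ne'
  refine ⟨?_, ?_⟩
  · have h3 := (integrable_indicator_iff hsm').1 (hint.congr h1)
    exact ((integrableOn_const_iff (by simp)).1 h3).resolve_left fun h => hpos (enorm_eq_zero.1 h)
  · rw [integral_congr_ae h1, integral_indicator_const _ hsm', smul_eq_mul, mul_left_comm,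
      ← rpow_add hB, add_neg_cancel, rpow_zero, mul_one]
    rfl

section Faces

variable {M : CanonicalMetric p n D} {ML : DivisorMetric p L} {Mc : ComponentMetrics p} {σ : ℝ}

theorem mem_clemensFaces {A : Finset (PrimeDivisor X)} : A ∈ clemensFaces p D L σ ↔
    A ⊆ D.support ∧ A.Nonempty ∧ (stratum p A).Nonempty ∧ ∀ α ∈ A, (D α : ℝ) = L α * σ + 1 := by
  classical
  rw [clemensFaces, mem_filter, mem_powerset]

theorem mem_maximalFaces {A : Finset (PrimeDivisor X)} : A ∈ maximalFaces p D L σ ↔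
    A ∈ clemensFaces p D L σ ∧ A.card = clemensRank p D L σ :=
  mem_filter

theorem card_le_clemensRank {A : Finset (PrimeDivisor X)} (h1 : A ⊆ D.support)
    (h2 : (stratum p A).Nonempty) (h3 : ∀ α ∈ A, (D α : ℝ) = L α * σ + 1) :
    A.card ≤ clemensRank p D L σ := by
  rcases A.eq_empty_or_nonempty with rfl | h
  · simp
  · exact le_sup (mem_clemensFaces.2 ⟨h1, h, h2, h3⟩)

theorem one_le_clemensRank (hDL : D.support ⊆ L.support)
    (hσ : ∃ α ∈ D.support, (stratum p {α}).Nonempty ∧ σ = ((D α : ℝ) - 1) / (L α : ℝ)) :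
    1 ≤ clemensRank p D L σ := by
  obtain ⟨α, hα, h1, h2⟩ := hσ
  have hL : (L α : ℝ) ≠ 0 := by exact_mod_cast Finsupp.mem_support_iff.1 (hDL hα)
  simpa using card_le_clemensRank (by simpa using hα) h1 (by
    intro β hβ
    rw [mem_singleton.1 hβ, h2]
    field_simp
    ring)

/-- The integral over a face of maximal dimension, by means of a partition of unity: near the
points `x` such that `Q x ≠ A`, the stratum of `A` is empty. -/
theorem integrable_and_faceIntegral_eq_sum [SecondCountableTopology (RatPoint p)] (μ : Measure F)
    (hX : IsSNCPair p n D L) {A : Finset (PrimeDivisor X)} (hA : A ⊆ D.support)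
    {T : Finset (RatPoint p)} {φ : RatPoint p → RatPoint p → ℝ} (hφ : ∀ y, ∑ x ∈ T, φ x y = 1)
    (Q : RatPoint p → Finset (PrimeDivisor X))
    (hint : ∀ x ∈ T, Integrable (fun y => φ x y * faceIntegrand D ML Mc (Q x) σ y)
    (residueMeasure μ M Mc (Q x))) (h0 : ∀ x ∈ T, Q x ≠ A → ∀ y ∈ stratum p A, φ x y = 0)
    [DecidableEq (PrimeDivisor X)] :
    Integrable (faceIntegrand D ML Mc A σ) (residueMeasure μ M Mc A) ∧
      faceIntegral μ M ML Mc A σ = ∑ x ∈ T, if Q x = A then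
        ∫ y, φ x y * faceIntegrand D ML Mc (Q x) σ y ∂(residueMeasure μ M Mc (Q x)) else 0 := by
  have hs : faceIntegrand D ML Mc A σ = fun y => ∑ x ∈ T, φ x y * faceIntegrand D ML Mc A σ y := by
    funext y
    rw [← sum_mul, hφ, one_mul]
  have h1 : ∀ x ∈ T, Q x ≠ A →
      (fun y => φ x y * faceIntegrand D ML Mc A σ y) =ᵐ[residueMeasure μ M Mc A] 0 := by
    intro x hx hxA
    filter_upwards [measure_eq_zero_iff_ae_notMem.1
      (residueMeasure_compl_stratum M Mc μ hX.1 (hA.trans hX.2))] with y hy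
    simp [h0 x hx hxA y (not_not.1 hy)]
  have h2 : ∀ x ∈ T, Integrable (fun y => φ x y * faceIntegrand D ML Mc A σ y)
      (residueMeasure μ M Mc A) := by
    intro x hx
    by_cases hxA : Q x = A
    · rw [← hxA]
      exact hint x hx
    · exact (integrable_zero _ _ _).congr (h1 x hx hxA).symm
  refine ⟨by rw [hs]; exact integrable_finsetSum T h2, ?_⟩
  rw [faceIntegral, hs, integral_finsetSum T h2]
  refine sum_congr rfl fun x hx => ?_
  split_ifs with hxA
  · rw [hxA]
  · rw [integral_congr_ae (h1 x hx hxA), integral_zero']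

theorem faceIntegrand_nonneg (hX : IsSNCPair p n D L) (μ : Measure F) [μ.IsAddHaarMeasure]
    (M : CanonicalMetric p n D) {A : Finset (PrimeDivisor X)} (hA : A ⊆ D.support)
    (hA1 : ∀ α ∈ A, (D α : ℝ) = L α * σ + 1) (y : RatPoint p) :
    0 ≤ faceIntegrand D ML Mc A σ y := by
  obtain ⟨C, hyC, -⟩ := exists_adaptedChart hX.1 y
  obtain ⟨N⟩ := exists_localNorms hX.2 M ML Mc C.etale C.localEq
  exact (C.faceIntegrand_eq μ hX N hA hA1 hyC).2

end Faces

/-- The expansion of the volume, from the expansion of the integral of the kernel of order `1`. -/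
theorem exists_volume_expansion [SecondCountableTopology (RatPoint p)] (μ : Measure F)
    [μ.IsAddHaarMeasure] (M : CanonicalMetric p n D) (ML : DivisorMetric p L)
    (hX : IsSNCPair p n D L) {σ δ c : ℝ} (hσ0 : 0 ≤ σ) (hδ : 0 < δ) (R : Polynomial ℝ)
    (hint : ∀ k T, Integrable (ML.weight σ k T) (tauPair μ M))
    (hR : ∀ T, |(∫ y, ML.weight σ 1 T y ∂(tauPair μ M)) -
      R.eval T| ≤ c * exp (-δ * T)) :
    (fun B => (volumeBall μ M ML B).toReal - B ^ σ * R.derivative.eval (log B))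
      =O[atTop] fun B => B ^ (σ - δ / 4) := by
  have hnn : 0 ≤ᵐ[tauPair μ M] fun y => ML.norm y ^ σ := by
    filter_upwards [ae_norm_pos μ M ML hX] with y hy
    exact rpow_nonneg hy.2.le _
  set A : ℝ → ℝ := fun T =>
    ∫ y, ML.weight σ 1 T y ∂(tauPair μ M)
  set W : ℝ → ℝ := fun T =>
    ∫ y, ML.weight σ 0 T y ∂(tauPair μ M)
  have hle : ∀ T η, 0 < η → W T ≤ exp (σ * η) / η * (A (T + η) - A T) := by
    intro T η hη
    rw [← integral_sub (hint 1 _) (hint 1 _), ← integral_const_mul]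
    refine integral_mono_ae (hint 0 T) (((hint 1 _).sub (hint 1 _)).const_mul _) ?_
    filter_upwards [hnn] with y hy
    have := mul_le_mul_of_nonneg_left (kernel_zero_le hσ0 hη (T + log (ML.norm y))) hy
    refine this.trans_eq ?_
    simp only [DivisorMetric.weight, add_right_comm T η]
    ring
  have hge : ∀ T η, 0 < η → exp (-σ * η) / η * (A T - A (T - η)) ≤ W T := by
    intro T η hη
    rw [← integral_sub (hint 1 _) (hint 1 _), ← integral_const_mul]
    refine integral_mono_ae (((hint 1 _).sub (hint 1 _)).const_mul _) (hint 0 T) ?_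
    filter_upwards [hnn] with y hy
    have := mul_le_mul_of_nonneg_left (le_kernel_zero hσ0 hη (T + log (ML.norm y))) hy
    refine Eq.trans_le ?_ this
    simp only [DivisorMetric.weight, sub_add_eq_add_sub T η]
    ring
  obtain ⟨C, hC⟩ := exists_tauberian hσ0 hδ R hR hle hge
  refine Asymptotics.IsBigO.of_bound C ?_
  filter_upwards [eventually_ge_atTop 1] with B hB
  have hB0 : 0 < B := one_pos.trans_le hB
  rw [(volumeBall_eq μ M ML hX hB0 (hint 0 _)).2, ← mul_sub, norm_mul,
    norm_of_nonneg (rpow_nonneg hB0.le _),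
    norm_of_nonneg (rpow_nonneg hB0.le _), sub_eq_add_neg σ, rpow_add hB0,
    mul_left_comm]
  refine mul_le_mul_of_nonneg_left ((hC _ (log_nonneg hB)).trans_eq ?_)
    (rpow_nonneg hB0.le _)
  rw [rpow_def_of_pos hB0, mul_comm (log B)]

end Global

end Variety

end VolAsymp
end

open VolAsymp in
theorem mainTheorem2 {F : Type u} [RCLike F] (μ : Measure F) [μ.IsAddHaarMeasure]
    {X : Scheme.{u}} (p : X ⟶ Spec (CommRingCat.of F)) (n : ℕ)
    (hsmooth : SmoothOfRelativeDimension n p) (hproj : IsProjectiveOver p)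
    (D L : EffDivisor X) (hDL : D.support ⊆ L.support) (hsnc : IsGeometricSNC p n L)
    (M : CanonicalMetric p n D) (ML : DivisorMetric p L)
    (Mc : ∀ α : PrimeDivisor X, DivisorMetric p (Finsupp.single α 1))
    (σ : ℝ)
    (hσ : IsGreatest {r : ℝ | ∃ α ∈ D.support, (stratum p {α}).Nonempty ∧
      r = ((D α : ℝ) - 1) / (L α : ℝ)} σ)
    (hσ0 : 0 ≤ σ) :
    1 ≤ clemensRank p D L σ ∧
    (∀ B : ℝ, 0 < B → volumeBall μ M ML B < ⊤) ∧
    (∀ A ∈ maximalFaces p D L σ,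
      Integrable (faceIntegrand D ML Mc A σ) (residueMeasure μ M Mc A)) ∧
    ∃ (P : Polynomial ℝ) (δ : ℝ), 0 < δ ∧
      ((fun B : ℝ => (volumeBall μ M ML B).toReal - B ^ σ * P.eval (Real.log B))
        =O[atTop] fun B : ℝ => B ^ (σ - δ)) ∧
      (0 < σ → P.degree = ((clemensRank p D L σ - 1 : ℕ) : WithBot ℕ) ∧
        P.leadingCoeff = 1 / (σ * ((clemensRank p D L σ - 1).factorial : ℝ)) *
          ∑ A ∈ maximalFaces p D L σ,
            faceIntegral μ M ML Mc A σ * ∏ α ∈ A, 1 / (L α : ℝ)) ∧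
      (σ = 0 → P.degree = (clemensRank p D L σ : WithBot ℕ) ∧
        P.leadingCoeff = 1 / ((clemensRank p D L σ).factorial : ℝ) *
          ∑ A ∈ maximalFaces p D L σ,
            faceIntegral μ M ML Mc A σ * ∏ α ∈ A, 1 / (L α : ℝ)) := by
  classical
  have hX : IsSNCPair p n D L := ⟨⟨hsmooth, hsnc⟩, hDL⟩
  obtain ⟨hc, ht2⟩ := compactSpace_and_t2Space hproj
  obtain ⟨h2, -⟩ := secondCountable_and_metrizable hX.1 hproj
  choose Ω Q hΩ hxΩ hQD hQ hxQ hQmax hexp using exists_local_expansion μ M ML Mc hX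
    hσ0 fun α hα h => hσ.2 ⟨α, hα, h, rfl⟩
  obtain ⟨T, φ, hφ1, hφ⟩ := exists_partition hX.1 hΩ hxΩ
  have hb := one_le_clemensRank hDL hσ.1
  set b := clemensRank p D L σ
  have hQb : ∀ x, (Q x).card ≤ b := fun x => card_le_clemensRank (hQD x) ⟨x, hxQ x⟩ (hQ x)
  have hQmem : ∀ x, (Q x).card = b → Q x ∈ maximalFaces p D L σ := fun x hx => mem_maximalFaces.2
    ⟨mem_clemensFaces.2 ⟨hQD x, Finset.card_pos.1 (by omega), ⟨x, hxQ x⟩, hQ x⟩, hx⟩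
  have hmax : ∀ A ∈ maximalFaces p D L σ, A ⊆ D.support ∧ (stratum p A).Nonempty ∧
      (∀ α ∈ A, (D α : ℝ) = L α * σ + 1) ∧ ∀ x, (stratum p A ∩ Ω x).Nonempty → Q x = A := by
    intro A hA
    obtain ⟨h, hAb⟩ := mem_maximalFaces.1 hA
    obtain ⟨h1, -, h3, h4⟩ := mem_clemensFaces.1 h
    exact ⟨h1, h3, h4, fun x hx => (Finset.eq_of_subset_of_card_le (hQmax x A h1 h4 hx)
      ((hQb x).trans_eq hAb.symm)).symm⟩
  have hloc := fun x (hx : x ∈ T) => hexp x (φ x) (hφ x hx).1 (hφ x hx).2.1 (hφ x hx).2.2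
  have hZ : ∀ A ∈ maximalFaces p D L σ, _ := fun A hA =>
    integrable_and_faceIntegral_eq_sum (ML := ML) (σ := σ) μ hX (hmax A hA).1 hφ1 Q
      (fun x hx => (hloc x hx).2.2.1) fun x hx hxA y hy => by
        obtain ⟨K, -, hK, hK0⟩ := (hφ x hx).2.2
        exact hK0 y fun hyK => hxA ((hmax A hA).2.2.2 x ⟨y, hy, hK hyK⟩)
  have hZpos : ∀ A ∈ maximalFaces p D L σ, 0 < faceIntegral μ M ML Mc A σ := by
    intro A hA
    obtain ⟨hAD, ⟨z, hz⟩, hA1, hAQ⟩ := hmax A hA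
    obtain rfl := hAQ z ⟨z, hz, hxΩ z⟩
    obtain ⟨C, hzC, -⟩ := exists_adaptedChart hX.1 z
    obtain ⟨θ, K, h1, h2, h3, h4, h5, Ω', h6, h7, -, h8⟩ := exists_chartSmooth_bump C.chart
      ((hΩ z).inter C.χ.open_source) ⟨hxΩ z, hzC⟩ Set.inter_subset_right
    obtain ⟨-, -, h9, h10⟩ := hexp z θ h1 (fun y => (h5 y).1)
      ⟨K, h2, h3.trans Set.inter_subset_left, h4⟩
    refine (h10 (by rw [h8 z h7]; exact one_pos)).trans_le (integral_mono h9 (hZ _ hA).1 fun y => ?_)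
    exact mul_le_of_le_one_left (faceIntegrand_nonneg hX μ M hAD hA1 y) (h5 y).2
  have hsum : ∀ g : RatPoint p → ℝ, g = fun y => ∑ x ∈ T, φ x y * g y := fun g => by
    funext y
    rw [← Finset.sum_mul, hφ1, one_mul]
  have hint : ∀ k t, Integrable (ML.weight σ k t)
      (tauPair μ M) := by
    intro k t
    rw [hsum (ML.weight σ k t)]
    exact integrable_finsetSum T fun x hx => (hloc x hx).1 k t
  choose! d hd hdR using fun x hx => (hloc x hx).2.1
  obtain ⟨δ, hδ, hδd⟩ := exists_pos_forall_le T d hd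
  choose! R c hRdeg hRc hR using fun x hx => hdR x hx δ hδ (hδd x hx)
  set q := kernelShift σ
  have hdeg : (∑ x ∈ T, R x).natDegree ≤ b + q := Polynomial.natDegree_sum_le_of_forall_le _ _
    fun x hx => (hRdeg x hx).trans (Nat.add_le_add_right (hQb x) _)
  have hcoeff : (∑ x ∈ T, R x).coeff (b + q) = kernelLead σ b *
      ∑ A ∈ maximalFaces p D L σ, faceIntegral μ M ML Mc A σ * ∏ α ∈ A, 1 / (L α : ℝ) := by
    rw [Polynomial.finsetSum_coeff, Finset.sum_congr rfl fun A hA =>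
      congrArg (· * ∏ α ∈ A, 1 / (L α : ℝ)) (hZ A hA).2]
    simp only [Finset.mul_sum, Finset.sum_mul]
    rw [Finset.sum_comm]
    refine Finset.sum_congr rfl fun x hx => ?_
    rcases (hQb x).lt_or_eq with hlt | heq
    · rw [Polynomial.coeff_eq_zero_of_natDegree_lt ((hRdeg x hx).trans_lt (by omega))]
      refine (Finset.sum_eq_zero fun A hA => ?_).symm
      rw [if_neg, zero_mul, mul_zero]
      rintro rfl
      exact hlt.ne (mem_maximalFaces.1 hA).2
    · rw [← heq, hRc x hx, Finset.sum_eq_single_of_mem _ (hQmem x heq) fun A _ hA => by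
        rw [if_neg hA.symm, zero_mul, mul_zero], if_pos rfl]
      ring
  have hlead : (∑ x ∈ T, R x).coeff (b + q) ≠ 0 := by
    have hne : (maximalFaces p D L σ).Nonempty := by
      have hne : (clemensFaces p D L σ).Nonempty := Finset.nonempty_iff_ne_empty.2 fun h => by
        have : b = 0 := by
          change (clemensFaces p D L σ).sup _ = 0
          rw [h]
          rfl
        omega
      obtain ⟨A, hA, hAb⟩ := Finset.exists_mem_eq_sup _ hne Finset.card
      exact ⟨A, mem_maximalFaces.2 ⟨hA, hAb.symm⟩⟩
    rw [hcoeff]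
    refine mul_ne_zero ?_ (Finset.sum_pos (fun A hA => mul_pos (hZpos A hA) (Finset.prod_pos
      fun α hα => one_div_pos.2 ?_)) hne).ne'
    · unfold kernelLead
      split_ifs <;> positivity
    · exact_mod_cast pos_iff_ne_zero.2 (Finsupp.mem_support_iff.1 (hDL ((hmax A hA).1 hα)))
  have hA : ∀ t, |(∫ y, ML.weight σ 1 t y ∂(tauPair μ M)) -
      (∑ x ∈ T, R x).eval t| ≤ (∑ x ∈ T, c x) * Real.exp (-δ * t) := by
    intro t
    rw [hsum (ML.weight σ 1 t),
      integral_finsetSum T fun x hx => (hloc x hx).1 1 t, Polynomial.eval_finsetSum,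
      ← Finset.sum_sub_distrib, Finset.sum_mul]
    exact (Finset.abs_sum_le_sum_abs _ _).trans (Finset.sum_le_sum fun x hx => hR x hx t)
  obtain ⟨N, hN⟩ : ∃ N, b + q = N + 1 := ⟨b + q - 1, by omega⟩
  rw [hN] at hdeg hcoeff hlead
  obtain ⟨hP1, hP2⟩ := degree_derivative_and_leadingCoeff hdeg hlead
  refine ⟨hb, fun B hB => (volumeBall_eq μ M ML hX hB (hint 0 _)).1,
    fun A hA => (hZ A hA).1, (∑ x ∈ T, R x).derivative, δ / 4, by positivity,
    exists_volume_expansion μ M ML hX hσ0 hδ _ hint hA, fun hσ => ?_, fun hσ => ?_⟩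
  · have hq0 : q = 0 := if_neg hσ.ne'
    have hbN : b = N + 1 := by omega
    refine ⟨by rw [hP1, hbN, Nat.add_sub_cancel], ?_⟩
    rw [hP2, hcoeff, kernelLead, if_neg hσ.ne', hbN, Nat.add_sub_cancel, Nat.factorial_succ]
    push_cast
    field_simp
  · have hq1 : q = 1 := if_pos hσ
    have hbN : b = N := by omega
    refine ⟨by rw [hP1, hbN], ?_⟩
    rw [hP2, hcoeff, kernelLead, if_pos hσ, hbN, Nat.factorial_succ]
    push_cast
    field_simp
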